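/- **Model.** Programs run on a quantum random access machine with $w$-bit words. It has classical word variables, classical two-dimensional arrays indexed by words, and quantum word variables of $w$ qubits each. Its elementary instructions are: constants and the usual word operations, reading and writing array entries, the reversible maps $|q\rangle\mapsto|q\oplus x\rangle$ (with $x$ a classical word), $|q\rangle|y\rangle|z\rangle\mapsto|q\oplus(y\circ z)\rangle|y\rangle|z\rangle$ (with $\circ$ a word operation) and $|q\rangle|i\rangle|j\rangle\mapsto|q\oplus a[i,j]\rangle|i\rangle|j\rangle$ (with $a$ a classical array), the gates $H$ and $\mathrm{diag}(1,e^{i\pi/4})$ on a single qubit, and measurements of quantum words. Programs are built from instructions by sequencing, if-then-else and while loops. Each instruction and each test costs one time step. The two input matrices are given as arrays, so reading one of their entries, also in superposition, costs one step; the integer parameters are given in classical variables. A program *computes a product in time $T$* if it halts within $T$ steps with probability $1$ and, with probability at least $2/3$, outputs all entries of the product. A program must do so for every word size $w$ that is at least a constant (depending on the program only) times the logarithm of the largest of the integer parameters (including the bound $L$, resp. $\lambda$, below). In the *Boolean product* $A\cdot B$, the entry $(i,j)$ is $1$ if and only if $A[i,k]=B[k,j]=1$ for some $k$. **Theorem.**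 There is a function $f(n)=n^{o(1)}$ with the following property. Let $M$ be a real-valued function of four natural numbers. Assume that there is a program (deterministic, or quantum with bounded error) which, given $n_1,n_2,n_3\ge 1$, an $n_1\times n_2$ Boolean matrix and an $n_2\times n_3$ Boolean matrix whose Boolean product has at most $L$ non-zero entries, computes this product in time $M(n_1,n_2,n_3,L)$. Then there is a quantum program which, given integers $n\ge1$, $m_1,m_2$, $\ell_1\in\{1,\dots,m_1\}$, $\ell_2,\ell_3\in\{1,\dots,m_2\}$ and two $n\times n$ Boolean matrices $A$ and $B$ with at most $m_1$ and $m_2$ non-zero entries, respectively, computes $A\cdot B$ in time $$f(n)\left(M(\ell_1',\ell_2',\ell_3',\lambda)+\sqrt{\frac{m_1m_2\min(\lambda,m_1m_2/\ell_2)}{\ell_2}}+\lambda\sqrt{\frac{m_1}{\ell_1}}+\lambda\sqrt{\frac{m_2}{\ell_3}}+n^2\right),$$ where $\ell_i'=\min(\ell_i,n)$ and $\lambda$ is the number of non-zero entries of $A\cdot B$, or any upper bound on this number. This holds in both of the following settings: neither program is told the bound ($L$, respectively $\lambda$) on the number of non-zero entries of the product, or both programs are told it. -/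

import Mathlib

open Filter Asymptotics
open scoped ENNReal

/-! ### Boolean matrices -/

/-- Boolean `a × b` matrices. -/
abbrev BoolMatrix (a b : ℕ) : Type := Matrix (Fin a) (Fin b) Bool

namespace BoolMatrix

/-- The Boolean product: `(A · B)[i,j] = 1` iff `A[i,k] = B[k,j] = 1` for some `k`. -/
def mul {a b c : ℕ} (A : BoolMatrix a b) (B : BoolMatrix b c) : BoolMatrix a c :=
  Matrix.of fun i j => decide (∃ k, A i k = true ∧ B k j = true)

/-- The number of non-zero entries. -/
def nnz {a b : ℕ} (A : BoolMatrix a b) : ℕ :=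
  (Finset.univ.filter fun p : Fin a × Fin b => A p.1 p.2 = true).card

end BoolMatrix

/-! ### A quantum random access machine

A word RAM with `w`-bit words, extended by quantum words.  A program manipulates

* classical word variables, named by natural numbers;
* classical two-dimensional arrays, named by natural numbers and indexed by two words, which can
  be read classically, written classically, and read in quantum superposition;
* quantum word variables of `w` qubits each, named by natural numbers.

Every elementary instruction and every test costs one time step. -/

namespace QRAM

/-- The word operations. -/
inductive BinOp
  | add | sub | mul | div | mod | lt | eq | and | or | xor | shl | shr

/-- The value of a word operation (arithmetic is modulo `2 ^ w`, tests return `0` or `1`). -/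
def BinOp.eval {w : ℕ} : BinOp → BitVec w → BitVec w → BitVec w
  | .add, x, y => x + y
  | .sub, x, y => x - y
  | .mul, x, y => x * y
  | .div, x, y => x / y
  | .mod, x, y => x % y
  | .lt, x, y => if x.toNat < y.toNat then 1 else 0
  | .eq, x, y => if x = y then 1 else 0
  | .and, x, y => x &&& y
  | .or, x, y => x ||| y
  | .xor, x, y => x ^^^ y
  | .shl, x, y => x <<< y.toNat
  | .shr, x, y => x >>> y.toNat

/-- Elementary instructions.  In the quantum instructions `q, y, z, i, j` are names of quantum
variables, and `x` is the name of a classical one; `a` is always the name of a classical array. -/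
inductive Instr
  /-- `x := v` -/
  | const (x v : ℕ)
  /-- `x := y o z` -/
  | op (o : BinOp) (x y z : ℕ)
  /-- `x := a[i, j]` -/
  | load (x a i j : ℕ)
  /-- `a[i, j] := x` -/
  | store (a i j x : ℕ)
  /-- `|q⟩ ↦ |q ⊕ x⟩`, with `x` a classical variable -/
  | qconst (q x : ℕ)
  /-- `|q⟩|y⟩|z⟩ ↦ |q ⊕ (y o z)⟩|y⟩|z⟩`, provided that `q` differs from `y` and `z` -/
  | qop (o : BinOp) (q y z : ℕ)
  /-- `|q⟩|i⟩|j⟩ ↦ |q ⊕ a[i, j]⟩|i⟩|j⟩`, provided that `q` differs from `i` and `j` -/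
  | qload (q a i j : ℕ)
  /-- the Hadamard gate on the qubit of `q` whose position is the value of the classical `x` -/
  | hadamard (q x : ℕ)
  /-- the gate `diag (1, exp (i π / 4))` on the qubit of `q` whose position is the value of the
  classical `x` -/
  | phase (q x : ℕ)
  /-- measure all qubits of `q` in the computational basis, and put the outcome into `x` -/
  | measure (x q : ℕ)

/-- Programs. The tests ask whether a classical variable is non-zero. -/
inductive Prog
  | skip
  | instr (i : Instr)
  | seq (p q : Prog)
  | ite (x : ℕ) (p q : Prog)
  | while (x : ℕ) (p : Prog)

/-- Computational basis states of the quantum variables. -/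
abbrev Basis (w : ℕ) : Type := ℕ → BitVec w

/-- The state of one branch of a computation: the classical variables, the classical arrays, the
state vector of the quantum variables, and the time used so far.  The state vector is not
normalised after a measurement: its squared norm is the probability of the branch. -/
structure State (w : ℕ) where
  reg : ℕ → BitVec w
  arr : ℕ → BitVec w → BitVec w → BitVec w
  psi : Basis w → ℂ
  time : ℕ

/-- The probability of a branch. -/
noncomputable def State.weight {w : ℕ} (s : State w) : ℝ≥0∞ := ∑' b : Basis w, ‖s.psi b‖ₑ ^ 2

/-- One time step is charged. -/
def State.tick {w : ℕ} (s : State w) : State w := { s with time := s.time + 1 }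

/-- Assign the word `v` to the classical variable `x`. -/
def State.set {w : ℕ} (s : State w) (x : ℕ) (v : BitVec w) : State w :=
  { s with reg := Function.update s.reg x v }

/-- `|b⟩ ↦ |b with q replaced by q ⊕ f b⟩`; unitary if `f b` does not depend on `b q`. -/
def xorGate {w : ℕ} (q : ℕ) (f : Basis w → BitVec w) (ψ : Basis w → ℂ) : Basis w → ℂ :=
  fun b => ψ (Function.update b q (b q ^^^ f b))

/-- The Hadamard gate on qubit `t` of `q` (nothing happens if there is no such qubit). -/
noncomputable def hadamardGate {w : ℕ} (q t : ℕ) (ψ : Basis w → ℂ) : Basis w → ℂ :=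
  if t < w then
    fun b => ((1 / Real.sqrt 2 : ℝ) : ℂ) *
      ((if (b q).getLsbD t then -ψ b else ψ b) +
        ψ (Function.update b q (b q ^^^ BitVec.twoPow w t)))
  else ψ

/-- The gate `diag (1, exp (i π / 4))` on qubit `t` of `q`. -/
noncomputable def phaseGate {w : ℕ} (q t : ℕ) (ψ : Basis w → ℂ) : Basis w → ℂ :=
  fun b => if (b q).getLsbD t then Complex.exp (Complex.I * (Real.pi / 4)) * ψ b else ψ b

/-- The projection onto the basis states in which `q` has the value `v`. -/
def project {w : ℕ} (q : ℕ) (v : BitVec w) (ψ : Basis w → ℂ) : Basis w → ℂ :=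
  fun b => if b q = v then ψ b else 0

/-- The effect of an instruction: the list of the resulting branches (several of them only for a
measurement). -/
noncomputable def Instr.exec {w : ℕ} (s : State w) : Instr → List (State w)
  | .const x v => [s.set x (BitVec.ofNat w v)]
  | .op o x y z => [s.set x (o.eval (s.reg y) (s.reg z))]
  | .load x a i j => [s.set x (s.arr a (s.reg i) (s.reg j))]
  | .store a i j x =>
      [{ s with arr := Function.update s.arr a (Function.update (s.arr a) (s.reg i)
          (Function.update (s.arr a (s.reg i)) (s.reg j) (s.reg x))) }]
  | .qconst q x => [{ s with psi := xorGate q (fun _ => s.reg x) s.psi }]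
  | .qop o q y z =>
      [if q = y ∨ q = z then s
        else { s with psi := xorGate q (fun b => o.eval (b y) (b z)) s.psi }]
  | .qload q a i j =>
      [if q = i ∨ q = j then s
        else { s with psi := xorGate q (fun b => s.arr a (b i) (b j)) s.psi }]
  | .hadamard q x => [{ s with psi := hadamardGate q (s.reg x).toNat s.psi }]
  | .phase q x => [{ s with psi := phaseGate q (s.reg x).toNat s.psi }]
  | .measure x q =>
      (List.finRange (2 ^ w)).map fun v =>
        { s.set x (BitVec.ofFin v) with psi := project q (BitVec.ofFin v) s.psi }

/-- `whileLoop x body k s`: the branches in which `while x ≠ 0 do body`, started in `s`, halts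
after fewer than `k` rounds. -/
def whileLoop {w : ℕ} (x : ℕ) (body : State w → List (State w)) : ℕ → State w → List (State w)
  | 0, _ => []
  | k + 1, s =>
      if s.reg x = 0 then [s.tick] else (body s.tick).flatMap (whileLoop x body k)

/-- The final states of all the branches, among those which halt with every loop running for fewer
than `k` rounds. -/
noncomputable def Prog.run {w : ℕ} (k : ℕ) : Prog → State w → List (State w)
  | .skip, s => [s]
  | .instr i, s => i.exec s.tick
  | .seq p q, s => (p.run k s).flatMap (q.run k)
  | .ite x p q, s => if s.reg x = 0 then q.run k s.tick else p.run k s.tick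
  | .while x p, s => whileLoop x (p.run k) k s

open scoped Classical in
/-- The probability that the final state belongs to the given list of branches and satisfies
`E`. -/
noncomputable def prob {w : ℕ} (l : List (State w)) (E : State w → Prop) : ℝ≥0∞ :=
  (l.map fun s => if E s then s.weight else 0).sum

/-- The array that holds a Boolean matrix. -/
def matrixArray {w a b : ℕ} (A : BoolMatrix a b) (i j : BitVec w) : BitVec w :=
  if h : i.toNat < a ∧ j.toNat < b then (if A ⟨i.toNat, h.1⟩ ⟨j.toNat, h.2⟩ then 1 else 0) else 0

open scoped Classical in
/-- The initial state: the integer parameters `ps` are in the classical variables `0, 1, …`, the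
two input matrices are the arrays `0` and `1`, and everything else is zero. -/
noncomputable def initState (w : ℕ) {a b c : ℕ} (ps : List ℕ) (A : BoolMatrix a b)
    (B : BoolMatrix b c) : State w where
  reg := fun x => BitVec.ofNat w (ps.getD x 0)
  arr := fun x => if x = 0 then matrixArray A else if x = 1 then matrixArray B else fun _ _ => 0
  psi := fun b => if b = 0 then 1 else 0
  time := 0

/-- Array `2` holds all the entries of the matrix `C`. -/
def State.Outputs {w a c : ℕ} (s : State w) (C : BoolMatrix a c) : Prop :=
  ∀ (i : Fin a) (j : Fin c),
    s.arr 2 (BitVec.ofNat w i.val) (BitVec.ofNat w j.val) = if C i j then 1 else 0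

/-- On words of `w` bits, with parameters `ps` and input matrices `A` and `B`, the program always
(with probability one) halts within time `T`, and with probability at least `2 / 3` it outputs all
the entries of the Boolean product of `A` and `B`. -/
def ComputesProduct (P : Prog) (w : ℕ) {a b c : ℕ} (ps : List ℕ) (A : BoolMatrix a b)
    (B : BoolMatrix b c) (T : ℝ) : Prop :=
  ∃ k : ℕ,
    prob (P.run k (initState w ps A B)) (fun s => (s.time : ℝ) ≤ T) = 1 ∧
    2 / 3 ≤ prob (P.run k (initState w ps A B)) (fun s => s.Outputs (A.mul B))

end QRAM

/-- `f (n) = n ^ o(1)`, as an upper bound. -/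
def IsSubpolynomial (f : ℕ → ℝ) : Prop :=
  ∀ ε : ℝ, 0 < ε → f =O[atTop] fun n : ℕ => (n : ℝ) ^ ε

namespace QRAM

variable {w : ℕ}

/-! ### Probabilities of lists of branches -/

/-! Call a row of `A` heavy if it has more than `m₁ / ℓ₁` ones, a row of `B` if it has more than `m₂
/ ℓ₂`, and a column of `B` if it has more than `m₂ / ℓ₃`. Counting ones leaves at most `ℓ₁`, `ℓ₂`,
`ℓ₃` of them (`cnt_flag_le`). A one `(i, j)` of the product with witness `k` has a light row `i`, or
a light column `j`, or a light witness row `k` of `B`, or all three are heavy. In the last case it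
is a one of the product of the heavy submatrices, which is left to the assumed program. The other
ones are found by Grover searches over tables of prefix counts and lists of ones, which are computed
in time `O(n²)`.

Light rows and columns: among the at most `m₁ / ℓ₁` ones of row `i`, search for a `k` whose row in
`B` has a one in a given interval of columns. Prefix counts decide this with a constant number of
lookups and also yield the column. A hit splits the interval and a miss closes it, so a row with `l`
outputs needs at most `2 l + 1` searches (`wp_rowSearch`). Summed over the rows this is `λ √(m₁ /
ℓ₁)` up to logarithms. Light columns are light rows of the transposed product.

Light witnesses: with `β = min (m₂ / ℓ₂) n`, the pairs of a one of row `i` and one of the first `β`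
ones of the corresponding row of `B` are encoded by numbers below `N`, the number of ones of the row
times `β`. A queue of dyadic intervals of codes is searched for outputs that are still missing; a
hit puts both halves at the end of the queue. The interval at position `q` then has length `O(N / (q
+ 2))`, so `l` hits cost `O(√(N l))` up to logarithms (`denseTime_le`). By Cauchy–Schwarz the rows
together cost `√(V min(λ, V))` with `V = m₁ m₂ / ℓ₂` (`denseTotalTime_le`), which is the first
square root of the bound.

A single search does not know the number of marked words. The search space is padded so that at most
half of it is marked; then the Grover angle `θ` is at most `π / 4`, and some `3 ^ i θ` lies between
`π / 4` and `3 π / 4`, where a measurement succeeds with probability at least one half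
(`exists_pow_three_good`). All relevant powers of three are tried, each `reps n` times. Every
outcome is verified, so errors are one-sided.

The time bound must hold with probability one, correctness only with probability `2 / 3`. Both are
derived in a program logic `WP` with an error fraction `δ`. The lemmas on searches carry a
proposition `g`: without `g` they assert soundness and time with error `0`, with `g` also
completeness with a small error. The assumed program is run three times on disjoint copies of its
variables (`wp_rename`), and a majority vote fails with probability at most `7 / 27`. The searches
fail with probability at most `2 / 27`, and the sum is `1 / 3`. -/

theorem prob_cons (s : State w) (l : List (State w)) (E : State w → Prop) :
    prob (s :: l) E = prob [s] E + prob l E := by simp [prob]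

theorem prob_append (l l' : List (State w)) (E : State w → Prop) :
    prob (l ++ l') E = prob l E + prob l' E := by simp [prob]

theorem prob_singleton_of {s : State w} {E : State w → Prop} (h : E s) :
    prob [s] E = s.weight := by simp [prob, h]

theorem prob_singleton_of_not {s : State w} {E : State w → Prop} (h : ¬ E s) :
    prob [s] E = 0 := by simp [prob, h]

theorem prob_flatMap (l : List (State w)) (f : State w → List (State w)) (E : State w → Prop) :
    prob (l.flatMap f) E = (l.map fun s => prob (f s) E).sum := by
  induction l with
  | nil => simp [prob]
  | cons a l ih => rw [List.flatMap_cons, prob_append, ih]; simp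

theorem sum_map_weight_ite (l : List (State w)) (E : State w → Prop) :
    prob l E = (l.map fun t => prob [t] E).sum := by
  rw [← prob_flatMap]; simp

theorem prob_mono {l : List (State w)} {E E' : State w → Prop} (h : ∀ t ∈ l, E t → E' t) :
    prob l E ≤ prob l E' := by
  induction l with
  | nil => simp [prob]
  | cons a l ih =>
    rw [prob_cons, prob_cons a l E']
    refine add_le_add ?_ (ih fun t ht => h t (List.mem_cons_of_mem _ ht))
    by_cases hE : E a
    · rw [prob_singleton_of hE, prob_singleton_of (h a List.mem_cons_self hE)]
    · rw [prob_singleton_of_not hE]; exact zero_le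

theorem prob_sublist {l l' : List (State w)} (h : List.Sublist l l') (E : State w → Prop) :
    prob l E ≤ prob l' E := by
  induction h with
  | slnil => exact le_rfl
  | cons a _ ih => rw [prob_cons]; exact ih.trans le_add_self
  | cons_cons a _ ih =>
    simp only [prob, List.map_cons, List.sum_cons] at ih ⊢
    exact add_le_add_right ih _

/-! ### Gates do not increase the weight -/

theorem weight_tick (s : State w) : s.tick.weight = s.weight := rfl

/-- As `f` ignores the coordinate `q`, the gate is composition with an involution of the basis, and
a sum over the basis does not change. -/
theorem tsum_xorGate (q : ℕ) (f : Basis w → BitVec w)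
    (hf : ∀ b v, f (Function.update b q v) = f b) (ψ : Basis w → ℂ) :
    ∑' b, ‖xorGate q f ψ b‖ₑ ^ 2 = ∑' b, ‖ψ b‖ₑ ^ 2 := by
  have hinv : Function.Involutive fun b : Basis w => Function.update b q (b q ^^^ f b) := by
    intro b
    simp [hf]
  exact (hinv.toPerm).tsum_eq fun b => ‖ψ b‖ₑ ^ 2

theorem enorm_add_sq_add_enorm_sub_sq (x y : ℂ) :
    ‖x + y‖ₑ ^ 2 + ‖x - y‖ₑ ^ 2 = 2 * (‖x‖ₑ ^ 2 + ‖y‖ₑ ^ 2) := by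
  have h := parallelogram_law_with_norm ℝ x y
  simp only [← ofReal_norm, ← ENNReal.ofReal_pow (norm_nonneg _)]
  rw [← ENNReal.ofReal_add (by positivity) (by positivity),
    ← ENNReal.ofReal_add (by positivity) (by positivity),
    show (2 : ℝ≥0∞) = ENNReal.ofReal 2 by simp, ← ENNReal.ofReal_mul (by norm_num)]
  exact congrArg _ (by nlinarith)

/-- Flipping bit `t` of `q` pairs up the basis states, and on each pair the parallelogram law
preserves the sum of the two squared norms. Summing over all states counts each pair twice, and the
factor `2` is cancelled at the end. -/
theorem tsum_hadamardGate (q t : ℕ) (ψ : Basis w → ℂ) :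
    ∑' b, ‖hadamardGate q t ψ b‖ₑ ^ 2 = ∑' b, ‖ψ b‖ₑ ^ 2 := by
  unfold hadamardGate
  by_cases ht : t < w
  swap
  · simp only [ht, if_false]
  simp only [ht, if_true]
  set τ : Basis w → Basis w := fun b => Function.update b q (b q ^^^ BitVec.twoPow w t) with hτ
  have hinv : Function.Involutive τ := by
    intro b
    simp [hτ]
  have key : ∀ b, ‖((1 / Real.sqrt 2 : ℝ) : ℂ) *
      ((if (b q).getLsbD t then -ψ b else ψ b) + ψ (τ b))‖ₑ ^ 2 +
      ‖((1 / Real.sqrt 2 : ℝ) : ℂ) *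
      ((if (τ b q).getLsbD t then -ψ (τ b) else ψ (τ b)) + ψ (τ (τ b)))‖ₑ ^ 2
      = ‖ψ b‖ₑ ^ 2 + ‖ψ (τ b)‖ₑ ^ 2 := by
    intro b
    rw [hinv b]
    have hb : (τ b q).getLsbD t = !(b q).getLsbD t := by
      simp [hτ, ht]
    have hc : ‖((1 / Real.sqrt 2 : ℝ) : ℂ)‖ₑ ^ 2 * 2 = 1 := by
      rw [← ofReal_norm, ← ENNReal.ofReal_pow (norm_nonneg _), Complex.norm_real, Real.norm_eq_abs,
        sq_abs, div_pow, Real.sq_sqrt (by norm_num), show (2 : ℝ≥0∞) = ENNReal.ofReal 2 by simp,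
        ← ENNReal.ofReal_mul (by norm_num)]
      norm_num
    rw [hb]
    simp only [enorm_mul, mul_pow]
    rw [← mul_add]
    rcases Bool.eq_false_or_eq_true ((b q).getLsbD t) with h | h
    · simp only [h, if_true, Bool.not_true, Bool.false_eq_true, if_false]
      rw [show -ψ b + ψ (τ b) = -(ψ b - ψ (τ b)) by ring, enorm_neg,
        show ψ (τ b) + ψ b = ψ b + ψ (τ b) by ring, add_comm (‖ψ b - ψ (τ b)‖ₑ ^ 2),
        enorm_add_sq_add_enorm_sub_sq, ← mul_assoc, hc, one_mul]
    · simp only [h, if_true, Bool.not_false, Bool.false_eq_true, if_false]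
      rw [show -ψ (τ b) + ψ b = ψ b - ψ (τ b) by ring,
        enorm_add_sq_add_enorm_sub_sq, ← mul_assoc, hc, one_mul]
  have e1 := fun F : Basis w → ℝ≥0∞ => (hinv.toPerm).tsum_eq F
  have h2 : ∀ F : Basis w → ℝ≥0∞, ∑' b, (F b + F (τ b)) = 2 * ∑' b, F b := by
    intro F
    rw [ENNReal.tsum_add, two_mul]
    congr 1
    exact e1 F
  have := h2 (fun b => ‖((1 / Real.sqrt 2 : ℝ) : ℂ) *
      ((if (b q).getLsbD t then -ψ b else ψ b) + ψ (τ b))‖ₑ ^ 2)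
  rw [tsum_congr key, h2 fun b => ‖ψ b‖ₑ ^ 2] at this
  exact ((ENNReal.mul_right_inj (by norm_num) (by norm_num)).1 this).symm

theorem tsum_phaseGate (q t : ℕ) (ψ : Basis w → ℂ) :
    ∑' b, ‖phaseGate q t ψ b‖ₑ ^ 2 = ∑' b, ‖ψ b‖ₑ ^ 2 := by
  refine tsum_congr fun b => ?_
  unfold phaseGate
  split_ifs
  · have : ‖Complex.exp (Complex.I * (Real.pi / 4))‖ₑ = 1 := by
      rw [← ofReal_norm, show Complex.I * (Real.pi / 4) = ((Real.pi / 4 : ℝ) : ℂ) * Complex.I by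
        push_cast; ring, Complex.norm_exp_ofReal_mul_I]
      simp
    rw [enorm_mul, this, one_mul]
  · rfl

theorem sum_finRange_bitVec (F : BitVec w → ℝ≥0∞) :
    ((List.finRange (2 ^ w)).map fun v => F (BitVec.ofFin v)).sum = ∑ v : Fin (2 ^ w), F ⟨v⟩ := by
  rw [← List.ofFn_eq_map, List.sum_ofFn]

/-- Each basis state survives exactly one of the projections, so the outcomes of a measurement share
the weight without loss. -/
theorem sum_tsum_project (q : ℕ) (ψ : Basis w → ℂ) :
    ((List.finRange (2 ^ w)).map fun v =>
      ∑' b, ‖project q (BitVec.ofFin v) ψ b‖ₑ ^ 2).sum = ∑' b, ‖ψ b‖ₑ ^ 2 := by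
  rw [sum_finRange_bitVec (fun v => ∑' b, ‖project q v ψ b‖ₑ ^ 2),
    ← Summable.tsum_finsetSum (fun _ _ => ENNReal.summable)]
  refine tsum_congr fun b => ?_
  rw [Finset.sum_eq_single (b q).toFin]
  · simp [project]
  · intro v _ hv
    have : b q ≠ ⟨v⟩ := fun h => hv (by rw [h])
    simp [project, this]
  · simp

theorem prob_exec_le (s : State w) (i : Instr) :
    prob (i.exec s) (fun _ => True) ≤ s.weight := by
  have key : ∀ t : State w, t.weight = s.weight → prob [t] (fun _ => True) ≤ s.weight := by
    intro t ht; rw [prob_singleton_of trivial, ht]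
  cases i with
  | const x v => exact key _ rfl
  | op o x y z => exact key _ rfl
  | load x a i j => exact key _ rfl
  | store a i j x => exact key _ rfl
  | qconst q x => exact key _ (tsum_xorGate q _ (fun _ _ => rfl) _)
  | qop o q y z =>
    refine key _ ?_
    split_ifs with h
    · rfl
    · push Not at h
      refine tsum_xorGate q _ (fun b v => ?_) _
      rw [Function.update_of_ne h.1.symm, Function.update_of_ne h.2.symm]
  | qload q a i j =>
    refine key _ ?_
    split_ifs with h
    · rfl
    · push Not at h
      refine tsum_xorGate q _ (fun b v => ?_) _
      rw [Function.update_of_ne h.1.symm, Function.update_of_ne h.2.symm]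
  | hadamard q x => exact key _ (tsum_hadamardGate q _ _)
  | phase q x => exact key _ (tsum_phaseGate q _ _)
  | measure x q =>
    refine le_of_eq ?_
    rw [← show _ = s.weight from sum_tsum_project q s.psi]
    simp [prob, Instr.exec, State.weight, Function.comp_def]

theorem prob_whileLoop_le {x : ℕ} {body : State w → List (State w)}
    (h : ∀ s, prob (body s) (fun _ => True) ≤ s.weight) (k : ℕ) (s : State w) :
    prob (whileLoop x body k s) (fun _ => True) ≤ s.weight := by
  induction k generalizing s with
  | zero => simp [whileLoop, prob]
  | succ k ih =>
    rw [whileLoop]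
    split_ifs
    · rw [prob_singleton_of trivial]; exact le_rfl
    · rw [prob_flatMap]
      refine le_trans (List.sum_le_sum fun t _ => (ih t).trans (prob_singleton_of (E := fun _ => True) trivial).ge) ?_
      rw [← sum_map_weight_ite]
      exact h s.tick

/-- Only an inequality, since branches in which a loop runs out of its `k` rounds are dropped. It
bounds the weight to which the error of a later program applies. -/
theorem prob_run_le (k : ℕ) (p : Prog) (s : State w) :
    prob (p.run k s) (fun _ => True) ≤ s.weight := by
  induction p generalizing s with
  | skip => rw [Prog.run, prob_singleton_of trivial]
  | instr i => exact prob_exec_le s.tick i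
  | seq p q ihp ihq =>
    rw [Prog.run, prob_flatMap]
    refine le_trans (List.sum_le_sum fun t _ => (ihq t).trans (prob_singleton_of (E := fun _ => True) trivial).ge) ?_
    rw [← sum_map_weight_ite]
    exact ihp s
  | ite x p q ihp ihq =>
    rw [Prog.run]
    split_ifs
    · exact ihq s.tick
    · exact ihp s.tick
  | _ x p ih => exact prob_whileLoop_le ih k s

/-! ### More rounds only add branches -/

theorem List.Sublist.flatMap_of_forall {α β : Type*} {l l' : List α} {f g : α → List β}
    (h : List.Sublist l l') (hfg : ∀ a, List.Sublist (f a) (g a)) :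
    List.Sublist (l.flatMap f) (l'.flatMap g) := by
  induction h with
  | slnil => simp
  | cons a _ ih => rw [List.flatMap_cons]; exact ih.trans (List.sublist_append_right _ _)
  | cons_cons a _ ih => rw [List.flatMap_cons, List.flatMap_cons]; exact (hfg a).append ih

theorem whileLoop_sublist {x : ℕ} {f g : State w → List (State w)}
    (hfg : ∀ s, List.Sublist (f s) (g s)) {k k' : ℕ} (hk : k ≤ k') (s : State w) :
    List.Sublist (whileLoop x f k s) (whileLoop x g k' s) := by
  induction k generalizing k' s with
  | zero => simp [whileLoop]
  | succ k ih =>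
    obtain ⟨k', rfl⟩ : ∃ m, k' = m + 1 := ⟨k' - 1, by omega⟩
    rw [whileLoop, whileLoop]
    split_ifs
    · exact List.Sublist.refl _
    · exact List.Sublist.flatMap_of_forall (hfg _) fun t => ih (by omega) t

/-- This lets the assumed program, whose number of rounds comes with the hypothesis, run under the
larger bound that the whole program uses. -/
theorem run_sublist {k k' : ℕ} (hk : k ≤ k') (p : Prog) (s : State w) :
    List.Sublist (p.run k s) (p.run k' s) := by
  induction p generalizing s with
  | skip => exact List.Sublist.refl _
  | instr i => exact List.Sublist.refl _
  | seq p q ihp ihq => exact List.Sublist.flatMap_of_forall (ihp s) ihq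
  | ite x p q ihp ihq =>
    rw [Prog.run, Prog.run]
    split_ifs
    · exact ihq s.tick
    · exact ihp s.tick
  | _ x p ih => exact whileLoop_sublist ih hk s

/-! ### A program logic -/

/-- Started in `s`, the program `p` halts in a state satisfying `E`, except for a fraction `δ` of
the weight of `s`. -/
def WP (k : ℕ) (p : Prog) (δ : ℝ≥0∞) (E : State w → Prop) (s : State w) : Prop :=
  s.weight ≤ prob (p.run k s) E + δ * s.weight

variable {k : ℕ} {p q : Prog} {δ δ' : ℝ≥0∞} {E E' : State w → Prop} {s : State w}

theorem WP.mono (h : WP k p δ E s) (hE : ∀ t, E t → E' t) (hδ : δ ≤ δ' := by exact le_rfl) :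
    WP k p δ' E' s :=
  h.trans (add_le_add (prob_mono fun t _ => hE t) (mul_le_mul_left hδ _))

theorem wp_of_one_le (h : 1 ≤ δ) : WP k p δ E s :=
  (le_mul_of_one_le_left zero_le h).trans le_add_self

/-- The total weight is at most `W` and the states in `F` take up all but `ε * W` of it, so the
states in `G` outside `F` have weight at most `ε * W`. The extra failure `η` is paid on this part
only, which makes the errors multiply. Finiteness of `W` is needed to cancel the weight of `F`. -/
theorem le_prob_flatMap_of_branch {l : List (State w)} {f : State w → List (State w)}
    {W : ℝ≥0∞} {F G : State w → Prop} {ε η : ℝ≥0∞} (hW : W ≠ ∞)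
    (hl : prob l (fun _ => True) ≤ W)
    (hF : W ≤ prob l F + ε * W) (hFG : W ≤ prob l (fun t => F t ∨ G t))
    (hfF : ∀ t, F t → t.weight ≤ prob (f t) E + δ * t.weight)
    (hfG : ∀ t, G t → t.weight ≤ prob (f t) E + (δ + η) * t.weight) :
    W ≤ prob (l.flatMap f) E + (δ + η * ε) * W := by
  classical
  rw [prob_flatMap]
  set X := prob l F
  set Y := prob l (fun t => G t ∧ ¬ F t)
  have hXY : prob l (fun t => F t ∨ G t) = X + Y := by
    simp only [X, Y, sum_map_weight_ite l]
    rw [← List.sum_map_add]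
    congr 1
    refine List.map_congr_left fun t _ => ?_
    by_cases h1 : F t <;> by_cases h2 : G t <;> simp [prob, h1, h2]
  have hle : X + Y ≤ W := by
    rw [← hXY]; exact (prob_mono fun _ _ _ => trivial).trans hl
  have hX : X ≠ ∞ := ne_top_of_le_ne_top hW (le_self_add.trans hle)
  have hY : Y ≤ ε * W := (ENNReal.add_le_add_iff_left hX).1 (hle.trans hF)
  have hmain : X + Y ≤ (l.map fun t => prob (f t) E).sum + δ * (X + Y) + η * Y := by
    simp only [X, Y, sum_map_weight_ite l]
    rw [← List.sum_map_add, ← List.sum_map_mul_left, ← List.sum_map_mul_left,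
      ← List.sum_map_add, ← List.sum_map_add]
    refine List.sum_le_sum fun t _ => ?_
    by_cases h1 : F t
    · rw [prob_singleton_of h1, prob_singleton_of_not (by simp [h1])]
      simpa using hfF t h1
    · by_cases h2 : G t
      · rw [prob_singleton_of_not h1, prob_singleton_of (by simp [h1, h2])]
        simpa [add_mul, add_assoc] using hfG t h2
      · rw [prob_singleton_of_not h1, prob_singleton_of_not (by simp [h2])]
        simp
  rw [hXY] at hFG
  calc W ≤ X + Y := hFG
    _ ≤ _ := hmain
    _ ≤ (l.map fun t => prob (f t) E).sum + δ * W + η * (ε * W) :=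
        add_le_add (add_le_add le_rfl (mul_le_mul_right hle _)) (mul_le_mul_right hY _)
    _ = _ := by rw [add_mul, mul_assoc, add_assoc]

/-- The rule for a sequence whose first part may end in a good state, except with probability
`ε`, or else in a bad one, from which the second part fails with a larger probability. -/
theorem wp_seq_branch {F G : State w → Prop} {ε η : ℝ≥0∞} (hs : s.weight ≠ ∞)
    (hF : WP k p ε F s) (hFG : WP k p 0 (fun t => F t ∨ G t) s)
    (hqF : ∀ t, F t → WP k q δ E t) (hqG : ∀ t, G t → WP k q (δ + η) E t) :
    WP k (p.seq q) (δ + η * ε) E s :=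
  le_prob_flatMap_of_branch hs (prob_run_le k p s) hF (by simpa [WP] using hFG) hqF hqG

/-- A union bound: the first stage loses `δ * W`, and the second loses a fraction `δ'` of a weight
that is at most `W`. -/
theorem wp_flatMap {l : List (State w)} {f : State w → List (State w)} {W : ℝ≥0∞}
    (hl : prob l (fun _ => True) ≤ W)
    (h : W ≤ prob l (fun t => t.weight ≤ prob (f t) E + δ' * t.weight) + δ * W) :
    W ≤ prob (l.flatMap f) E + (δ + δ') * W := by
  rw [prob_flatMap]
  have : prob l (fun t => t.weight ≤ prob (f t) E + δ' * t.weight)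
      ≤ (l.map fun t => prob (f t) E).sum + δ' * prob l (fun _ => True) := by
    rw [sum_map_weight_ite l, sum_map_weight_ite l, ← List.sum_map_mul_left, ← List.sum_map_add]
    refine List.sum_le_sum fun t _ => ?_
    by_cases ht : t.weight ≤ prob (f t) E + δ' * t.weight
    · rw [prob_singleton_of ht, prob_singleton_of (E := fun _ => True) trivial]; exact ht
    · rw [prob_singleton_of_not ht]; exact zero_le
  calc W ≤ _ := h
    _ ≤ (l.map fun t => prob (f t) E).sum + δ' * W + δ * W :=
        add_le_add (this.trans (add_le_add le_rfl (mul_le_mul_right hl _))) le_rfl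
    _ = _ := by rw [add_mul, add_assoc, add_comm (δ' * W)]

theorem wp_seq' (h : WP k p δ (fun t => WP k q δ' E t) s) : WP k (p.seq q) (δ + δ') E s :=
  wp_flatMap (prob_run_le k p s) h

theorem wp_seq {F : State w → Prop} (h : WP k p δ F s) (hq : ∀ t, F t → WP k q δ' E t) :
    WP k (p.seq q) (δ + δ') E s := wp_seq' (h.mono hq)

/-- The rule for a sequence whose first part cannot fail. -/
theorem wp_seq_left {F : State w → Prop} (h : WP k p 0 F s) (hq : ∀ t, F t → WP k q δ E t) :
    WP k (p.seq q) δ E s := by simpa using wp_seq h hq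

theorem wp_seq_right {F : State w → Prop} (h : WP k p δ F s) (hq : ∀ t, F t → WP k q 0 E t) :
    WP k (p.seq q) δ E s := by simpa using wp_seq h hq

theorem wp_skip (h : E s) : WP k .skip δ E s := by
  unfold WP; rw [Prog.run, prob_singleton_of h]; exact le_self_add

theorem wp_ite {x : ℕ} (h0 : s.reg x = 0 → WP k q δ E s.tick)
    (h1 : s.reg x ≠ 0 → WP k p δ E s.tick) : WP k (.ite x p q) δ E s := by
  unfold WP; rw [Prog.run]
  split_ifs with h
  · exact h0 h
  · exact h1 h

theorem wp_of_exec {i : Instr} {t : State w} (h : i.exec s.tick = [t])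
    (hw : t.weight = s.weight) (hE : E t) : WP k (.instr i) δ E s := by
  unfold WP; rw [Prog.run, h, prob_singleton_of hE, hw]; exact le_self_add

theorem wp_const {x v : ℕ} (h : E (s.tick.set x (BitVec.ofNat w v))) :
    WP k (.instr (.const x v)) δ E s := wp_of_exec rfl rfl h

theorem wp_op {o : BinOp} {x y z : ℕ} (h : E (s.tick.set x (o.eval (s.reg y) (s.reg z)))) :
    WP k (.instr (.op o x y z)) δ E s := wp_of_exec rfl rfl h

theorem wp_load {x a i j : ℕ} (h : E (s.tick.set x (s.arr a (s.reg i) (s.reg j)))) :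
    WP k (.instr (.load x a i j)) δ E s := wp_of_exec rfl rfl h

/-- Assign the word `v` to the entry `(i, j)` of the array `a`. -/
def State.put (s : State w) (a : ℕ) (i j v : BitVec w) : State w :=
  { s with arr := Function.update s.arr a (Function.update (s.arr a) i
      (Function.update (s.arr a i) j v)) }

theorem wp_store {x a i j : ℕ} (h : E (s.tick.put a (s.reg i) (s.reg j) (s.reg x))) :
    WP k (.instr (.store a i j x)) δ E s := wp_of_exec rfl rfl h

/-- The rule for loops: `Inv m` holds when at most `m` rounds are left. -/
theorem wp_while {x : ℕ} (Inv : ℕ → State w → Prop) {m : ℕ} (hm : m < k) (h0 : Inv m s)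
    (h : ∀ m s, Inv m s → s.reg x ≠ 0 → ∃ m', m = m' + 1 ∧ WP k p δ (Inv m') s.tick) :
    WP k (.while x p) (m * δ) (fun t => ∃ m' s', Inv m' s' ∧ s'.reg x = 0 ∧ t = s'.tick) s := by
  -- The bound `k'` on the rounds of this loop is decoupled from the bound `k` inside the body, so
  -- that the induction can run on `k'` alone.
  suffices H : ∀ k' m s, m < k' → Inv m s → s.weight ≤ prob (whileLoop x (p.run k) k' s)
      (fun t => ∃ m' s', Inv m' s' ∧ s'.reg x = 0 ∧ t = s'.tick) + m * δ * s.weight from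
    H k m s hm h0
  clear hm h0 m
  intro k'
  induction k' with
  | zero => intros; omega
  | succ k' ih =>
    intro m s hm h0
    rw [whileLoop]
    split_ifs with hx
    · rw [prob_singleton_of ⟨m, s, h0, hx, rfl⟩, weight_tick]; exact le_self_add
    · obtain ⟨m', rfl, hb⟩ := h m s h0 hx
      have := wp_flatMap (δ := δ) (δ' := m' * δ) (f := whileLoop x (p.run k) k')
        (E := fun t => ∃ m' s', Inv m' s' ∧ s'.reg x = 0 ∧ t = s'.tick)
        (prob_run_le k p s.tick) (hb.trans (add_le_add (prob_mono fun t _ ht => ?_) le_rfl))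
      · refine this.trans (le_of_eq ?_)
        rw [weight_tick]; push_cast; ring
      · exact ih m' t (by omega) ht

/-- The rule for a loop in which each round reaches a good state, except with probability one
half, and the following rounds stay in good states. -/
theorem wp_while_amplify {x : ℕ} (F G : ℕ → State w → Prop) {m : ℕ} (hm : m < k) (h0 : G m s)
    (hGs : ∀ m s, G m s → s.weight ≠ ∞) (hGx : ∀ m s, G (m + 1) s → s.reg x ≠ 0)
    (hF : ∀ m s, F m s → s.reg x ≠ 0 → ∃ m', m = m' + 1 ∧ WP k p 0 (F m') s.tick)
    (hG : ∀ m s, G (m + 1) s → WP k p 2⁻¹ (F m) s.tick ∧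
      WP k p 0 (fun t => F m t ∨ G m t) s.tick) :
    WP k (.while x p) (2⁻¹ ^ m)
      (fun t => ∃ m' s', F m' s' ∧ s'.reg x = 0 ∧ t = s'.tick) s := by
  set E : State w → Prop := fun t => ∃ m' s', F m' s' ∧ s'.reg x = 0 ∧ t = s'.tick with hE
  -- Once a good state is reached, the remaining rounds cannot fail.
  have H0 : ∀ k' m s, m < k' → F m s → s.weight ≤ prob (whileLoop x (p.run k) k' s) E := by
    intro k'
    induction k' with
    | zero => intros; omega
    | succ k' ih =>
      intro m s hm h0
      rw [whileLoop]
      split_ifs with hx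
      · rw [prob_singleton_of ⟨m, s, h0, hx, rfl⟩, weight_tick]
      · obtain ⟨m', rfl, hb⟩ := hF m s h0 hx
        have := wp_flatMap (δ := 0) (δ' := 0) (f := whileLoop x (p.run k) k') (E := E)
          (prob_run_le k p s.tick) (hb.trans (add_le_add (prob_mono fun t _ ht => ?_) le_rfl))
        · simpa [weight_tick] using this
        · simpa using ih m' t (by omega) ht
  suffices H : ∀ k' m s, m < k' → G m s → s.weight ≤ prob (whileLoop x (p.run k) k' s) E
      + 2⁻¹ ^ m * s.weight from H k m s hm h0
  clear hm h0 m
  intro k'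
  induction k' with
  | zero => intros; omega
  | succ k' ih =>
    intro m s hm h0
    cases m with
    | zero => simp
    | succ m =>
      rw [whileLoop, if_neg (hGx m s h0)]
      obtain ⟨h1, h2⟩ := hG m s h0
      -- From a good state nothing is lost; from a bad one, which has probability at most one half,
      -- the remaining `m` rounds lose `2⁻¹ ^ m`. The product is the claimed error for `m + 1`
      -- rounds.
      have := le_prob_flatMap_of_branch (E := E) (δ := 0) (η := 2⁻¹ ^ m) (ε := 2⁻¹)
        (f := whileLoop x (p.run k) k') (hGs _ s h0) (prob_run_le k p s.tick) h1
        (by simpa [WP, weight_tick] using h2) (fun t ht => by simpa using H0 k' m t (by omega) ht)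
        (fun t ht => by simpa using ih m t (by omega) ht)
      rwa [zero_add, ← pow_succ] at this

end QRAM

namespace QRAM

variable {w : ℕ}

/-! ### Words as natural numbers -/

/-- The word that represents a natural number. -/
def wd (w a : ℕ) : BitVec w := BitVec.ofNat w a

theorem wd_toNat {a : ℕ} (h : a < 2 ^ w) : (wd w a).toNat = a := by
  simp [wd, Nat.mod_eq_of_lt h]

theorem wd_toNat_self (x : BitVec w) : wd w x.toNat = x := by simp [wd]

theorem wd_inj {a b : ℕ} (ha : a < 2 ^ w) (hb : b < 2 ^ w) : wd w a = wd w b ↔ a = b := by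
  refine ⟨fun h => ?_, fun h => by rw [h]⟩
  rw [← wd_toNat ha, h, wd_toNat hb]

theorem wd_zero : wd w 0 = 0 := rfl

theorem wd_eq_zero {a : ℕ} (ha : a < 2 ^ w) : wd w a = 0 ↔ a = 0 := by
  rw [← wd_zero, wd_inj ha (by positivity)]

theorem wd_bool_eq_zero (hw : 0 < w) {P : Prop} [Decidable P] :
    wd w (if P then 1 else 0) = 0 ↔ ¬ P := by
  have : 1 < 2 ^ w := Nat.one_lt_two_pow hw.ne'
  rw [wd_eq_zero (by split_ifs <;> omega)]
  simp

theorem eval_add (a b : ℕ) : BinOp.add.eval (wd w a) (wd w b) = wd w (a + b) := by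
  simp [BinOp.eval, wd, BitVec.ofNat_add]

theorem eval_mul (a b : ℕ) : BinOp.mul.eval (wd w a) (wd w b) = wd w (a * b) := by
  simp [BinOp.eval, wd, BitVec.ofNat_mul]

theorem eval_sub {a b : ℕ} (h : b ≤ a) : BinOp.sub.eval (wd w a) (wd w b) = wd w (a - b) := by
  simp only [BinOp.eval, wd]
  obtain ⟨c, rfl⟩ := Nat.exists_eq_add_of_le h
  rw [BitVec.ofNat_add, Nat.add_sub_cancel_left, add_comm, BitVec.add_sub_cancel]

theorem eval_lt {a b : ℕ} (ha : a < 2 ^ w) (hb : b < 2 ^ w) :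
    BinOp.lt.eval (wd w a) (wd w b) = wd w (if a < b then 1 else 0) := by
  simp only [BinOp.eval, wd_toNat ha, wd_toNat hb]
  split_ifs <;> rfl

theorem eval_div {a b : ℕ} (ha : a < 2 ^ w) (hb : b < 2 ^ w) :
    BinOp.div.eval (wd w a) (wd w b) = wd w (a / b) := by
  apply BitVec.eq_of_toNat_eq
  rw [wd_toNat ((Nat.div_le_self _ _).trans_lt ha)]
  simp [BinOp.eval, wd_toNat ha, wd_toNat hb]

theorem eval_mod {a b : ℕ} (ha : a < 2 ^ w) (hb : b < 2 ^ w) :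
    BinOp.mod.eval (wd w a) (wd w b) = wd w (a % b) := by
  apply BitVec.eq_of_toNat_eq
  rw [wd_toNat ((Nat.mod_le _ _).trans_lt ha)]
  simp [BinOp.eval, wd_toNat ha, wd_toNat hb]

theorem eval_shl {a b : ℕ} (hb : b < 2 ^ w) :
    BinOp.shl.eval (wd w a) (wd w b) = wd w (a * 2 ^ b) := by
  simp only [BinOp.eval, wd_toNat hb]
  apply BitVec.eq_of_toNat_eq
  simp [wd, Nat.shiftLeft_eq, Nat.mod_mul_mod]

/-! ### Frames -/

open scoped Classical in
/-- A multiple of a computational basis state. -/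
noncomputable def delta (b₀ : Basis w) (c : ℂ) : Basis w → ℂ := fun b => if b = b₀ then c else 0

/-- All the quantum variables are zero. -/
def Clean (s : State w) : Prop := ∃ c : ℂ, s.psi = delta 0 c

/-- From `s` to `t`, of the registers below `100` only those from `a` on have changed, and of the
arrays only those in `S`. -/
structure Frm (a : ℕ) (S : Finset ℕ) (s t : State w) : Prop where
  reg : ∀ x, x < a ∨ 100 ≤ x → t.reg x = s.reg x
  arr : ∀ x, x ∉ S → t.arr x = s.arr x
  clean : Clean s → Clean t

theorem Frm.refl (a : ℕ) (S : Finset ℕ) (s : State w) : Frm a S s s :=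
  ⟨fun _ _ => rfl, fun _ _ => rfl, id⟩

theorem Frm.trans {a b : ℕ} {S S' : Finset ℕ} {s t u : State w} (h : Frm a S s t)
    (h' : Frm b S' t u) (hab : a ≤ b := by norm_num) (hS : S' ⊆ S := by simp) :
    Frm a S s u where
  reg x hx := (h'.reg x (by omega)).trans (h.reg x hx)
  arr x hx := (h'.arr x fun hx' => hx (hS hx')).trans (h.arr x hx)
  clean hs := h'.clean (h.clean hs)

theorem Frm.mono {a b : ℕ} {S S' : Finset ℕ} {s t : State w} (h : Frm b S' s t)
    (hab : a ≤ b := by norm_num) (hS : S' ⊆ S := by simp) : Frm a S s t :=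
  (Frm.refl a S s).trans h hab hS

/-- The two states differ only in the registers `i` and `c`, and in time. -/
structure SameBut (i c : ℕ) (s t : State w) : Prop where
  reg : ∀ x, x ≠ i → x ≠ c → t.reg x = s.reg x
  arr : t.arr = s.arr
  psi : t.psi = s.psi

theorem SameBut.frm {i c a : ℕ} {S : Finset ℕ} {s t : State w} (h : SameBut i c s t)
    (hi : a ≤ i ∧ i < 100) (hc : a ≤ c ∧ c < 100) : Frm a S s t where
  reg x hx := h.reg x (by omega) (by omega)
  arr x _ := by rw [h.arr]
  clean hs := by unfold Clean; rw [h.psi]; exact hs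

theorem Frm.sameBut {i c a : ℕ} {S : Finset ℕ} {s t u : State w} (h : Frm a S s t)
    (h' : SameBut i c t u) (hi : a ≤ i ∧ i < 100 := by norm_num)
    (hc : a ≤ c ∧ c < 100 := by norm_num) : Frm a S s u :=
  h.trans (h'.frm hi hc) le_rfl subset_rfl

@[simp] theorem reg_tick (s : State w) : s.tick.reg = s.reg := rfl
@[simp] theorem arr_tick (s : State w) : s.tick.arr = s.arr := rfl
@[simp] theorem psi_tick (s : State w) : s.tick.psi = s.psi := rfl
@[simp] theorem time_tick (s : State w) : s.tick.time = s.time + 1 := rfl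
@[simp] theorem arr_set (s : State w) (x : ℕ) (v : BitVec w) : (s.set x v).arr = s.arr := rfl
@[simp] theorem psi_set (s : State w) (x : ℕ) (v : BitVec w) : (s.set x v).psi = s.psi := rfl
@[simp] theorem time_set (s : State w) (x : ℕ) (v : BitVec w) : (s.set x v).time = s.time := rfl
theorem reg_set (s : State w) (x : ℕ) (v : BitVec w) (y : ℕ) :
    (s.set x v).reg y = if y = x then v else s.reg y := by
  simp [State.set, Function.update_apply]
@[simp] theorem reg_put (s : State w) (a : ℕ) (i j v : BitVec w) : (s.put a i j v).reg = s.reg :=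
  rfl
@[simp] theorem psi_put (s : State w) (a : ℕ) (i j v : BitVec w) : (s.put a i j v).psi = s.psi :=
  rfl
@[simp] theorem time_put (s : State w) (a : ℕ) (i j v : BitVec w) :
    (s.put a i j v).time = s.time := rfl
theorem arr_put (s : State w) (a : ℕ) (i j v : BitVec w) (a' : ℕ) (i' j' : BitVec w) :
    (s.put a i j v).arr a' i' j' = if a' = a ∧ i' = i ∧ j' = j then v else s.arr a' i' j' := by
  simp only [State.put, Function.update_apply]
  by_cases h1 : a' = a
  · subst h1
    simp only [if_true, true_and]
    by_cases h2 : i' = i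
    · subst h2; simp [Function.update_apply]
    · simp [h2]
  · simp [h1]

theorem weight_ne_top_of_clean {s : State w} (h : Clean s) : s.weight ≠ ∞ := by
  obtain ⟨c, hc⟩ := h
  rw [State.weight, hc, tsum_eq_single 0 (fun b hb => by simp [delta, hb])]
  simp [delta]

/-! ### Counted loops -/

/-- `for i = 0, …, N - 1 do body`; the register `7` contains `1`, and `c` is used for the test. -/
def forLoop (i c N : ℕ) (body : Prog) : Prog :=
  .seq (.instr (.const i 0)) (.seq (.instr (.op .lt c i N)) (.while c (.seq body
    (.seq (.instr (.op .add i i 7)) (.instr (.op .lt c i N))))))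

variable {k : ℕ} {p q : Prog} {δ δ' : ℝ≥0∞} {E E' : State w → Prop} {s : State w}

/-- The invariant of the loop behind `forLoop`. -/
structure ForInv (i c n : ℕ) (T : ℕ → ℕ) (τ : ℕ) (Inv : ℕ → State w → Prop) (r : ℕ)
    (s : State w) : Prop where
  le : r ≤ n
  inv : Inv (n - r) s
  reg_i : s.reg i = wd w (n - r)
  reg_c : s.reg c = wd w (if n - r < n then 1 else 0)
  time : s.time ≤ τ + ∑ m ∈ Finset.range (n - r), (T m + 3)

section

variable {i c N n : ℕ} {Inv : ℕ → State w → Prop} {T : ℕ → ℕ}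

theorem wp_for_init (hn : n < 2 ^ w) (hic : i ≠ c) (hiN : i ≠ N)
    (hI : ∀ m s, Inv m s → s.reg N = wd w n)
    (hst : ∀ m s t, Inv m s → SameBut i c s t → Inv m t) (h0 : Inv 0 s) :
    ForInv i c n T (s.time + 2) Inv n
      (((s.tick.set i (BitVec.ofNat w 0)).tick).set c (BinOp.lt.eval
        ((s.tick.set i (BitVec.ofNat w 0)).tick.reg i)
        ((s.tick.set i (BitVec.ofNat w 0)).tick.reg N))) := by
  have e1 : BinOp.lt.eval ((s.tick.set i (BitVec.ofNat w 0)).tick.reg i)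
      ((s.tick.set i (BitVec.ofNat w 0)).tick.reg N) = wd w (if 0 < n then 1 else 0) := by
    simp only [reg_tick, reg_set, if_true, if_neg hiN.symm, hI _ _ h0]
    exact eval_lt (by positivity) hn
  rw [e1]
  refine ⟨le_rfl, ?_, ?_, ?_, ?_⟩
  · rw [Nat.sub_self]
    refine hst 0 s _ h0 ⟨fun x h1 h2 => ?_, rfl, rfl⟩
    simp [reg_set, h1, h2]
  · rw [Nat.sub_self]; simp [reg_set, hic]; rfl
  · simp [reg_set]
  · simp

theorem wp_for_step (hn : n < 2 ^ w) (hic : i ≠ c) (hiN : i ≠ N)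
    (hI : ∀ m s, Inv m s → s.reg N = wd w n ∧ s.reg 7 = wd w 1)
    (hst : ∀ m s t, Inv m s → SameBut i c s t → Inv m t) {r τ : ℕ} {t : State w} {u : ℕ}
    (hr : r + 1 ≤ n) (ht : Inv (n - (r + 1) + 1) t) (hti : t.reg i = wd w (n - (r + 1)))
    (hu : u ≤ τ + ∑ m ∈ Finset.range (n - (r + 1)), (T m + 3))
    (htime : t.time ≤ u + 1 + T (n - (r + 1))) :
    WP k (.seq (.instr (.op .add i i 7)) (.instr (.op .lt c i N))) δ
      (ForInv i c n T τ Inv r) t := by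
  refine wp_seq_left (wp_op (E := fun t' => t' = t.tick.set i (wd w (n - r))) ?_) ?_
  · rw [hti, (hI _ _ ht).2, eval_add]
    congr 2; omega
  · rintro t' rfl
    refine wp_op ?_
    have e1 : BinOp.lt.eval ((t.tick.set i (wd w (n - r))).tick.reg i)
        ((t.tick.set i (wd w (n - r))).tick.reg N) = wd w (if n - r < n then 1 else 0) := by
      simp only [reg_tick, reg_set, if_true, if_neg hiN.symm, (hI _ _ ht).1]
      exact eval_lt (by omega) hn
    simp only [reg_tick] at e1 ⊢
    rw [e1]
    refine ⟨by omega, ?_, ?_, ?_, ?_⟩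
    · rw [show n - r = n - (r + 1) + 1 by omega]
      refine hst _ t _ ht ⟨fun x h1 h2 => ?_, rfl, rfl⟩
      simp [reg_set, h1, h2]
    · simp [reg_set, hic]
    · simp [reg_set]
    · simp only [time_set, time_tick]
      rw [show n - r = n - (r + 1) + 1 by omega, Finset.sum_range_succ]
      omega

theorem wp_for_final {τ : ℕ} (hw : 0 < w)
    (hst : ∀ m s t, Inv m s → SameBut i c s t → Inv m t) {t : State w}
    (h : ∃ r s', ForInv i c n T τ Inv r s' ∧ s'.reg c = 0 ∧ t = s'.tick) :
    Inv n t ∧ t.time ≤ τ + ∑ m ∈ Finset.range n, (T m + 3) + 1 := by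
  obtain ⟨r, s', h, hc, rfl⟩ := h
  rw [h.reg_c, wd_bool_eq_zero hw] at hc
  have hr : n - r = n := by omega
  have h1 := h.inv
  have h2 := h.time
  rw [hr] at h1 h2
  refine ⟨hst _ _ _ h1 ⟨fun _ _ _ => rfl, rfl, rfl⟩, ?_⟩
  rw [time_tick]; omega

/-- A round costs, besides its body, one test, one increment and one comparison, hence `T m + 3`;
the final `3` stands for the two instructions before the loop and the last test. The invariant has
to tolerate changes of `i` and `c`, because it is claimed for the next index before these registers
are updated. As `n < 2 ^ w < k`, the loop never runs out of rounds. -/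
theorem wp_for (hn : n < 2 ^ w) (hk : 2 ^ w < k) (hw : 0 < w) (hic : i ≠ c) (hiN : i ≠ N)
    (hI : ∀ m s, Inv m s → s.reg N = wd w n ∧ s.reg 7 = wd w 1)
    (hst : ∀ m s t, Inv m s → SameBut i c s t → Inv m t)
    (hbody : ∀ m s, m < n → Inv m s → s.reg i = wd w m →
      WP k p δ (fun t => Inv (m + 1) t ∧ t.reg i = s.reg i ∧ t.time ≤ s.time + T m) s)
    (h0 : Inv 0 s) :
    WP k (forLoop i c N p) (n * δ)
      (fun t => Inv n t ∧ t.time ≤ s.time + ∑ m ∈ Finset.range n, (T m + 3) + 3) s := by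
  refine wp_seq_left (wp_const (E := fun t => t = _) rfl) ?_
  rintro _ rfl
  refine wp_seq_left (wp_op (E := fun t => t = _) rfl) ?_
  rintro _ rfl
  refine (wp_while (ForInv i c n T (s.time + 2) Inv) (m := n) (by omega)
    (wp_for_init hn hic hiN (fun m s h => (hI m s h).1) hst h0) ?_).mono ?_
  · intro r s' h hc
    rw [h.reg_c, Ne, wd_bool_eq_zero hw, not_not] at hc
    obtain ⟨r, rfl⟩ : ∃ r', r = r' + 1 := ⟨r - 1, by have := h.le; omega⟩
    refine ⟨r, rfl, wp_seq_right (hbody _ s'.tick hc (hst _ _ _ h.inv ⟨fun _ _ _ => rfl, rfl, rfl⟩)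
      h.reg_i) fun t ht => ?_⟩
    exact wp_for_step hn hic hiN hI hst h.le ht.1 (ht.2.1.trans h.reg_i) h.time
      (by have := ht.2.2; simpa using this)
  · intro t ht
    have := wp_for_final hw hst ht
    exact ⟨this.1, by omega⟩

/-- The rule for a counted loop in which each round reaches a good state, except with probability
one half, and the following rounds stay in good states. -/
theorem wp_for_amplify {F : ℕ → State w → Prop} (hn : n < 2 ^ w) (hk : 2 ^ w < k) (hw : 0 < w)
    (hic : i ≠ c) (hiN : i ≠ N)
    (hI : ∀ m s, Inv m s → s.reg N = wd w n ∧ s.reg 7 = wd w 1)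
    (hst : ∀ m s t, Inv m s → SameBut i c s t → Inv m t)
    (hFI : ∀ m s, F m s → Inv m s) (hfin : ∀ m s, Inv m s → s.weight ≠ ∞)
    (hFst : ∀ m s t, F m s → SameBut i c s t → F m t)
    (hFbody : ∀ m s, m < n → F m s → s.reg i = wd w m →
      WP k p 0 (fun t => F (m + 1) t ∧ t.reg i = s.reg i ∧ t.time ≤ s.time + T m) s)
    (hbody : ∀ m s, m < n → Inv m s → s.reg i = wd w m →
      WP k p 0 (fun t => Inv (m + 1) t ∧ t.reg i = s.reg i ∧ t.time ≤ s.time + T m) s)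
    (hbody' : ∀ m s, m < n → Inv m s → s.reg i = wd w m →
      WP k p 2⁻¹ (fun t => F (m + 1) t ∧ t.reg i = s.reg i ∧ t.time ≤ s.time + T m) s)
    (h0 : Inv 0 s) :
    WP k (forLoop i c N p) (2⁻¹ ^ n)
      (fun t => F n t ∧ t.time ≤ s.time + ∑ m ∈ Finset.range n, (T m + 3) + 3) s := by
  refine wp_seq_left (wp_const (E := fun t => t = _) rfl) ?_
  rintro _ rfl
  refine wp_seq_left (wp_op (E := fun t => t = _) rfl) ?_
  rintro _ rfl
  refine (wp_while_amplify (ForInv i c n T (s.time + 2) F) (ForInv i c n T (s.time + 2) Inv)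
    (m := n) (by omega) (wp_for_init hn hic hiN (fun m s h => (hI m s h).1) hst h0)
    (fun r s h => hfin _ _ h.inv) ?_ ?_ ?_).mono ?_
  · intro r s' h
    rw [h.reg_c, Ne, wd_bool_eq_zero hw, not_not]
    have := h.le; omega
  · intro r s' h hc
    rw [h.reg_c, Ne, wd_bool_eq_zero hw, not_not] at hc
    obtain ⟨r, rfl⟩ : ∃ r', r = r' + 1 := ⟨r - 1, by have := h.le; omega⟩
    refine ⟨r, rfl, wp_seq_right (hFbody _ s'.tick hc
      (hFst _ _ _ h.inv ⟨fun _ _ _ => rfl, rfl, rfl⟩) h.reg_i) fun t ht => ?_⟩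
    exact wp_for_step hn hic hiN (fun m s h => hI m s (hFI m s h)) hFst h.le ht.1
      (ht.2.1.trans h.reg_i) h.time (by have := ht.2.2; simpa using this)
  · intro r s' h
    have hc : n - (r + 1) < n := by have := h.le; omega
    have hs := hst _ _ s'.tick h.inv ⟨fun _ _ _ => rfl, rfl, rfl⟩
    refine ⟨wp_seq_right (hbody' _ s'.tick hc hs h.reg_i) fun t ht => ?_,
      wp_seq_left (hbody _ s'.tick hc hs h.reg_i) fun t ht => ?_⟩
    · exact wp_for_step hn hic hiN (fun m s h => hI m s (hFI m s h)) hFst h.le ht.1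
        (ht.2.1.trans h.reg_i) h.time (by have := ht.2.2; simpa using this)
    · exact (wp_for_step hn hic hiN hI hst h.le ht.1
        (ht.2.1.trans h.reg_i) h.time (by have := ht.2.2; simpa using this)).mono
        fun t h => Or.inr h
  · intro t ht
    have := wp_for_final hw hFst ht
    exact ⟨this.1, by omega⟩

end

end QRAM

namespace QRAM

variable {w : ℕ}

/-! ### Hadamard gates on one quantum word -/

theorem toNat_lt_two_pow_iff (v : BitVec w) (m : ℕ) :
    v.toNat < 2 ^ m ↔ ∀ i, m ≤ i → v.getLsbD i = false := by
  constructor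
  · intro h i hi
    rw [← BitVec.testBit_toNat]
    exact Nat.testBit_lt_two_pow (h.trans_le (Nat.pow_le_pow_right (by norm_num) hi))
  · intro h
    refine Nat.lt_pow_two_of_testBit _ fun i hi => ?_
    rw [BitVec.testBit_toNat]
    exact h i hi

/-- The Hadamard gate on qubit `t` of a word. -/
noncomputable def hop (t : ℕ) : (BitVec w → ℂ) →ₗ[ℂ] (BitVec w → ℂ) where
  toFun α v := ((1 / Real.sqrt 2 : ℝ) : ℂ) *
    ((if v.getLsbD t then -α v else α v) + α (v ^^^ BitVec.twoPow w t))
  map_add' α β := by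
    ext v; simp only [Pi.add_apply]; split_ifs <;> ring
  map_smul' c α := by
    ext v; simp only [Pi.smul_apply, smul_eq_mul, RingHom.id_apply]; split_ifs <;> ring

theorem hop_apply (t : ℕ) (α : BitVec w → ℂ) (v : BitVec w) :
    hop t α v = ((1 / Real.sqrt 2 : ℝ) : ℂ) *
      ((if v.getLsbD t then -α v else α v) + α (v ^^^ BitVec.twoPow w t)) := rfl

theorem inv_sqrt_two_mul_self :
    ((1 / Real.sqrt 2 : ℝ) : ℂ) * ((1 / Real.sqrt 2 : ℝ) : ℂ) = 1 / 2 := by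
  rw [← Complex.ofReal_mul]
  have : (1 / Real.sqrt 2) * (1 / Real.sqrt 2) = 1 / 2 := by
    rw [div_mul_div_comm, Real.mul_self_sqrt (by norm_num)]; norm_num
  rw [this]; norm_num

theorem getLsbD_xor_twoPow (v : BitVec w) {t : ℕ} (ht : t < w) (i : ℕ) :
    (v ^^^ BitVec.twoPow w t).getLsbD i = if i = t then !v.getLsbD t else v.getLsbD i := by
  rw [BitVec.getLsbD_xor, BitVec.getLsbD_twoPow]
  by_cases h : i = t
  · subst h; simp [ht]
  · simp [h, Ne.symm h]

theorem hop_hop {t : ℕ} (ht : t < w) (α : BitVec w → ℂ) : hop t (hop t α) = α := by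
  ext v
  simp only [hop_apply, getLsbD_xor_twoPow v ht, if_true, BitVec.xor_assoc, BitVec.xor_self,
    BitVec.xor_zero]
  have h := inv_sqrt_two_mul_self
  cases v.getLsbD t <;> simp only [Bool.not_true, Bool.not_false, if_true, Bool.false_eq_true,
    if_false] <;> linear_combination (2 * α v) * h

theorem hop_comm {t u : ℕ} (ht : t < w) (hu : u < w) (htu : t ≠ u) (α : BitVec w → ℂ) :
    hop t (hop u α) = hop u (hop t α) := by
  ext v
  have hx : v ^^^ BitVec.twoPow w u ^^^ BitVec.twoPow w t
      = v ^^^ BitVec.twoPow w t ^^^ BitVec.twoPow w u := by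
    rw [BitVec.xor_assoc, BitVec.xor_comm (BitVec.twoPow w u), ← BitVec.xor_assoc]
  simp only [hop_apply, getLsbD_xor_twoPow v ht, getLsbD_xor_twoPow v hu, if_neg htu,
    if_neg htu.symm, hx]
  cases v.getLsbD t <;> cases v.getLsbD u <;> simp <;> ring

/-- Hadamard gates on the qubits `0, …, m - 1`. -/
noncomputable def hops : ℕ → (BitVec w → ℂ) → (BitVec w → ℂ)
  | 0, α => α
  | m + 1, α => hop m (hops m α)

theorem hops_add (m : ℕ) (α β : BitVec w → ℂ) : hops m (α + β) = hops m α + hops m β := by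
  induction m with
  | zero => rfl
  | succ m ih => simp only [hops, ih, map_add]

theorem hops_smul (m : ℕ) (c : ℂ) (α : BitVec w → ℂ) : hops m (c • α) = c • hops m α := by
  induction m with
  | zero => rfl
  | succ m ih => simp only [hops, ih, map_smul]

theorem hop_hops {m t : ℕ} (hmt : m ≤ t) (ht : t < w) (α : BitVec w → ℂ) :
    hop t (hops m α) = hops m (hop t α) := by
  induction m with
  | zero => rfl
  | succ m ih =>
    simp only [hops]
    rw [hop_comm ht (by omega) (by omega), ih (by omega)]

theorem hops_hops {m : ℕ} (hm : m ≤ w) (α : BitVec w → ℂ) : hops m (hops m α) = α := by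
  induction m with
  | zero => rfl
  | succ m ih =>
    simp only [hops]
    rw [hop_hops le_rfl (by omega), ← hop_hops le_rfl (by omega), ← hop_hops le_rfl (by omega),
      hop_hop (by omega), ih (by omega)]

theorem sum_mul_hop (t : ℕ) (α β : BitVec w → ℂ) :
    ∑ v, β v * hop t α v = ∑ v, hop t β v * α v := by
  have hinv : Function.Involutive fun v : BitVec w => v ^^^ BitVec.twoPow w t := by
    intro v; simp
  have h1 : ∑ v, β v * α (v ^^^ BitVec.twoPow w t) = ∑ v, β (v ^^^ BitVec.twoPow w t) * α v := by
    rw [← Equiv.sum_comp (hinv.toPerm)]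
    refine Finset.sum_congr rfl fun v _ => ?_
    simp
  have h2 : ∀ γ ρ : BitVec w → ℂ, ∑ v, γ v * hop t ρ v = ((1 / Real.sqrt 2 : ℝ) : ℂ) *
      (∑ v, (if v.getLsbD t then -(γ v * ρ v) else γ v * ρ v) +
        ∑ v, γ v * ρ (v ^^^ BitVec.twoPow w t)) := by
    intro γ ρ
    rw [← Finset.sum_add_distrib, Finset.mul_sum]
    refine Finset.sum_congr rfl fun v _ => ?_
    rw [hop_apply]; split_ifs <;> ring
  rw [h2, h1]
  simp only [mul_comm (hop t β _)]
  rw [h2]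
  simp only [mul_comm]

/-- The Hadamard matrix is real and symmetric. Pairing with the basis vector `0` therefore turns the
amplitude at `0` into an inner product with the uniform superposition. -/
theorem sum_mul_hops {m : ℕ} (hm : m ≤ w) (α β : BitVec w → ℂ) :
    ∑ v, β v * hops m α v = ∑ v, hops m β v * α v := by
  induction m generalizing α β with
  | zero => rfl
  | succ m ih =>
    simp only [hops]
    rw [sum_mul_hop, ih (by omega), hop_hops le_rfl (by omega)]

/-- The uniform superposition of the words below `2 ^ m`. -/
noncomputable def unif (w m : ℕ) : BitVec w → ℂ :=
  fun v => if v.toNat < 2 ^ m then ((1 / Real.sqrt (2 ^ m) : ℝ) : ℂ) else 0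

/-- For a word `v` below `2 ^ (m + 1)`, exactly one of `v` and `v` with bit `m` flipped lies below
`2 ^ m`, so one summand of `hop` survives. Its sign is positive: the diagonal term survives only if
bit `m` of `v` is zero. -/
theorem hops_single {m : ℕ} (hm : m ≤ w) : hops m (Pi.single (0 : BitVec w) 1) = unif w m := by
  induction m with
  | zero =>
    ext v
    simp only [hops, unif, pow_zero, Nat.lt_one_iff, Real.sqrt_one, div_one, Complex.ofReal_one,
      Pi.single_apply]
    congr 1
    rw [eq_iff_iff, ← BitVec.toNat_inj]; simp
  | succ m ih =>
    have hm' : m < w := hm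
    ext v
    rw [hops, ih hm'.le, hop_apply]
    simp only [unif]
    have hs : (1 / Real.sqrt 2) * (1 / Real.sqrt (2 ^ m)) = 1 / Real.sqrt (2 ^ (m + 1)) := by
      rw [div_mul_div_comm, ← Real.sqrt_mul (by norm_num), pow_succ, mul_comm (2 : ℝ)]; norm_num
    rw [← hs]
    by_cases h1 : ∀ i, m + 1 ≤ i → v.getLsbD i = false
    · rw [if_pos (c := v.toNat < 2 ^ (m + 1)) ((toNat_lt_two_pow_iff _ _).2 h1)]
      rcases Bool.eq_false_or_eq_true (v.getLsbD m) with hb | hb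
      · have e1 : ¬ v.toNat < 2 ^ m := fun h => by
          simp [(toNat_lt_two_pow_iff _ _).1 h m le_rfl] at hb
        have e2 : (v ^^^ BitVec.twoPow w m).toNat < 2 ^ m := by
          rw [toNat_lt_two_pow_iff]
          intro i hi
          rw [getLsbD_xor_twoPow v hm']
          split_ifs with h
          · simp [hb]
          · exact h1 i (by omega)
        rw [if_neg e1, if_pos e2]; simp
      · have e1 : v.toNat < 2 ^ m := by
          rw [toNat_lt_two_pow_iff]
          intro i hi
          rcases Nat.lt_or_ge m i with h | h
          · exact h1 i h
          · rwa [show i = m by omega]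
        have e2 : ¬ (v ^^^ BitVec.twoPow w m).toNat < 2 ^ m := fun h => by
          have := (toNat_lt_two_pow_iff _ _).1 h m le_rfl
          rw [getLsbD_xor_twoPow v hm', if_pos rfl, hb] at this
          simp at this
        rw [if_pos e1, if_neg e2]; simp [hb]
    · have e0 : ¬ v.toNat < 2 ^ (m + 1) := fun h => h1 ((toNat_lt_two_pow_iff _ _).1 h)
      have e1 : ¬ v.toNat < 2 ^ m := fun h => e0 (h.trans (by rw [pow_succ]; omega))
      have e2 : ¬ (v ^^^ BitVec.twoPow w m).toNat < 2 ^ m := fun h => by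
        refine h1 fun i hi => ?_
        have := (toNat_lt_two_pow_iff _ _).1 h i (by omega)
        rwa [getLsbD_xor_twoPow v hm', if_neg (by omega)] at this
      rw [if_neg e0, if_neg e1, if_neg e2]; simp

/-- The diffusion operator of Grover's algorithm on the words below `2 ^ m`. -/
noncomputable def diffuse (m : ℕ) (α : BitVec w → ℂ) : BitVec w → ℂ :=
  hops m fun v => if v = 0 then hops m α v else -hops m α v

/-- Changing the sign off `0` is twice the projection onto `0` minus the identity. Conjugation by
the involution `hops m` turns it into the reflection in the uniform superposition, which acts as
`-1` on words that are not below `2 ^ m`. -/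
theorem diffuse_apply {m : ℕ} (hm : m ≤ w) (α : BitVec w → ℂ) (v : BitVec w) :
    diffuse m α v =
      (if v.toNat < 2 ^ m then 2 / 2 ^ m * ∑ u with u.toNat < 2 ^ m, α u else 0) - α v := by
  have h0 : hops m α 0 = ((1 / Real.sqrt (2 ^ m) : ℝ) : ℂ) * ∑ u with u.toNat < 2 ^ m, α u := by
    have := sum_mul_hops hm α (Pi.single (0 : BitVec w) 1)
    rw [hops_single hm, Finset.sum_eq_single 0 (fun v _ hv => by rw [Pi.single_eq_of_ne hv, zero_mul]) (by simp)] at this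
    simp only [Pi.single_eq_same, one_mul] at this
    rw [this, Finset.sum_filter, Finset.mul_sum]
    refine Finset.sum_congr rfl fun v _ => ?_
    simp [unif]
  have h1 : (fun v => if v = 0 then hops m α v else -hops m α v)
      = (2 * hops m α 0) • Pi.single (0 : BitVec w) 1 + (-1 : ℂ) • hops m α := by
    ext v
    by_cases hv : v = 0
    · subst hv; simp; ring
    · rw [if_neg hv, Pi.add_apply, Pi.smul_apply, Pi.smul_apply, Pi.single_eq_of_ne hv]
      simp
  rw [diffuse, h1, hops_add, hops_smul, hops_smul, hops_single hm, hops_hops hm, h0]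
  simp only [Pi.add_apply, Pi.smul_apply, unif, smul_eq_mul]
  have h2 : ((1 / Real.sqrt (2 ^ m) : ℝ) : ℂ) * ((1 / Real.sqrt (2 ^ m) : ℝ) : ℂ) = 1 / 2 ^ m := by
    rw [← Complex.ofReal_mul, div_mul_div_comm, Real.mul_self_sqrt (by positivity)]
    push_cast; norm_num
  split_ifs
  · linear_combination (2 * ∑ u with u.toNat < 2 ^ m, α u) * h2
  · ring

/-! ### Grover's algorithm -/

theorem card_filter_toNat_lt {m : ℕ} (hm : m ≤ w) :
    (Finset.univ.filter fun v : BitVec w => v.toNat < 2 ^ m).card = 2 ^ m := by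
  rw [← Finset.card_range (2 ^ m)]
  refine Finset.card_bij (fun v _ => v.toNat) ?_ ?_ ?_
  · intro v hv; simpa using hv
  · intro v _ u _ h; exact BitVec.toNat_inj.1 h
  · intro a ha
    have ha' : a < 2 ^ m := by simpa using ha
    have h := ha'.trans_le (Nat.pow_le_pow_right (by norm_num : 0 < 2) hm)
    exact ⟨wd w a, by simp [wd_toNat h, ha'], wd_toNat h⟩

section

variable (m : ℕ) (mk : BitVec w → Prop) [DecidablePred mk]

/-- The number of marked words below `2 ^ m`. -/
def numMarked : ℕ := (Finset.univ.filter fun v : BitVec w => v.toNat < 2 ^ m ∧ mk v).card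

/-- The angle of Grover's algorithm. -/
noncomputable def groverAngle : ℝ := Real.arcsin (Real.sqrt (numMarked m mk / 2 ^ m))

/-- The amplitudes after `j` rounds of Grover's algorithm. -/
noncomputable def groverAmp (j : ℕ) (v : BitVec w) : ℝ :=
  if v.toNat < 2 ^ m then
    if mk v then Real.sin ((2 * j + 1) * groverAngle m mk) / Real.sqrt (numMarked m mk)
    else Real.cos ((2 * j + 1) * groverAngle m mk) / Real.sqrt (2 ^ m - numMarked m mk)
  else 0

variable {m mk}

theorem cos_groverAngle :
    Real.cos (groverAngle m mk) = Real.sqrt ((2 ^ m - numMarked m mk) / 2 ^ m) := by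
  rw [groverAngle, Real.cos_arcsin, Real.sq_sqrt (by positivity), sub_div, div_self (by positivity)]

theorem numMarked_div_le (hs : 2 * numMarked m mk ≤ 2 ^ m) :
    (numMarked m mk / 2 ^ m : ℝ) ≤ 1 / 2 := by
  rw [div_le_div_iff₀ (by positivity) (by norm_num)]
  have : ((2 * numMarked m mk : ℕ) : ℝ) ≤ ((2 ^ m : ℕ) : ℝ) := by exact_mod_cast hs
  push_cast at this
  linarith

theorem sin_groverAngle (hs : 2 * numMarked m mk ≤ 2 ^ m) :
    Real.sin (groverAngle m mk) = Real.sqrt (numMarked m mk / 2 ^ m) := by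
  rw [groverAngle, Real.sin_arcsin]
  · linarith [Real.sqrt_nonneg (numMarked m mk / 2 ^ m : ℝ)]
  · rw [Real.sqrt_le_one]; linarith [numMarked_div_le hs]

theorem numMarked_lt (hs : 2 * numMarked m mk ≤ 2 ^ m) : (numMarked m mk : ℝ) < 2 ^ m := by
  have h := numMarked_div_le hs
  rw [div_le_iff₀ (by positivity)] at h
  have : (0 : ℝ) < 2 ^ m := by positivity
  linarith

theorem numMarked_pos {v : BitVec w} (hv : v.toNat < 2 ^ m) (hmk : mk v) : 0 < numMarked m mk :=
  Finset.card_pos.2 ⟨v, by simp [hv, hmk]⟩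

theorem sum_ite_marked {R : Type*} [Field R] (hm : m ≤ w) (x y : R) :
    ∑ v : BitVec w with v.toNat < 2 ^ m, (if mk v then x else y)
      = numMarked m mk * x + (2 ^ m - numMarked m mk) * y := by
  have h1 : (Finset.univ.filter fun v : BitVec w => v.toNat < 2 ^ m ∧ ¬ mk v).card
      + numMarked m mk = 2 ^ m := by
    conv_rhs => rw [← card_filter_toNat_lt hm]
    rw [numMarked, ← Finset.filter_filter, ← Finset.filter_filter,
      add_comm, Finset.card_filter_add_card_filter_not]
  have h2 : ((Finset.univ.filter fun v : BitVec w => v.toNat < 2 ^ m ∧ ¬ mk v).card : R)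
      = 2 ^ m - numMarked m mk := by
    rw [eq_sub_iff_add_eq]; exact_mod_cast congrArg (Nat.cast (R := R)) h1
  rw [Finset.sum_ite, Finset.sum_const, Finset.sum_const, Finset.filter_filter,
    Finset.filter_filter, nsmul_eq_mul, nsmul_eq_mul, h2]
  rfl

theorem groverAmp_zero (hs : 2 * numMarked m mk ≤ 2 ^ m) (v : BitVec w) :
    (groverAmp m mk 0 v : ℂ) = unif w m v := by
  have hlt := numMarked_lt hs
  unfold groverAmp unif
  split_ifs with h1 h2
  · have := numMarked_pos h1 h2
    simp only [CharP.cast_eq_zero, mul_zero, zero_add, one_mul, sin_groverAngle hs]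
    rw [Real.sqrt_div (by positivity), div_div, mul_comm, ← div_div, div_self (by positivity)]
  · simp only [CharP.cast_eq_zero, mul_zero, zero_add, one_mul, cos_groverAngle]
    have : 0 < Real.sqrt (2 ^ m - numMarked m mk) := Real.sqrt_pos.2 (by linarith)
    rw [Real.sqrt_div (by linarith), div_div, mul_comm, ← div_div, div_self this.ne']
  · simp

/-- In the plane of vectors that are constant on marked and on unmarked words, a round is a rotation
by `2 θ`. After the sign change the amplitudes sum to `√(2 ^ m) cos (φ + θ)`, so reflecting in the
mean amounts to the addition theorems for `φ = (φ + θ) - θ` and `φ + 2 θ = (φ + θ) + θ`. -/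
theorem groverAmp_succ (hs : 2 * numMarked m mk ≤ 2 ^ m) (hm : m ≤ w) (j : ℕ) (v : BitVec w) :
    (groverAmp m mk (j + 1) v : ℂ) =
      diffuse m (fun v => if mk v then -(groverAmp m mk j v : ℂ) else groverAmp m mk j v) v := by
  have hlt := numMarked_lt hs
  set θ := groverAngle m mk with hθ
  set φ := (2 * j + 1) * θ with hφ
  set n : ℝ := (numMarked m mk : ℝ) with hn
  have hn0 : 0 ≤ n := by positivity
  set x := Real.sin φ / Real.sqrt n with hx
  set y := Real.cos φ / Real.sqrt (2 ^ m - n) with hy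
  have hD : (0 : ℝ) < Real.sqrt (2 ^ m) := by positivity
  have hD2 : Real.sqrt (2 ^ m) * Real.sqrt (2 ^ m) = (2 : ℝ) ^ m :=
    Real.mul_self_sqrt (by positivity)
  have hB : 0 < Real.sqrt (2 ^ m - n) := Real.sqrt_pos.2 (by linarith)
  have hB2 : Real.sqrt (2 ^ m - n) * Real.sqrt (2 ^ m - n) = 2 ^ m - n :=
    Real.mul_self_sqrt (by linarith)
  have hA2 : Real.sqrt n * Real.sqrt n = n := Real.mul_self_sqrt hn0
  have hsin : Real.sin θ = Real.sqrt n / Real.sqrt (2 ^ m) := by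
    rw [hθ, sin_groverAngle hs, Real.sqrt_div hn0]
  have hcos : Real.cos θ = Real.sqrt (2 ^ m - n) / Real.sqrt (2 ^ m) := by
    rw [hθ, cos_groverAngle, Real.sqrt_div (by linarith)]
  have hnx : n * x = Real.sqrt n * Real.sin φ := by
    rw [hx, mul_div_assoc', mul_comm, ← mul_div_assoc']
    nth_rewrite 1 [← hA2]
    -- Without marked words `x` is a division by zero, but both sides vanish.
    by_cases h0 : Real.sqrt n = 0
    · simp [h0]
    · field_simp
  have hny : (2 ^ m - n) * y = Real.sqrt (2 ^ m - n) * Real.cos φ := by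
    rw [hy]
    nth_rewrite 1 [← hB2]
    field_simp
  have hsum : ∑ u : BitVec w with u.toNat < 2 ^ m,
      (if mk u then -(groverAmp m mk j u : ℂ) else groverAmp m mk j u)
      = ((Real.sqrt (2 ^ m) * Real.cos (φ + θ) : ℝ) : ℂ) := by
    have : Real.sqrt (2 ^ m) * Real.cos (φ + θ) = n * (-x) + (2 ^ m - n) * y := by
      rw [mul_neg, hnx, hny, Real.cos_add, hsin, hcos]
      field_simp
      ring
    rw [this]
    push_cast
    rw [hn, Complex.ofReal_natCast, ← sum_ite_marked (m := m) (mk := mk) hm]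
    refine Finset.sum_congr rfl fun u hu => ?_
    have hu' : u.toNat < 2 ^ m := by simpa using hu
    simp only [groverAmp, hu', if_true]
    split_ifs <;> simp [hx, hy, hφ, hθ, hn]
  rw [diffuse_apply hm, hsum]
  have h3 : (2 * ((j + 1 : ℕ) : ℝ) + 1) * θ = φ + θ + θ := by rw [hφ]; push_cast; ring
  have h4 : φ = φ + θ - θ := by ring
  have hcs := Real.sin_sq_add_cos_sq θ
  by_cases hv : v.toNat < 2 ^ m
  swap
  · simp [groverAmp, hv]
  have hc : (2 / 2 ^ m * ((Real.sqrt (2 ^ m) * Real.cos (φ + θ) : ℝ) : ℂ) : ℂ)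
      = ((2 * Real.cos (φ + θ) / Real.sqrt (2 ^ m) : ℝ) : ℂ) := by
    have : 2 * Real.cos (φ + θ) / Real.sqrt (2 ^ m)
        = 2 / 2 ^ m * (Real.sqrt (2 ^ m) * Real.cos (φ + θ)) := by
      rw [div_eq_iff hD.ne', show 2 / 2 ^ m * (Real.sqrt (2 ^ m) * Real.cos (φ + θ))
        * Real.sqrt (2 ^ m) = 2 / 2 ^ m * (Real.sqrt (2 ^ m) * Real.sqrt (2 ^ m))
          * Real.cos (φ + θ) by ring, hD2, div_mul_cancel₀ _ (by positivity)]
    rw [this]; push_cast; ring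
  rw [if_pos hv, hc]
  by_cases hmk : mk v
  · have hnpos : 0 < n := by rw [hn]; exact_mod_cast numMarked_pos hv hmk
    have hA : 0 < Real.sqrt n := Real.sqrt_pos.2 hnpos
    simp only [groverAmp, hv, hmk, if_true, ← hθ, ← hn]
    rw [h3, ← hφ, ← Complex.ofReal_neg, ← Complex.ofReal_sub]
    congr 1
    have e : 2 * Real.cos (φ + θ) / Real.sqrt (2 ^ m)
        = 2 * Real.cos (φ + θ) * Real.sin θ / Real.sqrt n := by
      rw [hsin]; field_simp
    rw [e, Real.sin_add (φ + θ) θ]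
    have h5 : Real.sin φ
        = Real.sin (φ + θ) * Real.cos θ - Real.cos (φ + θ) * Real.sin θ := by
      rw [← Real.sin_sub, ← h4]
    rw [h5]; ring
  · simp only [groverAmp, hv, hmk, if_true, if_false, ← hθ, ← hn]
    rw [h3, ← hφ, ← Complex.ofReal_sub]
    congr 1
    have e : 2 * Real.cos (φ + θ) / Real.sqrt (2 ^ m)
        = 2 * Real.cos (φ + θ) * Real.cos θ / Real.sqrt (2 ^ m - n) := by
      rw [hcos]; field_simp
    rw [e, Real.cos_add (φ + θ) θ]
    have h5 : Real.cos φ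
        = Real.cos (φ + θ) * Real.cos θ + Real.sin (φ + θ) * Real.sin θ := by
      rw [← Real.cos_sub, ← h4]
    rw [h5]; ring

theorem sum_groverAmp_sq (hs : 2 * numMarked m mk ≤ 2 ^ m) (hm : m ≤ w) (j : ℕ) :
    ∑ v : BitVec w with v.toNat < 2 ^ m, groverAmp m mk j v ^ 2 = 1 := by
  have hlt := numMarked_lt hs
  have h1 : ∀ v ∈ Finset.univ.filter (fun v : BitVec w => v.toNat < 2 ^ m),
      groverAmp m mk j v ^ 2 = if mk v then
        Real.sin ((2 * j + 1) * groverAngle m mk) ^ 2 / numMarked m mk else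
        Real.cos ((2 * j + 1) * groverAngle m mk) ^ 2 / (2 ^ m - numMarked m mk) := by
    intro v hv
    have hv' : v.toNat < 2 ^ m := by simpa using hv
    simp only [groverAmp, hv', if_true]
    split_ifs
    · rw [div_pow, Real.sq_sqrt (by positivity)]
    · rw [div_pow, Real.sq_sqrt (by linarith)]
  rw [Finset.sum_congr rfl h1, sum_ite_marked hm,
    mul_div_cancel₀ (b := (2 ^ m - numMarked m mk : ℝ)) _ (by linarith)]
  -- Without marked words the sine term disappears from the sum; the angle is then zero and the
  -- cosine alone gives `1`.
  by_cases h0 : numMarked m mk = 0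
  · have : groverAngle m mk = 0 := by simp [groverAngle, h0]
    simp [h0, this]
  · have : (numMarked m mk : ℝ) ≠ 0 := by exact_mod_cast h0
    rw [mul_div_cancel₀ _ this, Real.sin_sq_add_cos_sq]

theorem sum_groverAmp_sq_marked (h : 0 < numMarked m mk) (j : ℕ) :
    ∑ v : BitVec w with v.toNat < 2 ^ m ∧ mk v, groverAmp m mk j v ^ 2
      = Real.sin ((2 * j + 1) * groverAngle m mk) ^ 2 := by
  have h1 : ∀ v ∈ Finset.univ.filter (fun v : BitVec w => v.toNat < 2 ^ m ∧ mk v),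
      groverAmp m mk j v ^ 2 =
        Real.sin ((2 * j + 1) * groverAngle m mk) ^ 2 / numMarked m mk := by
    intro v hv
    obtain ⟨h1, h2⟩ : v.toNat < 2 ^ m ∧ mk v := by simpa using hv
    simp only [groverAmp, h1, h2, if_true]
    rw [div_pow, Real.sq_sqrt (by positivity)]
  rw [Finset.sum_congr rfl h1, Finset.sum_const, nsmul_eq_mul]
  have : (numMarked m mk : ℝ) ≠ 0 := by exact_mod_cast h.ne'
  exact mul_div_cancel₀ _ this

/-- One of the numbers `3 ^ i` of half rounds is good. -/
theorem exists_pow_three_good (hs : 2 * numMarked m mk ≤ 2 ^ m) (h : 0 < numMarked m mk) :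
    ∃ i : ℕ, (3 ^ i) ^ 2 < 8 * 2 ^ m ∧
      1 / 2 ≤ Real.sin (3 ^ i * groverAngle m mk) ^ 2 := by
  have hlt := numMarked_lt hs
  set θ := groverAngle m mk with hθ
  have hD : (0 : ℝ) < 2 ^ m := by positivity
  have h1 : (1 : ℝ) ≤ numMarked m mk := by exact_mod_cast h
  have hsin : Real.sqrt (1 / 2 ^ m) ≤ Real.sin θ := by
    rw [hθ, sin_groverAngle hs]
    exact Real.sqrt_le_sqrt (by gcongr)
  have hpos : 0 < Real.sqrt (1 / 2 ^ m) := by positivity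
  have hθ0 : 0 ≤ θ := Real.arcsin_nonneg.2 (Real.sqrt_nonneg _)
  have hθpos : 0 < θ := by
    rcases hθ0.eq_or_lt with h | h
    · rw [← h, Real.sin_zero] at hsin; linarith
    · exact h
  have hθge : Real.sqrt (1 / 2 ^ m) ≤ θ := hsin.trans (Real.sin_le hθ0)
  have hθle : θ ≤ Real.pi / 4 := by
    rw [hθ, groverAngle, Real.arcsin_le_iff_le_sin' (by constructor <;> linarith [Real.pi_pos]),
      Real.sin_pi_div_four]
    have : Real.sqrt 2 / 2 = Real.sqrt (1 / 2) := by
      rw [Real.sqrt_div (by norm_num), Real.sqrt_one, div_eq_div_iff (by norm_num) (by positivity),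
        Real.mul_self_sqrt (by norm_num)]; norm_num
    rw [this]
    exact Real.sqrt_le_sqrt (numMarked_div_le hs)
  have hex : ∃ i : ℕ, Real.pi / 4 ≤ 3 ^ i * θ := by
    obtain ⟨i, hi⟩ := pow_unbounded_of_one_lt (Real.pi / 4 / θ) (by norm_num : (1 : ℝ) < 3)
    exact ⟨i, by rw [div_lt_iff₀ hθpos] at hi; exact hi.le⟩
  classical
  -- For the least exponent that reaches `π / 4`, tripling cannot jump past `3 π / 4`: either the
  -- previous multiple was below `π / 4`, or `i = 0` and `θ ≤ π / 4`. On this whole range the sine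
  -- is at least `√2 / 2`.
  set i := Nat.find hex with hi
  have hi1 : Real.pi / 4 ≤ 3 ^ i * θ := Nat.find_spec hex
  have hi2 : 3 ^ i * θ ≤ 3 * (Real.pi / 4) := by
    rcases Nat.eq_zero_or_pos i with h0 | h0
    · rw [h0]; linarith [Real.pi_pos]
    · have := Nat.find_min hex (m := i - 1) (by omega)
      rw [not_le] at this
      rw [show i = i - 1 + 1 by omega, pow_succ]
      linarith
  refine ⟨i, ?_, ?_⟩
  · have h2 : (3 : ℝ) ^ i * Real.sqrt (1 / 2 ^ m) ≤ 3 * (Real.pi / 4) :=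
      (mul_le_mul_of_nonneg_left hθge (by positivity)).trans hi2
    have h3 : ((3 : ℝ) ^ i * Real.sqrt (1 / 2 ^ m)) ^ 2 ≤ (3 * (Real.pi / 4)) ^ 2 := by gcongr
    rw [mul_pow, Real.sq_sqrt (by positivity), mul_one_div, div_le_iff₀ hD] at h3
    -- With `θ ≥ √(1 / 2 ^ m)` this bounds `(3 ^ i) ^ 2` by `8 * 2 ^ m`, which is why the search
    -- program stops at `2 ^ (e + 3)`.
    have h4 : (3 * (Real.pi / 4)) ^ 2 < 8 := by nlinarith [Real.pi_lt_d2, Real.pi_pos]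
    have h5 : ((3 : ℝ) ^ i) ^ 2 < 8 * 2 ^ m := h3.trans_lt (by gcongr)
    exact_mod_cast h5
  · have h6 : Real.sin (Real.pi / 4) ≤ Real.sin (3 ^ i * θ) := by
      rcases le_total (3 ^ i * θ) (Real.pi / 2) with h7 | h7
      · exact Real.sin_le_sin_of_le_of_le_pi_div_two (by linarith [Real.pi_pos]) h7 hi1
      · rw [← Real.sin_pi_sub (3 ^ i * θ)]
        exact Real.sin_le_sin_of_le_of_le_pi_div_two (by linarith [Real.pi_pos]) (by linarith)
          (by linarith)
    rw [Real.sin_pi_div_four] at h6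
    have h8 : (1 / 2 : ℝ) = (Real.sqrt 2 / 2) ^ 2 := by
      rw [div_pow, Real.sq_sqrt (by norm_num)]; norm_num
    rw [h8]
    gcongr

end

end QRAM

namespace QRAM

variable {w : ℕ} {k : ℕ} {p q : Prog} {δ δ' : ℝ≥0∞} {E E' : State w → Prop} {s : State w}

/-! ### Superpositions of one quantum word -/

/-- The basis state in which the quantum variable `0` is `v` and the others are zero. -/
def ket (v : BitVec w) : Basis w := Function.update 0 0 v

open scoped Classical in
/-- The state vector in which the quantum variable `0` has the amplitudes `α` and the others are
zero. -/
noncomputable def emb (α : BitVec w → ℂ) : Basis w → ℂ := fun b => if b = ket (b 0) then α (b 0) else 0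

@[simp] theorem ket_zero (v : BitVec w) : ket v 0 = v := by simp [ket]

theorem ket_of_ne (v : BitVec w) {x : ℕ} (h : x ≠ 0) : ket v x = 0 := by simp [ket, h]

theorem update_eq_ket_iff (b : Basis w) (u : BitVec w) :
    Function.update b 0 u = ket u ↔ b = ket (b 0) := by
  constructor
  · intro h
    funext x
    by_cases hx : x = 0
    · subst hx; simp
    · have := congrFun h x
      rw [Function.update_of_ne hx] at this
      rw [this, ket_of_ne _ hx, ket_of_ne _ hx]
  · intro h
    rw [h]; simp [ket]

open scoped Classical in
theorem emb_update (α : BitVec w → ℂ) (b : Basis w) (u : BitVec w) :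
    emb α (Function.update b 0 u) = if b = ket (b 0) then α u else 0 := by
  simp only [emb, Function.update_self]
  exact if_congr (by rw [← update_eq_ket_iff b u]) rfl rfl

theorem hadamardGate_emb {t : ℕ} (ht : t < w) (α : BitVec w → ℂ) :
    hadamardGate 0 t (emb α) = emb (hop t α) := by
  funext b
  simp only [hadamardGate, ht, if_true, emb_update]
  simp only [emb, hop_apply]
  by_cases h : b = ket (b 0)
  · simp only [if_pos h]
  · simp only [if_neg h]
    simp

theorem mul_emb (f : Basis w → ℂ) (α : BitVec w → ℂ) :
    (fun b => f b * emb α b) = emb fun v => f (ket v) * α v := by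
  funext b
  simp only [emb]
  split_ifs with h
  · rw [← h]
  · simp

theorem project_emb (v : BitVec w) (α : BitVec w → ℂ) :
    project 0 v (emb α) = delta (ket v) (α v) := by
  classical
  funext b
  simp only [project, emb, delta]
  by_cases h : b = ket v
  · subst h; simp
  · rw [if_neg h]
    by_cases h1 : b 0 = v
    · rw [if_pos h1, h1, if_neg h]
    · rw [if_neg h1]

theorem delta_zero_eq_emb (c : ℂ) :
    (delta 0 c : Basis w → ℂ) = emb (c • Pi.single (0 : BitVec w) 1) := by
  classical
  funext b
  have hk : ket (0 : BitVec w) = 0 := by simp [ket]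
  simp only [delta, emb, Pi.smul_apply, smul_eq_mul]
  by_cases h : b = 0
  · subst h; rw [if_pos rfl, Pi.zero_apply, hk, if_pos rfl, Pi.single_eq_same, mul_one]
  · rw [if_neg h]
    by_cases h0 : b 0 = 0
    · rw [h0, hk, if_neg h]
    · rw [Pi.single_eq_of_ne h0, mul_zero, ite_self]

theorem tsum_delta (b₀ : Basis w) (c : ℂ) : ∑' b, ‖delta b₀ c b‖ₑ ^ 2 = ‖c‖ₑ ^ 2 := by
  rw [tsum_eq_single b₀ (fun b hb => by simp [delta, hb])]
  simp [delta]

theorem sum_finRange_eq_sum (F : BitVec w → ℝ≥0∞) :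
    ((List.finRange (2 ^ w)).map fun v => F (BitVec.ofFin v)).sum = ∑ v, F v := by
  rw [sum_finRange_bitVec]
  exact Equiv.sum_comp (BitVec.equivFin.symm.toEquiv) F

theorem tsum_emb (α : BitVec w → ℂ) : ∑' b, ‖emb α b‖ₑ ^ 2 = ∑ v, ‖α v‖ₑ ^ 2 := by
  rw [← sum_tsum_project 0]
  simp only [project_emb, tsum_delta]
  exact sum_finRange_eq_sum fun v => ‖α v‖ₑ ^ 2

/-- Only the good outcomes are followed, each of which collapses the state to a multiple of one `ket
v`, since no other quantum variable is in superposition. The remaining outcomes count as failure,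
and `hsum` says how much weight they may have. -/
theorem wp_measure_emb {x : ℕ} {α : BitVec w → ℂ} (hs : s.psi = emb α) (good : BitVec w → Prop)
    [DecidablePred good]
    (h : ∀ v, good v → WP k q 0 E { s.tick.set x v with psi := delta (ket v) (α v) })
    (hsum : s.weight ≤ (∑ v with good v, ‖α v‖ₑ ^ 2) + δ * s.weight) :
    WP k (.seq (.instr (.measure x 0)) q) δ E s := by
  unfold WP
  refine hsum.trans (add_le_add ?_ le_rfl)
  rw [Prog.run, prob_flatMap, Prog.run, Instr.exec, List.map_map, Finset.sum_filter,
    ← sum_finRange_eq_sum]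
  refine List.sum_le_sum fun v _ => ?_
  split_ifs with hv
  · have := h _ hv
    simp only [WP, zero_mul, add_zero] at this
    rw [State.weight, tsum_delta] at this
    simpa [hs, project_emb] using this
  · exact zero_le

/-- In a basis state the outcome `b₀ y` carries the whole weight, so the measurement is
deterministic. The branches of weight zero are discarded through `prob_sublist`. -/
theorem wp_measure_delta {x y : ℕ} {b₀ : Basis w} {c : ℂ} (hs : s.psi = delta b₀ c)
    (h : E (s.tick.set x (b₀ y))) : WP k (.instr (.measure x y)) δ E s := by
  unfold WP
  refine le_trans ?_ le_self_add
  rw [Prog.run, Instr.exec]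
  have hp : project y (b₀ y) s.psi = s.psi := by
    rw [hs]; funext b
    simp only [project, delta]
    by_cases hb : b = b₀
    · simp [hb]
    · simp [hb]
  refine le_trans (le_of_eq ?_) (prob_sublist (l := [s.tick.set x (b₀ y)]) ?_ E)
  · rw [prob_singleton_of h]; rfl
  · rw [List.singleton_sublist, List.mem_map]
    refine ⟨(b₀ y).toFin, List.mem_finRange _, ?_⟩
    rw [psi_tick, hp]; rfl

/-! ### Reversible circuits -/

/-- Run a list of instructions. -/
def seqs : List Instr → Prog
  | [] => .skip
  | i :: l => .seq (.instr i) (seqs l)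

/-- The instructions of reversible circuits. Their classical parameters are in registers below
`60`. -/
def Instr.IsXor : Instr → Prop
  | .qconst _ x => x < 60
  | .qop _ q y z => q ≠ y ∧ q ≠ z
  | .qload q _ i j => q ≠ i ∧ q ≠ j
  | _ => False

/-- The permutation of the basis states computed by a reversible instruction. -/
def Instr.act (reg : ℕ → BitVec w) (arr : ℕ → BitVec w → BitVec w → BitVec w) :
    Instr → Basis w → Basis w
  | .qconst q x, b => Function.update b q (b q ^^^ reg x)
  | .qop o q y z, b => Function.update b q (b q ^^^ o.eval (b y) (b z))
  | .qload q a i j, b => Function.update b q (b q ^^^ arr a (b i) (b j))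
  | _, b => b

/-- The permutation of the basis states computed by a reversible circuit. -/
def acts (reg : ℕ → BitVec w) (arr : ℕ → BitVec w → BitVec w → BitVec w) :
    List Instr → Basis w → Basis w
  | [], b => b
  | i :: l, b => acts reg arr l (i.act reg arr b)

section

variable {reg : ℕ → BitVec w} {arr : ℕ → BitVec w → BitVec w → BitVec w}

theorem act_act {i : Instr} (hi : i.IsXor) (b : Basis w) :
    i.act reg arr (i.act reg arr b) = b := by
  cases i <;> simp only [Instr.IsXor] at hi <;> try exact hi.elim
  · simp [Instr.act]
  · simp [Instr.act, Function.update_of_ne hi.1.symm, Function.update_of_ne hi.2.symm]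
  · simp [Instr.act, Function.update_of_ne hi.1.symm, Function.update_of_ne hi.2.symm]

theorem acts_append (C C' : List Instr) (b : Basis w) :
    acts reg arr (C ++ C') b = acts reg arr C' (acts reg arr C b) := by
  induction C generalizing b with
  | nil => rfl
  | cons i C ih => exact ih _

theorem acts_reverse_acts {C : List Instr} (hC : ∀ i ∈ C, i.IsXor) (b : Basis w) :
    acts reg arr C.reverse (acts reg arr C b) = b := by
  induction C generalizing b with
  | nil => rfl
  | cons i C ih =>
    rw [List.reverse_cons, acts_append, acts.eq_2 _ _ b i, ih fun j hj => hC j (List.mem_cons_of_mem _ hj)]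
    exact act_act (hC i List.mem_cons_self) b

theorem acts_acts_reverse {C : List Instr} (hC : ∀ i ∈ C, i.IsXor) (b : Basis w) :
    acts reg arr C (acts reg arr C.reverse b) = b := by
  have := acts_reverse_acts (reg := reg) (arr := arr) (C := C.reverse)
    (fun i hi => hC i (List.mem_reverse.1 hi)) b
  rwa [List.reverse_reverse] at this

/-- The search program writes only to registers from `60` on, so the circuit keeps its meaning
during the search. This is the purpose of the bound in `Instr.IsXor`. -/
theorem acts_congr {reg' : ℕ → BitVec w} (h : ∀ x < 60, reg' x = reg x) {C : List Instr}
    (hC : ∀ i ∈ C, i.IsXor) (b : Basis w) : acts reg' arr C b = acts reg arr C b := by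
  induction C generalizing b with
  | nil => rfl
  | cons i C ih =>
    rw [acts, acts, ih fun j hj => hC j (List.mem_cons_of_mem _ hj)]
    congr 1
    have hi := hC i List.mem_cons_self
    cases i <;> simp only [Instr.IsXor] at hi <;> try exact hi.elim
    · simp [Instr.act, h _ hi]
    · rfl
    · rfl

end

theorem exec_isXor {i : Instr} (hi : i.IsXor) (s : State w) :
    i.exec s = [{ s with psi := fun b => s.psi (i.act s.reg s.arr b) }] := by
  cases i <;> simp only [Instr.IsXor] at hi <;> try exact hi.elim
  · rfl
  · rw [Instr.exec, if_neg (by tauto)]; rfl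
  · rw [Instr.exec, if_neg (by tauto)]; rfl

/-- The new amplitude at `b` is the old one at the preimage of `b`, and as every gate is its own
inverse, the preimage is computed by the reversed circuit. -/
theorem run_seqs_isXor {C : List Instr} (hC : ∀ i ∈ C, i.IsXor) (s : State w) :
    (seqs C).run k s = [{ s with
      psi := fun b => s.psi (acts s.reg s.arr C.reverse b), time := s.time + C.length }] := by
  induction C generalizing s with
  | nil => rfl
  | cons i C ih =>
    rw [seqs, Prog.run, Prog.run, exec_isXor (hC i List.mem_cons_self), List.flatMap_singleton,
      ih fun j hj => hC j (List.mem_cons_of_mem _ hj)]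
    simp only [List.reverse_cons, acts_append, acts, psi_tick, reg_tick, arr_tick, time_tick,
      List.length_cons]
    congr 2
    omega

theorem tsum_seqs_isXor {C : List Instr} (hC : ∀ i ∈ C, i.IsXor) (s : State w) :
    ∑' b, ‖s.psi (acts s.reg s.arr C.reverse b)‖ₑ ^ 2 = s.weight :=
  Equiv.tsum_eq (⟨acts s.reg s.arr C.reverse, acts s.reg s.arr C,
    acts_acts_reverse hC, acts_reverse_acts hC⟩ : Equiv.Perm (Basis w)) fun b => ‖s.psi b‖ₑ ^ 2

theorem wp_seqs_isXor {C : List Instr} (hC : ∀ i ∈ C, i.IsXor)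
    (h : E { s with psi := fun b => s.psi (acts s.reg s.arr C.reverse b),
                    time := s.time + C.length }) : WP k (seqs C) δ E s := by
  unfold WP
  rw [run_seqs_isXor hC, prob_singleton_of h]
  exact le_trans (tsum_seqs_isXor hC s).ge le_self_add

theorem delta_acts_reverse {reg : ℕ → BitVec w} {arr : ℕ → BitVec w → BitVec w → BitVec w}
    {C : List Instr} (hC : ∀ i ∈ C, i.IsXor) (b₀ : Basis w) (c : ℂ) :
    (fun b => delta b₀ c (acts reg arr C.reverse b)) = delta (acts reg arr C b₀) c := by
  funext b
  simp only [delta]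
  congr 1
  rw [eq_iff_iff]
  constructor
  · rintro rfl; rw [acts_acts_reverse hC]
  · rintro rfl; rw [acts_reverse_acts hC]

/-- Flip the sign of the basis states for which the circuit `C` writes an odd number into the
quantum variable `r`; the register `8` contains `0`. -/
def signFlip (C : List Instr) (r : ℕ) : Prog :=
  .seq (seqs C) (.seq (.instr (.phase r 8)) (.seq (.instr (.phase r 8)) (.seq (.instr (.phase r 8))
    (.seq (.instr (.phase r 8)) (seqs C.reverse)))))

theorem exp_four_mul (z : ℂ) : Complex.exp (Complex.I * (Real.pi / 4)) *
    (Complex.exp (Complex.I * (Real.pi / 4)) * (Complex.exp (Complex.I * (Real.pi / 4)) *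
    (Complex.exp (Complex.I * (Real.pi / 4)) * z))) = -z := by
  rw [← mul_assoc, ← mul_assoc, ← mul_assoc, ← Complex.exp_add, ← Complex.exp_add,
    ← Complex.exp_add, show Complex.I * (Real.pi / 4) + Complex.I * (Real.pi / 4) +
      Complex.I * (Real.pi / 4) + Complex.I * (Real.pi / 4) = Real.pi * Complex.I by ring,
    Complex.exp_pi_mul_I, neg_one_mul]

theorem wp_phase {x y : ℕ} (h : E { s.tick with psi := phaseGate x (s.reg y).toNat s.psi }) :
    WP k (.instr (.phase x y)) δ E s := wp_of_exec rfl (tsum_phaseGate _ _ _) h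

/-- Four eighth-turn phases on the lowest qubit of `r` multiply by `exp (i π) = -1` exactly where
this bit is set. The reversed circuit then restores the basis state, so that only the sign remains.
-/
theorem wp_signFlip {C : List Instr} {r : ℕ} (hC : ∀ i ∈ C, i.IsXor) (h8 : s.reg 8 = wd w 0)
    (h : E { s with
      psi := fun b => (if (acts s.reg s.arr C b r).getLsbD 0 then -1 else 1) * s.psi b,
      time := s.time + (2 * C.length + 4) }) : WP k (signFlip C r) δ E s := by
  refine wp_seq_left (wp_seqs_isXor hC (E := fun t => t = _) rfl) ?_
  rintro _ rfl
  set ψ := fun b => s.psi (acts s.reg s.arr C.reverse b)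
  have hstep : ∀ (ψ' : Basis w → ℂ) (τ : ℕ) (δ : ℝ≥0∞) (p : Prog) (E : State w → Prop),
      WP k p δ E { s with psi := phaseGate r 0 ψ', time := τ + 1 } →
        WP k (.seq (.instr (.phase r 8)) p) δ E { s with psi := ψ', time := τ } := by
    intro ψ' τ δ p E h
    refine wp_seq_left (wp_phase (E := fun t => t = _) rfl) ?_
    rintro _ rfl
    simp only [h8, wd_toNat (Nat.two_pow_pos w)]
    exact h
  apply hstep
  apply hstep
  apply hstep
  apply hstep
  refine wp_seqs_isXor (fun i hi => hC i (List.mem_reverse.1 hi)) ?_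
  convert h using 2
  · funext b
    simp only [phaseGate, List.reverse_reverse, ψ]
    rw [acts_reverse_acts hC]
    split_ifs
    · rw [exp_four_mul, neg_one_mul]
    · rw [one_mul]
  · simp; omega

end QRAM

namespace QRAM

variable {w : ℕ} {k : ℕ} {p q : Prog} {δ δ' : ℝ≥0∞} {E E' : State w → Prop} {s t : State w}

/-! ### The search program -/

/-- The arrays agree, and so do the registers below `100` except for those from `a` on. -/
structure Near (a : ℕ) (s t : State w) : Prop where
  reg : ∀ x, x < a ∨ 100 ≤ x → t.reg x = s.reg x
  arr : t.arr = s.arr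

theorem Near.trans {a b : ℕ} {s t u : State w} (h : Near a s t) (h' : Near b t u)
    (hab : a ≤ b := by norm_num) : Near a s u where
  reg x hx := (h'.reg x (by omega)).trans (h.reg x hx)
  arr := h'.arr.trans h.arr

theorem Near.refl (a : ℕ) (s : State w) : Near a s s := ⟨fun _ _ => rfl, rfl⟩

theorem Near.mono {a b : ℕ} {s t : State w} (h : Near b s t) (hab : a ≤ b := by norm_num) :
    Near a s t := (Near.refl a s).trans h hab

theorem Near.frm {a : ℕ} {S : Finset ℕ} {s t : State w} (h : Near a s t) (ht : Clean t) :
    Frm a S s t := ⟨h.reg, fun _ _ => by rw [h.arr], fun _ => ht⟩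

theorem SameBut.near {i c a : ℕ} {s t : State w} (h : SameBut i c s t)
    (hi : a ≤ i ∧ i < 100 := by norm_num) (hc : a ≤ c ∧ c < 100 := by norm_num) : Near a s t :=
  ⟨fun x hx => h.reg x (by omega) (by omega), h.arr⟩

/-- Apply a Hadamard gate to each of the qubits `0, …, e - 1` of the quantum variable `0`, where
`e` is the value of the register `50`. -/
def hadamards : Prog := forLoop 90 91 50 (.instr (.hadamard 0 90))

theorem wp_hadamard {x : ℕ} (h : E { s.tick with psi := hadamardGate 0 (s.reg x).toNat s.psi }) :
    WP k (.instr (.hadamard 0 x)) δ E s := wp_of_exec rfl (tsum_hadamardGate _ _ _) h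

theorem wp_hadamards {e : ℕ} (hk : 2 ^ w < k) (hw : 0 < w) (he : e ≤ w)
    (h50 : s.reg 50 = wd w e) (h7 : s.reg 7 = wd w 1) {α : BitVec w → ℂ} (hs : s.psi = emb α) :
    WP k hadamards 0 (fun t => Near 90 s t ∧ t.psi = emb (hops e α) ∧
      t.time ≤ s.time + (4 * e + 3)) s := by
  have hew : e < 2 ^ w := he.trans_lt Nat.lt_two_pow_self
  refine (wp_for (k := k) (s := s) (p := .instr (.hadamard 0 90)) (δ := 0) (i := 90) (c := 91)
    (N := 50) (Inv := fun m t => Near 90 s t ∧ t.psi = emb (hops m α)) (T := fun _ => 1)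
    hew hk hw (by norm_num) (by norm_num)
    (fun m t ht => ⟨(ht.1.reg 50 (by norm_num)).trans h50, (ht.1.reg 7 (by norm_num)).trans h7⟩)
    (fun m t u ht hu => ⟨ht.1.trans (b := 90) (hu.near (a := 90)), hu.psi.trans ht.2⟩)
    (fun m t hm ht hi => wp_hadamard ⟨⟨ht.1.trans (b := 90) ⟨fun _ _ => rfl, rfl⟩, ?_⟩, rfl,
      le_rfl⟩) ⟨Near.refl _ _, hs⟩).mono (fun t ht => ⟨ht.1.1, ht.1.2, ht.2.trans ?_⟩) (by simp)
  · simp only [hi]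
    rw [wd_toNat (by omega), ht.2, hadamardGate_emb (by omega)]
    rfl
  · simp; omega

/-- The data of a search: the circuit `C` decides in the quantum variable `r` whether the word in
the quantum variable `0` is marked, and computes from it a word in the quantum variable `j`. -/
structure SearchCtx (C : List Instr) (r j e R : ℕ) (mk : BitVec w → Prop)
    (J : BitVec w → BitVec w) (s : State w) : Prop where
  xor : ∀ i ∈ C, i.IsXor
  r50 : s.reg 50 = wd w e
  r7 : s.reg 7 = wd w 1
  r8 : s.reg 8 = wd w 0
  r10 : s.reg 10 = wd w R
  flag : ∀ v : BitVec w, v.toNat < 2 ^ e →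
    (mk v → acts s.reg s.arr C (ket v) r = 1) ∧ (¬ mk v → acts s.reg s.arr C (ket v) r = 0)
  val : ∀ v : BitVec w, v.toNat < 2 ^ e → acts s.reg s.arr C (ket v) j = J v

section

variable {C : List Instr} {r jv e R : ℕ} {mk : BitVec w → Prop} {J : BitVec w → BitVec w}

theorem SearchCtx.near (h : SearchCtx C r jv e R mk J s) (hst : Near 60 s t) :
    SearchCtx C r jv e R mk J t := by
  have hc : ∀ b, acts t.reg t.arr C b = acts s.reg s.arr C b := by
    intro b
    rw [hst.arr]
    exact acts_congr (fun x hx => hst.reg x (Or.inl hx)) h.xor b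
  refine ⟨h.xor, ?_, ?_, ?_, ?_, ?_, ?_⟩
  · rw [hst.reg 50 (by norm_num), h.r50]
  · rw [hst.reg 7 (by norm_num), h.r7]
  · rw [hst.reg 8 (by norm_num), h.r8]
  · rw [hst.reg 10 (by norm_num), h.r10]
  · intro v hv; rw [hc]; exact h.flag v hv
  · intro v hv; rw [hc]; exact h.val v hv

/-- One round of Grover's algorithm. -/
def groverStep (C : List Instr) (r : ℕ) : Prog :=
  .seq (signFlip C r) (.seq hadamards (.seq (signFlip [.qop .lt 2 1 0] 2) hadamards))

theorem diffuse_smul (m : ℕ) (c : ℂ) (α : BitVec w → ℂ) :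
    diffuse m (c • α) = c • diffuse m α := by
  unfold diffuse
  rw [← hops_smul, hops_smul]
  congr 1
  funext v
  simp only [Pi.smul_apply, smul_eq_mul]
  split_ifs <;> ring

theorem acts_lt_zero (reg : ℕ → BitVec w) (arr : ℕ → BitVec w → BitVec w → BitVec w)
    (hw : 0 < w) (v : BitVec w) :
    (acts reg arr [.qop .lt 2 1 0] (ket v) 2).getLsbD 0 = decide (v ≠ 0) := by
  simp only [acts, Instr.act, Function.update_self, ket_of_ne _ (two_ne_zero),
    ket_of_ne _ (one_ne_zero), ket_zero, BinOp.eval]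
  have : ((0 : BitVec w).toNat < v.toNat) ↔ v ≠ 0 := by
    rw [show (0 : BitVec w).toNat = 0 from rfl, Nat.pos_iff_ne_zero, Ne, Ne, ← BitVec.toNat_inj]; rfl
  by_cases h : v = 0
  · simp [h]
  · rw [if_pos (this.2 h), decide_eq_true h]; simp [hw]

/-- The quantum variable `1` is zero, so the second sign change, by the test whether it is less than
the variable `0`, negates all words except `0`; between two rounds of Hadamard gates it becomes
`diffuse`. The scalar `c` is carried along because branches are not normalised. -/
theorem wp_groverStep [DecidablePred mk] (hk : 2 ^ w < k) (hw : 0 < w) (he : e ≤ w)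
    (h : SearchCtx C r jv e R mk J s) {c : ℂ} {j : ℕ}
    (hm : 2 * numMarked e mk ≤ 2 ^ e)
    (hs : s.psi = emb (c • fun v => (groverAmp e mk j v : ℂ))) :
    WP k (groverStep C r) 0 (fun t => Near 90 s t ∧
      t.psi = emb (c • fun v => (groverAmp e mk (j + 1) v : ℂ)) ∧
      t.time ≤ s.time + (2 * C.length + 8 * e + 16)) s := by
  set α : BitVec w → ℂ := c • fun v => if mk v then -(groverAmp e mk j v : ℂ)
    else groverAmp e mk j v with hα
  refine wp_seq_left (F := fun t => Near 90 s t ∧ t.psi = emb α ∧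
    t.time ≤ s.time + (2 * C.length + 4)) (wp_signFlip h.xor h.r8 ⟨⟨fun _ _ => rfl, rfl⟩, ?_,
      le_rfl⟩) ?_
  · simp only [hs]
    rw [mul_emb]
    congr 1
    funext v
    simp only [hα, Pi.smul_apply, smul_eq_mul]
    by_cases hv : v.toNat < 2 ^ e
    · by_cases hmk : mk v
      · rw [(h.flag v hv).1 hmk, if_pos hmk]; simp [hw]
      · rw [(h.flag v hv).2 hmk, if_neg hmk]; simp
    -- Nothing is known about the flag of words from `2 ^ e` on, but their amplitudes vanish.
    · simp [groverAmp, hv]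
  · rintro t ⟨h1, h2, h3⟩
    have ht := h.near (h1.mono)
    refine wp_seq_left (wp_hadamards hk hw he ht.r50 ht.r7 h2) ?_
    rintro u ⟨h4, h5, h6⟩
    have hu := ht.near h4.mono
    refine wp_seq_left (F := fun x => Near 90 u x ∧ x.psi = emb (fun v => if v = 0 then
      hops e α v else - hops e α v) ∧ x.time ≤ u.time + 6) (wp_signFlip (by simp [Instr.IsXor])
      hu.r8 ⟨⟨fun _ _ => rfl, rfl⟩, ?_, le_rfl⟩) ?_
    · simp only [h5]
      rw [mul_emb]
      congr 1
      funext v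
      rw [acts_lt_zero _ _ hw]
      by_cases hv : v = 0 <;> simp [hv]
    · rintro x ⟨h7, h8, h9⟩
      have hx := hu.near h7.mono
      refine (wp_hadamards hk hw he hx.r50 hx.r7 h8).mono ?_
      rintro y ⟨h10, h11, h12⟩
      refine ⟨((h1.trans h4).trans h7).trans h10, ?_, by omega⟩
      rw [h11]
      congr 1
      change diffuse e α = _
      rw [hα, diffuse_smul]
      congr 1
      funext v
      rw [groverAmp_succ hm he]

/-- Measure the quantum variable `0`; if the outcome is marked, note this in the register `72`,
and the computed word in `73`. -/
def readout (C : List Instr) (r j : ℕ) : Prog :=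
  .seq (.instr (.measure 82 0)) (.seq (seqs C) (.seq (.instr (.measure 83 r))
    (.seq (.instr (.measure 84 j)) (.seq (seqs C.reverse) (.seq (.instr (.qconst 0 82))
      (.ite 83 (.seq (.instr (.const 72 1)) (.instr (.op .or 73 84 8))) .skip))))))

/-- The effect of reading out the word `v`. -/
structure ReadPost (C : List Instr) (mk : BitVec w → Prop) (J : BitVec w → BitVec w)
    (v : BitVec w) (s t : State w) : Prop where
  near : Near 72 s t
  clean : Clean t
  time : t.time ≤ s.time + (2 * C.length + 8)
  pos : mk v → t.reg 72 = wd w 1 ∧ t.reg 73 = J v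
  neg : ¬ mk v → t.reg 72 = s.reg 72 ∧ t.reg 73 = s.reg 73

theorem wp_qconst {x y : ℕ} (h : E { s.tick with psi := xorGate x (fun _ => s.reg y) s.psi }) :
    WP k (.instr (.qconst x y)) δ E s :=
  wp_of_exec rfl (tsum_xorGate _ _ (fun _ _ => rfl) _) h

theorem xorGate_delta_ket (v : BitVec w) (c : ℂ) :
    xorGate 0 (fun _ => v) (delta (ket v) c) = delta 0 c := by
  funext b
  simp only [xorGate, delta]
  congr 1
  rw [eq_iff_iff]
  constructor
  · intro h
    funext x
    have := congrFun h x
    by_cases hx : x = 0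
    · subst hx
      rw [Function.update_self, ket_zero] at this
      have h2 : (b 0 ^^^ v) ^^^ v = v ^^^ v := by rw [this]
      rwa [BitVec.xor_assoc, BitVec.xor_self, BitVec.xor_zero] at h2
    · rwa [Function.update_of_ne hx, ket_of_ne _ hx] at this
  · rintro rfl
    simp [ket]

/-- After the first measurement the state is a basis state, so measuring flag and value after `C`
disturbs nothing. The reversed circuit clears the auxiliary words, and the xor with the recorded
outcome clears the variable `0`; the quantum memory is then ready for the next attempt. -/
theorem wp_readout_branch (hw : 0 < w) (h : SearchCtx C r jv e R mk J s) (v : BitVec w)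
    (hv : v.toNat < 2 ^ e) (c : ℂ) :
    WP k (.seq (seqs C) (.seq (.instr (.measure 83 r))
    (.seq (.instr (.measure 84 jv)) (.seq (seqs C.reverse) (.seq (.instr (.qconst 0 82))
      (.ite 83 (.seq (.instr (.const 72 1)) (.instr (.op .or 73 84 8))) .skip)))))) 0
      (ReadPost C mk J v s) { s.tick.set 82 v with psi := delta (ket v) c } := by
  set s₁ : State w := { s.tick.set 82 v with psi := delta (ket v) c } with hs₁
  have hn : Near 60 s s₁ := ⟨fun x hx => by simp [hs₁, reg_set]; omega, rfl⟩
  have h1 := h.near hn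
  set b := acts s₁.reg s₁.arr C (ket v) with hb
  refine wp_seq_left (F := fun t => t = { s₁ with psi := delta b c, time := s₁.time + C.length })
    (wp_seqs_isXor h.xor ?_) ?_
  · simp only [hs₁]
    rw [delta_acts_reverse h.xor]
  rintro _ rfl
  refine wp_seq_left (wp_measure_delta (E := fun t => t = _) rfl rfl) ?_
  rintro _ rfl
  refine wp_seq_left (wp_measure_delta (E := fun t => t = _) rfl rfl) ?_
  rintro _ rfl
  set s₂ : State w := (State.set (State.set { s₁ with
    psi := delta b c, time := s₁.time + C.length }.tick 83 (b r)).tick 84 (b jv)) with hs₂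
  have hr2 : ∀ x, s₂.reg x = if x = 84 then b jv else if x = 83 then b r else if x = 82 then v
      else s.reg x := by
    intro x
    simp only [hs₂, reg_set, reg_tick, hs₁]
  -- The registers written since then are `83` and `84`, which are not parameters of the circuit.
  have hbs : acts s₂.reg s₂.arr C (ket v) = b := by
    rw [hb]
    exact acts_congr (fun x hx => by
      simp only [hs₂, reg_set, reg_tick]; rw [if_neg (by omega), if_neg (by omega)]) h.xor _
  refine wp_seq_left (F := fun t => t = { s₂ with
    psi := delta (ket v) c, time := s₂.time + C.length })
    (wp_seqs_isXor (fun i hi => h.xor i (List.mem_reverse.1 hi)) ?_) ?_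
  · have : (fun x => s₂.psi (acts s₂.reg s₂.arr C.reverse.reverse x)) = delta (ket v) c := by
      rw [show s₂.psi = delta b c from rfl, delta_acts_reverse
        (fun i hi => h.xor i (List.mem_reverse.1 hi)), ← hbs, acts_reverse_acts h.xor]
    rw [this, List.length_reverse]
  rintro _ rfl
  refine wp_seq_left (F := fun t => t = { s₂ with
    psi := delta 0 c, time := s₂.time + C.length + 1 }) (wp_qconst ?_) ?_
  · have : s₂.reg 82 = v := by rw [hr2]; norm_num
    simp only [this, xorGate_delta_ket]
    rfl
  rintro _ rfl
  have htime : s₂.time = s.time + C.length + 3 := by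
    simp only [hs₂, hs₁, time_set, time_tick]; omega
  have h83 : s₂.reg 83 = b r := by rw [hr2]; norm_num
  have hfl := h1.flag v hv
  have hvl := h1.val v hv
  rw [← hb] at hfl hvl
  have h01 : (1 : BitVec w) ≠ 0 := by
    have := wd_eq_zero (w := w) (Nat.one_lt_two_pow hw.ne')
    intro h; exact one_ne_zero (this.1 h)
  by_cases hmk : mk v
  · refine wp_ite (fun h0 => ?_) fun _ => ?_
    · exact absurd ((hfl.1 hmk).symm.trans (h83.symm.trans h0)) h01
    · refine wp_seq_left (wp_const (E := fun t => t = _) rfl) ?_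
      rintro _ rfl
      refine wp_op ?_
      refine ⟨⟨fun x hx => ?_, rfl⟩, ⟨c, rfl⟩, ?_, fun _ => ⟨?_, ?_⟩, fun h => absurd hmk h⟩
      · simp only [reg_set, reg_tick, hr2]
        rw [if_neg (by omega), if_neg (by omega), if_neg (by omega), if_neg (by omega),
          if_neg (by omega)]
      · simp [htime]; omega
      · simp [reg_set]; rfl
      · simp only [reg_set, reg_tick, hr2]
        norm_num
        rw [h.r8, hvl, wd_zero]
        simp [BinOp.eval]
  · refine wp_ite (fun _ => ?_) fun h0 => ?_
    · refine wp_skip ⟨⟨fun x hx => ?_, rfl⟩, ⟨c, rfl⟩, ?_, fun h => absurd h hmk, fun _ => ⟨?_, ?_⟩⟩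
      · simp only [reg_tick, hr2]
        rw [if_neg (by omega), if_neg (by omega), if_neg (by omega)]
      · simp [htime]; omega
      · simp [hr2]
      · simp [hr2]
    · exact absurd (h83.trans (hfl.2 hmk)) h0

theorem sum_enorm_sq_smul (c : ℂ) (f : BitVec w → ℝ) (A : Finset (BitVec w)) :
    ∑ v ∈ A, ‖(c • fun v => (f v : ℂ)) v‖ₑ ^ 2 = ‖c‖ₑ ^ 2 * ENNReal.ofReal (∑ v ∈ A, f v ^ 2) := by
  rw [ENNReal.ofReal_sum_of_nonneg (fun v _ => sq_nonneg _), Finset.mul_sum]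
  refine Finset.sum_congr rfl fun v _ => ?_
  rw [Pi.smul_apply, smul_eq_mul, enorm_mul, mul_pow]
  congr 1
  rw [← ofReal_norm, ← ENNReal.ofReal_pow (norm_nonneg _), Complex.norm_real, Real.norm_eq_abs,
    sq_abs]

theorem sum_groverAmp_sq_univ [DecidablePred mk] (hm : 2 * numMarked e mk ≤ 2 ^ e) (he : e ≤ w)
    (j : ℕ) : ∑ v : BitVec w, groverAmp e mk j v ^ 2 = 1 := by
  rw [← sum_groverAmp_sq hm he j, eq_comm]
  refine Finset.sum_subset (Finset.subset_univ _) fun v _ hv => ?_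
  have : ¬ v.toNat < 2 ^ e := by simpa using hv
  simp [groverAmp, this]

/-- The weight of the marked outcomes is the squared sine times the weight of the state. The first
claim is certain and needs no assumption on the angle; since the outcome is checked by `C`, an
unmarked one leaves the result registers as they were. -/
theorem wp_readout [DecidablePred mk] (hw : 0 < w) (he : e ≤ w)
    (h : SearchCtx C r jv e R mk J s) (hm : 2 * numMarked e mk ≤ 2 ^ e) {c : ℂ} {j : ℕ}
    (hs : s.psi = emb (c • fun v => (groverAmp e mk j v : ℂ))) :
    WP k (readout C r jv) 0 (fun t => ∃ v, v.toNat < 2 ^ e ∧ ReadPost C mk J v s t) s ∧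
    (0 < numMarked e mk → 1 / 2 ≤ Real.sin ((2 * j + 1) * groverAngle e mk) ^ 2 →
      WP k (readout C r jv) 2⁻¹
        (fun t => ∃ v, (v.toNat < 2 ^ e ∧ mk v) ∧ ReadPost C mk J v s t) s) := by
  have hwt : s.weight = ‖c‖ₑ ^ 2 := by
    rw [State.weight, hs, tsum_emb, sum_enorm_sq_smul, sum_groverAmp_sq_univ hm he]
    simp
  constructor
  · refine wp_measure_emb hs (fun v => v.toNat < 2 ^ e) (fun v hv =>
      (wp_readout_branch hw h v hv _).mono fun t ht => ⟨v, hv, ht⟩) ?_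
    rw [sum_enorm_sq_smul, sum_groverAmp_sq hm he, hwt]
    simp
  · intro h0 hsin
    refine wp_measure_emb hs (fun v => v.toNat < 2 ^ e ∧ mk v) (fun v hv =>
      (wp_readout_branch hw h v hv.1 _).mono fun t ht => ⟨v, hv, ht⟩) ?_
    rw [sum_enorm_sq_smul, sum_groverAmp_sq_marked h0, hwt]
    have h2 : (2⁻¹ : ℝ≥0∞) ≤
        ENNReal.ofReal (Real.sin ((2 * j + 1) * groverAngle e mk) ^ 2) := by
      rw [show (2⁻¹ : ℝ≥0∞) = ENNReal.ofReal (1 / 2) by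
        rw [one_div, ENNReal.ofReal_inv_of_pos (by norm_num)]; simp]
      exact ENNReal.ofReal_le_ofReal hsin
    calc ‖c‖ₑ ^ 2 = ‖c‖ₑ ^ 2 * 2⁻¹ + 2⁻¹ * ‖c‖ₑ ^ 2 := by
          rw [mul_comm, ← add_mul, ENNReal.inv_two_add_inv_two, one_mul]
      _ ≤ _ := add_le_add (mul_le_mul_right h2 _) le_rfl

/-- Run Grover's algorithm once, with as many rounds as the register `64` says. -/
def attempt (C : List Instr) (r j : ℕ) : Prog :=
  .seq hadamards (.seq (forLoop 80 81 64 (groverStep C r)) (readout C r j))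

/-- What holds after an attempt that may have failed. -/
structure AttemptPost (C : List Instr) (e j : ℕ) (mk : BitVec w → Prop) (J : BitVec w → BitVec w)
    (s t : State w) : Prop where
  near : Near 72 s t
  clean : Clean t
  time : t.time ≤ s.time + (j + 1) * (2 * C.length + 8 * e + 20)
  res : (t.reg 72 = s.reg 72 ∧ t.reg 73 = s.reg 73) ∨
    (t.reg 72 = wd w 1 ∧ ∃ v : BitVec w, v.toNat < 2 ^ e ∧ mk v ∧ t.reg 73 = J v)

/-- The part of an attempt before the readout is deterministic. It is stated with an arbitrary
continuation `q`, so that the certain and the probabilistic guarantee can share it. -/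
theorem wp_attempt_prepare [DecidablePred mk] (hk : 2 ^ w < k) (hw : 0 < w) (he : e ≤ w)
    (h : SearchCtx C r jv e R mk J s) (hm : 2 * numMarked e mk ≤ 2 ^ e) {j : ℕ} (hj : j < 2 ^ w)
    (h64 : s.reg 64 = wd w j) (hs : Clean s)
    (hq : ∀ t, Near 80 s t → t.time ≤ s.time + (4 * e + 3 + (j * (2 * C.length + 8 * e + 19) + 3)) →
      (∃ c : ℂ, t.psi = emb (c • fun v => (groverAmp e mk j v : ℂ))) → WP k q δ E t) :
    WP k (.seq hadamards (.seq (forLoop 80 81 64 (groverStep C r)) q)) δ E s := by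
  obtain ⟨c, hc⟩ := hs
  rw [delta_zero_eq_emb] at hc
  refine wp_seq_left (wp_hadamards hk hw he h.r50 h.r7 hc) ?_
  rintro t ⟨h1, h2, h3⟩
  have h4 : hops e (c • Pi.single (0 : BitVec w) 1) = c • fun v => (groverAmp e mk 0 v : ℂ) := by
    rw [hops_smul, hops_single he]
    congr 1
    funext v
    rw [groverAmp_zero hm]
  rw [h4] at h2
  refine wp_seq_left ((wp_for (k := k) (s := t) (p := groverStep C r) (δ := 0) (n := j)
    (Inv := fun m u => Near 80 s u ∧ u.psi = emb (c • fun v => (groverAmp e mk m v : ℂ)))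
    (T := fun _ => 2 * C.length + 8 * e + 16) hj hk hw (by norm_num) (by norm_num)
    (fun m t ht => ⟨(ht.1.reg 64 (by norm_num)).trans h64, (ht.1.reg 7 (by norm_num)).trans h.r7⟩)
    (fun m t u ht hu => ⟨ht.1.trans (b := 80) (hu.near (a := 80)), hu.psi.trans ht.2⟩)
    (fun m t _ ht hi => ?_) ⟨h1.mono, h2⟩).mono (fun _ => id) (by simp)) ?_
  · refine (wp_groverStep hk hw he (h.near ht.1.mono) hm ht.2).mono ?_
    rintro u ⟨h5, h6, h7⟩
    exact ⟨⟨ht.1.trans h5, h6⟩, h5.reg 80 (by norm_num), h7⟩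
  · rintro u ⟨⟨h5, h6⟩, h7⟩
    refine hq u h5 ?_ ⟨c, h6⟩
    simp only [Finset.sum_const, Finset.card_range, smul_eq_mul] at h7
    rw [show 2 * C.length + 8 * e + 16 + 3 = 2 * C.length + 8 * e + 19 from rfl] at h7
    omega

theorem attempt_time_le (l e j x : ℕ) (h : x ≤ 4 * e + 3 + (j * (2 * l + 8 * e + 19) + 3)) :
    x + (2 * l + 8) ≤ (j + 1) * (2 * l + 8 * e + 20) := by nlinarith

theorem wp_attempt [DecidablePred mk] (hk : 2 ^ w < k) (hw : 0 < w) (he : e ≤ w)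
    (h : SearchCtx C r jv e R mk J s) (hm : 2 * numMarked e mk ≤ 2 ^ e) {j : ℕ} (hj : j < 2 ^ w)
    (h64 : s.reg 64 = wd w j) (hs : Clean s) :
    WP k (attempt C r jv) 0 (AttemptPost C e j mk J s) s ∧
    (0 < numMarked e mk → 1 / 2 ≤ Real.sin ((2 * j + 1) * groverAngle e mk) ^ 2 →
      WP k (attempt C r jv) 2⁻¹ (fun t => AttemptPost C e j mk J s t ∧ t.reg 72 = wd w 1) s) := by
  have key : ∀ t u v, Near 80 s t →
      t.time ≤ s.time + (4 * e + 3 + (j * (2 * C.length + 8 * e + 19) + 3)) → v.toNat < 2 ^ e →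
      ReadPost C mk J v t u → AttemptPost C e j mk J s u := by
    intro t u v h1 h2 hv h3
    refine ⟨h1.mono.trans h3.near (le_refl 72), h3.clean, ?_, ?_⟩
    · have h4 := attempt_time_le C.length e j (t.time - s.time) (by omega)
      have h5 := h3.time
      generalize (j + 1) * (2 * C.length + 8 * e + 20) = y at h4 ⊢
      omega
    · by_cases hmk : mk v
      · exact Or.inr ⟨(h3.pos hmk).1, v, hv, hmk, (h3.pos hmk).2⟩
      · refine Or.inl ?_
        rw [(h3.neg hmk).1, (h3.neg hmk).2]
        exact ⟨h1.reg 72 (by norm_num), h1.reg 73 (by norm_num)⟩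
  constructor
  · refine wp_attempt_prepare hk hw he h hm hj h64 hs fun t h1 h2 ⟨c, h3⟩ => ?_
    refine (wp_readout hw he (h.near h1.mono) hm h3).1.mono ?_
    rintro u ⟨v, hv, h4⟩
    exact key t u v h1 h2 hv h4
  · intro h0 hsin
    refine wp_attempt_prepare hk hw he h hm hj h64 hs fun t h1 h2 ⟨c, h3⟩ => ?_
    refine ((wp_readout hw he (h.near h1.mono) hm h3).2 h0 hsin).mono ?_
    rintro u ⟨v, hv, h4⟩
    exact ⟨key t u v h1 h2 hv.1 h4, (h4.pos hv.2).1⟩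

end

end QRAM

/-! ### Grover search for an unknown number of marked words -/

namespace QRAM

variable {w : ℕ} {k : ℕ} {p q : Prog} {δ δ' : ℝ≥0∞} {E E' : State w → Prop} {s t : State w}

section

variable {l : List Instr}

theorem wp_seqs_nil (h : E s) : WP k (seqs []) δ E s := wp_skip h

theorem wp_seqs_const {x v : ℕ} (h : WP k (seqs l) δ E (s.tick.set x (wd w v))) :
    WP k (seqs (.const x v :: l)) δ E s :=
  wp_seq_left (wp_const (E := fun t => t = _) rfl) (by rintro _ rfl; exact h)

theorem wp_seqs_op {o : BinOp} {x y z : ℕ}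
    (h : WP k (seqs l) δ E (s.tick.set x (o.eval (s.reg y) (s.reg z)))) :
    WP k (seqs (.op o x y z :: l)) δ E s :=
  wp_seq_left (wp_op (E := fun t => t = _) rfl) (by rintro _ rfl; exact h)

theorem wp_seqs_load {x a i j : ℕ}
    (h : WP k (seqs l) δ E (s.tick.set x (s.arr a (s.reg i) (s.reg j)))) :
    WP k (seqs (.load x a i j :: l)) δ E s :=
  wp_seq_left (wp_load (E := fun t => t = _) rfl) (by rintro _ rfl; exact h)

theorem wp_seqs_store {x a i j : ℕ}
    (h : WP k (seqs l) δ E (s.tick.put a (s.reg i) (s.reg j) (s.reg x))) :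
    WP k (seqs (.store a i j x :: l)) δ E s :=
  wp_seq_left (wp_store (E := fun t => t = _) rfl) (by rintro _ rfl; exact h)

end

/-- Search for a marked word below `2 ^ e`, where `e` is the value of the register `50`; each
number of rounds is tried as often as the register `10` says. If a marked word is found, then the
register `72` becomes `1`, and the computed word is in the register `73`. -/
def search (C : List Instr) (r j : ℕ) : Prog :=
  .seq (seqs [.const 72 0, .const 62 3, .op .add 61 50 62, .op .shl 61 7 61, .const 63 1,
    .const 64 0, .op .mul 65 63 63, .op .lt 66 65 61])
  (.while 66 (.seq (forLoop 70 71 10 (attempt C r j))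
    (seqs [.op .add 64 64 63, .const 62 3, .op .mul 63 63 62, .op .mul 65 63 63,
      .op .lt 66 65 61])))

/-- What a search of which nothing is expected guarantees. -/
structure Sound (e : ℕ) (mk : BitVec w → Prop) (J : BitVec w → BitVec w) (t : State w) : Prop where
  clean : Clean t
  res : t.reg 72 = wd w 0 ∨
    (t.reg 72 = wd w 1 ∧ ∃ v : BitVec w, v.toNat < 2 ^ e ∧ mk v ∧ t.reg 73 = J v)

/-- The cost of a round of a search, in units of the number of half rounds of Grover's algorithm. -/
def searchUnit (l e R : ℕ) : ℕ := R * (2 * l + 8 * e + 23) + 9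

/-- The cost of a search. -/
def searchTime (l e R : ℕ) : ℕ := 9 + 2 * searchUnit l e R * Nat.sqrt (2 ^ (e + 3))

section

variable {C : List Instr} {r jv e R : ℕ} {mk : BitVec w → Prop} {J : BitVec w → BitVec w}

theorem AttemptPost.sound {j : ℕ} (h : AttemptPost C e j mk J s t) (hs : Sound e mk J s) :
    Sound e mk J t ∧ (s.reg 72 = wd w 1 → t.reg 72 = wd w 1) := by
  refine ⟨⟨h.clean, ?_⟩, ?_⟩
  · rcases h.res with h1 | h1
    · rw [h1.1, h1.2]; exact hs.res
    · exact Or.inr h1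
  · intro h2
    rcases h.res with h1 | h1
    · rw [h1.1, h2]
    · exact h1.1

/-- The invariant of repeated attempts. -/
structure AttemptsInv (e : ℕ) (mk : BitVec w → Prop) (J : BitVec w → BitVec w)
    (s t : State w) : Prop where
  near : Near 70 s t
  sound : Sound e mk J t
  found : s.reg 72 = wd w 1 → t.reg 72 = wd w 1

theorem AttemptsInv.sameBut {u : State w} (h : AttemptsInv e mk J s t)
    (hu : SameBut 70 71 t u) : AttemptsInv e mk J s u := by
  have h2 := hu.reg 72 (by norm_num) (by norm_num)
  have h3 := hu.reg 73 (by norm_num) (by norm_num)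
  refine ⟨h.near.trans (b := 70) (hu.near (a := 70)), ⟨?_, ?_⟩, ?_⟩
  · unfold Clean; rw [hu.psi]; exact h.sound.clean
  · rw [h2, h3]; exact h.sound.res
  · rw [h2]; exact h.found

theorem attempts_time_le (l e j R : ℕ) :
    ∑ _m ∈ Finset.range R, ((j + 1) * (2 * l + 8 * e + 20) + 3) + 9
      ≤ searchUnit l e R * (2 * j + 1) := by
  rw [Finset.sum_const, Finset.card_range, smul_eq_mul, searchUnit]
  have h : (j + 1) * (2 * l + 8 * e + 20) + 3 ≤ (2 * l + 8 * e + 23) * (2 * j + 1) := by nlinarith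
  calc R * ((j + 1) * (2 * l + 8 * e + 20) + 3) + 9
      ≤ R * ((2 * l + 8 * e + 23) * (2 * j + 1)) + 9 * (2 * j + 1) :=
        add_le_add (Nat.mul_le_mul_left _ h) (by omega)
    _ = _ := by ring

/-- A failed attempt does not erase an earlier success, so success is a good state in the sense of
`wp_for_amplify`, and `R` attempts with a good number of rounds all fail with probability at most
`2⁻¹ ^ R`. The first claim holds for every number of rounds and has no error. -/
theorem wp_attempts [DecidablePred mk] (hk : 2 ^ w < k) (hw : 0 < w) (he : e ≤ w)
    (hR : R < 2 ^ w)
    (h : SearchCtx C r jv e R mk J s) (hm : 2 * numMarked e mk ≤ 2 ^ e) {j : ℕ} (hj : j < 2 ^ w)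
    (h64 : s.reg 64 = wd w j) (hs : Sound e mk J s) :
    WP k (forLoop 70 71 10 (attempt C r jv)) 0 (fun t => AttemptsInv e mk J s t ∧
      t.time ≤ s.time + ∑ _m ∈ Finset.range R, ((j + 1) * (2 * C.length + 8 * e + 20) + 3) + 3) s ∧
    (0 < numMarked e mk → 1 / 2 ≤ Real.sin ((2 * j + 1) * groverAngle e mk) ^ 2 →
      WP k (forLoop 70 71 10 (attempt C r jv)) (2⁻¹ ^ R) (fun t =>
        (AttemptsInv e mk J s t ∧ t.reg 72 = wd w 1) ∧
        t.time ≤ s.time + ∑ _m ∈ Finset.range R, ((j + 1) * (2 * C.length + 8 * e + 20) + 3) + 3)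
        s) := by
  have h0 : AttemptsInv e mk J s s := ⟨Near.refl _ _, hs, id⟩
  have hatt : ∀ u, AttemptsInv e mk J s u → _ := fun u hu =>
    wp_attempt (k := k) hk hw he (h.near hu.near.mono) hm hj
      ((hu.near.reg 64 (by norm_num)).trans h64) hu.sound.clean
  have hpost : ∀ u v, AttemptsInv e mk J s u → AttemptPost C e j mk J u v →
      AttemptsInv e mk J s v ∧ v.reg 70 = u.reg 70 ∧
        v.time ≤ u.time + (j + 1) * (2 * C.length + 8 * e + 20) := fun u v hu hv =>
    ⟨⟨hu.near.trans hv.near, (hv.sound hu.sound).1, fun h => (hv.sound hu.sound).2 (hu.found h)⟩,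
      hv.near.reg 70 (by norm_num), hv.time⟩
  have hI : ∀ (m : ℕ) (u : State w), AttemptsInv e mk J s u →
      u.reg 10 = wd w R ∧ u.reg 7 = wd w 1 := fun m u hu =>
    ⟨(hu.near.reg 10 (by norm_num)).trans h.r10, (hu.near.reg 7 (by norm_num)).trans h.r7⟩
  constructor
  · exact (wp_for (k := k) (δ := 0) (Inv := fun _ t => AttemptsInv e mk J s t)
      (T := fun _ => (j + 1) * (2 * C.length + 8 * e + 20))
      hR hk hw (by norm_num) (by norm_num) hI
      (fun m t u ht hu => ht.sameBut hu) (fun m u _ hu _ => ((hatt u hu).1).mono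
        fun v hv => hpost u v hu hv) h0).mono (fun _ => id) (by simp)
  · intro hm0 hsin
    refine wp_for_amplify (k := k) (Inv := fun _ t => AttemptsInv e mk J s t)
      (F := fun _ t => AttemptsInv e mk J s t ∧ t.reg 72 = wd w 1)
      (T := fun _ => (j + 1) * (2 * C.length + 8 * e + 20))
      hR hk hw (by norm_num) (by norm_num) hI (fun m t u ht hu => ht.sameBut hu)
      (fun m t ht => ht.1) (fun m t ht => weight_ne_top_of_clean ht.sound.clean)
      (fun m t u ht hu => ⟨ht.1.sameBut hu, (hu.reg 72 (by norm_num) (by norm_num)).trans ht.2⟩)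
      (fun m u _ hu _ => ((hatt u hu.1).1).mono fun v hv => ?_)
      (fun m u _ hu _ => ((hatt u hu).1).mono fun v hv => hpost u v hu hv)
      (fun m u _ hu _ => ((hatt u hu).2 hm0 hsin).mono fun v hv => ?_) h0
    · have := hpost u v hu.1 hv
      exact ⟨⟨this.1, (hv.sound hu.1.sound).2 hu.2⟩, this.2⟩
    · have := hpost u v hu hv.1
      exact ⟨⟨this.1, hv.2⟩, this.2⟩

/-- The invariant of a search: `i` rounds are done. -/
structure SearchInv (g : Prop) (l e R : ℕ) (mk : BitVec w → Prop) [DecidablePred mk]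
    (J : BitVec w → BitVec w) (s : State w) (i j : ℕ) (t : State w) : Prop where
  hj : 2 * j + 1 = 3 ^ i
  le : i = 0 ∨ (3 ^ (i - 1)) ^ 2 < 2 ^ (e + 3)
  near : Near 60 s t
  r61 : t.reg 61 = wd w (2 ^ (e + 3))
  r63 : t.reg 63 = wd w (3 ^ i)
  r64 : t.reg 64 = wd w j
  r66 : t.reg 66 = wd w (if (3 ^ i) ^ 2 < 2 ^ (e + 3) then 1 else 0)
  time : t.time ≤ s.time + 8 + searchUnit l e R * j
  sound : Sound e mk J t
  found : g → 0 < numMarked e mk → ∀ i' < i,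
    1 / 2 ≤ Real.sin (3 ^ i' * groverAngle e mk) ^ 2 → t.reg 72 = wd w 1

theorem wp_search_init [DecidablePred mk] (g : Prop) (he : e + 7 ≤ w)
    (h : SearchCtx C r jv e R mk J s) (hs : Clean s) :
    WP k (seqs [.const 72 0, .const 62 3, .op .add 61 50 62, .op .shl 61 7 61, .const 63 1,
    .const 64 0, .op .mul 65 63 63, .op .lt 66 65 61]) 0
      (SearchInv g C.length e R mk J s 0 0) s := by
  have h1 : e + 3 < 2 ^ w := by
    have : w < 2 ^ w := Nat.lt_two_pow_self
    omega
  have h2 : 2 ^ (e + 3) < 2 ^ w := Nat.pow_lt_pow_right (by norm_num) (by omega)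
  refine wp_seqs_const (wp_seqs_const (wp_seqs_op (wp_seqs_op (wp_seqs_const (wp_seqs_const
    (wp_seqs_op (wp_seqs_op (wp_seqs_nil ?_))))))))
  refine ⟨rfl, Or.inl rfl, ⟨fun x hx => ?_, rfl⟩, ?_, ?_, ?_, ?_, ?_, ⟨hs, ?_⟩, ?_⟩
  · simp only [reg_set, reg_tick]
    repeat rw [if_neg (by omega)]
  · simp [reg_set, h.r50, h.r7, eval_add, eval_shl h1]
  · simp [reg_set]
  · simp [reg_set]
  · simp [reg_set, h.r50, h.r7, eval_add, eval_shl h1, eval_mul]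
    rw [eval_lt (Nat.one_lt_two_pow (by omega)) h2, if_pos (Nat.one_lt_two_pow (by omega))]
  · simp
  · simp [reg_set]
  · intro _ _ i' hi'; omega

/-- After `j` rounds the angle is `(2 j + 1) θ`. Adding `3 ^ i` to `j` maintains `2 j + 1 = 3 ^ i`,
so the angles tried are the multiples `3 ^ i θ`. -/
theorem wp_search_next [DecidablePred mk] {g : Prop} {i j : ℕ} (he : e + 7 ≤ w)
    (h : SearchInv g C.length e R mk J s i j t) (hc : (3 ^ i) ^ 2 < 2 ^ (e + 3)) {u : State w}
    (hu : AttemptsInv e mk J t.tick u)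
    (htime : u.time ≤ t.time + 1 +
      ∑ _m ∈ Finset.range R, ((j + 1) * (2 * C.length + 8 * e + 20) + 3) + 3)
    (hf : g → 0 < numMarked e mk → 1 / 2 ≤ Real.sin ((2 * j + 1) * groverAngle e mk) ^ 2 →
      u.reg 72 = wd w 1) :
    WP k (seqs [.op .add 64 64 63, .const 62 3, .op .mul 63 63 62, .op .mul 65 63 63,
      .op .lt 66 65 61]) 0 (SearchInv g C.length e R mk J s (i + 1) (j + 3 ^ i)) u := by
  have h61 : u.reg 61 = wd w (2 ^ (e + 3)) := (hu.near.reg 61 (by norm_num)).trans h.r61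
  have h63 : u.reg 63 = wd w (3 ^ i) := (hu.near.reg 63 (by norm_num)).trans h.r63
  have h64 : u.reg 64 = wd w j := (hu.near.reg 64 (by norm_num)).trans h.r64
  have h2 : 2 ^ (e + 3) < 2 ^ w := Nat.pow_lt_pow_right (by norm_num) (by omega)
  -- The next square may exceed `2 ^ (e + 3)`, but only by a factor `9 < 2 ^ 4`. Therefore it does
  -- not overflow if `e + 7 ≤ w`.
  have h3 : 3 ^ i * 3 * (3 ^ i * 3) < 2 ^ w := by
    have h4 : 2 ^ (e + 7) ≤ 2 ^ w := Nat.pow_le_pow_right (by norm_num) he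
    rw [show e + 7 = e + 3 + 4 by ring, pow_add _ (e + 3)] at h4
    nlinarith
  refine wp_seqs_op (wp_seqs_const (wp_seqs_op (wp_seqs_op (wp_seqs_op (wp_seqs_nil ?_)))))
  refine ⟨?_, Or.inr hc, h.near.trans (b := 60) ⟨fun x hx => ?_, hu.near.arr⟩, ?_, ?_, ?_, ?_, ?_,
    ⟨hu.sound.clean, ?_⟩, ?_⟩
  · rw [pow_succ, ← h.hj]; ring
  · simp only [reg_set, reg_tick]
    repeat rw [if_neg (by omega)]
    exact hu.near.reg x (by omega)
  · simp [reg_set, h61]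
  · simp [reg_set, h63, eval_mul, pow_succ]
  · simp [reg_set, h63, h64, eval_add]
  · simp [reg_set, h63, h61, eval_mul]
    rw [eval_lt h3 h2, show 3 ^ i * 3 * (3 ^ i * 3) = (3 ^ (i + 1)) ^ 2 by ring]
  · simp only [time_set, time_tick]
    have h5 := attempts_time_le C.length e j R
    have h6 := h.time
    rw [h.hj] at h5
    rw [mul_add]
    generalize searchUnit C.length e R * j = a at *
    generalize searchUnit C.length e R * 3 ^ i = b at *
    omega
  · simpa [reg_set] using hu.sound.res
  · intro hg h0 i' hi' hsin
    have : u.reg 72 = wd w 1 := by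
      rcases Nat.lt_succ_iff_lt_or_eq.1 hi' with h7 | h7
      · exact hu.found (h.found hg h0 i' h7 hsin)
      · refine hf hg h0 ?_
        have h8 : (2 * (j : ℝ) + 1) = 3 ^ i := by exact_mod_cast h.hj
        rw [h8, ← h7]; exact hsin
    simpa [reg_set] using this

/-- What a search guarantees. -/
structure SearchPost (g : Prop) (T e : ℕ) (mk : BitVec w → Prop) (J : BitVec w → BitVec w)
    (s t : State w) : Prop where
  near : Near 60 s t
  time : t.time ≤ s.time + T
  sound : Sound e mk J t
  found : g → (∃ v : BitVec w, v.toNat < 2 ^ e ∧ mk v) → t.reg 72 = wd w 1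

/-- At most `e + 4` powers of three are tried, and each loses at most `2⁻¹ ^ R`. The numbers of
rounds grow geometrically, so the largest one, of order `√(2 ^ e)`, determines the time. With `g`
false the same program is credited only with what is certain. -/
theorem wp_search [DecidablePred mk] (g : Prop) [Decidable g] (hk : 2 ^ w < k) (he : e + 7 ≤ w)
    (hR : R < 2 ^ w) (h : SearchCtx C r jv e R mk J s) (hm : 2 * numMarked e mk ≤ 2 ^ e)
    (hs : Clean s) :
    WP k (search C r jv) (if g then (e + 4) * 2⁻¹ ^ R else 0)
      (SearchPost g (searchTime C.length e R) e mk J s) s := by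
  have hw : 0 < w := by omega
  have hew : e + 4 < 2 ^ w := by
    have : w < 2 ^ w := Nat.lt_two_pow_self
    omega
  refine wp_seq_left (wp_search_init g he h hs) fun t ht => ?_
  refine (wp_while (δ := if g then 2⁻¹ ^ R else 0) (m := e + 4)
    (fun m u => ∃ i j, i + m = e + 4 ∧ SearchInv g C.length e R mk J s i j u) (by omega)
    ⟨0, 0, by omega, ht⟩ ?_).mono ?_ ?_
  · rintro m u ⟨i, j, him, hu⟩ hc
    rw [hu.r66, Ne, wd_bool_eq_zero hw, not_not] at hc
    have hi : i < e + 4 := by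
      have h1 : 2 ^ i ≤ (3 ^ i) ^ 2 := by
        calc 2 ^ i ≤ 3 ^ i := Nat.pow_le_pow_left (by norm_num) _
          _ ≤ (3 ^ i) ^ 2 := Nat.le_self_pow (by norm_num) _
      have h2 := (Nat.pow_lt_pow_iff_right (by norm_num)).1 (h1.trans_lt hc)
      omega
    obtain ⟨m, rfl⟩ : ∃ m', m = m' + 1 := ⟨m - 1, by omega⟩
    refine ⟨m, rfl, ?_⟩
    have hctx : SearchCtx C r jv e R mk J u.tick := h.near (hu.near.trans ⟨fun _ _ => rfl, rfl⟩ le_rfl)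
    have hj : j < 2 ^ w := by
      have h3 : 2 ^ (e + 3) < 2 ^ w := Nat.pow_lt_pow_right (by norm_num) (by omega)
      have h4 := hu.hj
      have h5 : 3 ^ i ≤ (3 ^ i) ^ 2 := Nat.le_self_pow (by norm_num) _
      omega
    have hatt := wp_attempts (k := k) hk hw (by omega) hR hctx hm hj hu.r64
      ⟨hu.sound.clean, hu.sound.res⟩
    by_cases hgood : g ∧ 0 < numMarked e mk ∧
        1 / 2 ≤ Real.sin ((2 * j + 1) * groverAngle e mk) ^ 2
    · rw [if_pos hgood.1]
      refine wp_seq_right (hatt.2 hgood.2.1 hgood.2.2) fun v hv => ?_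
      exact (wp_search_next he hu hc hv.1.1 hv.2 fun _ _ _ => hv.1.2).mono
        fun x hx => ⟨i + 1, _, by omega, hx⟩
    · refine WP.mono (wp_seq_left hatt.1 fun v hv => ?_) (fun _ => id) zero_le
      exact (wp_search_next he hu hc hv.1 hv.2 fun h1 h2 h3 => absurd ⟨h1, h2, h3⟩ hgood).mono
        fun x hx => ⟨i + 1, _, by omega, hx⟩
  · rintro _ ⟨m, u, ⟨i, j, him, hu⟩, hc, rfl⟩
    rw [hu.r66, wd_bool_eq_zero hw, not_lt] at hc
    refine ⟨hu.near.trans ⟨fun _ _ => rfl, rfl⟩ le_rfl, ?_, ⟨hu.sound.clean, hu.sound.res⟩, ?_⟩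
    · rw [time_tick, searchTime]
      -- The last power that passed the test is at most the square root, and the final one is three
      -- times as large; `j` is less than half of it.
      have hj : j ≤ 2 * Nat.sqrt (2 ^ (e + 3)) := by
        have h1 := hu.hj
        rcases hu.le with h0 | h0
        · subst h0; simp at h1; omega
        · rcases Nat.eq_zero_or_pos i with h2 | h2
          · subst h2; simp at h1; omega
          · have h3 : 3 ^ (i - 1) ≤ Nat.sqrt (2 ^ (e + 3)) := Nat.le_sqrt'.2 h0.le
            rw [show i = i - 1 + 1 by omega, pow_succ] at h1
            omega
      have h1 := hu.time
      have h2 := Nat.mul_le_mul_left (searchUnit C.length e R) hj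
      rw [show 2 * searchUnit C.length e R * Nat.sqrt (2 ^ (e + 3))
        = searchUnit C.length e R * (2 * Nat.sqrt (2 ^ (e + 3))) by ring]
      omega
    · rintro hg ⟨v, hv, hmk⟩
      have h0 := numMarked_pos hv hmk
      obtain ⟨i', h1, h2⟩ := exists_pow_three_good hm h0
      refine hu.found hg h0 i' ?_ h2
      -- The loop has ended with `(3 ^ i) ^ 2 ≥ 8 * 2 ^ e`, whereas the good exponent satisfies the
      -- opposite inequality, so it has been tried.
      by_contra hle
      have h3 : 3 ^ i ≤ 3 ^ i' := Nat.pow_le_pow_right (by norm_num) (by omega)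
      have h4 : (3 ^ i) ^ 2 ≤ (3 ^ i') ^ 2 := Nat.pow_le_pow_left h3 2
      rw [pow_add] at hc
      omega
  · split_ifs <;> simp

end

end QRAM

namespace QRAM

variable {w : ℕ} {k : ℕ} {p q : Prog} {δ δ' : ℝ≥0∞} {E E' : State w → Prop} {s t : State w}

/-! ### Counting the ones in a row -/

/-- The number of ones among the first `j` entries of the row `i` of `X`. -/
def cnt (X : ℕ → ℕ → Bool) (i j : ℕ) : ℕ := Nat.count (fun j => X i j = true) j

section

variable {X Y : ℕ → ℕ → Bool} {i j j' n : ℕ}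

theorem cnt_zero : cnt X i 0 = 0 := Nat.count_zero _

theorem cnt_succ : cnt X i (j + 1) = cnt X i j + if X i j then 1 else 0 := Nat.count_succ _ _

theorem cnt_mono (h : j ≤ j') : cnt X i j ≤ cnt X i j' := Nat.count_monotone _ h

theorem cnt_le : cnt X i j ≤ j := Nat.count_le _

theorem cnt_lt_cnt (h : X i j) (hj : j < j') : cnt X i j < cnt X i j' := by
  have := cnt_mono (X := X) (i := i) (j := j + 1) (j' := j') hj
  rw [cnt_succ, if_pos h] at this
  omega

theorem cnt_injective (h : X i j) (h' : X i j') (he : cnt X i j = cnt X i j') : j = j' :=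
  Nat.count_injective (p := fun j => X i j = true) h h' he

/-- Every number between two values of the count is the count at a one. -/
theorem exists_cnt_eq {c : ℕ} (h1 : cnt X i j ≤ c) (h2 : c < cnt X i j') :
    ∃ m, j ≤ m ∧ m < j' ∧ X i m ∧ cnt X i m = c := by
  induction j' with
  | zero => rw [cnt_zero] at h2; omega
  | succ j' ih =>
    by_cases h3 : c < cnt X i j'
    · obtain ⟨m, h4, h5, h6⟩ := ih h3
      exact ⟨m, h4, by omega, h6⟩
    · rw [cnt_succ] at h2
      split_ifs at h2 with hx
      · refine ⟨j', ?_, by omega, hx, by omega⟩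
        by_contra hlt
        have := cnt_lt_cnt hx (not_le.1 hlt)
        omega
      · omega

end

/-! ### Binary logarithms -/

/-- Compute the binary logarithm, rounded up, of the register `46` into the register `50`. -/
def bitLength : Prog :=
  .seq (seqs [.const 50 0, .const 51 1, .op .lt 52 51 46])
    (.while 52 (seqs [.op .add 51 51 51, .op .add 50 50 7, .op .lt 52 51 46]))

theorem wp_bitLength {x : ℕ} (hk : 2 ^ w < k) (hw : 0 < w) (hx : 2 * x < 2 ^ w) (h7 : s.reg 7 = wd w 1)
    (h46 : s.reg 46 = wd w x) :
    WP k bitLength 0 (fun t => Near 50 s t ∧ t.psi = s.psi ∧ t.reg 50 = wd w (Nat.clog 2 x) ∧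
      t.time ≤ s.time + (4 + 4 * Nat.clog 2 x)) s := by
  set Inv : ℕ → State w → Prop := fun m t => ∃ e, e + m = Nat.clog 2 x ∧ Near 50 s t ∧
    t.psi = s.psi ∧ t.reg 50 = wd w e ∧ t.reg 51 = wd w (2 ^ e) ∧
    t.reg 52 = wd w (if 2 ^ e < x then 1 else 0) ∧ t.time ≤ s.time + 3 + 4 * e with hInv
  have hlt : ∀ e, 2 ^ e < x ↔ e < Nat.clog 2 x := fun e =>
    (Nat.lt_clog_iff_pow_lt (by norm_num)).symm
  have hclog : Nat.clog 2 x < 2 ^ w := by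
    refine lt_of_le_of_lt (Nat.clog_le_of_le_pow (y := w) (by omega)) Nat.lt_two_pow_self
  refine wp_seq_left (F := Inv (Nat.clog 2 x)) ?_ fun t ht => ?_
  · refine wp_seqs_const (wp_seqs_const (wp_seqs_op (wp_seqs_nil ?_)))
    refine ⟨0, by omega, ⟨fun y hy => ?_, rfl⟩, rfl, ?_, ?_, ?_, ?_⟩
    · simp only [reg_set, reg_tick]
      repeat rw [if_neg (by omega)]
    · simp [reg_set]
    · simp [reg_set]
    · simp only [reg_set, reg_tick, h46]
      norm_num
      rw [eval_lt (Nat.one_lt_two_pow hw.ne') (by omega)]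
    · simp
  · refine (wp_while (δ := 0) Inv (by omega) ht ?_).mono ?_ (by simp)
    · rintro m u ⟨e, h1, h2, h3, h4, h5, h6, h7'⟩ hc
      rw [h6, Ne, wd_bool_eq_zero hw, not_not] at hc
      have h8 := (hlt e).1 hc
      obtain ⟨m, rfl⟩ : ∃ m', m = m' + 1 := ⟨m - 1, by omega⟩
      refine ⟨m, rfl, wp_seqs_op (wp_seqs_op (wp_seqs_op (wp_seqs_nil ?_)))⟩
      have e7 : u.reg 7 = wd w 1 := (h2.reg 7 (by norm_num)).trans h7
      have e46 : u.reg 46 = wd w x := (h2.reg 46 (by norm_num)).trans h46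
      refine ⟨e + 1, by omega, h2.trans (b := 50) ⟨fun y hy => ?_, rfl⟩, h3, ?_, ?_, ?_, ?_⟩
      · simp only [reg_set, reg_tick]
        repeat rw [if_neg (by omega)]
      · simp [reg_set, h4, e7, eval_add]
      · simp [reg_set, h5, eval_add, pow_succ, mul_two]
      · simp only [reg_set, reg_tick, h5, e46, eval_add]
        norm_num
        rw [eval_lt (by omega) (by omega), pow_succ, mul_two]
      · simp only [time_set, time_tick]; omega
    · rintro _ ⟨m, u, ⟨e, h1, h2, h3, h4, h5, h6, h7'⟩, hc, rfl⟩
      rw [h6, wd_bool_eq_zero hw, hlt] at hc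
      have he : e = Nat.clog 2 x := by omega
      subst he
      exact ⟨h2.trans (b := 50) ⟨fun _ _ => rfl, rfl⟩, h3, h4, by rw [time_tick]; omega⟩

/-! ### The outputs in a light row -/

/-- The array `pc` contains the counts, and the array `lst` the lists, of the ones in the rows of
`X`. -/
structure Listed (s : State w) (pc lst : ℕ) (X : ℕ → ℕ → Bool) (m n : ℕ) : Prop where
  pc : ∀ i < m, ∀ j ≤ n, s.arr pc (wd w i) (wd w j) = wd w (cnt X i j)
  lst : ∀ i < m, ∀ j < n, X i j → s.arr lst (wd w i) (wd w (cnt X i j)) = wd w j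

theorem Listed.congr {pc lst m n : ℕ} {X : ℕ → ℕ → Bool} (h : Listed s pc lst X m n)
    (h1 : t.arr pc = s.arr pc) (h2 : t.arr lst = s.arr lst) : Listed t pc lst X m n :=
  ⟨by rw [h1]; exact h.pc, by rw [h2]; exact h.lst⟩

/-- The array `a` contains the `0`-`1`-matrix of the relation `O`. -/
def Holds (s : State w) (a n : ℕ) (O : ℕ → ℕ → Prop) : Prop :=
  ∀ i < n, ∀ j < n, (O i j → s.arr a (wd w i) (wd w j) = 1) ∧
    (¬ O i j → s.arr a (wd w i) (wd w j) = 0)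

theorem Holds.congr {a n : ℕ} {O : ℕ → ℕ → Prop} (h : Holds s a n O) (h1 : t.arr a = s.arr a) :
    Holds t a n O := by unfold Holds; rw [h1]; exact h

theorem Holds.put {a n : ℕ} {O : ℕ → ℕ → Prop} (h : Holds s a n O) {i j : ℕ} (hn : n < 2 ^ w)
    (hi : i < n) (hj : j < n) :
    Holds (s.put a (wd w i) (wd w j) (wd w 1)) a n fun i' j' => O i' j' ∨ (i' = i ∧ j' = j) := by
  intro i' hi' j' hj'
  simp only [arr_put, wd_inj (hi'.trans hn) (hi.trans hn), wd_inj (hj'.trans hn) (hj.trans hn)]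
  by_cases hc : i' = i ∧ j' = j
  · simp [hc]; rfl
  · simpa [hc] using h i' hi' j' hj'

theorem Holds.iff_congr {a n : ℕ} {O O' : ℕ → ℕ → Prop} (h : Holds s a n O)
    (hO : ∀ i < n, ∀ j < n, O i j ↔ O' i j) : Holds s a n O' := by
  intro i hi j hj
  rw [← hO i hi j hj]
  exact h i hi j hj

/-- The circuit that looks for a one of the product of `X` and `Y` in the row with the number in
register `30`, between the columns in registers `41` and `42`; the length of the row is in the
register `40`. -/
def rowCircuit (lX pY lY : ℕ) : List Instr :=
  [.qconst 1 30, .qload 2 lX 1 0, .qconst 3 41, .qload 4 pY 2 3, .qconst 5 42, .qload 6 pY 2 5,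
    .qop .lt 7 4 6, .qload 8 lY 2 4, .qconst 9 40, .qop .lt 10 0 9, .qop .and 11 7 10]

/-- The row `i` of the product of two matrices. -/
def prodRow (X Y : ℕ → ℕ → Bool) (n i : ℕ) : Finset ℕ :=
  (Finset.range n).filter fun j => ∃ k < n, X i k ∧ Y k j

section

variable {X Y : ℕ → ℕ → Bool} {n i lo hi pX lX pY lY : ℕ}

/-- The word `v` is the position of a `k` in the row `i` of `X` for which the row `k` of `Y` has a
one between `lo` and `hi`. -/
def rowMark (w : ℕ) (X Y : ℕ → ℕ → Bool) (n i lo hi : ℕ) (v : BitVec w) : Prop :=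
  ∃ k < n, X i k ∧ v = wd w (cnt X i k) ∧ cnt Y k lo < cnt Y k hi

theorem acts_rowCircuit (reg : ℕ → BitVec w) (arr : ℕ → BitVec w → BitVec w → BitVec w)
    (v : BitVec w) :
    acts reg arr (rowCircuit lX pY lY) (ket v) 11 = BinOp.and.eval
      (BinOp.lt.eval (arr pY (arr lX (reg 30) v) (reg 41)) (arr pY (arr lX (reg 30) v) (reg 42)))
      (BinOp.lt.eval v (reg 40)) ∧
    acts reg arr (rowCircuit lX pY lY) (ket v) 8 =
      arr lY (arr lX (reg 30) v) (arr pY (arr lX (reg 30) v) (reg 41)) := by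
  constructor <;> simp [rowCircuit, acts, Instr.act, ket]

theorem eval_and_zero (x : BitVec w) : BinOp.and.eval x 0 = 0 := by simp [BinOp.eval]

theorem eval_zero_and (x : BitVec w) : BinOp.and.eval 0 x = 0 := by simp [BinOp.eval]

theorem eval_and_one : BinOp.and.eval (1 : BitVec w) 1 = 1 := by simp [BinOp.eval]

theorem eval_lt_of_lt {x y : BitVec w} (h : x.toNat < y.toNat) : BinOp.lt.eval x y = 1 := by
  simp [BinOp.eval, h]

theorem eval_lt_of_not_lt {x y : BitVec w} (h : ¬ x.toNat < y.toNat) : BinOp.lt.eval x y = 0 := by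
  simp [BinOp.eval, h]

theorem rowCircuit_isXor : ∀ i ∈ rowCircuit lX pY lY, i.IsXor := by
  simp [rowCircuit, Instr.IsXor]

/-- The row `k` of `Y` has a one in the interval exactly if its prefix counts at `lo` and `hi`
differ. The comparison of `v` with the length of the row is needed because beyond its end the
contents of the list are arbitrary. -/
theorem rowMark_spec (hn : n < 2 ^ w) (hi' : i < n) (hX : Listed s pX lX X n n)
    (hY : Listed s pY lY Y n n) (h30 : s.reg 30 = wd w i) (h40 : s.reg 40 = wd w (cnt X i n))
    (h41 : s.reg 41 = wd w lo) (h42 : s.reg 42 = wd w hi) (hlo : lo ≤ n) (hhi : hi ≤ n)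
    (v : BitVec w) :
    (rowMark w X Y n i lo hi v → acts s.reg s.arr (rowCircuit lX pY lY) (ket v) 11 = 1) ∧
    (¬ rowMark w X Y n i lo hi v → acts s.reg s.arr (rowCircuit lX pY lY) (ket v) 11 = 0) := by
  have hcn : ∀ (Z : ℕ → ℕ → Bool) k j, j ≤ n → cnt Z k j < 2 ^ w := fun Z k j hj =>
    (cnt_le.trans hj).trans_lt hn
  rw [(acts_rowCircuit s.reg s.arr v).1, h30, h40, h41, h42]
  constructor
  · rintro ⟨k, hk, hXk, rfl, hlt⟩
    rw [hX.lst i hi' k hk hXk, hY.pc k hk lo hlo, hY.pc k hk hi hhi, eval_lt_of_lt, eval_lt_of_lt,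
      eval_and_one]
    · rw [wd_toNat (hcn _ _ _ hk.le), wd_toNat (hcn _ _ _ le_rfl)]
      exact cnt_lt_cnt hXk hk
    · rw [wd_toNat (hcn _ _ _ hlo), wd_toNat (hcn _ _ _ hhi)]
      exact hlt
  · intro hno
    by_cases hv : v.toNat < cnt X i n
    · obtain ⟨k, -, hk, hXk, hc⟩ := exists_cnt_eq (j := 0) (by rw [cnt_zero]; omega) hv
      have hve : v = wd w (cnt X i k) := by rw [hc, wd_toNat_self]
      rw [hve, hX.lst i hi' k hk hXk, hY.pc k hk lo hlo, hY.pc k hk hi hhi,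
        eval_lt_of_not_lt (x := wd w (cnt Y k lo)), eval_zero_and]
      rw [wd_toNat (hcn _ _ _ hlo), wd_toNat (hcn _ _ _ hhi)]
      exact fun hlt => hno ⟨k, hk, hXk, hve, hlt⟩
    · rw [eval_lt_of_not_lt (x := v), eval_and_zero]
      rwa [wd_toNat (hcn _ _ _ le_rfl)]

/-- The one with number `cnt Y k lo` is the first at or after `lo`, and as the counts differ it
comes before `hi`. A lookup in the list of row `k` thus yields an output without a search among the
columns. -/
theorem rowMark_val (hi' : i < n) (hX : Listed s pX lX X n n)
    (hY : Listed s pY lY Y n n) (h30 : s.reg 30 = wd w i)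
    (h41 : s.reg 41 = wd w lo) (hlo : lo ≤ n) (hhi : hi ≤ n)
    {v : BitVec w} (hv : rowMark w X Y n i lo hi v) :
    ∃ j ∈ prodRow X Y n i, lo ≤ j ∧ j < hi ∧
      acts s.reg s.arr (rowCircuit lX pY lY) (ket v) 8 = wd w j := by
  obtain ⟨k, hk, hXk, rfl, hlt⟩ := hv
  obtain ⟨j, h1, h2, h3, h4⟩ := exists_cnt_eq le_rfl hlt
  refine ⟨j, ?_, h1, h2, ?_⟩
  · simp only [prodRow, Finset.mem_filter, Finset.mem_range]
    exact ⟨by omega, k, hk, hXk, h3⟩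
  · rw [(acts_rowCircuit s.reg s.arr _).2, h30, h41, hX.lst i hi' k hk hXk, hY.pc k hk lo hlo, ← h4,
      hY.lst k hk j (by omega) h3]

theorem exists_rowMark {j : ℕ} (hj : j ∈ prodRow X Y n i) (h1 : lo ≤ j)
    (h2 : j < hi) (hn : n < 2 ^ w) :
    ∃ v : BitVec w, v.toNat < cnt X i n ∧ rowMark w X Y n i lo hi v := by
  simp only [prodRow, Finset.mem_filter, Finset.mem_range] at hj
  obtain ⟨_, k, hk, hXk, hYk⟩ := hj
  refine ⟨wd w (cnt X i k), ?_, k, hk, hXk, rfl, (cnt_mono h1).trans_lt (cnt_lt_cnt hYk h2)⟩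
  rw [wd_toNat ((cnt_le.trans hk.le).trans_lt hn)]
  exact cnt_lt_cnt hXk hk

theorem numMarked_le {e c : ℕ} {mk : BitVec w → Prop} [DecidablePred mk]
    (h : ∀ v, mk v → v.toNat < c) : numMarked e mk ≤ c := by
  rw [numMarked, ← Finset.card_range c]
  refine Finset.card_le_card_of_injOn (fun v => v.toNat) (fun v hv => ?_) fun v _ u _ h => ?_
  · simp only [Finset.coe_filter, Set.mem_ofPred_eq] at hv
    simpa using h v hv.2.2
  · exact BitVec.toNat_inj.1 h

end

end QRAM

/-! ### The search of a light row with a stack of interval ends -/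

namespace QRAM

variable {w : ℕ} {k : ℕ} {p q : Prog} {δ δ' : ℝ≥0∞} {E E' : State w → Prop} {s t : State w}

/-- The constants and the tables of two matrices. -/
structure Env (n R pX lX pY lY : ℕ) (X Y : ℕ → ℕ → Bool) (s : State w) : Prop where
  r0 : s.reg 0 = wd w n
  r7 : s.reg 7 = wd w 1
  r8 : s.reg 8 = wd w 0
  r10 : s.reg 10 = wd w R
  hX : Listed s pX lX X n n
  hY : Listed s pY lY Y n n

theorem Env.frm {n R pX lX pY lY a : ℕ} {S : Finset ℕ} {X Y : ℕ → ℕ → Bool}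
    (h : Env n R pX lX pY lY X Y s) (hst : Frm a S s t)
    (hS : pX ∉ S ∧ lX ∉ S ∧ pY ∉ S ∧ lY ∉ S) (ha : 10 < a := by norm_num) :
    Env n R pX lX pY lY X Y t where
  r0 := (hst.reg _ (by omega)).trans h.r0
  r7 := (hst.reg _ (by omega)).trans h.r7
  r8 := (hst.reg _ (by omega)).trans h.r8
  r10 := (hst.reg _ (by omega)).trans h.r10
  hX := h.hX.congr (hst.arr _ hS.1) (hst.arr _ hS.2.1)
  hY := h.hY.congr (hst.arr _ hS.2.2.1) (hst.arr _ hS.2.2.2)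

/-! ### The outputs in a light row -/

/-- Find the ones in the row of the product with the number in register `30`. The array `16`
contains the stack of the right ends of the intervals that are still to be searched. -/
def rowSearch (pX lX pY lY oarr : ℕ) : Prog :=
  .seq (seqs [.load 40 pX 30 0, .op .add 46 40 40])
  (.seq bitLength
  (.seq (seqs [.store 16 8 8 0, .const 43 1, .const 41 0])
  (.while 43
    (.seq (seqs [.op .sub 44 43 7, .load 42 16 8 44])
    (.seq (search (rowCircuit lX pY lY) 11 8)
    (.ite 72 (seqs [.store oarr 30 73 7, .store 16 8 43 73, .op .add 43 43 7])
      (seqs [.op .add 41 42 7, .op .sub 43 43 7])))))))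

/-- The cost of `rowSearch`, for a row with `c` ones and a row of the product with `l` ones. -/
def rowTime (R c l : ℕ) : ℕ :=
  (2 * l + 1) * (searchTime 11 (Nat.clog 2 (2 * c)) R + 7) + 4 * Nat.clog 2 (2 * c) + 10

section

variable {X Y : ℕ → ℕ → Bool} {n i R pX lX pY lY oarr e : ℕ} {g : Prop}
  {O : ℕ → ℕ → Prop}

/-- The invariant of `rowSearch`: the ones in `F` have been found, those before `lo` all have been
found, and `σ 0, …, σ (sp - 1)` is the stack. -/
structure RowInv (g : Prop) (X Y : ℕ → ℕ → Bool) (n i R oarr e τ : ℕ) (O : ℕ → ℕ → Prop)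
    (s : State w) (F : Finset ℕ) (lo sp : ℕ) (σ : ℕ → ℕ) (t : State w) : Prop where
  frm : Frm 40 {oarr, 16} s t
  clean : Clean t
  r40 : t.reg 40 = wd w (cnt X i n)
  r41 : t.reg 41 = wd w lo
  r43 : t.reg 43 = wd w sp
  r50 : t.reg 50 = wd w e
  stack : ∀ m < sp, t.arr 16 (wd w 0) (wd w m) = wd w (σ m)
  sub : F ⊆ prodRow X Y n i
  mem : ∀ j ∈ F, j < lo ∨ ∃ m < sp, σ m = j
  compl : g → ∀ j ∈ prodRow X Y n i, j < lo → j ∈ F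
  top : ∀ m < sp, 0 < m → σ m ∈ F
  anti : ∀ m m', m < m' → m' < sp → σ m' < σ m
  zero : 0 < sp → σ 0 = n
  le : ∀ m < sp, lo ≤ σ m
  fin : sp = 0 → n ≤ lo
  lo_le : lo ≤ n + 1
  card : sp ≤ F.card + 1
  holds : Holds t oarr n fun i' j' => O i' j' ∨ (i' = i ∧ j' ∈ F)
  fuel : F.card ≤ (prodRow X Y n i).card
  time : t.time ≤ s.time + τ + (searchTime 11 e R + 7) *
    (2 * (prodRow X Y n i).card + 1 - (2 * ((prodRow X Y n i).card - F.card) + sp))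

theorem card_prodRow_le : (prodRow X Y n i).card ≤ n :=
  (Finset.card_filter_le _ _).trans (by simp)

theorem lt_of_mem_prodRow {j : ℕ} (h : j ∈ prodRow X Y n i) : j < n := by
  simp only [prodRow, Finset.mem_filter, Finset.mem_range] at h; exact h.1

/-- The hit `j` lies in the interval from `lo` to the top `σ sp` of the stack, so it is new: earlier
finds are below `lo` or on the stack, whose entries decrease towards the top. Pushing `j` makes the
part before `j` the next interval. Twice the number of missing outputs plus the height of the stack
falls by one. -/
theorem rowInv_positive {F : Finset ℕ} {lo sp τ : ℕ} {σ : ℕ → ℕ} {u : State w} {j : ℕ}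
    (hn : 2 * n + 2 < 2 ^ w) (hi : i < n) (ho : oarr ≠ 16)
    (h : RowInv g X Y n i R oarr e τ O s F lo (sp + 1) σ t) (h7 : t.reg 7 = wd w 1)
    (h8 : t.reg 8 = wd w 0) (h30 : t.reg 30 = wd w i)
    (hu : Frm 42 ∅ t u) (hc : Clean u) (h43 : u.reg 43 = wd w (sp + 1)) (h50 : u.reg 50 = wd w e)
    (h73 : u.reg 73 = wd w j) (hj : j ∈ prodRow X Y n i) (hlo : lo ≤ j) (hhi : j < σ sp)
    (htime : u.time ≤ t.time + (searchTime 11 e R + 4)) :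
    WP k (seqs [.store oarr 30 73 7, .store 16 8 43 73, .op .add 43 43 7]) 0 (fun v =>
      RowInv g X Y n i R oarr e τ O s (insert j F) lo (sp + 2) (Function.update σ (sp + 1) j) v ∧
      2 * ((prodRow X Y n i).card - (insert j F).card) + (sp + 2) + 1 =
        2 * ((prodRow X Y n i).card - F.card) + (sp + 1)) u := by
  have hjF : j ∉ F := fun hjF => by
    rcases h.mem j hjF with h1 | ⟨m, hm, rfl⟩
    · omega
    · rcases Nat.lt_succ_iff_lt_or_eq.1 hm with h2 | rfl
      · have := h.anti m sp h2 (by omega); omega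
      · omega
  have hjn := lt_of_mem_prodRow hj
  have hcard := card_prodRow_le (X := X) (Y := Y) (n := n) (i := i)
  have hsub : insert j F ⊆ prodRow X Y n i := Finset.insert_subset hj h.sub
  have hle := Finset.card_le_card hsub
  have hins := Finset.card_insert_of_notMem hjF
  have hsp := h.card
  have e7 : u.reg 7 = wd w 1 := (hu.reg 7 (by norm_num)).trans h7
  have e8 : u.reg 8 = wd w 0 := (hu.reg 8 (by norm_num)).trans h8
  have e30 : u.reg 30 = wd w i := (hu.reg 30 (by norm_num)).trans h30
  refine wp_seqs_store (wp_seqs_store (wp_seqs_op (wp_seqs_nil ?_)))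
  simp only [reg_put, reg_tick, e7, e8, e30, h43, h73, eval_add]
  refine ⟨⟨?_, hc, ?_, ?_, ?_, ?_, ?_, hsub, ?_, ?_, ?_, ?_, ?_, ?_, by omega, h.lo_le, by omega,
    ?_, hle, ?_⟩, by omega⟩
  · refine (h.frm.trans (b := 42) (S' := {oarr, 16}) (hu.mono le_rfl (by simp))).trans (b := 42)
      (S' := {oarr, 16}) (t := u) ⟨?_, ?_, fun _ => hc⟩
    · intro x hx
      simp only [reg_set, reg_tick, reg_put]
      rw [if_neg (by omega)]
    · intro x hx
      simp only [Finset.mem_insert, Finset.mem_singleton, not_or] at hx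
      funext a b
      simp [arr_put, hx.1, hx.2]
  · simp only [reg_set, reg_tick, reg_put]
    rw [if_neg (by omega), hu.reg 40 (by norm_num), h.r40]
  · simp only [reg_set, reg_tick, reg_put]
    rw [if_neg (by omega), hu.reg 41 (by norm_num), h.r41]
  · simp only [reg_set, if_true]
  · simp only [reg_set, reg_tick, reg_put]
    rw [if_neg (by omega), h50]
  · intro m hm
    simp only [arr_set, arr_tick, arr_put, true_and, ho.symm, false_and, if_false]
    by_cases hms : m = sp + 1
    · subst hms; simp
    · rw [if_neg, Function.update_of_ne hms, hu.arr _ (by simp), h.stack m (by omega)]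
      rw [wd_inj (by omega) (by omega)]
      exact hms
  · intro j' hj'
    rcases Finset.mem_insert.1 hj' with rfl | hj'
    · exact Or.inr ⟨sp + 1, by omega, by simp⟩
    · rcases h.mem j' hj' with h1 | ⟨m, hm, rfl⟩
      · exact Or.inl h1
      · exact Or.inr ⟨m, by omega, by rw [Function.update_of_ne (by omega)]⟩
  · intro hg j' hj' hlt
    exact Finset.mem_insert_of_mem (h.compl hg j' hj' hlt)
  · intro m hm h0
    by_cases hms : m = sp + 1
    · subst hms; simp
    · rw [Function.update_of_ne hms]
      exact Finset.mem_insert_of_mem (h.top m (by omega) h0)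
  · intro m m' hmm hm'
    rw [Function.update_of_ne (by omega : m ≠ sp + 1)]
    by_cases hms : m' = sp + 1
    · subst hms
      rw [Function.update_self]
      rcases Nat.lt_succ_iff_lt_or_eq.1 hmm with h2 | rfl
      · have := h.anti m sp h2 (by omega); omega
      · exact hhi
    · rw [Function.update_of_ne hms]
      exact h.anti m m' hmm (by omega)
  · intro _
    rw [Function.update_of_ne (by omega)]
    exact h.zero (by omega)
  · intro m hm
    by_cases hms : m = sp + 1
    · subst hms; simpa using hlo
    · rw [Function.update_of_ne hms]
      exact h.le m (by omega)
  · have h1 : Holds u oarr n fun i' j' => O i' j' ∨ (i' = i ∧ j' ∈ F) :=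
      h.holds.congr (hu.arr _ (by simp))
    have h2 := Holds.iff_congr (h1.put (by omega : n < 2 ^ w) hi hjn)
      (O' := fun i' j' => O i' j' ∨ (i' = i ∧ j' ∈ insert j F))
      (fun i' _ j' _ => by simp only [Finset.mem_insert]; tauto)
    refine h2.congr ?_
    funext a b
    simp [arr_put, ho]
  · simp only [time_set, time_tick, time_put]
    have h1 := h.time
    rw [show 2 * (prodRow X Y n i).card + 1 - (2 * ((prodRow X Y n i).card - (insert j F).card)
      + (sp + 2)) = 2 * (prodRow X Y n i).card + 1 - (2 * ((prodRow X Y n i).card - F.card)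
      + (sp + 1)) + 1 by omega, mul_add]
    omega

/-- A failed search settles the columns from `lo` to `σ sp - 1`. The column `σ sp` has been found
before, or is `n` at the bottom of the stack, so `lo` may jump to `σ sp + 1`. The stack becomes
lower by one. -/
theorem rowInv_negative {F : Finset ℕ} {lo sp τ : ℕ} {σ : ℕ → ℕ} {u : State w}
    (h : RowInv g X Y n i R oarr e τ O s F lo (sp + 1) σ t) (h7 : t.reg 7 = wd w 1)
    (hu : Frm 42 ∅ t u) (hc : Clean u) (h43 : u.reg 43 = wd w (sp + 1)) (h50 : u.reg 50 = wd w e)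
    (h42 : u.reg 42 = wd w (σ sp))
    (hno : g → ∀ j ∈ prodRow X Y n i, lo ≤ j → j < σ sp → False)
    (htime : u.time ≤ t.time + (searchTime 11 e R + 4)) :
    WP k (seqs [.op .add 41 42 7, .op .sub 43 43 7]) 0 (fun v =>
      RowInv g X Y n i R oarr e τ O s F (σ sp + 1) sp σ v) u := by
  have e7 : u.reg 7 = wd w 1 := (hu.reg 7 (by norm_num)).trans h7
  refine wp_seqs_op (wp_seqs_op (wp_seqs_nil ?_))
  have hz := h.zero (by omega)
  have hsn : σ sp ≤ n := by
    rcases Nat.eq_zero_or_pos sp with h0 | h0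
    · rw [h0, hz]
    · have := h.anti 0 sp h0 (by omega); omega
  have hsp := h.card
  have hcd := h.fuel
  refine ⟨?_, hc, ?_, ?_, ?_, ?_, ?_, h.sub, ?_, ?_, ?_, ?_, ?_, ?_, ?_, by omega, by omega,
    h.holds.congr (hu.arr _ (by simp)), h.fuel, ?_⟩
  · refine (h.frm.trans (b := 42) (S' := {oarr, 16}) (hu.mono le_rfl (by simp))).trans (b := 41)
      (S' := {oarr, 16}) (t := u) ⟨?_, fun _ _ => rfl, fun _ => hc⟩
    intro x hx
    simp only [reg_set, reg_tick]
    repeat rw [if_neg (by omega)]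
  · simp only [reg_set, reg_tick]
    repeat rw [if_neg (by omega)]
    rw [hu.reg 40 (by norm_num), h.r40]
  · simp [reg_set, h42, e7, eval_add]
  · simp only [reg_set, reg_tick, e7, h43, if_true]
    norm_num
    rw [eval_sub (by omega)]
    rfl
  · simp only [reg_set, reg_tick]
    repeat rw [if_neg (by omega)]
    exact h50
  · intro m hm
    simp only [arr_set, arr_tick]
    rw [hu.arr _ (by simp), h.stack m (by omega)]
  · intro j hj
    rcases h.mem j hj with h1 | ⟨m, hm, rfl⟩
    · left; have := h.le sp (by omega); omega
    · rcases Nat.lt_succ_iff_lt_or_eq.1 hm with h2 | rfl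
      · exact Or.inr ⟨m, h2, rfl⟩
      · left; omega
  · intro hg j hj hlt
    by_cases h1 : j < lo
    · exact h.compl hg j hj h1
    · by_cases h2 : j < σ sp
      · exact (hno hg j hj (by omega) h2).elim
      · have h3 : j = σ sp := by omega
        rcases Nat.eq_zero_or_pos sp with h0 | h0
        · rw [h0, hz] at h3
          have := lt_of_mem_prodRow hj; omega
        · rw [h3]; exact h.top sp (by omega) h0
  · intro m hm h0; exact h.top m (by omega) h0
  · intro m m' hm hm'; exact h.anti m m' hm (by omega)
  · intro _; exact hz
  · intro m hm; exact h.anti m sp hm (by omega)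
  · intro h0; rw [h0, hz]; omega
  · simp only [time_set, time_tick]
    have h1 := h.time
    rw [show 2 * (prodRow X Y n i).card + 1 - (2 * ((prodRow X Y n i).card - F.card) + sp)
      = 2 * (prodRow X Y n i).card + 1 - (2 * ((prodRow X Y n i).card - F.card)
      + (sp + 1)) + 1 by omega, mul_add]
    omega

/-- What `rowSearch` guarantees. -/
structure RowPost (g : Prop) (n oarr i : ℕ) (S : Finset ℕ) (C : Finset ℕ) (T : ℕ)
    (O : ℕ → ℕ → Prop) (s t : State w) : Prop where
  frm : Frm 40 S s t
  clean : Clean t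
  time : t.time ≤ s.time + T
  holds : ∃ F ⊆ C, (g → C ⊆ F) ∧ Holds t oarr n fun i' j' => O i' j' ∨ (i' = i ∧ j' ∈ F)

theorem wp_rowSearch_step [Decidable g] {F : Finset ℕ} {lo sp τ : ℕ} {σ : ℕ → ℕ}
    (hk : 2 ^ w < k) (hn : 2 * n + 2 < 2 ^ w) (he : e + 7 ≤ w) (hR : R < 2 ^ w)
    (hce : 2 * cnt X i n ≤ 2 ^ e)
    (hi : i < n) (ho : oarr ≠ 16)
    (hE : Env n R pX lX pY lY X Y t) (h30 : t.reg 30 = wd w i)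
    (h : RowInv g X Y n i R oarr e τ O s F lo (sp + 1) σ t) :
    WP k (.seq (seqs [.op .sub 44 43 7, .load 42 16 8 44])
      (.seq (search (rowCircuit lX pY lY) 11 8)
      (.ite 72 (seqs [.store oarr 30 73 7, .store 16 8 43 73, .op .add 43 43 7])
      (seqs [.op .add 41 42 7, .op .sub 43 43 7])))) (if g then (e + 4) * 2⁻¹ ^ R else 0)
      (fun v => ∃ F' lo' sp' σ', RowInv g X Y n i R oarr e τ O s F' lo' sp' σ' v ∧
        2 * ((prodRow X Y n i).card - F'.card) + sp' + 1 =
        2 * ((prodRow X Y n i).card - F.card) + (sp + 1)) t.tick := by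
  classical
  refine wp_seq_left (F := fun u => Near 42 t u ∧ u.psi = t.psi ∧ u.reg 42 = wd w (σ sp) ∧
    u.reg 43 = wd w (sp + 1) ∧ u.reg 50 = wd w e ∧ u.time ≤ t.time + 3) ?_ ?_
  · refine wp_seqs_op (wp_seqs_load (wp_seqs_nil ⟨⟨fun x hx => ?_, rfl⟩, rfl, ?_, ?_, ?_, ?_⟩))
    · simp only [reg_set, reg_tick]
      repeat rw [if_neg (by omega)]
    · simp only [reg_set, reg_tick, arr_set, arr_tick, if_true]
      rw [if_neg (by norm_num), h.r43, hE.r7, hE.r8, eval_sub (by omega)]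
      exact h.stack sp (by omega)
    · simp [reg_set, h.r43]
    · simp [reg_set, h.r50]
    · simp
  rintro u ⟨hu, hpsi, h42, h43, h50, htu⟩
  have hsn : σ sp ≤ n := by
    have hz := h.zero (by omega)
    rcases Nat.eq_zero_or_pos sp with h0 | h0
    · rw [h0, hz]
    · have := h.anti 0 sp h0 (by omega); omega
  have hlon : lo ≤ n := (h.le sp (by omega)).trans hsn
  have hcu : Clean u := by unfold Clean; rw [hpsi]; exact h.clean
  have hEu : Env n R pX lX pY lY X Y u := hE.frm (hu.frm hcu (S := ∅)) (by simp)
  have u30 : u.reg 30 = wd w i := (hu.reg 30 (by norm_num)).trans h30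
  have u41 : u.reg 41 = wd w lo := (hu.reg 41 (by norm_num)).trans h.r41
  have u40 : u.reg 40 = wd w (cnt X i n) := (hu.reg 40 (by norm_num)).trans h.r40
  set J : BitVec w → BitVec w := fun v => acts u.reg u.arr (rowCircuit lX pY lY) (ket v) 8 with hJ
  have hctx : SearchCtx (rowCircuit lX pY lY) 11 8 e R (rowMark w X Y n i lo (σ sp)) J u :=
    ⟨rowCircuit_isXor, h50, hEu.r7, hEu.r8, hEu.r10,
      fun v _ => rowMark_spec (by omega) hi hEu.hX hEu.hY u30 u40 u41 h42 hlon hsn v, fun _ _ => rfl⟩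
  -- Marked words are ranks of ones in row `i`, and `2 ^ e` is at least twice the number of these
  -- ones, so at most half of the search space is marked.
  have hnm : 2 * numMarked e (rowMark w X Y n i lo (σ sp)) ≤ 2 ^ e := by
    refine le_trans (Nat.mul_le_mul_left 2 (numMarked_le ?_)) hce
    rintro v ⟨k', hk', hX, rfl, -⟩
    rw [wd_toNat ((cnt_le.trans hk'.le).trans_lt (by omega))]
    exact cnt_lt_cnt hX hk'
  refine wp_seq_right (wp_search g hk he hR hctx hnm hcu) fun v hv => ?_
  have hvt : Frm 42 ∅ t v.tick := by
    refine (hu.frm (S := ∅) hcu).trans (b := 60) (S' := ∅) (hv.near.frm (S := ∅) hv.sound.clean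
      |>.trans (b := 60) (S' := ∅) ⟨fun _ _ => rfl, fun _ _ => rfl, id⟩)
  have hw : 1 < 2 ^ w := Nat.one_lt_two_pow (by omega)
  have v42 := (hv.near.reg 42 (by norm_num)).trans h42
  have v43 := (hv.near.reg 43 (by norm_num)).trans h43
  have v50 := (hv.near.reg 50 (by norm_num)).trans h50
  have htv := hv.time
  rw [show (rowCircuit lX pY lY).length = 11 from rfl] at htv
  refine wp_ite (fun h72 => ?_) fun h72 => ?_
  · refine (rowInv_negative h hE.r7 hvt hv.sound.clean v43 v50 v42 ?_
      (by rw [time_tick]; omega)).mono fun x hx => ⟨F, _, sp, σ, hx, by omega⟩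
    intro hg j hj h1 h2
    obtain ⟨x, hx, hmk⟩ := exists_rowMark hj h1 h2 (by omega : n < 2 ^ w)
    have := hv.found hg ⟨x, by omega, hmk⟩
    rw [h72, ← wd_zero, wd_inj (by omega) hw] at this
    omega
  · rcases hv.sound.res with h73 | ⟨-, x, -, hmk, h73⟩
    · exact absurd h73 h72
    · obtain ⟨j, hj, h1, h2, h3⟩ := rowMark_val hi hEu.hX hEu.hY u30 u41 hlon hsn hmk
      refine (rowInv_positive hn hi ho h hE.r7 hE.r8 h30 hvt hv.sound.clean v43 v50
        (h73.trans h3) hj h1 h2 (by rw [time_tick]; omega)).mono fun x hx =>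
          ⟨_, lo, sp + 2, _, hx.1, hx.2⟩

/-- The potential of `rowInv_positive` starts at `2 l + 1` for `l` outputs and falls with every
search; this bounds both the time and the number of searches that may fail. At the end the stack is
empty and `lo` has passed `n`. -/
theorem wp_rowSearch [Decidable g] (hk : 2 ^ w < k) (hn : 4 * n + 4 < 2 ^ w)
    (he : Nat.clog 2 (2 * n) + 7 ≤ w) (hR : R < 2 ^ w) (hi : i < n) (ho : oarr ≠ 16)
    (hS : pX ∉ ({oarr, 16} : Finset ℕ) ∧ lX ∉ ({oarr, 16} : Finset ℕ) ∧
      pY ∉ ({oarr, 16} : Finset ℕ) ∧ lY ∉ ({oarr, 16} : Finset ℕ))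
    (hE : Env n R pX lX pY lY X Y s) (h30 : s.reg 30 = wd w i) (hO : Holds s oarr n O)
    (hs : Clean s) :
    WP k (rowSearch pX lX pY lY oarr)
      (if g then (2 * n + 1) * ((Nat.clog 2 (2 * n) + 4) * 2⁻¹ ^ R) else 0)
      (RowPost g n oarr i {oarr, 16} (prodRow X Y n i)
        (rowTime R (cnt X i n) (prodRow X Y n i).card) O s) s := by
  have hcn : cnt X i n ≤ n := cnt_le
  set e := Nat.clog 2 (2 * cnt X i n) with hedef
  have hee : e ≤ Nat.clog 2 (2 * n) := Nat.clog_mono_right 2 (by omega)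
  have hcard := card_prodRow_le (X := X) (Y := Y) (n := n) (i := i)
  refine wp_seq_left (F := fun u => Near 40 s u ∧ u.psi = s.psi ∧ u.reg 40 = wd w (cnt X i n) ∧
    u.reg 46 = wd w (2 * cnt X i n) ∧ u.time = s.time + 2) ?_ ?_
  · refine wp_seqs_load (wp_seqs_op (wp_seqs_nil ?_))
    refine ⟨⟨fun x hx => ?_, rfl⟩, rfl, ?_, ?_, ?_⟩
    · simp only [reg_set, reg_tick]
      repeat rw [if_neg (by omega)]
    · simp only [reg_set, reg_tick]
      rw [if_neg (by norm_num), if_pos trivial, h30, hE.r0, hE.hX.pc i hi n le_rfl]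
    · simp only [reg_set, reg_tick, if_true]
      rw [h30, hE.r0, hE.hX.pc i hi n le_rfl, eval_add, two_mul]
    · simp
  rintro u ⟨hu, hup, u40, u46, hut⟩
  refine wp_seq_left (wp_bitLength (x := 2 * cnt X i n) hk (by omega) (by omega)
    ((hu.reg 7 (by norm_num)).trans hE.r7) u46) ?_
  rintro v ⟨hv, hvp, v50, hvt⟩
  have hsv : Near 40 s v := hu.trans hv
  have hcv : Clean v := by unfold Clean; rw [hvp, hup]; exact hs
  have hEv : Env n R pX lX pY lY X Y v := hE.frm (hsv.frm hcv (S := ∅)) (by simp)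
  refine wp_seq_left (F := fun x => RowInv g X Y n i R oarr e (4 * e + 9) O s ∅ 0 1 (fun _ => n) x)
    ?_ ?_
  · refine wp_seqs_store (wp_seqs_const (wp_seqs_const (wp_seqs_nil ?_)))
    simp only [hEv.r8, hEv.r0]
    refine ⟨?_, hcv, ?_, ?_, ?_, ?_, ?_, by simp, by simp, by simp, by omega, by omega,
      fun _ => rfl, by simp, by simp, by simp, by simp, ?_, by simp, ?_⟩
    · refine (hsv.frm (S := {oarr, 16}) hcv).trans (b := 40) (S' := {oarr, 16})
        ⟨?_, ?_, fun _ => hcv⟩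
      · intro x hx
        simp only [reg_set, reg_tick, reg_put]
        repeat rw [if_neg (by omega)]
      · intro x hx
        simp only [Finset.mem_insert, Finset.mem_singleton, not_or] at hx
        funext a b
        simp [arr_put, hx.2]
    · simp [reg_set, hv.reg 40 (by norm_num), u40]
    · simp [reg_set]
    · simp [reg_set]
    · simp [reg_set, v50, hedef]
    · intro m hm
      obtain rfl : m = 0 := by omega
      simp [arr_put]
    · refine Holds.iff_congr ((hO.congr (t := v) (by rw [hsv.arr])).congr ?_) (by simp)
      funext a b
      simp [arr_put, ho]
    · simp only [time_set, time_tick, time_put]; omega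
  · intro x hx
    refine (wp_while (δ := if g then (e + 4) * 2⁻¹ ^ R else 0)
      (m := 2 * (prodRow X Y n i).card + 1)
      (fun m y => ∃ F lo sp σ, m = 2 * ((prodRow X Y n i).card - F.card) + sp ∧
        RowInv g X Y n i R oarr e (4 * e + 9) O s F lo sp σ y) (by omega)
      ⟨∅, 0, 1, _, by simp, hx⟩ ?_).mono ?_ ?_
    · rintro m y ⟨F, lo, sp, σ, rfl, hy⟩ hne
      obtain ⟨sp, rfl⟩ : ∃ sp', sp = sp' + 1 := by
        refine ⟨sp - 1, ?_⟩
        rw [hy.r43, Ne, wd_eq_zero (by have := hy.card; have := hy.fuel; omega)] at hne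
        omega
      refine ⟨2 * ((prodRow X Y n i).card - F.card) + sp, by omega, ?_⟩
      refine (wp_rowSearch_step hk (by omega) (by omega) hR (Nat.le_pow_clog (by norm_num) _) hi ho
        (hE.frm hy.frm hS) ((hy.frm.reg 30 (by norm_num)).trans h30) hy).mono ?_
      rintro z ⟨F', lo', sp', σ', hz, hm⟩
      exact ⟨F', lo', sp', σ', by omega, hz⟩
    · rintro _ ⟨m, y, ⟨F, lo, sp, σ, rfl, hy⟩, h0, rfl⟩
      have hsp : sp = 0 := by
        rwa [hy.r43, wd_eq_zero (by have := hy.card; have := hy.fuel; omega)] at h0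
      refine ⟨hy.frm.trans (b := 40) (S' := {oarr, 16}) ⟨fun _ _ => rfl, fun _ _ => rfl, id⟩,
        hy.clean, ?_, F, hy.sub, fun hg j hj => ?_, hy.holds⟩
      · have h1 := hy.time
        have h2 := Nat.mul_le_mul_left (searchTime 11 e R + 7)
          (Nat.sub_le (2 * (prodRow X Y n i).card + 1)
            (2 * ((prodRow X Y n i).card - F.card) + sp))
        rw [time_tick, rowTime, ← hedef, mul_comm (2 * _ + 1)]
        omega
      · exact hy.compl hg j hj ((lt_of_mem_prodRow hj).trans_le (hy.fin hsp))
    · split_ifs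
      · push_cast
        gcongr
      · simp

end

end QRAM

namespace QRAM

variable {w : ℕ} {k : ℕ} {p q : Prog} {δ δ' : ℝ≥0∞} {E E' : State w → Prop} {s t : State w}

/-! ### Loops over the rows -/

section

variable {n oarr : ℕ} {S : Finset ℕ} {C : ℕ → Finset ℕ} {T : ℕ → ℕ} {g : Prop} {O : ℕ → ℕ → Prop}

/-- What a loop over the first `m` rows guarantees, apart from its running time. -/
structure RowsPost (g : Prop) (n oarr : ℕ) (S : Finset ℕ) (C : ℕ → Finset ℕ) (O : ℕ → ℕ → Prop)
    (s : State w) (m : ℕ) (t : State w) : Prop where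
  frm : Frm 30 S s t
  clean : Clean t
  holds : ∃ G : ℕ → ℕ → Prop, (∀ i j, G i j → i < m ∧ j ∈ C i) ∧
    (g → ∀ i < m, ∀ j ∈ C i, G i j) ∧ Holds t oarr n fun i j => O i j ∨ G i j

theorem wp_rows (hk : 2 ^ w < k) (hw : 0 < w) (hn : n < 2 ^ w) (h0 : s.reg 0 = wd w n)
    (h7 : s.reg 7 = wd w 1) (hs : Clean s) (hO : Holds s oarr n O)
    (hb : ∀ i < n, ∀ t O', Frm 30 S s t → Clean t → t.reg 30 = wd w i → Holds t oarr n O' →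
      WP k p δ (RowPost g n oarr i S (C i) (T i) O' t) t) :
    WP k (forLoop 30 31 0 p) (n * δ) (fun t => RowsPost g n oarr S C O s n t ∧
      t.time ≤ s.time + ∑ i ∈ Finset.range n, (T i + 3) + 3) s := by
  refine wp_for (Inv := RowsPost g n oarr S C O s) hn hk hw (by norm_num) (by norm_num)
    (fun m t ht => ⟨(ht.frm.reg 0 (by norm_num)).trans h0, (ht.frm.reg 7 (by norm_num)).trans h7⟩)
    (fun m t u ht hu => ⟨ht.frm.sameBut hu, ?_, ?_⟩) (fun m t hm ht hi => ?_)
    ⟨Frm.refl _ _ _, hs, fun _ _ => False, by simp, by simp, hO.iff_congr (by simp)⟩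
  · unfold Clean; rw [hu.psi]; exact ht.clean
  · obtain ⟨G, h1, h2, h3⟩ := ht.holds
    exact ⟨G, h1, h2, h3.congr (by rw [hu.arr])⟩
  · obtain ⟨G, h1, h2, h3⟩ := ht.holds
    refine (hb m hm t _ ht.frm ht.clean hi h3).mono fun u hu => ⟨⟨ht.frm.trans (b := 40) (S' := S)
      hu.frm (by norm_num) subset_rfl, hu.clean, ?_⟩, hu.frm.reg 30 (by norm_num), hu.time⟩
    obtain ⟨F, hF, hgF, hh⟩ := hu.holds
    refine ⟨fun i j => G i j ∨ (i = m ∧ j ∈ F), ?_, ?_, hh.iff_congr fun _ _ _ _ => or_assoc⟩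
    · rintro i j (h | ⟨rfl, h⟩)
      · have := h1 i j h; exact ⟨by omega, this.2⟩
      · exact ⟨by omega, hF h⟩
    · intro hg i hi j hj
      rcases Nat.lt_succ_iff_lt_or_eq.1 hi with h | rfl
      · exact Or.inl (h2 hg i h j hj)
      · exact Or.inr ⟨rfl, hgF hg hj⟩

end

/-- Find the ones in the rows of a product that are not flagged in the row `b` of the array `13`. -/
def lightRows (pX lX pY lY oarr b : ℕ) : Prog :=
  forLoop 30 31 0 (.seq (seqs [.const 45 b, .load 44 13 45 30])
    (.ite 44 .skip (rowSearch pX lX pY lY oarr)))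

/-- The array `a` contains the `0`-`1`-matrix of `F`, which has `m` rows and `n` columns. -/
def HoldsBool (s : State w) (a m n : ℕ) (F : ℕ → ℕ → Bool) : Prop :=
  ∀ i < m, ∀ j < n, s.arr a (wd w i) (wd w j) = wd w (if F i j then 1 else 0)

theorem HoldsBool.congr {a m n : ℕ} {F : ℕ → ℕ → Bool} (h : HoldsBool s a m n F)
    (h1 : t.arr a = s.arr a) : HoldsBool t a m n F := by unfold HoldsBool; rw [h1]; exact h

section

variable {X Y F : ℕ → ℕ → Bool} {n i R pX lX pY lY oarr b : ℕ} {g : Prop} {O : ℕ → ℕ → Prop}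

theorem wp_lightRows [Decidable g] (hk : 2 ^ w < k) (hn : 4 * n + 4 < 2 ^ w)
    (he : Nat.clog 2 (2 * n) + 7 ≤ w) (hR : R < 2 ^ w) (ho : oarr ≠ 16 ∧ oarr ≠ 13) (hb : b < 3)
    (hS : pX ∉ ({oarr, 16} : Finset ℕ) ∧ lX ∉ ({oarr, 16} : Finset ℕ) ∧
      pY ∉ ({oarr, 16} : Finset ℕ) ∧ lY ∉ ({oarr, 16} : Finset ℕ))
    (hE : Env n R pX lX pY lY X Y s) (hF : HoldsBool s 13 3 n F) (hO : Holds s oarr n O)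
    (hs : Clean s) :
    WP k (lightRows pX lX pY lY oarr b)
      (if g then n * ((2 * n + 1) * ((Nat.clog 2 (2 * n) + 4) * 2⁻¹ ^ R)) else 0)
      (fun t => RowsPost g n oarr {oarr, 16} (fun i => if F b i then ∅ else prodRow X Y n i) O s n t ∧
        t.time ≤ s.time + ∑ i ∈ Finset.range n,
          ((if F b i then 0 else rowTime R (cnt X i n) (prodRow X Y n i).card) + 6) + 3) s := by
  refine (wp_rows (k := k) (S := {oarr, 16})
    (C := fun i => if F b i then ∅ else prodRow X Y n i)
    (T := fun i => (if F b i then 0 else rowTime R (cnt X i n) (prodRow X Y n i).card) + 3)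
    (g := g) (δ := if g then (2 * n + 1) * ((Nat.clog 2 (2 * n) + 4) * 2⁻¹ ^ R) else 0)
    hk (by omega) (by omega) hE.r0 hE.r7 hs hO ?_).mono (fun t ht => ht) (by split_ifs <;> simp)
  intro i hi t O' ht hc h30 hO'
  refine wp_seq_left (F := fun u => Frm 40 {oarr, 16} t u ∧ Clean u ∧ u.arr = t.arr ∧
    u.reg 44 = wd w (if F b i then 1 else 0) ∧ u.time = t.time + 2) ?_ ?_
  · refine wp_seqs_const (wp_seqs_load (wp_seqs_nil ⟨⟨fun x hx => ?_, fun _ _ => rfl, fun _ => hc⟩,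
      hc, rfl, ?_, ?_⟩))
    · simp only [reg_set, reg_tick]
      repeat rw [if_neg (by omega)]
    · simp only [reg_set, reg_tick, arr_set, arr_tick, if_true]
      rw [if_neg (by norm_num), h30, ht.arr 13 (by simp [ho.2.symm])]
      exact hF b hb i hi
    · simp
  · rintro u ⟨hu, hcu, hua, h44, htu⟩
    refine wp_ite (fun h => ?_) fun h => ?_
    · rw [h44, wd_bool_eq_zero (by omega)] at h
      have hsu : Frm 30 {oarr, 16} s u.tick :=
        (ht.trans (b := 40) (S' := {oarr, 16}) hu).trans (b := 40) (S' := {oarr, 16})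
          ⟨fun _ _ => rfl, fun _ _ => rfl, id⟩
      refine (wp_rowSearch hk hn he hR hi ho.1 hS (hE.frm hsu hS)
        ((hu.reg 30 (by norm_num)).trans h30) (hO'.congr (by rw [arr_tick, hua])) hcu).mono
        fun v hv => ⟨?_, hv.clean, ?_, ?_⟩
      · exact (hu.trans (b := 40) (S' := {oarr, 16}) (u := u.tick)
          ⟨fun _ _ => rfl, fun _ _ => rfl, id⟩).trans
          (b := 40) (S' := {oarr, 16}) hv.frm
      · have := hv.time
        rw [time_tick] at this
        rw [if_neg h]; omega
      · rw [if_neg h]; exact hv.holds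
    · rw [h44, Ne, wd_bool_eq_zero (by omega), not_not] at h
      refine wp_skip ⟨hu.trans (b := 40) (S' := {oarr, 16}) ⟨fun _ _ => rfl, fun _ _ => rfl, id⟩,
        hcu, by rw [time_tick]; omega, ∅, by simp, by simp [h], ?_⟩
      exact Holds.iff_congr (hO'.congr (by rw [arr_tick, hua])) (by simp)

end

end QRAM

namespace QRAM

variable {w : ℕ} {k : ℕ} {p q : Prog} {δ δ' : ℝ≥0∞} {E E' : State w → Prop} {s t : State w}

/-! ### The outputs in an arbitrary row, through light rows of the second matrix -/

/-- The circuit that looks for a new one in the row of the product with the number in register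
`30`. A word encodes a one of the row and one of at most `β` ones of the corresponding row of the
second matrix. -/
def denseCircuit (lX pY lY : ℕ) : List Instr :=
  [.qconst 1 41, .qop .add 2 0 1, .qconst 3 9, .qop .div 4 2 3, .qop .mod 5 2 3, .qconst 6 30,
    .qload 7 lX 6 4, .qload 8 lY 7 5, .qconst 9 40, .qop .lt 10 4 9, .qconst 11 0,
    .qload 12 pY 7 11, .qop .lt 13 5 12, .qload 14 2 6 8, .qconst 15 42, .qop .lt 16 0 15,
    .qop .eq 17 14 20, .qop .and 18 10 13, .qop .and 19 16 17, .qop .and 21 18 19]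

theorem denseCircuit_isXor {lX pY lY : ℕ} : ∀ i ∈ denseCircuit lX pY lY, i.IsXor := by
  simp [denseCircuit, Instr.IsXor]

/-- The number `x` encodes a `k` with `X i k` and `Y k j`, of which the latter is among the first
`β` ones of its row. -/
def Codes (X Y : ℕ → ℕ → Bool) (n β i x j : ℕ) : Prop :=
  ∃ k < n, j < n ∧ X i k ∧ Y k j ∧ cnt Y k j < β ∧ x = cnt X i k * β + cnt Y k j

open scoped Classical in
/-- The part of the row `i` of the product that is encoded by some number. -/
noncomputable def denseRow (X Y : ℕ → ℕ → Bool) (n β i : ℕ) : Finset ℕ :=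
  (Finset.range n).filter fun j => ∃ x, Codes X Y n β i x j

section

variable {X Y : ℕ → ℕ → Bool} {n i β x j j' pX lX pY lY : ℕ}

theorem Codes.lt (h : Codes X Y n β i x j) : x < cnt X i n * β := by
  obtain ⟨k, hk, hj, hX, hY, hc, rfl⟩ := h
  have := cnt_lt_cnt hX hk
  nlinarith

theorem Codes.div (h : Codes X Y n β i x j) :
    ∃ k < n, j < n ∧ X i k ∧ Y k j ∧ x / β = cnt X i k ∧ x % β = cnt Y k j := by
  obtain ⟨k, hk, hj, hX, hY, hc, rfl⟩ := h
  refine ⟨k, hk, hj, hX, hY, ?_, ?_⟩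
  · rw [mul_comm, Nat.mul_add_div (by omega), Nat.div_eq_of_lt hc, add_zero]
  · rw [mul_comm, Nat.mul_add_mod, Nat.mod_eq_of_lt hc]

/-- Quotient and remainder by `β` recover the two ranks, and a rank determines a one of its row. So
there are no more encoded outputs than codes, and an interval with a single code is exhausted after
one hit. -/
theorem Codes.unique (h : Codes X Y n β i x j) (h' : Codes X Y n β i x j') : j = j' := by
  obtain ⟨k, -, -, hX, hY, h1, h2⟩ := h.div
  obtain ⟨k', -, -, hX', hY', h1', h2'⟩ := h'.div
  obtain rfl := cnt_injective hX hX' (h1.symm.trans h1')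
  exact cnt_injective hY hY' (h2.symm.trans h2')

theorem denseRow_subset : denseRow X Y n β i ⊆ prodRow X Y n i := by
  intro j hj
  simp only [denseRow, prodRow, Finset.mem_filter, Finset.mem_range] at hj ⊢
  obtain ⟨h1, x, k, hk, -, hX, hY, -⟩ := hj
  exact ⟨h1, k, hk, hX, hY⟩

theorem card_denseRow_le_mul : (denseRow X Y n β i).card ≤ cnt X i n * β := by
  classical
  rw [← Finset.card_range (cnt X i n * β)]
  have h : ∀ j ∈ denseRow X Y n β i, ∃ x, Codes X Y n β i x j := fun j hj => by
    simp only [denseRow, Finset.mem_filter] at hj; exact hj.2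
  choose! f hf using h
  refine Finset.card_le_card_of_injOn f (fun j hj => ?_) fun j hj j' hj' hjj => ?_
  · simpa using (hf j hj).lt
  · have h1 := hf j hj
    rw [hjj] at h1
    exact h1.unique (hf j' hj')

theorem acts_denseCircuit (reg : ℕ → BitVec w) (arr : ℕ → BitVec w → BitVec w → BitVec w)
    (v : BitVec w) {x a b kk j pp : BitVec w} (hx : BinOp.add.eval v (reg 41) = x)
    (ha : BinOp.div.eval x (reg 9) = a) (hb : BinOp.mod.eval x (reg 9) = b)
    (hk : arr lX (reg 30) a = kk) (hj : arr lY kk b = j) (hp : arr pY kk (reg 0) = pp) :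
    acts reg arr (denseCircuit lX pY lY) (ket v) 21 = BinOp.and.eval
      (BinOp.and.eval (BinOp.lt.eval a (reg 40)) (BinOp.lt.eval b pp))
      (BinOp.and.eval (BinOp.lt.eval v (reg 42)) (BinOp.eq.eval (arr 2 (reg 30) j) 0)) ∧
    acts reg arr (denseCircuit lX pY lY) (ket v) 8 = j := by
  subst hp hj hk hb ha hx
  constructor <;> simp [denseCircuit, acts, Instr.act, ket]

/-- The word `v` encodes, relative to `lo`, a one of the row `i` of the product that does not yet
belong to `O`. -/
def denseMark (X Y : ℕ → ℕ → Bool) (n β i : ℕ) (O : ℕ → ℕ → Prop) (lo len : ℕ) (v : BitVec w) :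
    Prop := v.toNat < len ∧ ∃ j, Codes X Y n β i (lo + v.toNat) j ∧ ¬ O i j

variable {pX lo len R : ℕ} {O : ℕ → ℕ → Prop} {v : BitVec w}

theorem eval_eq_self (x : BitVec w) : BinOp.eq.eval x x = 1 := by simp [BinOp.eval]

theorem acts_denseCircuit_of_codes (hn : n < 2 ^ w) (hi : i < n) (hβ : β < 2 ^ w)
    (hE : Env n R pX lX pY lY X Y s) (h9 : s.reg 9 = wd w β) (h30 : s.reg 30 = wd w i)
    (h40 : s.reg 40 = wd w (cnt X i n)) (h41 : s.reg 41 = wd w lo) (hv : lo + v.toNat < 2 ^ w)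
    (h : Codes X Y n β i (lo + v.toNat) j) :
    acts s.reg s.arr (denseCircuit lX pY lY) (ket v) 21 = BinOp.and.eval 1
      (BinOp.and.eval (BinOp.lt.eval v (s.reg 42)) (BinOp.eq.eval (s.arr 2 (wd w i) (wd w j)) 0)) ∧
    acts s.reg s.arr (denseCircuit lX pY lY) (ket v) 8 = wd w j := by
  have hcn : ∀ (Z : ℕ → ℕ → Bool) k j, j ≤ n → cnt Z k j < 2 ^ w := fun Z k j hj =>
    (cnt_le.trans hj).trans_lt hn
  obtain ⟨k, hk, hj, hXk, hYk, h1, h2⟩ := h.div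
  have hx : BinOp.add.eval v (s.reg 41) = wd w (lo + v.toNat) := by
    conv_lhs => rw [h41, ← wd_toNat_self v]
    rw [eval_add, add_comm]
  have hd : BinOp.div.eval (wd w (lo + v.toNat)) (s.reg 9) = wd w (cnt X i k) := by
    rw [h9, eval_div hv hβ, h1]
  have hm : BinOp.mod.eval (wd w (lo + v.toNat)) (s.reg 9) = wd w (cnt Y k j) := by
    rw [h9, eval_mod hv hβ, h2]
  have h3 : s.arr lX (s.reg 30) (wd w (cnt X i k)) = wd w k := by
    rw [h30, hE.hX.lst i hi k hk hXk]
  have h4 := acts_denseCircuit (lX := lX) (pY := pY) (lY := lY) s.reg s.arr v hx hd hm h3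
    (hE.hY.lst k hk j hj hYk) (by rw [hE.r0, hE.hY.pc k hk n le_rfl])
  rw [h40, h30, eval_lt_of_lt (x := wd w (cnt X i k)), eval_lt_of_lt (x := wd w (cnt Y k j)),
    eval_and_one] at h4
  · exact h4
  · rw [wd_toNat (hcn _ _ _ hj.le), wd_toNat (hcn _ _ _ le_rfl)]
    exact cnt_lt_cnt hYk hj
  · rw [wd_toNat (hcn _ _ _ hk.le), wd_toNat (hcn _ _ _ le_rfl)]
    exact cnt_lt_cnt hXk hk

/-- Outside the lists the tables may contain anything, but then one of the range tests fails: either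
the quotient exceeds the row of `X`, or it gives a valid `k` and the remainder exceeds the row `k`
of `Y`. A single failed test makes the conjunction zero. -/
theorem acts_denseCircuit_of_not_codes (hn : n < 2 ^ w) (hi : i < n) (hβ : β < 2 ^ w) (hβ0 : 0 < β)
    (hE : Env n R pX lX pY lY X Y s) (h9 : s.reg 9 = wd w β) (h30 : s.reg 30 = wd w i)
    (h40 : s.reg 40 = wd w (cnt X i n)) (h41 : s.reg 41 = wd w lo) (hv : lo + v.toNat < 2 ^ w)
    (h : ¬ ∃ j, Codes X Y n β i (lo + v.toNat) j) :
    acts s.reg s.arr (denseCircuit lX pY lY) (ket v) 21 = 0 := by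
  have hcn : ∀ (Z : ℕ → ℕ → Bool) k j, j ≤ n → cnt Z k j < 2 ^ w := fun Z k j hj =>
    (cnt_le.trans hj).trans_lt hn
  have hx : BinOp.add.eval v (s.reg 41) = wd w (lo + v.toNat) := by
    conv_lhs => rw [h41, ← wd_toNat_self v]
    rw [eval_add, add_comm]
  have hd : BinOp.div.eval (wd w (lo + v.toNat)) (s.reg 9) = wd w ((lo + v.toNat) / β) := by
    rw [h9, eval_div hv hβ]
  have hm : BinOp.mod.eval (wd w (lo + v.toNat)) (s.reg 9) = wd w ((lo + v.toNat) % β) := by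
    rw [h9, eval_mod hv hβ]
  rw [(acts_denseCircuit (lX := lX) (pY := pY) (lY := lY) s.reg s.arr v hx hd hm rfl rfl rfl).1]
  by_cases h1 : (lo + v.toNat) / β < cnt X i n
  · obtain ⟨k, -, hk, hXk, hc⟩ := exists_cnt_eq (j := 0) (by rw [cnt_zero]; exact Nat.zero_le _) h1
    have h3 : s.arr lX (s.reg 30) (wd w ((lo + v.toNat) / β)) = wd w k := by
      rw [h30, ← hc, hE.hX.lst i hi k hk hXk]
    rw [h3, hE.r0, hE.hY.pc k hk n le_rfl]
    rw [eval_lt_of_not_lt (x := wd w ((lo + v.toNat) % β)), eval_and_zero, eval_zero_and]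
    rw [wd_toNat ((Nat.mod_le _ _).trans_lt hv), wd_toNat (hcn _ _ _ le_rfl)]
    intro h2
    obtain ⟨j, -, hj, hYj, hc'⟩ := exists_cnt_eq (j := 0) (by rw [cnt_zero]; exact Nat.zero_le _) h2
    refine h ⟨j, k, hk, hj, hXk, hYj, ?_, ?_⟩
    · rw [hc']; exact Nat.mod_lt _ hβ0
    · rw [hc, hc', Nat.div_add_mod']
  · rw [h40, eval_lt_of_not_lt (x := wd w ((lo + v.toNat) / β)), eval_zero_and, eval_zero_and]
    rwa [wd_toNat ((Nat.div_le_self _ _).trans_lt hv), wd_toNat (hcn _ _ _ le_rfl)]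

/-- The circuit also reads the output array, so a code counts only while its entry is missing. Since
a code belongs to one column only, this lookup decides the mark. -/
theorem denseMark_spec (hw : 0 < w) (hn : n < 2 ^ w) (hi : i < n) (hβ : β < 2 ^ w) (hβ0 : 0 < β)
    (hE : Env n R pX lX pY lY X Y s) (h9 : s.reg 9 = wd w β) (h30 : s.reg 30 = wd w i)
    (h40 : s.reg 40 = wd w (cnt X i n)) (h41 : s.reg 41 = wd w lo) (h42 : s.reg 42 = wd w len)
    (hlen : len < 2 ^ w) (hO : Holds s 2 n O) (hv : lo + v.toNat < 2 ^ w) :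
    (denseMark X Y n β i O lo len v →
      acts s.reg s.arr (denseCircuit lX pY lY) (ket v) 21 = 1) ∧
    (¬ denseMark X Y n β i O lo len v →
      acts s.reg s.arr (denseCircuit lX pY lY) (ket v) 21 = 0) := by
  by_cases h : ∃ j, Codes X Y n β i (lo + v.toNat) j
  · obtain ⟨j, hj⟩ := h
    have hjn : j < n := by
      obtain ⟨k, hk, hjn, -⟩ := hj
      exact hjn
    rw [(acts_denseCircuit_of_codes hn hi hβ hE h9 h30 h40 h41 hv hj).1, h42]
    have h1 : BinOp.lt.eval v (wd w len) = if v.toNat < len then 1 else 0 := by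
      rw [BinOp.eval, wd_toNat hlen]
    by_cases hl : v.toNat < len
    · rw [h1, if_pos hl]
      by_cases ho : O i j
      · rw [((hO i hi j hjn).1 ho)]
        have h2 : BinOp.eq.eval (1 : BitVec w) 0 = 0 := by
          have := Nat.one_lt_two_pow hw.ne'
          rw [BinOp.eval, if_neg]
          intro h3
          have h4 := (wd_inj (w := w) (a := 1) (b := 0) this (by omega)).1 h3
          omega
        rw [h2, eval_and_zero, eval_and_zero]
        refine ⟨fun hm => ?_, fun _ => rfl⟩
        obtain ⟨_, j', hj', hno⟩ := hm
        exact absurd ho (hj.unique hj' ▸ hno)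
      · rw [((hO i hi j hjn).2 ho), eval_eq_self, eval_and_one, eval_and_one]
        exact ⟨fun _ => rfl, fun hm => absurd ⟨hl, j, hj, ho⟩ hm⟩
    · rw [h1, if_neg hl, eval_zero_and, eval_and_zero]
      exact ⟨fun hm => absurd hm.1 hl, fun _ => rfl⟩
  · rw [acts_denseCircuit_of_not_codes hn hi hβ hβ0 hE h9 h30 h40 h41 hv h]
    exact ⟨fun hm => absurd ⟨hm.2.choose, hm.2.choose_spec.1⟩ h, fun _ => rfl⟩

end

end QRAM

/-! ### The queue of dyadic intervals of codes -/

namespace QRAM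

variable {w : ℕ} {k : ℕ} {p q : Prog} {δ δ' : ℝ≥0∞} {E E' : State w → Prop} {s t : State w}

/-- Record the word in the register `73`, and split the interval of length `2 ^ d` from `lo` on,
where `lo` and `d` are in the registers `41` and `48`, unless `d` is zero. -/
def denseRecord : Prog :=
  .seq (seqs [.store 2 30 73 7])
  (.ite 48 (seqs [.op .sub 48 48 7, .op .shl 42 7 48, .store 16 8 47 41, .store 17 8 47 48,
    .op .add 47 47 7, .op .add 41 41 42, .store 16 8 47 41, .store 17 8 47 48,
    .op .add 47 47 7]) .skip)

/-- Find ones in the row of the product with the number in register `30`, by means of a queue of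
dyadic intervals in the arrays `16` and `17`. -/
def denseSearch (pX lX pY lY : ℕ) : Prog :=
  .seq (seqs [.load 40 pX 30 0, .op .mul 46 40 9])
  (.seq bitLength
  (.seq (seqs [.store 16 8 8 8, .store 17 8 8 50, .const 43 0, .const 47 1, .op .lt 44 43 47])
  (.while 44
    (.seq (seqs [.load 41 16 8 43, .load 48 17 8 43, .op .shl 42 7 48, .op .add 50 48 7])
    (.seq (search (denseCircuit lX pY lY) 21 8)
    (.seq (.ite 72 denseRecord .skip)
      (seqs [.op .add 43 43 7, .op .lt 44 43 47])))))))

/-- The cost of the search in the interval at the position `q` of the queue, if the intervals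
together have the length `2 ^ D`. -/
def denseStep (D R q : ℕ) : ℕ :=
  2 * searchUnit 20 (D + 1) R * Nat.sqrt (32 * 2 ^ D / (q + 2)) + 40

/-- The cost of `denseSearch`, if there are `N` codes and `l` ones to be found. -/
def denseTime (R N l : ℕ) : ℕ :=
  ∑ q ∈ Finset.range (2 * l + 1), denseStep (Nat.clog 2 N) R q + 4 * Nat.clog 2 N + 20

section

variable {X Y : ℕ → ℕ → Bool} {n i R β pX lX pY lY D : ℕ} {g : Prop} {O : ℕ → ℕ → Prop}

/-- The invariant of `denseSearch`: the ones in `F` have been found, and the intervals at the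
positions `hd, …, tl - 1` of the queue are still to be searched. -/
structure DenseInv (g : Prop) (X Y : ℕ → ℕ → Bool) (n β i D : ℕ) (O : ℕ → ℕ → Prop)
    (s : State w) (F : Finset ℕ) (hd tl : ℕ) (lam eps : ℕ → ℕ) (t : State w) : Prop where
  frm : Frm 40 {2, 16, 17} s t
  clean : Clean t
  r40 : t.reg 40 = wd w (cnt X i n)
  r47 : t.reg 47 = wd w tl
  r_lam : ∀ q < tl, t.arr 16 (wd w 0) (wd w q) = wd w (lam q)
  r_eps : ∀ q < tl, t.arr 17 (wd w 0) (wd w q) = wd w (eps q)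
  sub : F ⊆ denseRow X Y n β i
  new : ∀ j ∈ F, ¬ O i j
  hd_le : hd ≤ tl
  tl_le : tl ≤ 2 * F.card + 1
  tl_le' : tl ≤ 2 * hd + 1
  size : ∀ q < tl, 2 ^ eps q * (q + 2) ≤ 2 * 2 ^ D
  bound : ∀ q < tl, lam q + 2 ^ eps q ≤ 2 ^ D
  compl : g → ∀ x j, Codes X Y n β i x j → O i j ∨ j ∈ F ∨
    ∃ q < tl, hd ≤ q ∧ lam q ≤ x ∧ x < lam q + 2 ^ eps q
  holds : Holds t 2 n fun i' j' => O i' j' ∨ (i' = i ∧ j' ∈ F)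
  fuel : F.card ≤ (denseRow X Y n β i).card

theorem card_denseRow_le : (denseRow X Y n β i).card ≤ n :=
  (Finset.card_le_card denseRow_subset).trans card_prodRow_le

variable {F : Finset ℕ} {hd tl j : ℕ} {lam eps : ℕ → ℕ} {u : State w}

/-- After a search without a result, the interval is dropped. -/
theorem DenseInv.drop (h : DenseInv g X Y n β i D O s F hd tl lam eps t) (hlt : hd < tl)
    (hu : Frm 41 ∅ t u) (hc : Clean u) (h47 : u.reg 47 = wd w tl)
    (hno : g → ∀ x j, Codes X Y n β i x j → lam hd ≤ x → x < lam hd + 2 ^ eps hd →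
      O i j ∨ j ∈ F) :
    DenseInv g X Y n β i D O s F (hd + 1) tl lam eps u := by
  have ha : ∀ a, u.arr a = t.arr a := fun a => hu.arr a (by simp)
  refine ⟨h.frm.trans (b := 41) (S' := {2, 16, 17}) (hu.mono le_rfl (by simp)), hc,
    (hu.reg 40 (by norm_num)).trans h.r40, h47, by rw [ha]; exact h.r_lam, by rw [ha]; exact h.r_eps,
    h.sub, h.new, hlt, h.tl_le, by have := h.tl_le'; omega, h.size, h.bound, ?_,
    h.holds.congr (ha 2), h.fuel⟩
  intro hg x j hx
  rcases h.compl hg x j hx with h1 | h1 | ⟨q, hq, h2, h3, h4⟩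
  · exact Or.inl h1
  · exact Or.inr (Or.inl h1)
  · rcases Nat.eq_or_lt_of_le h2 with rfl | h5
    · rcases hno hg x j hx h3 h4 with h1 | h1
      · exact Or.inl h1
      · exact Or.inr (Or.inl h1)
    · exact Or.inr (Or.inr ⟨q, hq, h5, h3, h4⟩)

/-- A result of a search is recorded. -/
theorem DenseInv.record (hn : n < 2 ^ w) (hi : i < n)
    (h : DenseInv g X Y n β i D O s F hd tl lam eps t) (hlt : hd < tl) {x : ℕ}
    (hu : Frm 41 ∅ t u) (hc : Clean u) (h47 : u.reg 47 = wd w tl)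
    (hx : Codes X Y n β i x j) (h1 : lam hd ≤ x) (h2 : x < lam hd + 2 ^ eps hd) (hO : ¬ O i j)
    (hF : j ∉ F) (h0 : eps hd = 0) :
    DenseInv g X Y n β i D O s (insert j F) (hd + 1) tl lam eps
      (u.tick.put 2 (wd w i) (wd w j) (wd w 1)) := by
  obtain ⟨kk, hk, hj, -⟩ := id hx
  have hjG : j ∈ denseRow X Y n β i := by
    simp only [denseRow, Finset.mem_filter, Finset.mem_range]
    exact ⟨hj, x, hx⟩
  have hsub : insert j F ⊆ denseRow X Y n β i := Finset.insert_subset hjG h.sub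
  have hins := Finset.card_insert_of_notMem hF
  have ha : ∀ a, u.arr a = t.arr a := fun a => hu.arr a (by simp)
  refine ⟨?_, hc, (hu.reg 40 (by norm_num)).trans h.r40, h47, ?_, ?_, hsub, ?_, hlt,
    by have := h.tl_le; omega, by have := h.tl_le'; omega, h.size, h.bound, ?_, ?_,
    Finset.card_le_card hsub⟩
  · exact (h.frm.trans (b := 41) (S' := {2, 16, 17}) (hu.mono le_rfl (by simp))).trans (b := 41)
      (S' := {2, 16, 17}) (t := u) ⟨fun _ _ => rfl, fun y hy => by
        simp only [Finset.mem_insert, Finset.mem_singleton, not_or] at hy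
        funext a b
        simp [arr_put, hy.1], fun _ => hc⟩
  · intro q hq; simpa [arr_put, ha] using h.r_lam q hq
  · intro q hq; simpa [arr_put, ha] using h.r_eps q hq
  · intro j' hj'
    rcases Finset.mem_insert.1 hj' with rfl | hj'
    · exact hO
    · exact h.new j' hj'
  · intro hg x' j' hx'
    rcases h.compl hg x' j' hx' with h3 | h3 | ⟨q, hq, h4, h5, h6⟩
    · exact Or.inl h3
    · exact Or.inr (Or.inl (Finset.mem_insert_of_mem h3))
    · rcases Nat.eq_or_lt_of_le h4 with rfl | h7
      -- The interval has length one, so `x` is its only code, and `x` encodes no column but `j`.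
      · rw [h0] at h2 h6
        obtain rfl : x' = x := by omega
        obtain rfl := hx.unique hx'
        exact Or.inr (Or.inl (Finset.mem_insert_self _ _))
      · exact Or.inr (Or.inr ⟨q, hq, h7, h5, h6⟩)
  · exact Holds.iff_congr ((h.holds.congr (ha 2)).congr (t := u.tick) rfl |>.put hn hi hj)
      (fun i' _ j' _ => by simp only [Finset.mem_insert]; tauto)

/-- A result of a search is recorded, and the interval is split. -/
theorem DenseInv.split (hn : 4 * n + 4 < 2 ^ w) (hi : i < n)
    (h : DenseInv g X Y n β i D O s F hd tl lam eps t) (hlt : hd < tl) {x : ℕ} {t' : State w}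
    (hu : Frm 41 ∅ t u) (hc : Clean u)
    (hx : Codes X Y n β i x j) (hO : ¬ O i j) (hF : j ∉ F) {d : ℕ} (h0 : eps hd = d + 1)
    (ht'r : ∀ y, y < 41 ∨ 100 ≤ y → t'.reg y = u.reg y) (ht'47 : t'.reg 47 = wd w (tl + 2))
    (ht'p : t'.psi = u.psi)
    (ht'a : t'.arr = (((((u.put 2 (wd w i) (wd w j) (wd w 1)).put 16 (wd w 0) (wd w tl)
      (wd w (lam hd))).put 17 (wd w 0) (wd w tl) (wd w d)).put 16 (wd w 0) (wd w (tl + 1))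
      (wd w (lam hd + 2 ^ d))).put 17 (wd w 0) (wd w (tl + 1)) (wd w d)).arr) :
    DenseInv g X Y n β i D O s (insert j F) (hd + 1) (tl + 2)
      (Function.update (Function.update lam tl (lam hd)) (tl + 1) (lam hd + 2 ^ d))
      (Function.update (Function.update eps tl d) (tl + 1) d) t' := by
  obtain ⟨kk, hk, hj, -⟩ := id hx
  have hjG : j ∈ denseRow X Y n β i := by
    simp only [denseRow, Finset.mem_filter, Finset.mem_range]
    exact ⟨hj, x, hx⟩
  have hsub : insert j F ⊆ denseRow X Y n β i := Finset.insert_subset hjG h.sub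
  have hins := Finset.card_insert_of_notMem hF
  have hle := Finset.card_le_card hsub
  have hGn := card_denseRow_le (X := X) (Y := Y) (n := n) (β := β) (i := i)
  have htl := h.tl_le
  have htl' := h.tl_le'
  have ha : ∀ a, u.arr a = t.arr a := fun a => hu.arr a (by simp)
  have hc' : Clean t' := by unfold Clean; rw [ht'p]; exact hc
  have hw : ∀ q < tl, ¬ wd w q = wd w tl ∧ ¬ wd w q = wd w (tl + 1) := fun q hq => by
    rw [wd_inj (by omega) (by omega), wd_inj (by omega) (by omega)]; omega
  have hw' : ¬ wd w tl = wd w (tl + 1) := by rw [wd_inj (by omega) (by omega)]; omega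
  have hsz := h.size hd hlt
  have hbd := h.bound hd hlt
  rw [h0, pow_succ] at hsz hbd
  refine ⟨?_, hc', by rw [ht'r 40 (by norm_num), hu.reg 40 (by norm_num), h.r40], ht'47, ?_, ?_,
    hsub, ?_, by omega, by omega, by omega, ?_, ?_, ?_, ?_, hle⟩
  · refine (h.frm.trans (b := 41) (S' := {2, 16, 17}) (hu.mono le_rfl (by simp))).trans (b := 41)
      (S' := {2, 16, 17}) (t := u) ⟨ht'r, fun y hy => ?_, fun _ => hc'⟩
    simp only [Finset.mem_insert, Finset.mem_singleton, not_or] at hy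
    funext a b
    simp [ht'a, arr_put, hy]
  · intro q hq
    simp only [ht'a, arr_put]
    rcases Nat.lt_or_ge q tl with h1 | h1
    · rw [Function.update_of_ne (by omega), Function.update_of_ne (by omega)]
      simpa [hw q h1, ha] using h.r_lam q h1
    · obtain rfl | rfl : q = tl ∨ q = tl + 1 := by omega
      · rw [Function.update_of_ne (by omega), Function.update_self]
        simp [hw']
      · simp
  · intro q hq
    simp only [ht'a, arr_put]
    rcases Nat.lt_or_ge q tl with h1 | h1
    · rw [Function.update_of_ne (by omega), Function.update_of_ne (by omega)]
      simpa [hw q h1, ha] using h.r_eps q h1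
    · obtain rfl | rfl : q = tl ∨ q = tl + 1 := by omega
      · rw [Function.update_of_ne (by omega), Function.update_self]
        simp [hw']
      · simp
  · intro j' hj'
    rcases Finset.mem_insert.1 hj' with rfl | hj'
    · exact hO
    · exact h.new j' hj'
  · intro q hq
    rcases Nat.lt_or_ge q tl with h1 | h1
    · rw [Function.update_of_ne (by omega), Function.update_of_ne (by omega)]
      exact h.size q h1
    · have h2 : 2 ^ d * (q + 2) ≤ 2 * 2 ^ D := by
        refine le_trans ?_ hsz
        rw [mul_assoc]
        exact Nat.mul_le_mul_left _ (by omega)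
      obtain rfl | rfl : q = tl ∨ q = tl + 1 := by omega
      · rwa [Function.update_of_ne (by omega), Function.update_self]
      · rwa [Function.update_self]
  · intro q hq
    rcases Nat.lt_or_ge q tl with h1 | h1
    · simp only [Function.update_of_ne (by omega : q ≠ tl), Function.update_of_ne (by omega : q ≠ tl + 1)]
      exact h.bound q h1
    · obtain rfl | rfl : q = tl ∨ q = tl + 1 := by omega
      · simp only [Function.update_of_ne (by omega : q ≠ q + 1), Function.update_self]
        omega
      · simp only [Function.update_self]
        omega
  · intro hg x' j' hx'
    rcases h.compl hg x' j' hx' with h3 | h3 | ⟨q, hq, h4, h5, h6⟩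
    · exact Or.inl h3
    · exact Or.inr (Or.inl (Finset.mem_insert_of_mem h3))
    · rcases Nat.eq_or_lt_of_le h4 with rfl | h7
      · rw [h0, pow_succ] at h6
        right; right
        by_cases h8 : x' < lam hd + 2 ^ d
        · refine ⟨tl, by omega, by omega, ?_⟩
          simp only [Function.update_of_ne (by omega : tl ≠ tl + 1), Function.update_self]
          exact ⟨h5, h8⟩
        · refine ⟨tl + 1, by omega, by omega, ?_⟩
          simp only [Function.update_self]
          omega
      · refine Or.inr (Or.inr ⟨q, by omega, h7, ?_⟩)
        simp only [Function.update_of_ne (by omega : q ≠ tl), Function.update_of_ne (by omega : q ≠ tl + 1)]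
        exact ⟨h5, h6⟩
  · have h2 : Holds u 2 n fun i' j' => O i' j' ∨ (i' = i ∧ j' ∈ F) := h.holds.congr (ha 2)
    refine (Holds.iff_congr (h2.put (by omega) hi hj)
      (O' := fun i' j' => O i' j' ∨ (i' = i ∧ j' ∈ insert j F))
      (fun i' _ j' _ => by simp only [Finset.mem_insert]; tauto)).congr ?_
    funext a b
    simp [ht'a, arr_put]

end

end QRAM

/-! ### One search in the queue of intervals -/

namespace QRAM

variable {w : ℕ} {k : ℕ} {p q : Prog} {δ δ' : ℝ≥0∞} {E E' : State w → Prop} {s t : State w}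

section

variable {X Y : ℕ → ℕ → Bool} {n i R β pX lX pY lY D : ℕ} {g : Prop} {O : ℕ → ℕ → Prop}
  {F : Finset ℕ} {hd tl j : ℕ} {lam eps : ℕ → ℕ} {u : State w}

theorem DenseInv.keep (h : DenseInv g X Y n β i D O s F hd tl lam eps t) (hu : Frm 41 ∅ t u)
    (hc : Clean u) (h47 : u.reg 47 = t.reg 47) :
    DenseInv g X Y n β i D O s F hd tl lam eps u := by
  have ha : ∀ a, u.arr a = t.arr a := fun a => hu.arr a (by simp)
  exact ⟨h.frm.trans (b := 41) (S' := {2, 16, 17}) (hu.mono le_rfl (by simp)), hc,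
    (hu.reg 40 (by norm_num)).trans h.r40, h47.trans h.r47, by rw [ha]; exact h.r_lam,
    by rw [ha]; exact h.r_eps,
    h.sub, h.new, h.hd_le, h.tl_le, h.tl_le', h.size, h.bound, h.compl,
    h.holds.congr (ha 2), h.fuel⟩

theorem searchUnit_mono {l e e' : ℕ} (h : e ≤ e') : searchUnit l e R ≤ searchUnit l e' R := by
  unfold searchUnit; gcongr

/-- The size invariant replaces the length of an interval by its position in the queue, so the total
cost will depend only on how many positions are treated. The slack `30` pays for the bookkeeping
around the search. -/
theorem searchTime_le_denseStep {ε q : ℕ} (h1 : 2 ^ ε * (q + 2) ≤ 2 * 2 ^ D) (h2 : ε ≤ D) :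
    searchTime 20 (ε + 1) R + 30 ≤ denseStep D R q := by
  have h3 : Nat.sqrt (2 ^ (ε + 1 + 3)) ≤ Nat.sqrt (32 * 2 ^ D / (q + 2)) := by
    refine Nat.sqrt_le_sqrt ?_
    rw [Nat.le_div_iff_mul_le (by omega), show ε + 1 + 3 = ε + 4 by ring, pow_add]
    linarith
  have h4 := Nat.mul_le_mul (Nat.mul_le_mul_left 2 (searchUnit_mono (l := 20) (R := R)
    (by omega : ε + 1 ≤ D + 1))) h3
  rw [searchTime, denseStep]
  omega

/-- What the body of the loop of `denseSearch` has achieved before the next interval is chosen. -/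
structure DenseMid (g : Prop) (X Y : ℕ → ℕ → Bool) (n β i D : ℕ) (O : ℕ → ℕ → Prop)
    (s : State w) (hd m T : ℕ) (t : State w) : Prop where
  inv : ∃ F tl lam eps, DenseInv g X Y n β i D O s F (hd + 1) tl lam eps t ∧
    2 * ((denseRow X Y n β i).card - F.card) + (tl - (hd + 1)) + 1 ≤ m
  r43 : t.reg 43 = wd w hd
  time : t.time ≤ T

theorem wp_denseRecord {x : ℕ} (hn : 4 * n + 4 < 2 ^ w) (hi : i < n) (hD : D + 8 ≤ w)
    (h : DenseInv g X Y n β i D O s F hd tl lam eps t) (hlt : hd < tl)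
    (hu : Frm 41 ∅ t u) (hc : Clean u) (h47 : u.reg 47 = wd w tl) (h43 : u.reg 43 = wd w hd)
    (h41 : u.reg 41 = wd w (lam hd)) (h48 : u.reg 48 = wd w (eps hd))
    (h30 : u.reg 30 = wd w i) (h7 : u.reg 7 = wd w 1) (h8 : u.reg 8 = wd w 0)
    (h73 : u.reg 73 = wd w j)
    (hx : Codes X Y n β i x j) (h1 : lam hd ≤ x) (h2 : x < lam hd + 2 ^ eps hd) (hO : ¬ O i j)
    (hF : j ∉ F) :
    WP k denseRecord 0 (DenseMid g X Y n β i D O s hd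
      (2 * ((denseRow X Y n β i).card - F.card) + (tl - hd)) (u.time + 11)) u := by
  obtain ⟨_, _, hj, -⟩ := id hx
  have hjG : j ∈ denseRow X Y n β i := by
    simp only [denseRow, Finset.mem_filter, Finset.mem_range]
    exact ⟨hj, x, hx⟩
  have hle := Finset.card_le_card (Finset.insert_subset hjG h.sub)
  have hins := Finset.card_insert_of_notMem hF
  have hDw : 2 ^ D < 2 ^ w := Nat.pow_lt_pow_right (by norm_num) (by omega)
  have heps : eps hd < 2 ^ w := by
    have h3 := h.bound hd hlt
    have h4 : eps hd < 2 ^ eps hd := Nat.lt_two_pow_self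
    omega
  refine wp_seq_left (F := fun v => v = u.tick.put 2 (wd w i) (wd w j) (wd w 1)) ?_ ?_
  · refine wp_seqs_store (wp_seqs_nil ?_)
    simp only [h30, h73, h7]
  rintro _ rfl
  refine wp_ite (fun h0 => ?_) fun h0 => ?_
  · rw [reg_put, reg_tick, h48, wd_eq_zero heps] at h0
    have h5 := h.record (by omega) hi hlt hu hc h47 hx h1 h2 hO hF h0
    exact wp_skip ⟨⟨_, _, _, _, h5.keep (u := (u.tick.put 2 (wd w i) (wd w j) (wd w 1)).tick)
      ⟨fun _ _ => rfl, fun _ _ => rfl, id⟩ h5.clean rfl, by omega⟩, h43,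
      by simp only [time_tick, time_put]; omega⟩
  · rw [reg_put, reg_tick, h48, Ne, wd_eq_zero heps] at h0
    obtain ⟨d, hd'⟩ : ∃ d, eps hd = d + 1 := ⟨eps hd - 1, by omega⟩
    have hdw : d < 2 ^ w := by omega
    refine wp_seqs_op (wp_seqs_op (wp_seqs_store (wp_seqs_store (wp_seqs_op (wp_seqs_op
      (wp_seqs_store (wp_seqs_store (wp_seqs_op (wp_seqs_nil ?_)))))))))
    rw [hd'] at h48
    refine ⟨⟨_, _, _, _, h.split hn hi hlt hu hc hx hO hF hd' ?_ ?_ rfl ?_, by omega⟩, ?_, ?_⟩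
    · intro y hy
      simp only [reg_set, reg_tick, reg_put]
      repeat rw [if_neg (by omega)]
    · simp [reg_set, h47, h7, eval_add]
    · simp [reg_set, h47, h7, h8, h41, h48, eval_add, eval_sub, eval_shl hdw]
      simp [State.put, State.tick, State.set]
    · simp [reg_set, h43]
    · simp only [time_tick, time_put, time_set]; omega

/-- An interval of length `2 ^ eps hd` is searched in a space of twice this size, whose upper half
the length test in the circuit rejects; so at most half of it is marked. Twice the number of missing
outputs plus the length of the queue falls by at least one: a split adds one interval on balance,
but its hit counts two. -/
theorem wp_denseSearch_step [Decidable g] (hk : 2 ^ w < k) (hn : 4 * n + 4 < 2 ^ w)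
    (hD : D + 8 ≤ w) (hR : R < 2 ^ w) (hβ : β < 2 ^ w) (hβ0 : 0 < β) (hi : i < n)
    (hE : Env n R pX lX pY lY X Y t) (h30 : t.reg 30 = wd w i) (h9 : t.reg 9 = wd w β)
    (h : DenseInv g X Y n β i D O s F hd tl lam eps t) (hlt : hd < tl) (h43 : t.reg 43 = wd w hd) :
    WP k (.seq (seqs [.load 41 16 8 43, .load 48 17 8 43, .op .shl 42 7 48, .op .add 50 48 7])
      (.seq (search (denseCircuit lX pY lY) 21 8)
      (.seq (.ite 72 denseRecord .skip)
      (seqs [.op .add 43 43 7, .op .lt 44 43 47]))))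
      (if g then (D + 5) * 2⁻¹ ^ R else 0)
      (fun v => ∃ F' tl' lam' eps', DenseInv g X Y n β i D O s F' (hd + 1) tl' lam' eps' v ∧
        2 * ((denseRow X Y n β i).card - F'.card) + (tl' - (hd + 1)) + 1 ≤
        2 * ((denseRow X Y n β i).card - F.card) + (tl - hd) ∧
        v.reg 43 = wd w (hd + 1) ∧ v.reg 44 = wd w (if hd + 1 < tl' then 1 else 0) ∧
        v.time ≤ t.time + denseStep D R hd) t.tick := by
  classical
  have hDw : 2 ^ (D + 1) < 2 ^ w := Nat.pow_lt_pow_right (by norm_num) (by omega)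
  have hpw : 2 ^ (D + 1) = 2 * 2 ^ D := by rw [pow_succ, mul_comm]
  have hbd := h.bound hd hlt
  have heD : eps hd ≤ D := (Nat.pow_le_pow_iff_right (a := 2) (by norm_num)).1 (by omega)
  have heps : eps hd < 2 ^ w := by
    have h4 : eps hd < 2 ^ eps hd := Nat.lt_two_pow_self
    omega
  have hpe : 2 ^ (eps hd + 1) = 2 * 2 ^ eps hd := by rw [pow_succ, mul_comm]
  refine wp_seq_left (F := fun u => Near 41 t u ∧ u.psi = t.psi ∧ u.reg 41 = wd w (lam hd) ∧
    u.reg 48 = wd w (eps hd) ∧ u.reg 42 = wd w (2 ^ eps hd) ∧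
    u.reg 43 = wd w hd ∧ u.reg 47 = wd w tl ∧ u.reg 50 = wd w (eps hd + 1) ∧
    u.time ≤ t.time + 5) ?_ ?_
  · have hl := h.r_lam hd hlt
    have hep := h.r_eps hd hlt
    refine wp_seqs_load (wp_seqs_load (wp_seqs_op (wp_seqs_op (wp_seqs_nil
      ⟨⟨fun x hx => ?_, rfl⟩, rfl, ?_, ?_, ?_, ?_, ?_, ?_, ?_⟩))))
    · simp only [reg_set, reg_tick]
      repeat rw [if_neg (by omega)]
    all_goals
      simp [reg_set, hE.r7, hE.r8, h43, hl, hep, h.r47, eval_shl heps, eval_add]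
  rintro u ⟨hu, hpsi, h41, h48, h42, h43', h47, h50, htu⟩
  have hcu : Clean u := by unfold Clean; rw [hpsi]; exact h.clean
  have hEu : Env n R pX lX pY lY X Y u := hE.frm (hu.frm hcu (S := ∅)) (by simp)
  have u30 : u.reg 30 = wd w i := (hu.reg 30 (by norm_num)).trans h30
  have u9 : u.reg 9 = wd w β := (hu.reg 9 (by norm_num)).trans h9
  have u40 : u.reg 40 = wd w (cnt X i n) := (hu.reg 40 (by norm_num)).trans h.r40
  set O' : ℕ → ℕ → Prop := fun i' j' => O i' j' ∨ (i' = i ∧ j' ∈ F) with hO'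
  have hOu : Holds u 2 n O' := h.holds.congr (by rw [hu.arr])
  set mk : BitVec w → Prop := denseMark X Y n β i O' (lam hd) (2 ^ eps hd) with hmk
  set J : BitVec w → BitVec w := fun v => acts u.reg u.arr (denseCircuit lX pY lY) (ket v) 8 with hJ
  have hctx : SearchCtx (denseCircuit lX pY lY) 21 8 (eps hd + 1) R mk J u :=
    ⟨denseCircuit_isXor, h50, hEu.r7, hEu.r8, hEu.r10,
      fun v hv => denseMark_spec (by omega) (by omega) hi hβ hβ0 hEu u9 u30 u40 h41 h42 (by omega)
        hOu (by omega), fun _ _ => rfl⟩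
  have hnm : 2 * numMarked (eps hd + 1) mk ≤ 2 ^ (eps hd + 1) := by
    rw [hpe]
    exact Nat.mul_le_mul_left 2 (numMarked_le fun v hv => hv.1)
  refine WP.mono (wp_seq_right (wp_search g hk (by omega) hR hctx hnm hcu) fun v hv => ?_)
    (fun _ => id) ?_
  swap
  · split_ifs
    · gcongr ?_ * _
      have : ((eps hd : ℕ) : ℝ≥0∞) ≤ D := by exact_mod_cast heD
      push_cast
      calc (eps hd : ℝ≥0∞) + 1 + 4 ≤ D + 1 + 4 := by gcongr
        _ = D + 5 := by ring
    · exact le_rfl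
  have hvt : Frm 41 ∅ t v.tick := by
    refine (hu.frm (S := ∅) hcu).trans (b := 60) (S' := ∅) (hv.near.frm (S := ∅) hv.sound.clean
      |>.trans (b := 60) (S' := ∅) ⟨fun _ _ => rfl, fun _ _ => rfl, id⟩)
  have hw : 1 < 2 ^ w := Nat.one_lt_two_pow (by omega)
  have v43 := (hv.near.reg 43 (by norm_num)).trans h43'
  have v47 := (hv.near.reg 47 (by norm_num)).trans h47
  have v48 := (hv.near.reg 48 (by norm_num)).trans h48
  have v41 := (hv.near.reg 41 (by norm_num)).trans h41
  have v30 := (hv.near.reg 30 (by norm_num)).trans u30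
  have v7 := (hv.near.reg 7 (by norm_num)).trans hEu.r7
  have v8 := (hv.near.reg 8 (by norm_num)).trans hEu.r8
  have htv := hv.time
  rw [show (denseCircuit lX pY lY).length = 20 from rfl] at htv
  have hstep := searchTime_le_denseStep (R := R) (h.size hd hlt) heD
  refine wp_seq_left (F := DenseMid g X Y n β i D O s hd
      (2 * ((denseRow X Y n β i).card - F.card) + (tl - hd)) (v.tick.time + 11)) ?_ ?_
  · refine wp_ite (fun h72 => wp_skip ⟨⟨F, tl, lam, eps, h.drop hlt hvt hv.sound.clean v47 ?_,
      by omega⟩, v43, by omega⟩) fun h72 => ?_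
    · intro hg x j hx h1 h2
      by_contra hno
      push Not at hno
      -- The searched word is the offset of a code from the start of the interval.
      have hxl : (wd w (x - lam hd)).toNat = x - lam hd := wd_toNat (by omega)
      have := hv.found hg ⟨wd w (x - lam hd), by omega, by omega, j, by rwa [hxl, Nat.add_sub_cancel' h1],
        by simp [hO', hno.1, hno.2]⟩
      rw [h72, ← wd_zero, wd_inj (by omega) hw] at this
      omega
    · rcases hv.sound.res with h73 | ⟨-, x, hx2, ⟨hx, j, hcode, hno⟩, h73⟩
      · exact absurd h73 h72
      · simp only [hO', true_and, not_or] at hno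
        have h3 := (acts_denseCircuit_of_codes (by omega) hi hβ hEu u9 u30 u40 h41 (by omega)
          hcode).2
        exact wp_denseRecord hn hi hD h hlt hvt hv.sound.clean v47 v43 v41 v48 v30 v7 v8
          (h73.trans h3) hcode (by omega) (by omega) hno.1 hno.2
  · rintro z ⟨⟨F', tl', lam', eps', hz, hm⟩, z43, htz⟩
    have z7 : z.reg 7 = wd w 1 := by
      rw [hz.frm.reg 7 (by norm_num), ← h.frm.reg 7 (by norm_num), hE.r7]
    have htl := hz.tl_le
    have hf := hz.fuel
    have hG := card_denseRow_le (X := X) (Y := Y) (n := n) (β := β) (i := i)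
    have hhd := hz.hd_le
    refine wp_seqs_op (wp_seqs_op (wp_seqs_nil ⟨F', tl', lam', eps', hz.keep ⟨fun x hx => ?_,
      fun _ _ => rfl, fun _ => hz.clean⟩ hz.clean ?_, hm, ?_, ?_, ?_⟩))
    · simp only [reg_set, reg_tick]
      repeat rw [if_neg (by omega)]
    · simp [reg_set]
    · simp [reg_set, z43, z7, eval_add]
    · simp only [reg_set, reg_tick, z43, z7, eval_add, if_true]
      norm_num
      rw [hz.r47, eval_lt (by omega) (by omega)]
    · simp only [time_set, time_tick] at htz ⊢
      omega

end

end QRAM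

/-! ### The outputs of a row that have light witnesses -/

namespace QRAM

variable {w : ℕ} {k : ℕ} {p q : Prog} {δ δ' : ℝ≥0∞} {E E' : State w → Prop} {s t : State w}

section

variable {X Y : ℕ → ℕ → Bool} {n i R β pX lX pY lY : ℕ} {g : Prop} {O : ℕ → ℕ → Prop}

/-- The head `hd` of the queue is the number of searches made so far, so the time is a sum over
positions. With `l` outputs to be found, the number of positions is at most `2 l + 1`. -/
theorem wp_denseSearch [Decidable g] (hk : 2 ^ w < k) (hn : 4 * n + 4 < 2 ^ w)
    (hD : Nat.clog 2 (n * n) + 8 ≤ w) (hR : R < 2 ^ w) (hβ : β ≤ n) (hβ0 : 0 < β) (hi : i < n)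
    (hS : pX ∉ ({2, 16, 17} : Finset ℕ) ∧ lX ∉ ({2, 16, 17} : Finset ℕ) ∧
      pY ∉ ({2, 16, 17} : Finset ℕ) ∧ lY ∉ ({2, 16, 17} : Finset ℕ))
    (hE : Env n R pX lX pY lY X Y s) (h30 : s.reg 30 = wd w i) (h9 : s.reg 9 = wd w β)
    (hO : Holds s 2 n O) (hs : Clean s) :
    WP k (denseSearch pX lX pY lY)
      (if g then (2 * n + 1) * ((Nat.clog 2 (n * n) + 5) * 2⁻¹ ^ R) else 0)
      (RowPost g n 2 i {2, 16, 17} (denseRow X Y n β i)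
        (denseTime R (cnt X i n * β) (denseRow X Y n β i).card) O s) s := by
  classical
  have hN : cnt X i n * β ≤ n * n := Nat.mul_le_mul cnt_le hβ
  set N := cnt X i n * β with hNdef
  set D := Nat.clog 2 N with hDdef
  have hDD : D ≤ Nat.clog 2 (n * n) := Nat.clog_mono_right 2 hN
  have hND : N ≤ 2 ^ D := Nat.le_pow_clog (by norm_num) _
  have hDw : 2 ^ (D + 1) < 2 ^ w := Nat.pow_lt_pow_right (by norm_num) (by omega)
  have hpw : 2 ^ (D + 1) = 2 * 2 ^ D := by rw [pow_succ, mul_comm]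
  have hDw' : D < 2 ^ w := by
    have : D < 2 ^ D := Nat.lt_two_pow_self
    omega
  have hcard := card_denseRow_le (X := X) (Y := Y) (n := n) (β := β) (i := i)
  refine wp_seq_left (F := fun u => Near 40 s u ∧ u.psi = s.psi ∧ u.reg 40 = wd w (cnt X i n) ∧
    u.reg 46 = wd w N ∧ u.time = s.time + 2) ?_ ?_
  · refine wp_seqs_load (wp_seqs_op (wp_seqs_nil ?_))
    refine ⟨⟨fun x hx => ?_, rfl⟩, rfl, ?_, ?_, ?_⟩
    · simp only [reg_set, reg_tick]
      repeat rw [if_neg (by omega)]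
    · simp only [reg_set, reg_tick]
      rw [if_neg (by norm_num), if_pos trivial, h30, hE.r0, hE.hX.pc i hi n le_rfl]
    · simp [reg_set, h30, hE.r0, h9, hE.hX.pc i hi n le_rfl, eval_mul, hNdef]
    · simp
  rintro u ⟨hu, hup, u40, u46, hut⟩
  refine wp_seq_left (wp_bitLength (x := N) hk (by omega) (by omega)
    ((hu.reg 7 (by norm_num)).trans hE.r7) u46) ?_
  rintro v ⟨hv, hvp, v50, hvt⟩
  have hsv : Near 40 s v := hu.trans hv
  have hcv : Clean v := by unfold Clean; rw [hvp, hup]; exact hs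
  have hEv : Env n R pX lX pY lY X Y v := hE.frm (hsv.frm hcv (S := ∅)) (by simp)
  refine wp_seq_left (F := fun x => DenseInv g X Y n β i D O s ∅ 0 1 (fun _ => 0) (fun _ => D) x ∧
    x.reg 43 = wd w 0 ∧ x.reg 44 = wd w (if 0 < 1 then 1 else 0) ∧
    x.time ≤ s.time + (4 * D + 15)) ?_ ?_
  · refine wp_seqs_store (wp_seqs_store (wp_seqs_const (wp_seqs_const (wp_seqs_op
      (wp_seqs_nil ?_)))))
    have hv50 : v.reg 50 = wd w D := v50
    simp only [reg_tick, reg_put, hEv.r8, hv50]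
    refine ⟨⟨?_, hcv, ?_, ?_, ?_, ?_, by simp, by simp, by omega, by simp, by omega, ?_, ?_, ?_, ?_,
      by simp⟩, ?_, ?_, ?_⟩
    · refine (hsv.frm (S := {2, 16, 17}) hcv).trans (b := 40) (S' := {2, 16, 17})
        ⟨?_, ?_, fun _ => hcv⟩
      · intro x hx
        simp only [reg_set, reg_tick, reg_put]
        repeat rw [if_neg (by omega)]
      · intro x hx
        simp only [Finset.mem_insert, Finset.mem_singleton, not_or] at hx
        funext a b
        simp [arr_put, hx]
    · simp [reg_set, hv.reg 40 (by norm_num), u40]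
    · simp [reg_set]
    · intro q hq
      obtain rfl : q = 0 := by omega
      simp [arr_put]
    · intro q hq
      obtain rfl : q = 0 := by omega
      simp [arr_put]
    · intro q hq
      obtain rfl : q = 0 := by omega
      rw [mul_comm]
    · intro q hq; omega
    -- At the start the only interval has length `2 ^ D ≥ N` and contains all codes.
    · intro _ x j hx
      exact Or.inr (Or.inr ⟨0, by omega, le_rfl, by omega, by have := hx.lt; omega⟩)
    · refine Holds.iff_congr ((hO.congr (t := v) (by rw [hsv.arr])).congr ?_) (by simp)
      funext a b
      simp [arr_put]
    · simp [reg_set]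
    · have := eval_lt (w := w) (a := 0) (b := 1) (by omega) (by omega)
      simpa [wd, reg_set] using this
    · simp only [time_set, time_tick, time_put]; omega
  · rintro x ⟨hx, x43, x44, hxt⟩
    refine (wp_while (δ := if g then (D + 5) * 2⁻¹ ^ R else 0)
      (m := 2 * (denseRow X Y n β i).card + 1)
      (fun m y => ∃ F hd tl lam eps, 2 * ((denseRow X Y n β i).card - F.card) + (tl - hd) ≤ m ∧
        DenseInv g X Y n β i D O s F hd tl lam eps y ∧ y.reg 43 = wd w hd ∧
        y.reg 44 = wd w (if hd < tl then 1 else 0) ∧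
        y.time ≤ s.time + (4 * D + 15) + ∑ q ∈ Finset.range hd, denseStep D R q) (by omega)
      ⟨∅, 0, 1, _, _, by simp, hx, x43, x44, by simpa using hxt⟩ ?_).mono ?_ ?_
    · rintro m y ⟨F, hd, tl, lam, eps, hm, hy, y43, y44, hyt⟩ hne
      rw [y44, Ne, wd_bool_eq_zero (by omega), not_not] at hne
      refine ⟨m - 1, by omega, ?_⟩
      refine (wp_denseSearch_step hk hn (by omega) hR (by omega) hβ0 hi
        (hE.frm hy.frm hS) ((hy.frm.reg 30 (by norm_num)).trans h30)
        ((hy.frm.reg 9 (by norm_num)).trans h9) hy hne y43).mono ?_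
      rintro z ⟨F', tl', lam', eps', hz, hm', z43, z44, hzt⟩
      refine ⟨F', hd + 1, tl', lam', eps', by omega, hz, z43, z44, ?_⟩
      rw [Finset.sum_range_succ]; omega
    · rintro _ ⟨m, y, ⟨F, hd, tl, lam, eps, hm, hy, y43, y44, hyt⟩, h0, rfl⟩
      rw [y44, wd_bool_eq_zero (by omega)] at h0
      refine ⟨hy.frm.trans (b := 40) (S' := {2, 16, 17}) ⟨fun _ _ => rfl, fun _ _ => rfl, id⟩,
        -- Outputs that earlier searches had already recorded are never marked here; they are added
        -- to `F` to obtain the complete encoded part of the row.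
        hy.clean, ?_, F ∪ (denseRow X Y n β i).filter fun j => O i j, ?_, fun hg j hj => ?_, ?_⟩
      · have h1 := hy.tl_le
        have h2 := hy.fuel
        have h3 := hy.hd_le
        have h4 : ∑ q ∈ Finset.range hd, denseStep D R q ≤
            ∑ q ∈ Finset.range (2 * (denseRow X Y n β i).card + 1), denseStep D R q :=
          Finset.sum_le_sum_of_subset (Finset.range_subset_range.2 (by omega))
        rw [time_tick, denseTime, ← hDdef]
        omega
      · exact Finset.union_subset hy.sub (Finset.filter_subset _ _)
      · obtain ⟨x', hx'⟩ : ∃ x', Codes X Y n β i x' j := by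
          simp only [denseRow, Finset.mem_filter] at hj; exact hj.2
        rcases hy.compl hg x' j hx' with h1 | h1 | ⟨q, hq, h2, h3, h4⟩
        · exact Finset.mem_union_right _ (Finset.mem_filter.2 ⟨hj, h1⟩)
        · exact Finset.mem_union_left _ h1
        · omega
      · refine (hy.holds.congr (t := y.tick) rfl).iff_congr fun i' _ j' _ => ?_
        simp only [Finset.mem_union, Finset.mem_filter]
        constructor
        · rintro (h1 | ⟨h1, h2⟩)
          · exact Or.inl h1
          · exact Or.inr ⟨h1, Or.inl h2⟩
        · rintro (h1 | ⟨rfl, h2 | h2⟩)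
          · exact Or.inl h1
          · exact Or.inr ⟨rfl, h2⟩
          · exact Or.inl h2.2
    · split_ifs
      · push_cast
        gcongr
      · simp

/-- Find the ones of a product that are encoded by some number. -/
def denseRows (pX lX pY lY : ℕ) : Prog := forLoop 30 31 0 (denseSearch pX lX pY lY)

theorem wp_denseRows [Decidable g] (hk : 2 ^ w < k) (hn : 4 * n + 4 < 2 ^ w)
    (hD : Nat.clog 2 (n * n) + 8 ≤ w) (hR : R < 2 ^ w) (hβ : β ≤ n) (hβ0 : 0 < β)
    (hS : pX ∉ ({2, 16, 17} : Finset ℕ) ∧ lX ∉ ({2, 16, 17} : Finset ℕ) ∧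
      pY ∉ ({2, 16, 17} : Finset ℕ) ∧ lY ∉ ({2, 16, 17} : Finset ℕ))
    (hE : Env n R pX lX pY lY X Y s) (h9 : s.reg 9 = wd w β)
    (hO : Holds s 2 n O) (hs : Clean s) :
    WP k (denseRows pX lX pY lY)
      (if g then n * ((2 * n + 1) * ((Nat.clog 2 (n * n) + 5) * 2⁻¹ ^ R)) else 0)
      (fun t => RowsPost g n 2 {2, 16, 17} (denseRow X Y n β) O s n t ∧
        t.time ≤ s.time + ∑ i ∈ Finset.range n,
          (denseTime R (cnt X i n * β) (denseRow X Y n β i).card + 3) + 3) s := by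
  refine (wp_rows (k := k) (S := {2, 16, 17}) (C := denseRow X Y n β)
    (T := fun i => denseTime R (cnt X i n * β) (denseRow X Y n β i).card)
    (g := g) (δ := if g then (2 * n + 1) * ((Nat.clog 2 (n * n) + 5) * 2⁻¹ ^ R) else 0)
    hk (by omega) (by omega) hE.r0 hE.r7 hs hO ?_).mono (fun t ht => ht) (by split_ifs <;> simp)
  intro i hi t O' ht hc h30 hO'
  exact wp_denseSearch hk hn hD hR hβ hβ0 hi hS (hE.frm ht hS) h30
    ((ht.reg 9 (by norm_num)).trans h9) hO' hc

end

end QRAM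

namespace QRAM

variable {w : ℕ} {k : ℕ} {p q : Prog} {δ δ' : ℝ≥0∞} {E E' : State w → Prop} {s t : State w}

/-! ### Loops over the entries of a matrix -/

/-- Two nested loops, with the indices in the registers `30` and `32`. -/
def forLoop₂ (N₁ N₂ : ℕ) (p : Prog) : Prog := forLoop 30 31 N₁ (forLoop 32 33 N₂ p)

/-- The cost of two nested loops. -/
def forTime₂ (n₁ n₂ T : ℕ) : ℕ := n₁ * (n₂ * (T + 3) + 6) + 3

/-- The lexicographic order. -/
def Before (i j i' j' : ℕ) : Prop := i' < i ∨ (i' = i ∧ j' < j)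

section

variable {N₁ N₂ n₁ n₂ T : ℕ}

/-- The invariant is indexed by a position in lexicographic order. By `hrow` the end of one row may
be taken as the start of the next one, which links the inner loop to the outer. -/
theorem wp_for₂ {Inv : ℕ → ℕ → State w → Prop} (hk : 2 ^ w < k) (hw : 0 < w) (hn₁ : n₁ < 2 ^ w)
    (hn₂ : n₂ < 2 ^ w) (hN₁ : N₁ < 30) (hN₂ : N₂ < 30)
    (hI : ∀ i j t, Inv i j t → t.reg N₁ = wd w n₁ ∧ t.reg N₂ = wd w n₂ ∧ t.reg 7 = wd w 1)
    (hst : ∀ i j t u, Inv i j t → Frm 30 ∅ t u → u.arr = t.arr → u.psi = t.psi → Inv i j u)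
    (hrow : ∀ i t, Inv i n₂ t → Inv (i + 1) 0 t)
    (hbody : ∀ i < n₁, ∀ j < n₂, ∀ t, Inv i j t → t.reg 30 = wd w i → t.reg 32 = wd w j →
      WP k p 0 (fun u => Inv i (j + 1) u ∧ u.reg 30 = t.reg 30 ∧ u.reg 32 = t.reg 32 ∧
        u.time ≤ t.time + T) t)
    (h0 : Inv 0 0 s) :
    WP k (forLoop₂ N₁ N₂ p) 0 (fun t => Inv n₁ 0 t ∧ t.time ≤ s.time + forTime₂ n₁ n₂ T) s := by
  have hst' : ∀ i c, 30 ≤ i → i < 100 → 30 ≤ c → c < 100 → ∀ a b t u, Inv a b t → SameBut i c t u →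
      Inv a b u := fun i c h1 h2 h3 h4 a b t u ht hu =>
    hst a b t u ht (hu.frm ⟨h1, h2⟩ ⟨h3, h4⟩) hu.arr hu.psi
  refine (wp_for (δ := 0) (T := fun _ => n₂ * (T + 3) + 3) (Inv := fun i t => Inv i 0 t)
    hn₁ hk hw (by norm_num) (by omega)
    (fun i t ht => ⟨(hI i 0 t ht).1, (hI i 0 t ht).2.2⟩)
    (fun i t u ht hu => hst' 30 31 (by norm_num) (by norm_num) (by norm_num) (by norm_num) _ _ t u
      ht hu)
    (fun i t hi ht h30 => ?_) h0).mono (fun t ht => ⟨ht.1, ht.2.trans (le_of_eq ?_)⟩) (by simp)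
  · refine (wp_for (δ := 0) (T := fun _ => T)
      (Inv := fun j u => Inv i j u ∧ u.reg 30 = t.reg 30) hn₂ hk hw (by norm_num)
      (by omega) (fun j u hu => (hI i j u hu.1).2)
      (fun j u v hu hv => ⟨hst' 32 33 (by norm_num) (by norm_num) (by norm_num) (by norm_num) _ _
        u v hu.1 hv, (hv.reg 30 (by norm_num) (by norm_num)).trans hu.2⟩)
      (fun j u hj hu h32 => ?_) ⟨ht, rfl⟩).mono
      (fun u hu => ⟨hrow i u hu.1.1, hu.1.2, hu.2.trans (le_of_eq ?_)⟩) (by simp)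
    · exact (hbody i hi j hj u hu.1 (hu.2.trans h30) h32).mono
        fun v hv => ⟨⟨hv.1, hv.2.1.trans hu.2⟩, hv.2.2⟩
    · simp; ring
  · simp [forTime₂]; ring

/-- The rule for two nested loops in which the round `(i, j)` achieves `P i j`. -/
theorem wp_for₂_forall {S : Finset ℕ} {P : ℕ → ℕ → State w → Prop} (hk : 2 ^ w < k) (hw : 0 < w)
    (hn₁ : n₁ < 2 ^ w) (hn₂ : n₂ < 2 ^ w) (hN₁ : N₁ < 30) (hN₂ : N₂ < 30)
    (h1 : s.reg N₁ = wd w n₁) (h2 : s.reg N₂ = wd w n₂) (h7 : s.reg 7 = wd w 1)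
    (hP : ∀ i j t u, P i j t → u.arr = t.arr → P i j u)
    (hbody : ∀ i < n₁, ∀ j < n₂, ∀ t, Frm 30 S s t → t.reg 30 = wd w i → t.reg 32 = wd w j →
      (∀ i' < n₁, ∀ j' < n₂, Before i j i' j' → P i' j' t) →
      WP k p 0 (fun u => Frm 34 S t u ∧ P i j u ∧
        (∀ i' < n₁, ∀ j' < n₂, Before i j i' j' → P i' j' u) ∧ u.time ≤ t.time + T) t) :
    WP k (forLoop₂ N₁ N₂ p) 0 (fun t => (Frm 30 S s t ∧ ∀ i < n₁, ∀ j < n₂, P i j t) ∧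
      t.time ≤ s.time + forTime₂ n₁ n₂ T) s := by
  refine (wp_for₂ (T := T) (Inv := fun i j t => Frm 30 S s t ∧
    ∀ i' < n₁, ∀ j' < n₂, Before i j i' j' → P i' j' t) hk hw hn₁ hn₂ hN₁ hN₂
    (fun i j t ht => ⟨(ht.1.reg _ (by omega)).trans h1, (ht.1.reg _ (by omega)).trans h2,
      (ht.1.reg _ (by omega)).trans h7⟩)
    (fun i j t u ht hu ha _ => ⟨ht.1.trans (b := 30) (S' := ∅) hu, fun i' hi j' hj hb =>
      hP _ _ _ _ (ht.2 i' hi j' hj hb) ha⟩)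
    (fun i t ht => ⟨ht.1, fun i' hi j' hj hb => ht.2 i' hi j' hj ?_⟩)
    (fun i hi j hj t ht h30 h32 => ?_)
    ⟨Frm.refl _ _ _, fun i' _ j' _ hb => by simp [Before] at hb⟩).mono
    fun t ht => ⟨⟨ht.1.1, fun i hi j hj => ht.1.2 i hi j hj (Or.inl hi)⟩, ht.2⟩
  · rcases hb with h | h
    · rcases Nat.lt_succ_iff_lt_or_eq.1 h with h3 | h3
      · exact Or.inl h3
      · exact Or.inr ⟨h3, hj⟩
    · omega
  · refine (hbody i hi j hj t ht.1 h30 h32 ht.2).mono fun u hu =>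
      ⟨⟨ht.1.trans (b := 34) (S' := S) hu.1 (by norm_num) subset_rfl, ?_⟩,
        hu.1.reg 30 (by norm_num), hu.1.reg 32 (by norm_num), hu.2.2.2⟩
    intro i' hi' j' hj' hb
    rcases hb with h | ⟨h, h3⟩
    · exact hu.2.2.1 i' hi' j' hj' (Or.inl h)
    · rcases Nat.lt_succ_iff_lt_or_eq.1 h3 with h4 | h4
      · exact hu.2.2.1 i' hi' j' hj' (Or.inr ⟨h, h4⟩)
      · rw [h, h4]; exact hu.2.1

end

/-! ### Tables of the input matrices -/

/-- Copy the transpose of the matrix in the array `a` into the array `b`. -/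
def transposeArr (a b : ℕ) : Prog :=
  forLoop₂ 0 0 (seqs [.load 40 a 32 30, .store b 30 32 40])

/-- Tabulate the counts and the lists of the ones in the rows of the matrix in the array `a`. -/
def scan (N a pc lst : ℕ) : Prog :=
  forLoop₂ N 0 (.seq (seqs [.load 40 pc 30 32, .load 41 a 30 32])
    (.seq (.ite 41 (seqs [.store lst 30 40 32, .op .add 40 40 7]) .skip)
      (seqs [.op .add 42 32 7, .store pc 30 42 40])))

/-- Flag the rows of a matrix with more ones than the register `thr` says, in the row `b` of the
array `13`. -/
def flagRows (pc thr b : ℕ) : Prog :=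
  forLoop 30 31 0 (seqs [.const 42 b, .load 40 pc 30 0, .op .lt 41 thr 40, .store 13 42 30 41])

section

variable {a b n m N pc lst thr : ℕ} {X F : ℕ → ℕ → Bool}

theorem wp_transposeArr (hk : 2 ^ w < k) (hw : 0 < w) (hn : n < 2 ^ w) (h0 : s.reg 0 = wd w n)
    (h7 : s.reg 7 = wd w 1) (hab : a ≠ b) (hX : HoldsBool s a n n X) :
    WP k (transposeArr a b) 0 (fun t => (Frm 30 {b} s t ∧ HoldsBool t b n n fun i j => X j i) ∧
      t.time ≤ s.time + forTime₂ n n 2) s := by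
  refine wp_for₂_forall (P := fun i j t => t.arr b (wd w i) (wd w j) = wd w (if X j i then 1 else 0))
    hk hw hn hn (by norm_num) (by norm_num) h0 h0 h7 (fun i j t u h h' => by rw [h']; exact h) ?_
  intro i hi j hj t ht h30 h32 hP
  have e1 : t.arr a (wd w j) (wd w i) = wd w (if X j i then 1 else 0) := by
    rw [ht.arr a (by simpa using hab)]; exact hX j hj i hi
  refine wp_seqs_load (wp_seqs_store (wp_seqs_nil ?_))
  simp only [reg_set, reg_tick, h30, h32, e1, Nat.reduceEqDiff, if_false, if_true]
  refine ⟨⟨fun x hx => ?_, fun x hx => ?_, id⟩, ?_, ?_, ?_⟩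
  · simp only [reg_set, reg_tick, reg_put]
    rw [if_neg (by omega)]
  · simp only [Finset.mem_singleton] at hx
    funext y z
    simp [arr_put, hx]
  · simp [arr_put]
  · intro i' hi' j' hj' hb
    simp only [arr_put, true_and]
    by_cases h1 : wd w i' = wd w i ∧ wd w j' = wd w j
    · rw [if_pos h1]
      simp only [wd_inj (hi'.trans hn) (hi.trans hn), wd_inj (hj'.trans hn) (hj.trans hn)] at h1
      rw [h1.1, h1.2]
    · rw [if_neg h1]
      exact hP i' hi' j' hj' hb
  · simp

/-- Round `(i, j)` extends the running count by one column; the counts in column `0` are never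
written and are zero by assumption. Distinct ones of a row have distinct ranks, so no entry of a
list is overwritten by a later one. -/
theorem wp_scan (hk : 2 ^ w < k) (hw : 0 < w) (hn : n + 1 < 2 ^ w) (hm : m < 2 ^ w)
    (hN : N < 30) (hsN : s.reg N = wd w m) (h0 : s.reg 0 = wd w n)
    (h7 : s.reg 7 = wd w 1) (hd : a ≠ pc ∧ a ≠ lst ∧ pc ≠ lst) (hX : HoldsBool s a m n X)
    (hpc : ∀ i < m, s.arr pc (wd w i) (wd w 0) = wd w 0) :
    WP k (scan N a pc lst) 0 (fun t => (Frm 30 {pc, lst} s t ∧ Listed t pc lst X m n) ∧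
      t.time ≤ s.time + forTime₂ m n 7) s := by
  obtain ⟨hd1, hd2, hd3⟩ := hd
  refine (wp_for₂ (T := 7) (Inv := fun i j t => Frm 30 {pc, lst} s t ∧
    (∀ i' < m, t.arr pc (wd w i') (wd w 0) = wd w 0) ∧
    ∀ i' < m, ∀ j' < n, Before i j i' j' →
      t.arr pc (wd w i') (wd w (j' + 1)) = wd w (cnt X i' (j' + 1)) ∧
      (X i' j' → t.arr lst (wd w i') (wd w (cnt X i' j')) = wd w j'))
    hk hw hm (by omega) hN (by norm_num : 0 < 30)
    (fun i j t ht => ⟨(ht.1.reg _ (by omega)).trans hsN, (ht.1.reg _ (by omega)).trans h0,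
      (ht.1.reg _ (by omega)).trans h7⟩)
    (fun i j t u ht hu ha _ => ⟨ht.1.trans (b := 30) (S' := ∅) hu, by rw [ha]; exact ht.2⟩)
    (fun i t ht => ⟨ht.1, ht.2.1, fun i' hi j' hj hb => ht.2.2 i' hi j' hj ?_⟩)
    (fun i hi j hj t ht h30 h32 => ?_)
    ⟨Frm.refl _ _ _, hpc, fun i' _ j' _ hb => by simp [Before] at hb⟩).mono
    fun t ht => ⟨⟨ht.1.1, ?_, fun i hi j hj hx => (ht.1.2.2 i hi j hj (Or.inl hi)).2 hx⟩, ht.2⟩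
  · rcases hb with h | h
    · rcases Nat.lt_succ_iff_lt_or_eq.1 h with h3 | h3
      · exact Or.inl h3
      · exact Or.inr ⟨h3, hj⟩
    · omega
  · obtain ⟨ht, hz, hP⟩ := ht
    have e7 : t.reg 7 = wd w 1 := (ht.reg 7 (by norm_num)).trans h7
    have e1 : t.arr a (wd w i) (wd w j) = wd w (if X i j then 1 else 0) := by
      rw [ht.arr a (by simp [hd1, hd2])]; exact hX i hi j hj
    have e2 : t.arr pc (wd w i) (wd w j) = wd w (cnt X i j) := by
      cases j with
      | zero => rw [hz i hi, cnt_zero]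
      | succ j => exact (hP i hi j (by omega) (Or.inr ⟨rfl, by omega⟩)).1
    have hcj : cnt X i j ≤ j := cnt_le
    refine wp_seq_left (F := fun u => Frm 34 ∅ t u ∧ u.arr = t.arr ∧ u.reg 40 = wd w (cnt X i j) ∧
      u.reg 41 = wd w (if X i j then 1 else 0) ∧ u.time = t.time + 2) ?_ ?_
    · refine wp_seqs_load (wp_seqs_load (wp_seqs_nil ⟨⟨fun x hx => ?_, fun _ _ => rfl, id⟩, rfl,
        ?_, ?_, ?_⟩))
      · simp only [reg_set, reg_tick]
        repeat rw [if_neg (by omega)]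
      · simp [reg_set, h30, h32, e2]
      · simp [reg_set, h30, h32, e1]
      · simp
    rintro u ⟨hu, hua, u40, u41, hut⟩
    have u30 : u.reg 30 = wd w i := (hu.reg 30 (by norm_num)).trans h30
    have u32 : u.reg 32 = wd w j := (hu.reg 32 (by norm_num)).trans h32
    have u7 : u.reg 7 = wd w 1 := (hu.reg 7 (by norm_num)).trans e7
    refine wp_seq_left (F := fun v => Frm 34 {pc, lst} t v ∧ v.reg 40 = wd w (cnt X i (j + 1)) ∧
      (∀ x y, v.arr lst x y = if X i j ∧ x = wd w i ∧ y = wd w (cnt X i j) then wd w j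
        else t.arr lst x y) ∧ v.arr pc = t.arr pc ∧ v.time ≤ t.time + 5) ?_ ?_
    · refine wp_ite (fun h => wp_skip ?_) fun h => ?_
      · rw [u41, wd_bool_eq_zero hw] at h
        refine ⟨(hu.mono (S := {pc, lst}) le_rfl (by simp)).trans (b := 34) (S' := {pc, lst})
          ⟨fun _ _ => rfl, fun _ _ => rfl, id⟩, ?_, ?_, ?_, ?_⟩
        · rw [reg_tick, u40, cnt_succ, if_neg h, add_zero]
        · intro x y
          rw [if_neg (fun h' => h h'.1), arr_tick, hua]
        · rw [arr_tick, hua]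
        · rw [time_tick]; omega
      · rw [u41, Ne, wd_bool_eq_zero hw, not_not] at h
        refine wp_seqs_store (wp_seqs_op (wp_seqs_nil ⟨⟨fun x hx => ?_, fun x hx => ?_, fun h => ?_⟩,
          ?_, ?_, ?_, ?_⟩))
        · simp only [reg_set, reg_tick, reg_put]
          rw [if_neg (by omega), hu.reg x hx]
        · simp only [Finset.mem_insert, Finset.mem_singleton, not_or] at hx
          funext y z
          simp [arr_put, hx, hua]
        · exact hu.clean h
        · simp [reg_set, u40, u7, eval_add, cnt_succ, h]
        · intro x y
          simp only [arr_set, arr_tick, arr_put, reg_tick, u30, u40, u32, true_and, h, hua]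
        · funext x y
          simp [arr_put, hd3, hua]
        · simp; omega
    rintro v ⟨hv, v40, hvl, hvp, hvt⟩
    have v30 : v.reg 30 = wd w i := (hv.reg 30 (by norm_num)).trans h30
    have v32 : v.reg 32 = wd w j := (hv.reg 32 (by norm_num)).trans h32
    have v7 : v.reg 7 = wd w 1 := (hv.reg 7 (by norm_num)).trans e7
    refine wp_seqs_op (wp_seqs_store (wp_seqs_nil ?_))
    simp only [reg_set, reg_tick, v30, v32, v7, v40, eval_add, Nat.reduceEqDiff, if_false, if_true]
    refine ⟨⟨?_, ?_, ?_⟩, ?_, ?_, ?_⟩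
    · refine (ht.trans (b := 34) (S' := {pc, lst}) hv (by norm_num) subset_rfl).trans (b := 34)
        (S' := {pc, lst}) ⟨fun x hx => ?_, fun x hx => ?_, id⟩ (by norm_num) subset_rfl
      · simp only [reg_set, reg_tick, reg_put]
        rw [if_neg (by omega)]
      · simp only [Finset.mem_insert, Finset.mem_singleton, not_or] at hx
        funext y z
        simp [arr_put, hx]
    · intro i' hi'
      have h1 : ¬ wd w 0 = wd w (j + 1) := by rw [wd_inj (by omega) (by omega)]; omega
      simp only [arr_put, h1, and_false, if_false, arr_tick, arr_set, hvp]
      exact hz i' hi'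
    · intro i' hi' j' hj' hb
      have hc' : cnt X i' j' ≤ j' := cnt_le
      constructor
      · simp only [arr_put, true_and, wd_inj (hi'.trans hm) (hi.trans hm),
          wd_inj (w := w) (a := j' + 1) (b := j + 1) (by omega) (by omega), arr_tick, arr_set, hvp]
        split_ifs with h1
        · obtain ⟨rfl, h1⟩ := h1
          obtain rfl : j' = j := by omega
          rfl
        · refine (hP i' hi' j' hj' ?_).1
          rcases hb with h | h
          · exact Or.inl h
          · exact Or.inr ⟨h.1, by omega⟩
      · intro hx
        have hc : cnt X i' j' < 2 ^ w := by omega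
        have hc₁ : cnt X i j < 2 ^ w := by omega
        simp only [arr_put, hd3.symm, false_and, if_false, arr_tick, arr_set, hvl,
          wd_inj (hi'.trans hm) (hi.trans hm), wd_inj hc hc₁]
        split_ifs with h1
        · obtain ⟨h2, rfl, h1⟩ := h1
          rw [cnt_injective hx h2 h1]
        · refine (hP i' hi' j' hj' ?_).2 hx
          rcases hb with h | h
          · exact Or.inl h
          · refine Or.inr ⟨h.1, ?_⟩
            by_contra h3
            obtain rfl : j' = j := by omega
            obtain ⟨rfl, -⟩ := h
            exact h1 ⟨hx, rfl, rfl⟩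
    · simp [reg_set, v30, h30]
    · simp [reg_set, v32, h32]
    · simp; omega
  · intro i hi j hj
    cases j with
    | zero => rw [ht.1.2.1 i hi, cnt_zero]
    | succ j => exact (ht.1.2.2 i hi j (by omega) (Or.inl hi)).1

theorem wp_flagRows (hk : 2 ^ w < k) (hw : 0 < w) (hn : n < 2 ^ w) (h0 : s.reg 0 = wd w n)
    (h7 : s.reg 7 = wd w 1) (hb : b < 3) (hw3 : 3 < 2 ^ w) (hthr : thr < 30) {τ : ℕ}
    (hτ : s.reg thr = wd w τ) (hτw : τ < 2 ^ w) (hpc : pc ≠ 13)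
    (hP : ∀ i < n, s.arr pc (wd w i) (wd w n) = wd w (cnt X i n)) {F' : ℕ → ℕ → Bool}
    (hF : ∀ b' < b, ∀ i < n, s.arr 13 (wd w b') (wd w i) = wd w (if F' b' i then 1 else 0))
    (hFb : ∀ i < n, F' b i = decide (τ < cnt X i n)) :
    WP k (flagRows pc thr b) 0 (fun t => (Frm 30 {13} s t ∧ ∀ b' < b + 1, ∀ i < n,
      t.arr 13 (wd w b') (wd w i) = wd w (if F' b' i then 1 else 0)) ∧
      t.time ≤ s.time + (n * 7 + 3)) s := by
  refine (wp_for (δ := 0) (T := fun _ => 4) (Inv := fun i t => Frm 30 {13} s t ∧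
    (∀ b' < b, ∀ i < n, t.arr 13 (wd w b') (wd w i) = wd w (if F' b' i then 1 else 0)) ∧
    ∀ i' < i, i' < n → t.arr 13 (wd w b) (wd w i') = wd w (if F' b i' then 1 else 0))
    hn hk hw (by norm_num) (by norm_num)
    (fun i t ht => ⟨(ht.1.reg _ (by omega)).trans h0, (ht.1.reg _ (by omega)).trans h7⟩)
    (fun i t u ht hu => ⟨ht.1.sameBut hu, by rw [hu.arr]; exact ht.2⟩)
    (fun i t hi ht h30 => ?_) ⟨Frm.refl _ _ _, hF, fun i hi => by omega⟩).mono
    (fun t ht => ⟨⟨ht.1.1, fun b' hb' i hi => ?_⟩, ht.2.trans (le_of_eq ?_)⟩) (by simp)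
  · obtain ⟨ht, h1, h2⟩ := ht
    have e1 : t.arr pc (wd w i) (wd w n) = wd w (cnt X i n) := by
      rw [ht.arr pc (by simpa using hpc)]; exact hP i hi
    have e0 : t.reg 0 = wd w n := (ht.reg 0 (by norm_num)).trans h0
    have eτ : t.reg thr = wd w τ := (ht.reg thr (by omega)).trans hτ
    have hcn : cnt X i n ≤ n := cnt_le
    refine wp_seqs_const (wp_seqs_load (wp_seqs_op (wp_seqs_store (wp_seqs_nil ?_))))
    have n1 : thr ≠ 40 := by omega
    have n2 : thr ≠ 42 := by omega
    have e2 : BinOp.lt.eval (wd w τ) (wd w (cnt X i n)) = wd w (if F' b i then 1 else 0) := by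
      rw [eval_lt hτw (by omega), hFb i hi]
      simp
    simp only [reg_set, reg_tick, arr_set, arr_tick, if_true, h30, e0, eτ, n1, n2, if_false,
      Nat.reduceEqDiff, e1, e2]
    refine ⟨⟨ht.trans (b := 34) (S' := {13}) ⟨fun x hx => ?_, fun x hx => ?_, id⟩, ?_, ?_⟩, ?_⟩
    · simp only [reg_set, reg_tick, reg_put]
      repeat rw [if_neg (by omega)]
    · simp only [Finset.mem_singleton] at hx
      funext y z
      simp [arr_put, hx]
    · intro b' hb' i' hi'
      have h3 : ¬ wd w b' = wd w b := by rw [wd_inj (by omega) (by omega)]; omega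
      simp [arr_put, h3, h1 b' hb' i' hi']
    · intro i' hi' hin
      simp only [arr_put, true_and, wd_inj (hin.trans hn) (hi.trans hn)]
      by_cases h3 : i' = i
      · rw [if_pos h3, h3]
      · rw [if_neg h3]
        exact h2 i' (by omega) hin
    · simp [reg_set, h30]
  · rcases Nat.lt_succ_iff_lt_or_eq.1 hb' with h | rfl
    · exact ht.1.2.1 b' h i hi
    · exact ht.1.2.2 i hi hi
  · simp; ring

end

end QRAM

namespace QRAM

variable {w : ℕ} {k : ℕ} {p q : Prog} {δ δ' : ℝ≥0∞} {E E' : State w → Prop} {s t : State w}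

/-! ### Renaming the variables of a program -/

/-- Rename the variables and arrays of an instruction. -/
def Instr.rename (f : ℕ → ℕ) : Instr → Instr
  | .const x v => .const (f x) v
  | .op o x y z => .op o (f x) (f y) (f z)
  | .load x a i j => .load (f x) (f a) (f i) (f j)
  | .store a i j x => .store (f a) (f i) (f j) (f x)
  | .qconst q x => .qconst (f q) (f x)
  | .qop o q y z => .qop o (f q) (f y) (f z)
  | .qload q a i j => .qload (f q) (f a) (f i) (f j)
  | .hadamard q x => .hadamard (f q) (f x)
  | .phase q x => .phase (f q) (f x)
  | .measure x q => .measure (f x) (f q)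

/-- Rename the variables and arrays of a program. -/
def Prog.rename (f : ℕ → ℕ) : Prog → Prog
  | .skip => .skip
  | .instr i => .instr (i.rename f)
  | .seq p q => .seq (p.rename f) (q.rename f)
  | .ite x p q => .ite (f x) (p.rename f) (q.rename f)
  | .while x p => .while (f x) (p.rename f)

/-- The state `t`, with its variables renamed by `f`, as a part of the state `s`. -/
noncomputable def embed (f : ℕ → ℕ) (s : State w) (φ : Basis w → ℂ) (t : State w) : State w where
  reg := Function.extend f t.reg s.reg
  arr := Function.extend f t.arr s.arr
  psi := fun b => φ b * t.psi (b ∘ f)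
  time := s.time + t.time

section

variable {f : ℕ → ℕ} {φ : Basis w → ℂ}

theorem update_extend {α : Type*} (hf : Function.Injective f) (g e : ℕ → α) (a : ℕ) (v : α) :
    Function.update (Function.extend f g e) (f a) v
      = Function.extend f (Function.update g a v) e := by
  funext x
  by_cases hx : ∃ y, f y = x
  · obtain ⟨y, rfl⟩ := hx
    rw [hf.extend_apply, Function.update_apply, Function.update_apply, hf.extend_apply]
    simp [hf.eq_iff]
  · rw [Function.extend_apply' _ _ _ hx, Function.update_of_ne (fun h => hx ⟨a, h.symm⟩),
      Function.extend_apply' _ _ _ hx]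

theorem update_comp_rename (hf : Function.Injective f) (b : Basis w) (a : ℕ) (v : BitVec w) :
    Function.update b (f a) v ∘ f = Function.update (b ∘ f) a v :=
  Function.update_comp_eq_of_injective _ hf _ _

theorem embed_set (hf : Function.Injective f) (x : ℕ) (v : BitVec w) :
    (embed f s φ t).set (f x) v = embed f s φ (t.set x v) := by
  simp [State.set, embed, update_extend hf]

theorem embed_tick : (embed f s φ t).tick = embed f s φ t.tick := by
  simp [State.tick, embed, add_assoc]

theorem embed_reg (hf : Function.Injective f) (x : ℕ) : (embed f s φ t).reg (f x) = t.reg x :=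
  hf.extend_apply _ _ _

theorem embed_arr (hf : Function.Injective f) (x : ℕ) : (embed f s φ t).arr (f x) = t.arr x :=
  hf.extend_apply _ _ _

/-- The function depends only on the variables that are not in the range of `f`. -/
def Indep (f : ℕ → ℕ) (φ : Basis w → ℂ) : Prop :=
  ∀ b b' : Basis w, (∀ x, x ∉ Set.range f → b x = b' x) → φ b = φ b'

theorem Indep.update (hφ : Indep f φ) (b : Basis w) (a : ℕ) (v : BitVec w) :
    φ (Function.update b (f a) v) = φ b :=
  hφ _ _ fun _ hx => Function.update_of_ne (fun h => hx ⟨a, h.symm⟩) _ _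

theorem xorGate_rename (hf : Function.Injective f) (hφ : Indep f φ) (q : ℕ)
    (g : Basis w → BitVec w) (ψ : Basis w → ℂ) :
    (xorGate (f q) (fun b => g (b ∘ f)) fun b => φ b * ψ (b ∘ f))
      = fun b => φ b * xorGate q g ψ (b ∘ f) := by
  funext b
  simp only [xorGate, hφ.update, update_comp_rename hf, Function.comp_apply]

theorem hadamardGate_rename (hf : Function.Injective f) (hφ : Indep f φ) (q m : ℕ)
    (ψ : Basis w → ℂ) :
    (hadamardGate (f q) m fun b => φ b * ψ (b ∘ f))
      = fun b => φ b * hadamardGate q m ψ (b ∘ f) := by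
  unfold hadamardGate
  split_ifs
  · funext b
    simp only [hφ.update, update_comp_rename hf, Function.comp_apply]
    split_ifs <;> ring
  · rfl

theorem phaseGate_rename (q m : ℕ) (ψ : Basis w → ℂ) :
    (phaseGate (f q) m fun b => φ b * ψ (b ∘ f)) = fun b => φ b * phaseGate q m ψ (b ∘ f) := by
  funext b
  simp only [phaseGate, Function.comp_apply]
  split_ifs
  · ring
  · rfl

theorem exec_rename (hf : Function.Injective f) (hφ : Indep f φ) (i : Instr) :
    (i.rename f).exec (embed f s φ t) = (i.exec t).map (embed f s φ) := by
  cases i with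
  | const x v => simp [Instr.rename, Instr.exec, embed_set hf]
  | op o x y z => simp [Instr.rename, Instr.exec, embed_set hf, embed_reg hf]
  | load x a i j => simp [Instr.rename, Instr.exec, embed_set hf, embed_reg hf, embed_arr hf]
  | store a i j x =>
    simp [Instr.rename, Instr.exec, embed_reg hf, embed_arr hf]
    simp [embed, update_extend hf]
  | qconst q x =>
    simp only [Instr.rename, Instr.exec, embed_reg hf, List.map_cons, List.map_nil]
    exact congrArg (fun ψ => [{embed f s φ t with psi := ψ}])
      (xorGate_rename hf hφ q (fun _ => t.reg x) t.psi)
  | qop o q y z =>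
    simp only [Instr.rename, Instr.exec, List.map_cons, List.map_nil, hf.eq_iff]
    split_ifs
    · rfl
    · exact congrArg (fun ψ => [{embed f s φ t with psi := ψ}])
        (xorGate_rename hf hφ q (fun b => o.eval (b y) (b z)) t.psi)
  | qload q a i j =>
    simp only [Instr.rename, Instr.exec, embed_arr hf, List.map_cons, List.map_nil, hf.eq_iff]
    split_ifs
    · rfl
    · exact congrArg (fun ψ => [{embed f s φ t with psi := ψ}])
        (xorGate_rename hf hφ q (fun b => t.arr a (b i) (b j)) t.psi)
  | hadamard q x =>
    simp only [Instr.rename, Instr.exec, embed_reg hf, List.map_cons, List.map_nil]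
    exact congrArg (fun ψ => [{embed f s φ t with psi := ψ}])
      (hadamardGate_rename hf hφ q _ t.psi)
  | phase q x =>
    simp only [Instr.rename, Instr.exec, embed_reg hf, List.map_cons, List.map_nil]
    exact congrArg (fun ψ => [{embed f s φ t with psi := ψ}]) (phaseGate_rename q _ t.psi)
  | measure x q =>
    simp only [Instr.rename, Instr.exec, List.map_map]
    refine List.map_congr_left fun v _ => ?_
    simp only [Function.comp_apply, embed_set hf]
    simp only [embed, project, State.set, Function.comp_apply, State.mk.injEq, and_true, true_and]
    funext b
    by_cases h : b (f q) = BitVec.ofFin v <;> simp [project, h]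

/-- The renamed program acts only on the second factor of a product state, and its branches
correspond one by one to those of the original program. -/
theorem run_rename (hf : Function.Injective f) (hφ : Indep f φ) (p : Prog) (t : State w) :
    (p.rename f).run k (embed f s φ t) = (p.run k t).map (embed f s φ) := by
  induction p generalizing t with
  | skip => rfl
  | instr i => rw [Prog.rename, Prog.run, Prog.run, embed_tick, exec_rename hf hφ]
  | seq p q hp hq =>
    rw [Prog.rename, Prog.run, Prog.run, hp, List.flatMap_map, List.map_flatMap]
    exact congrArg (fun F => List.flatMap F _) (funext hq)
  | ite x p q hp hq =>
    rw [Prog.rename, Prog.run, Prog.run, embed_reg hf, embed_tick, hp, hq]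
    split_ifs <;> rfl
  | _ x p hp =>
    rw [Prog.rename, Prog.run, Prog.run]
    have H : ∀ k' t, whileLoop (f x) ((p.rename f).run k) k' (embed f s φ t)
        = (whileLoop x (p.run k) k' t).map (embed f s φ) := by
      intro k'
      induction k' with
      | zero => intro t; rfl
      | succ k' ih =>
        intro t
        rw [whileLoop, whileLoop, embed_reg hf, embed_tick, hp, List.flatMap_map]
        split_ifs
        · rfl
        · rw [List.map_flatMap]; simp only [ih]
    exact H k t

open scoped Classical in
/-- A basis state with given values of the variables in the range of `f` and of the other ones. -/
noncomputable def mergeBasis (f : ℕ → ℕ) (a : Basis w) (c : {x // x ∉ Set.range f} → BitVec w) :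
    Basis w := Function.extend f a fun x => if h : x ∈ Set.range f then 0 else c ⟨x, h⟩

theorem mergeBasis_apply (hf : Function.Injective f) (a : Basis w)
    (c : {x // x ∉ Set.range f} → BitVec w) (y : ℕ) : mergeBasis f a c (f y) = a y :=
  hf.extend_apply _ _ _

theorem mergeBasis_of_notMem (a : Basis w) (c : {x // x ∉ Set.range f} → BitVec w)
    (x : {x // x ∉ Set.range f}) : mergeBasis f a c x = c x := by
  refine (Function.extend_apply' _ _ _ x.2).trans ?_
  exact dif_neg x.2

/-- The variables in the range of `f` and the other ones. -/
noncomputable def splitBasis (hf : Function.Injective f) :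
    Basis w ≃ (Basis w) × ({x // x ∉ Set.range f} → BitVec w) where
  toFun b := (b ∘ f, fun x => b x)
  invFun a := mergeBasis f a.1 a.2
  left_inv b := by
    funext x
    by_cases hx : x ∈ Set.range f
    · obtain ⟨y, rfl⟩ := hx
      exact mergeBasis_apply hf _ _ _
    · exact mergeBasis_of_notMem _ _ ⟨x, hx⟩
  right_inv a := Prod.ext (funext fun y => mergeBasis_apply hf _ _ y)
    (funext fun x => mergeBasis_of_notMem _ _ x)

/-- Splitting the basis into the renamed variables and the others makes the squared norm a product.
The factor `W` of the other variables is the same for every `t`. -/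
theorem exists_weight_embed (hf : Function.Injective f) (hφ : Indep f φ) :
    ∃ W : ℝ≥0∞, ∀ t, (embed f s φ t).weight = W * t.weight := by
  refine ⟨∑' c, ‖φ ((splitBasis hf).symm (0, c))‖ₑ ^ 2, fun t => ?_⟩
  rw [State.weight, ← (splitBasis hf).symm.tsum_eq, ENNReal.tsum_prod (f := fun a c =>
    ‖(embed f s φ t).psi ((splitBasis hf).symm (a, c))‖ₑ ^ 2), State.weight, ENNReal.tsum_comm, ← ENNReal.tsum_mul_right]
  refine tsum_congr fun c => ?_
  rw [← ENNReal.tsum_mul_left]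
  refine tsum_congr fun a => ?_
  have h1 : φ ((splitBasis hf).symm (a, c)) = φ ((splitBasis hf).symm (0, c)) := by
    refine hφ _ _ fun x hx => ?_
    have h2 : ∀ a, (splitBasis hf).symm (a, c) x = c ⟨x, hx⟩ := fun a => by
      have := congrArg (fun y => y.2 ⟨x, hx⟩) ((splitBasis hf).apply_symm_apply (a, c))
      exact this
    rw [h2, h2]
  have h3 : (splitBasis hf).symm (a, c) ∘ f = a :=
    congrArg Prod.fst ((splitBasis hf).apply_symm_apply (a, c))
  simp only [embed]
  rw [h1, h3, enorm_mul, mul_pow]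

/-- What remains true when a renamed program is run in the state `s`, and its result is `t`. -/
structure Renamed (f : ℕ → ℕ) (s t u : State w) : Prop where
  reg : ∀ y, u.reg (f y) = t.reg y
  arr : ∀ y, u.arr (f y) = t.arr y
  reg' : ∀ x, x ∉ Set.range f → u.reg x = s.reg x
  arr' : ∀ x, x ∉ Set.range f → u.arr x = s.arr x
  time : u.time = s.time + t.time
  psi : ∀ g : ℕ → ℕ, (∀ x y, g x ≠ f y) → (∀ b, s.psi b ≠ 0 → b ∘ g = 0) →
    ∀ b, u.psi b ≠ 0 → b ∘ g = 0

/-- The state `s` is itself an embedding of `t`: take for `φ` the amplitude of `s` after the renamed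
variables are set to zero. All probabilities are then multiplied by the weight of `s`. The program
may leave its quantum variables dirty, but it keeps those of any disjoint family zero, which the
next copy needs. -/
theorem wp_rename (hf : Function.Injective f) {k' : ℕ} (hk : k' ≤ k)
    (hreg : ∀ y, s.reg (f y) = t.reg y) (harr : ∀ y, s.arr (f y) = t.arr y)
    (hpsi : ∀ b, s.psi b ≠ 0 → b ∘ f = 0) (ht : t.psi = delta 0 1)
    (ht0 : t.time = 0) (h : 1 ≤ prob (p.run k' t) E + δ) :
    WP k (p.rename f) δ (fun u => ∃ t', E t' ∧ Renamed f s t' u) s := by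
  classical
  set Z : Basis w → Basis w := fun b => Function.extend f 0 b with hZ
  set φ : Basis w → ℂ := fun b => s.psi (Z b) with hφdef
  have hZf : ∀ b, Z b ∘ f = 0 := fun b => by
    funext y; exact hf.extend_apply _ _ _
  have hZ' : ∀ b x, x ∉ Set.range f → Z b x = b x := fun b x hx =>
    Function.extend_apply' _ _ _ (by simpa using hx)
  have hφ : Indep f φ := by
    intro b b' hb
    simp only [hφdef]
    congr 1
    funext x
    by_cases hx : ∃ y, f y = x
    · obtain ⟨y, rfl⟩ := hx
      rw [show Z b (f y) = 0 from congrFun (hZf b) y, show Z b' (f y) = 0 from congrFun (hZf b') y]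
    · rw [hZ' b x (by simpa using hx), hZ' b' x (by simpa using hx), hb x (by simpa using hx)]
  have hs : s = embed f s φ t := by
    have e1 : s.reg = Function.extend f t.reg s.reg := by
      funext x
      by_cases hx : ∃ y, f y = x
      · obtain ⟨y, rfl⟩ := hx
        rw [hf.extend_apply, hreg]
      · rw [Function.extend_apply' _ _ _ hx]
    have e2 : s.arr = Function.extend f t.arr s.arr := by
      funext x
      by_cases hx : ∃ y, f y = x
      · obtain ⟨y, rfl⟩ := hx
        rw [hf.extend_apply, harr]
      · rw [Function.extend_apply' _ _ _ hx]
    have e3 : s.psi = fun b => φ b * t.psi (b ∘ f) := by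
      funext b
      rw [ht]
      by_cases hb : b ∘ f = 0
      · have h1 : Z b = b := by
          funext x
          by_cases hx : ∃ y, f y = x
          · obtain ⟨y, rfl⟩ := hx
            rw [show Z b (f y) = 0 from congrFun (hZf b) y]
            exact (congrFun hb y).symm
          · exact hZ' b x (by simpa using hx)
        simp [hb, hφdef, h1, delta]
      · simp only [delta, hb, if_false, mul_zero]
        by_contra h1
        exact hb (hpsi b h1)
    calc s = ⟨s.reg, s.arr, s.psi, s.time⟩ := rfl
      _ = embed f s φ t := by
        rw [embed, ← e1, ← e2, ← e3, ht0, add_zero]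
  obtain ⟨W, hW⟩ := exists_weight_embed (s := s) hf hφ
  have hweight : t.weight = 1 := by
    rw [State.weight, tsum_eq_single 0 (fun b hb => by simp [ht, hb, delta])]
    simp [ht, delta]
  have hRen : ∀ t', Renamed f s t' (embed f s φ t') := fun t' => by
    refine ⟨embed_reg hf, embed_arr hf, fun x hx => Function.extend_apply' _ _ _ (by simpa using hx),
      fun x hx => Function.extend_apply' _ _ _ (by simpa using hx), rfl, fun g hg h0 b hb => ?_⟩
    have h1 : s.psi (Z b) ≠ 0 := left_ne_zero_of_mul hb
    rw [← h0 _ h1]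
    funext y
    exact (hZ' b (g y) (by rintro ⟨x, hx⟩; exact hg y x hx.symm)).symm
  have hprob : ∀ l : List (State w), W * prob l E
      ≤ prob (l.map (embed f s φ)) fun u => ∃ t', E t' ∧ Renamed f s t' u := by
    intro l
    induction l with
    | nil => simp [prob]
    | cons a l ih =>
      rw [List.map_cons, prob_cons, prob_cons _ (l.map _), mul_add]
      refine add_le_add ?_ ih
      by_cases ha : E a
      · rw [prob_singleton_of ha, prob_singleton_of ⟨a, ha, hRen a⟩, hW]
      · simp [prob_singleton_of_not ha]
  unfold WP
  have h1 : s.weight = W := by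
    have h2 := congrArg State.weight hs
    rw [h2, hW, hweight, mul_one]
  have h3 := run_rename (k := k) (s := s) hf hφ p t
  rw [← hs] at h3
  rw [h3, h1]
  calc W = W * 1 := (mul_one W).symm
    _ ≤ W * (prob (p.run k t) E + δ) :=
        mul_le_mul_right (h.trans (add_le_add (prob_sublist (run_sublist hk p t) E) le_rfl)) W
    _ = W * prob (p.run k t) E + δ * W := by rw [mul_add, mul_comm W δ]
    _ ≤ _ := add_le_add (hprob _) le_rfl

end

end QRAM

namespace QRAM

variable {w : ℕ} {k : ℕ} {p q : Prog} {δ δ' : ℝ≥0∞} {E E' : State w → Prop} {s t : State w}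

/-! ### The constants -/

/-- Put the minimum of the registers `y` and `z` into the register `x`. -/
def minReg (x y z : ℕ) : Prog :=
  .seq (.instr (.op .lt 44 y z)) (.ite 44 (.instr (.op .add x y 8)) (.instr (.op .add x z 8)))

/-- Compute the constants from the parameters. -/
def computeConsts : Prog :=
  .seq (seqs [.const 7 1, .const 8 0, .const 17 3, .op .div 11 1 3, .op .div 12 2 4,
    .op .div 13 2 5, .op .add 46 0 0])
  (.seq bitLength
  (.seq (seqs [.op .add 10 50 50, .op .add 10 10 10, .const 44 8, .op .add 10 10 44])
  (.seq (minReg 9 12 0) (.seq (minReg 14 3 0) (.seq (minReg 15 4 0) (minReg 16 5 0))))))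

/-- The number of repetitions of the searches. -/
def reps (n : ℕ) : ℕ := 4 * Nat.clog 2 (2 * n) + 8

/-- The constants that are computed from the parameters. -/
structure Consts (n m₁ m₂ ℓ₁ ℓ₂ ℓ₃ : ℕ) (t : State w) : Prop where
  r0 : t.reg 0 = wd w n
  r7 : t.reg 7 = wd w 1
  r8 : t.reg 8 = wd w 0
  r9 : t.reg 9 = wd w (min (m₂ / ℓ₂) n)
  r10 : t.reg 10 = wd w (reps n)
  r11 : t.reg 11 = wd w (m₁ / ℓ₁)
  r12 : t.reg 12 = wd w (m₂ / ℓ₂)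
  r13 : t.reg 13 = wd w (m₂ / ℓ₃)
  r14 : t.reg 14 = wd w (min ℓ₁ n)
  r15 : t.reg 15 = wd w (min ℓ₂ n)
  r16 : t.reg 16 = wd w (min ℓ₃ n)
  r17 : t.reg 17 = wd w 3

section

variable {n m₁ m₂ ℓ₁ ℓ₂ ℓ₃ : ℕ}

theorem Consts.frm {a : ℕ} {S : Finset ℕ} (h : Consts n m₁ m₂ ℓ₁ ℓ₂ ℓ₃ s) (hst : Frm a S s t)
    (ha : 17 < a := by norm_num) : Consts n m₁ m₂ ℓ₁ ℓ₂ ℓ₃ t := by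
  have e : ∀ x ≤ 17, t.reg x = s.reg x := fun x hx => hst.reg x (by omega)
  constructor <;> rw [e _ (by norm_num)]
  exacts [h.r0, h.r7, h.r8, h.r9, h.r10, h.r11, h.r12, h.r13, h.r14, h.r15, h.r16, h.r17]

theorem wp_minReg {x y z a b : ℕ} (hw : 0 < w) (ha : a < 2 ^ w) (hb : b < 2 ^ w)
    (h8 : s.reg 8 = wd w 0) (hy : s.reg y = wd w a) (hz : s.reg z = wd w b)
    (hy' : y ≠ 44) (hz' : z ≠ 44) :
    WP k (minReg x y z) 0 (fun t => SameBut x 44 s t ∧ t.reg x = wd w (min a b) ∧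
      t.time ≤ s.time + 3) s := by
  refine wp_seq_left (wp_op (E := fun u => u = s.tick.set 44 (wd w (if a < b then 1 else 0))) ?_) ?_
  · rw [hy, hz, eval_lt ha hb]
  rintro _ rfl
  refine wp_ite (fun h => wp_op ⟨⟨fun v h1 h2 => ?_, rfl, rfl⟩, ?_, ?_⟩)
    fun h => wp_op ⟨⟨fun v h1 h2 => ?_, rfl, rfl⟩, ?_, ?_⟩
  · simp [reg_set, h1, h2]
  · simp only [reg_set, reg_tick, if_true] at h
    rw [wd_bool_eq_zero hw] at h
    simp [reg_set, hz, hz', h8, eval_add, min_eq_right (not_lt.1 h)]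
  · simp
  · simp [reg_set, h1, h2]
  · simp only [reg_set, reg_tick, if_true] at h
    rw [Ne, wd_bool_eq_zero hw, not_not] at h
    simp [reg_set, hy, hy', h8, eval_add, min_eq_left h.le]
  · simp

theorem wp_computeConsts (hk : 2 ^ w < k) (hw : 4 < w) (hn : 4 * n < 2 ^ w) (h1 : m₁ < 2 ^ w)
    (h2 : m₂ < 2 ^ w) (h3 : ℓ₁ < 2 ^ w) (h4 : ℓ₂ < 2 ^ w) (h5 : ℓ₃ < 2 ^ w)
    (e0 : s.reg 0 = wd w n) (e1 : s.reg 1 = wd w m₁) (e2 : s.reg 2 = wd w m₂)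
    (e3 : s.reg 3 = wd w ℓ₁) (e4 : s.reg 4 = wd w ℓ₂) (e5 : s.reg 5 = wd w ℓ₃) :
    WP k computeConsts 0 (fun t => Consts n m₁ m₂ ℓ₁ ℓ₂ ℓ₃ t ∧ Near 7 s t ∧ t.psi = s.psi ∧
      t.time ≤ s.time + (4 * Nat.clog 2 (2 * n) + 27)) s := by
  refine wp_seq_left (F := fun u => Near 7 s u ∧ u.psi = s.psi ∧ u.reg 7 = wd w 1 ∧
    u.reg 8 = wd w 0 ∧ u.reg 17 = wd w 3 ∧ u.reg 11 = wd w (m₁ / ℓ₁) ∧ u.reg 12 = wd w (m₂ / ℓ₂) ∧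
    u.reg 13 = wd w (m₂ / ℓ₃) ∧ u.reg 46 = wd w (2 * n) ∧ u.time = s.time + 7) ?_ ?_
  · refine wp_seqs_const (wp_seqs_const (wp_seqs_const (wp_seqs_op (wp_seqs_op (wp_seqs_op
      (wp_seqs_op (wp_seqs_nil ⟨⟨fun x hx => ?_, rfl⟩, rfl, ?_⟩)))))))
    · simp only [reg_set, reg_tick]
      repeat rw [if_neg (by omega)]
    · simp [reg_set, e0, e1, e2, e3, e4, e5, eval_div, h1, h2, h3, h4, h5, eval_add, two_mul]
  rintro u ⟨hu, hup, u7, u8, u17, u11, u12, u13, u46, hut⟩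
  refine wp_seq_left (wp_bitLength (x := 2 * n) hk (by omega) (by omega) u7 u46) ?_
  rintro v ⟨hv, hvp, v50, hvt⟩
  refine wp_seq_left (F := fun y => Near 7 s y ∧ y.psi = s.psi ∧
    (∀ x, x ≠ 10 → x ≠ 44 → y.reg x = v.reg x) ∧
    y.reg 10 = wd w (reps n) ∧ y.time = v.time + 4) ?_ ?_
  · refine wp_seqs_op (wp_seqs_op (wp_seqs_const (wp_seqs_op (wp_seqs_nil
      ⟨(hu.trans (b := 50) hv).trans (b := 7) ⟨fun x hx => ?_, rfl⟩, hvp.trans hup,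
        fun x hx1 hx2 => ?_, ?_, ?_⟩))))
    · simp only [reg_set, reg_tick]
      repeat rw [if_neg (by omega)]
    · simp [reg_set, hx1, hx2]
    · simp [reg_set, v50, eval_add, reps]
      congr 1; ring
    · simp
  rintro y ⟨hy, hyp, hyr, y10, hyt⟩
  have g1 : ∀ x < 50, x ≠ 10 → x ≠ 44 → y.reg x = u.reg x := fun x hx hx1 hx2 =>
    (hyr x hx1 hx2).trans (hv.reg x (by omega))
  have g2 : ∀ x < 7, y.reg x = s.reg x := fun x hx => hy.reg x (by omega)
  have d2 : m₂ / ℓ₂ ≤ m₂ := Nat.div_le_self _ _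
  refine wp_seq_left (wp_minReg (x := 9) (by omega) (by omega) (by omega)
    ((g1 8 (by norm_num) (by norm_num) (by norm_num)).trans u8)
    ((g1 12 (by norm_num) (by norm_num) (by norm_num)).trans u12)
    ((g2 0 (by norm_num)).trans e0) (by norm_num) (by norm_num)) ?_
  rintro z1 ⟨hz1, z9, hz1t⟩
  refine wp_seq_left (wp_minReg (x := 14) (b := n) (by omega) h3 (by omega)
    (by simp [hz1.reg, g1, u8]) (by simp [hz1.reg, g2, e3]) (by simp [hz1.reg, g2, e0])
    (by norm_num) (by norm_num)) ?_
  rintro z2 ⟨hz2, z14, hz2t⟩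
  refine wp_seq_left (wp_minReg (x := 15) (b := n) (by omega) h4 (by omega)
    (by simp [hz2.reg, hz1.reg, g1, u8]) (by simp [hz2.reg, hz1.reg, g2, e4])
    (by simp [hz2.reg, hz1.reg, g2, e0]) (by norm_num) (by norm_num)) ?_
  rintro z3 ⟨hz3, z15, hz3t⟩
  refine (wp_minReg (x := 16) (b := n) (by omega) h5 (by omega)
    (by simp [hz3.reg, hz2.reg, hz1.reg, g1, u8]) (by simp [hz3.reg, hz2.reg, hz1.reg, g2, e5])
    (by simp [hz3.reg, hz2.reg, hz1.reg, g2, e0]) (by norm_num) (by norm_num)).mono ?_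
  rintro z4 ⟨hz4, z16, hz4t⟩
  refine ⟨?_, ?_, ?_, by omega⟩
  · constructor
    · simp [hz4.reg, hz3.reg, hz2.reg, hz1.reg, g2, e0]
    · simp [hz4.reg, hz3.reg, hz2.reg, hz1.reg, g1, u7]
    · simp [hz4.reg, hz3.reg, hz2.reg, hz1.reg, g1, u8]
    · simp [hz4.reg, hz3.reg, hz2.reg, z9]
    · simp [hz4.reg, hz3.reg, hz2.reg, hz1.reg, y10]
    · simp [hz4.reg, hz3.reg, hz2.reg, hz1.reg, g1, u11]
    · simp [hz4.reg, hz3.reg, hz2.reg, hz1.reg, g1, u12]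
    · simp [hz4.reg, hz3.reg, hz2.reg, hz1.reg, g1, u13]
    · simp [hz4.reg, hz3.reg, z14]
    · simp [hz4.reg, z15]
    · exact z16
    · simp [hz4.reg, hz3.reg, hz2.reg, hz1.reg, g1, u17]
  · refine hy.trans (b := 7) ((((hz1.near).trans (b := 7) hz2.near).trans (b := 7) hz3.near).trans
      (b := 7) hz4.near)
  · rw [hz4.psi, hz3.psi, hz2.psi, hz1.psi, hyp]

/-! ### The tables -/

/-- Compute the tables of the two matrices. -/
def computeTables : Prog :=
  .seq (transposeArr 0 3) (.seq (transposeArr 1 4)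
  (.seq (scan 0 0 5 6) (.seq (scan 0 1 7 8) (.seq (scan 0 3 9 10) (.seq (scan 0 4 11 12)
  (.seq (flagRows 5 11 0) (.seq (flagRows 7 12 1) (.seq (flagRows 11 13 2)
  (.seq (scan 17 13 14 15)
  (seqs [.load 18 14 8 0, .const 44 1, .load 19 14 44 0, .const 44 2,
    .load 20 14 44 0]))))))))))

/-- The flags of the rows of the first matrix, the rows of the second one, and the columns of the
second one with many ones. -/
def flags (n m₁ m₂ ℓ₁ ℓ₂ ℓ₃ : ℕ) (X Y : ℕ → ℕ → Bool) (b i : ℕ) : Bool :=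
  if b = 0 then decide (m₁ / ℓ₁ < cnt X i n) else if b = 1 then decide (m₂ / ℓ₂ < cnt Y i n)
    else decide (m₂ / ℓ₃ < cnt (fun i j => Y j i) i n)

/-- The tables of two matrices and of the flags of their rows. -/
structure Tables (n : ℕ) (X Y F : ℕ → ℕ → Bool) (t : State w) : Prop where
  a0 : HoldsBool t 0 n n X
  a1 : HoldsBool t 1 n n Y
  a13 : HoldsBool t 13 3 n F
  l5 : Listed t 5 6 X n n
  l7 : Listed t 7 8 Y n n
  l9 : Listed t 9 10 (fun i j => X j i) n n
  l11 : Listed t 11 12 (fun i j => Y j i) n n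
  l14 : Listed t 14 15 F 3 n
  r18 : ∀ b < 3, t.reg (18 + b) = wd w (cnt F b n)

theorem Tables.frm {a : ℕ} {S : Finset ℕ} {X Y F : ℕ → ℕ → Bool} (h : Tables n X Y F s)
    (hst : Frm a S s t) (hS : ∀ x ∈ S, x = 2 ∨ 15 < x) (ha : 20 < a := by norm_num) :
    Tables n X Y F t := by
  have e : ∀ x, x ≠ 2 → x ≤ 15 → t.arr x = s.arr x := fun x h1 h2 => hst.arr x fun h3 => by
    have := hS x h3; omega
  refine ⟨h.a0.congr (e _ ?_ ?_), h.a1.congr (e _ ?_ ?_), h.a13.congr (e _ ?_ ?_),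
    h.l5.congr (e _ ?_ ?_) (e _ ?_ ?_), h.l7.congr (e _ ?_ ?_) (e _ ?_ ?_),
    h.l9.congr (e _ ?_ ?_) (e _ ?_ ?_), h.l11.congr (e _ ?_ ?_) (e _ ?_ ?_),
    h.l14.congr (e _ ?_ ?_) (e _ ?_ ?_), fun b hb => (hst.reg _ (by omega)).trans (h.r18 b hb)⟩ <;>
    norm_num

theorem wp_computeTables {X Y : ℕ → ℕ → Bool} (hk : 2 ^ w < k) (hw : 4 < w) (hn : n + 1 < 2 ^ w)
    (h1 : m₁ < 2 ^ w) (h2 : m₂ < 2 ^ w) (hs : Consts n m₁ m₂ ℓ₁ ℓ₂ ℓ₃ s)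
    (hX : HoldsBool s 0 n n X) (hY : HoldsBool s 1 n n Y)
    (hz : ∀ a, 3 ≤ a → a ≤ 15 → ∀ x y, s.arr a x y = 0) :
    WP k computeTables 0 (fun t => Tables n X Y (flags n m₁ m₂ ℓ₁ ℓ₂ ℓ₃ X Y) t ∧
      Frm 18 {3, 4, 5, 6, 7, 8, 9, 10, 11, 12, 13, 14, 15} s t ∧
      t.time ≤ s.time + (2 * forTime₂ n n 2 + 4 * forTime₂ n n 7 + 3 * (n * 7 + 3) +
        forTime₂ 3 n 7 + 5)) s := by
  have h3w : 3 < 2 ^ w := lt_of_lt_of_le (by norm_num) (Nat.pow_le_pow_right (n := 2) (by norm_num) hw.le)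
  have d1 : m₁ / ℓ₁ ≤ m₁ := Nat.div_le_self _ _
  have d2 : m₂ / ℓ₂ ≤ m₂ := Nat.div_le_self _ _
  have d3 : m₂ / ℓ₃ ≤ m₂ := Nat.div_le_self _ _
  refine wp_seq_left (wp_transposeArr hk (by omega) (by omega) hs.r0 hs.r7 (by norm_num) hX) ?_
  rintro t1 ⟨⟨f1, x1⟩, b1⟩
  refine wp_seq_left (wp_transposeArr (X := Y) hk (by omega) (by omega) (by simp [f1.reg, hs.r0])
    (by simp [f1.reg, hs.r7]) (by norm_num) (hY.congr (by simp [f1.arr]))) ?_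
  rintro t2 ⟨⟨f2, x2⟩, b2⟩
  refine wp_seq_left (wp_scan (X := X) (m := n) hk (by omega) hn (by omega) (by norm_num)
    (by simp [f2.reg, f1.reg, hs.r0]) (by simp [f2.reg, f1.reg, hs.r0])
    (by simp [f2.reg, f1.reg, hs.r7]) (by norm_num) (hX.congr (by simp [f2.arr, f1.arr]))
    (by intro i _; simp [f2.arr, f1.arr, hz, wd])) ?_
  rintro t3 ⟨⟨f3, x3⟩, b3⟩
  refine wp_seq_left (wp_scan (X := Y) (m := n) hk (by omega) hn (by omega) (by norm_num)
    (by simp [f3.reg, f2.reg, f1.reg, hs.r0]) (by simp [f3.reg, f2.reg, f1.reg, hs.r0])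
    (by simp [f3.reg, f2.reg, f1.reg, hs.r7]) (by norm_num)
    (hY.congr (by simp [f3.arr, f2.arr, f1.arr]))
    (by intro i _; simp [f3.arr, f2.arr, f1.arr, hz, wd])) ?_
  rintro t4 ⟨⟨f4, x4⟩, b4⟩
  refine wp_seq_left (wp_scan (X := fun i j => X j i) (m := n) hk (by omega) hn (by omega)
    (by norm_num)
    (by simp [f4.reg, f3.reg, f2.reg, f1.reg, hs.r0])
    (by simp [f4.reg, f3.reg, f2.reg, f1.reg, hs.r0])
    (by simp [f4.reg, f3.reg, f2.reg, f1.reg, hs.r7]) (by norm_num)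
    (x1.congr (by simp [f4.arr, f3.arr, f2.arr]))
    (by intro i _; simp [f4.arr, f3.arr, f2.arr, f1.arr, hz, wd])) ?_
  rintro t5 ⟨⟨f5, x5⟩, b5⟩
  refine wp_seq_left (wp_scan (X := fun i j => Y j i) (m := n) hk (by omega) hn (by omega)
    (by norm_num)
    (by simp [f5.reg, f4.reg, f3.reg, f2.reg, f1.reg, hs.r0])
    (by simp [f5.reg, f4.reg, f3.reg, f2.reg, f1.reg, hs.r0])
    (by simp [f5.reg, f4.reg, f3.reg, f2.reg, f1.reg, hs.r7]) (by norm_num)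
    (x2.congr (by simp [f5.arr, f4.arr, f3.arr]))
    (by intro i _; simp [f5.arr, f4.arr, f3.arr, f2.arr, f1.arr, hz, wd])) ?_
  rintro t6 ⟨⟨f6, x6⟩, b6⟩
  have g6 : Frm 30 {3, 4, 5, 6, 7, 8, 9, 10, 11, 12} s t6 :=
    ((((((f1.mono (S := {3, 4, 5, 6, 7, 8, 9, 10, 11, 12}) le_rfl (by decide)).trans (b := 30) f2
      le_rfl (by decide)).trans (b := 30) f3 le_rfl (by decide)).trans (b := 30) f4 le_rfl
      (by decide)).trans (b := 30) f5 le_rfl (by decide)).trans (b := 30) f6 le_rfl (by decide))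
  have c6 := hs.frm g6
  set F := flags n m₁ m₂ ℓ₁ ℓ₂ ℓ₃ X Y with hF
  refine wp_seq_left (wp_flagRows (X := X) (F' := F) hk (by omega) (by omega) c6.r0 c6.r7
    (by norm_num) h3w (by norm_num) c6.r11 (by omega) (by norm_num)
    (fun i hi => by simpa [f6.arr, f5.arr, f4.arr] using x3.pc i hi n le_rfl)
    (by intro b hb; omega) (fun i _ => rfl)) ?_
  rintro t7 ⟨⟨f7, x7⟩, b7⟩
  have c7 := c6.frm f7
  refine wp_seq_left (wp_flagRows (X := Y) (F' := F) hk (by omega) (by omega) c7.r0 c7.r7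
    (by norm_num) h3w (by norm_num) c7.r12 (by omega) (by norm_num)
    (fun i hi => by simpa [f7.arr, f6.arr, f5.arr] using x4.pc i hi n le_rfl)
    x7 (fun i _ => rfl)) ?_
  rintro t8 ⟨⟨f8, x8⟩, b8⟩
  have c8 := c7.frm f8
  refine wp_seq_left (wp_flagRows (X := fun i j => Y j i) (F' := F) hk (by omega) (by omega)
    c8.r0 c8.r7 (by norm_num) h3w (by norm_num) c8.r13 (by omega) (by norm_num)
    (fun i hi => by simpa [f8.arr, f7.arr] using x6.pc i hi n le_rfl)
    x8 (fun i _ => rfl)) ?_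
  rintro t9 ⟨⟨f9, x9⟩, b9⟩
  have c9 := c8.frm f9
  refine wp_seq_left (wp_scan (X := F) (m := 3) hk (by omega) hn h3w (by norm_num)
    c9.r17 c9.r0 c9.r7 (by norm_num) x9
    (by intro i _; simp [f9.arr, f8.arr, f7.arr, g6.arr, hz, wd])) ?_
  rintro t10 ⟨⟨f10, x10⟩, b10⟩
  have c10 := c9.frm f10
  have hpc : ∀ b < 3, t10.arr 14 (wd w b) (wd w n) = wd w (cnt F b n) := fun b hb =>
    x10.pc b hb n le_rfl
  have g10 : Frm 30 {3, 4, 5, 6, 7, 8, 9, 10, 11, 12, 13, 14, 15} s t10 :=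
    ((((g6.mono (S := {3, 4, 5, 6, 7, 8, 9, 10, 11, 12, 13, 14, 15}) le_rfl (by decide)).trans
      (b := 30) f7 le_rfl (by decide)).trans (b := 30) f8 le_rfl (by decide)).trans (b := 30) f9
      le_rfl (by decide)).trans (b := 30) f10 le_rfl (by decide)
  refine wp_seqs_load (wp_seqs_const (wp_seqs_load (wp_seqs_const (wp_seqs_load (wp_seqs_nil
    ⟨⟨?_, ?_, ?_, ?_, ?_, ?_, ?_, ?_, ?_⟩, ?_, ?_⟩)))))
  · exact hX.congr (by simp [g10.arr])
  · exact hY.congr (by simp [g10.arr])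
  · exact HoldsBool.congr (s := t9) x9 (by simp [f10.arr])
  · exact x3.congr (by simp [f10.arr, f9.arr, f8.arr, f7.arr, f6.arr, f5.arr, f4.arr])
      (by simp [f10.arr, f9.arr, f8.arr, f7.arr, f6.arr, f5.arr, f4.arr])
  · exact x4.congr (by simp [f10.arr, f9.arr, f8.arr, f7.arr, f6.arr, f5.arr])
      (by simp [f10.arr, f9.arr, f8.arr, f7.arr, f6.arr, f5.arr])
  · exact x5.congr (by simp [f10.arr, f9.arr, f8.arr, f7.arr, f6.arr])
      (by simp [f10.arr, f9.arr, f8.arr, f7.arr, f6.arr])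
  · exact x6.congr (by simp [f10.arr, f9.arr, f8.arr, f7.arr])
      (by simp [f10.arr, f9.arr, f8.arr, f7.arr])
  · exact x10.congr rfl rfl
  · intro b hb
    interval_cases b <;> simp [reg_set, c10.r0, c10.r8, hpc]
  · refine (g10.mono (by norm_num) subset_rfl).trans (b := 18)
      (S' := {3, 4, 5, 6, 7, 8, 9, 10, 11, 12, 13, 14, 15}) ⟨fun x hx => ?_, fun _ _ => rfl, id⟩
    simp only [reg_set, reg_tick]
    repeat rw [if_neg (by omega)]
  · simp only [time_set, time_tick]; omega

end

end QRAM

namespace QRAM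

variable {w : ℕ} {k : ℕ} {p q : Prog} {δ δ' : ℝ≥0∞} {E E' : State w → Prop} {s t : State w}

/-! ### The submatrices of the flagged rows and columns -/

/-- The flagged row with the number `p`. -/
noncomputable def heavy (F : ℕ → ℕ → Bool) (b p : ℕ) : ℕ := Nat.nth (fun i => F b i = true) p

section

variable {F X Y Z : ℕ → ℕ → Bool} {b b₁ b₂ i n : ℕ}

theorem heavy_cnt (h : F b i) : heavy F b (cnt F b i) = i :=
  Nat.nth_count (p := fun i => F b i = true) h

theorem heavy_spec {p : ℕ} (h : p < cnt F b n) :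
    heavy F b p < n ∧ F b (heavy F b p) ∧ cnt F b (heavy F b p) = p := by
  obtain ⟨i, -, h1, h2, h3⟩ := exists_cnt_eq (j := 0) (by rw [cnt_zero]; exact Nat.zero_le p) h
  have := heavy_cnt h2
  rw [h3] at this
  rw [this]
  exact ⟨h1, h2, h3⟩

/-- There are few rows with many ones. -/
theorem cnt_flag_le {m ℓ : ℕ} (hℓ : 1 ≤ ℓ) (hF : ∀ i, F b i = decide (m / ℓ < cnt Z i n))
    (hm : ∑ i ∈ Finset.range n, cnt Z i n ≤ m) : cnt F b n ≤ ℓ := by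
  -- A count above the rounded quotient is at least `m / ℓ + 1`, which exceeds the exact quotient;
  -- so rounding loses nothing.
  have h1 : cnt F b n * (m / ℓ + 1) ≤ m := by
    rw [cnt, Nat.count_eq_card_filter_range, ← smul_eq_mul]
    refine le_trans (Finset.card_nsmul_le_sum _ (fun i => cnt Z i n) _ fun i hi => ?_) ((Finset.sum_le_sum_of_subset (Finset.filter_subset _ _)).trans hm)
    have h2 := (Finset.mem_filter.1 hi).2
    rw [hF i, decide_eq_true_eq] at h2
    exact h2
  have h2 : m < ℓ * (m / ℓ + 1) := Nat.lt_mul_div_succ m hℓ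
  exact (lt_of_mul_lt_mul_right (h1.trans_lt h2) (Nat.zero_le _)).le

/-- The submatrix of the flagged rows and columns, padded with zeros. -/
noncomputable def subMatrix (F Z : ℕ → ℕ → Bool) (n b₁ b₂ a c : ℕ) : BoolMatrix a c :=
  Matrix.of fun p q => decide (p.1 < cnt F b₁ n ∧ q.1 < cnt F b₂ n) &&
    Z (heavy F b₁ p) (heavy F b₂ q)

instance (i j i' j' : ℕ) : Decidable (Before i j i' j') :=
  inferInstanceAs (Decidable (_ ∨ _))

/-- Copy the submatrix of the flagged rows and columns of the matrix in the array `a` into the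
arrays `d`, `d + 1` and `d + 2`. -/
def copySub (b₁ b₂ a d : ℕ) : Prog :=
  forLoop₂ (18 + b₁) (18 + b₂) (seqs [.const 43 b₁, .const 44 b₂, .load 40 15 43 30,
    .load 41 15 44 32, .load 42 a 40 41, .store d 30 32 42, .store (d + 1) 30 32 42,
    .store (d + 2) 30 32 42])

theorem eq_wd_iff {x : BitVec w} {a : ℕ} (ha : a < 2 ^ w) : x = wd w a ↔ x.toNat = a := by
  rw [← wd_toNat_self x, wd_inj x.isLt ha, wd_toNat_self]

/-- The contents are described for all words `x` and `y`, because the result has to agree with the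
initial arrays of the assumed program everywhere, including the zeros outside the matrix. The three
arrays serve its three copies. -/
theorem wp_copySub {a d : ℕ} (hk : 2 ^ w < k) (hw : 0 < w) (hn : n < 2 ^ w) (hb₁ : b₁ < 3)
    (hb₂ : b₂ < 3) (ha : a < 100) (hd : 100 ≤ d) (h7 : s.reg 7 = wd w 1)
    (hr : ∀ b < 3, s.reg (18 + b) = wd w (cnt F b n)) (hl : Listed s 14 15 F 3 n)
    (hZ : HoldsBool s a n n Z) (h0 : ∀ c < 3, ∀ x y, s.arr (d + c) x y = 0) :
    WP k (copySub b₁ b₂ a d) 0 (fun t => (Frm 30 {d, d + 1, d + 2} s t ∧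
      ∀ c < 3, ∀ x y, t.arr (d + c) x y = if x.toNat < cnt F b₁ n ∧ y.toNat < cnt F b₂ n ∧
        Z (heavy F b₁ x.toNat) (heavy F b₂ y.toNat) then 1 else 0) ∧
      t.time ≤ s.time + forTime₂ n n 8) s := by
  have hc₁ : cnt F b₁ n ≤ n := cnt_le
  have hc₂ : cnt F b₂ n ≤ n := cnt_le
  refine (wp_for₂ (T := 8) (n₁ := cnt F b₁ n) (n₂ := cnt F b₂ n)
    (Inv := fun i j t => Frm 30 {d, d + 1, d + 2} s t ∧ ∀ c < 3, ∀ x y, t.arr (d + c) x y =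
      if (Before i j x.toNat y.toNat ∧ y.toNat < cnt F b₂ n) ∧
        Z (heavy F b₁ x.toNat) (heavy F b₂ y.toNat) then wd w 1 else wd w 0)
    hk hw (by omega) (by omega) (by omega) (by omega)
    (fun i j t ht => ⟨(ht.1.reg _ (by omega)).trans (hr b₁ hb₁),
      (ht.1.reg _ (by omega)).trans (hr b₂ hb₂), (ht.1.reg _ (by omega)).trans h7⟩)
    (fun i j t u ht hu ha _ => ⟨ht.1.trans (b := 30) (S' := ∅) hu, by rw [ha]; exact ht.2⟩)
    (fun i t ht => ⟨ht.1, fun c hc x y => ?_⟩)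
    (fun i hi j hj t ht h30 h32 => ?_)
    ⟨Frm.refl _ _ _, fun c hc x y => by simp [Before, h0 c hc, wd]⟩).mono
    fun t ht => ⟨⟨ht.1.1, fun c hc x y => ?_⟩, ht.2.trans (by unfold forTime₂; gcongr)⟩
  · rw [ht.2 c hc x y]
    have h1 : (Before i (cnt F b₂ n) x.toNat y.toNat ∧ y.toNat < cnt F b₂ n) ↔
        (Before (i + 1) 0 x.toNat y.toNat ∧ y.toNat < cnt F b₂ n) := by
      unfold Before; omega
    simp only [h1]
  · obtain ⟨hi1, -, hi3⟩ := heavy_spec hi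
    obtain ⟨hj1, -, hj3⟩ := heavy_spec hj
    have e1 : t.arr 15 (wd w b₁) (wd w i) = wd w (heavy F b₁ i) := by
      rw [ht.1.arr 15 (by simp; omega)]
      conv_lhs => rw [← hi3]
      exact hl.lst b₁ hb₁ _ hi1 (heavy_spec hi).2.1
    have e2 : t.arr 15 (wd w b₂) (wd w j) = wd w (heavy F b₂ j) := by
      rw [ht.1.arr 15 (by simp; omega)]
      conv_lhs => rw [← hj3]
      exact hl.lst b₂ hb₂ _ hj1 (heavy_spec hj).2.1
    have e3 : t.arr a (wd w (heavy F b₁ i)) (wd w (heavy F b₂ j))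
        = wd w (if Z (heavy F b₁ i) (heavy F b₂ j) then 1 else 0) := by
      rw [ht.1.arr a (by simp; omega)]
      exact hZ _ hi1 _ hj1
    refine wp_seqs_const (wp_seqs_const (wp_seqs_load (wp_seqs_load (wp_seqs_load (wp_seqs_store
      (wp_seqs_store (wp_seqs_store (wp_seqs_nil ?_))))))))
    simp only [reg_set, reg_put, reg_tick, arr_set, arr_tick, h30, h32, e1, e2, e3, if_true,
      if_false, Nat.reduceEqDiff]
    refine ⟨⟨ht.1.trans (b := 30) (S' := {d, d + 1, d + 2}) ⟨fun x hx => ?_, fun x hx => ?_, id⟩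
      le_rfl subset_rfl, ?_⟩, ?_⟩
    · simp only [reg_set, reg_tick, reg_put]
      repeat rw [if_neg (by omega)]
    · simp only [Finset.mem_insert, Finset.mem_singleton, not_or] at hx
      funext y z
      simp [arr_put, hx]
    · intro c hc x y
      have h1 : (Before i (j + 1) x.toNat y.toNat ∧ y.toNat < cnt F b₂ n) ↔
          ((Before i j x.toNat y.toNat ∧ y.toNat < cnt F b₂ n) ∨ (x.toNat = i ∧ y.toNat = j)) := by
        unfold Before; omega
      have h2 := ht.2 c hc x y
      simp only [h1]
      have h3 : d + c = d ∨ d + c = d + 1 ∨ d + c = d + 2 := by omega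
      simp only [arr_put, arr_tick, arr_set, eq_wd_iff (by omega : i < 2 ^ w),
        eq_wd_iff (by omega : j < 2 ^ w)]
      by_cases h4 : x.toNat = i ∧ y.toNat = j
      · rcases h3 with h3 | h3 | h3 <;> simp [h4, h3] <;> split_ifs <;> rfl
      · simp only [h4, and_false, if_false, or_false]
        exact h2
    · simp
  · rw [ht.1.2 c hc x y]
    have h1 : ((Before (cnt F b₁ n) 0 x.toNat y.toNat ∧ y.toNat < cnt F b₂ n) ∧
        Z (heavy F b₁ x.toNat) (heavy F b₂ y.toNat)) ↔ (x.toNat < cnt F b₁ n ∧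
        y.toNat < cnt F b₂ n ∧ Z (heavy F b₁ x.toNat) (heavy F b₂ y.toNat)) := by
      unfold Before
      constructor
      · rintro ⟨⟨h2 | h2, h3⟩, h4⟩
        · exact ⟨h2, h3, h4⟩
        · omega
      · rintro ⟨h2, h3, h4⟩
        exact ⟨⟨Or.inl h2, h3⟩, h4⟩
    simp only [h1]
    rfl

theorem matrixArray_subMatrix {a c : ℕ} (ha : cnt F b₁ n ≤ a) (hc : cnt F b₂ n ≤ c)
    (x y : BitVec w) : matrixArray (subMatrix F Z n b₁ b₂ a c) x y =
      if x.toNat < cnt F b₁ n ∧ y.toNat < cnt F b₂ n ∧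
        Z (heavy F b₁ x.toNat) (heavy F b₂ y.toNat) then 1 else 0 := by
  unfold matrixArray
  by_cases h : x.toNat < a ∧ y.toNat < c
  · rw [dif_pos h]
    simp [subMatrix, and_assoc]
  · rw [dif_neg h, if_neg]
    rintro ⟨h1, h2, -⟩
    exact h ⟨by omega, by omega⟩

end

/-! ### The preparations -/

/-- The names of the variables and arrays of a copy of the assumed program. -/
def copyVar (c x : ℕ) : ℕ := 100 + 3 * x + c

/-- Set the parameters of the copies of the assumed program. -/
def setParams : Prog :=
  seqs [.op .add 100 14 8, .op .add 103 15 8, .op .add 106 16 8, .op .add 109 6 8,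
    .op .add 101 14 8, .op .add 104 15 8, .op .add 107 16 8, .op .add 110 6 8,
    .op .add 102 14 8, .op .add 105 15 8, .op .add 108 16 8, .op .add 111 6 8]

/-- Everything before the searches. -/
def prepare : Prog :=
  .seq computeConsts (.seq computeTables (.seq (copySub 0 1 0 100) (.seq (copySub 1 2 1 103)
    setParams)))

/-- The state before the searches; `I` is the initial state of the assumed program. -/
structure Prepared (n m₁ m₂ ℓ₁ ℓ₂ ℓ₃ : ℕ) (X Y : ℕ → ℕ → Bool) (I t : State w) : Prop where
  consts : Consts n m₁ m₂ ℓ₁ ℓ₂ ℓ₃ t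
  tables : Tables n X Y (flags n m₁ m₂ ℓ₁ ℓ₂ ℓ₃ X Y) t
  a2 : ∀ x y, t.arr 2 x y = 0
  a18 : ∀ x y, t.arr 18 x y = 0
  clean : Clean t
  reg : ∀ c < 3, ∀ x, t.reg (copyVar c x) = I.reg x
  arr : ∀ c < 3, ∀ x, t.arr (copyVar c x) = I.arr x

/-- A Boolean matrix as a function on all pairs of numbers. -/
def extend {n : ℕ} (A : BoolMatrix n n) (i j : ℕ) : Bool :=
  if h : i < n ∧ j < n then A ⟨i, h.1⟩ ⟨j, h.2⟩ else false

theorem holdsBool_matrixArray {n : ℕ} (hn : n < 2 ^ w) (A : BoolMatrix n n) {i j : ℕ} (hi : i < n)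
    (hj : j < n) : matrixArray A (wd w i) (wd w j) = wd w (if extend A i j then 1 else 0) := by
  have hi' := wd_toNat (hi.trans hn)
  have hj' := wd_toNat (hj.trans hn)
  unfold matrixArray
  rw [dif_pos (by rw [hi', hj']; exact ⟨hi, hj⟩)]
  simp only [hi', hj', extend, hi, hj, and_self, dif_pos]
  split_ifs <;> rfl

section

variable {n m₁ m₂ ℓ₁ ℓ₂ ℓ₃ lam : ℕ}

/-- The time for the preparations. -/
def prepTime (n : ℕ) : ℕ :=
  4 * Nat.clog 2 (2 * n) + 2 * forTime₂ n n 2 + 4 * forTime₂ n n 7 + 3 * (n * 7 + 3) +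
    forTime₂ 3 n 7 + 2 * forTime₂ n n 8 + 44

/-- The arrays `100 + c` and `103 + c` are the two inputs of copy `c` under `copyVar`. The register
`6` is passed on unchanged, whether it holds the bound on the product or zero, so one program serves
both settings. -/
theorem wp_prepare (hk : 2 ^ w < k) (hw : 4 < w) (hn : 4 * n + 4 < 2 ^ w) (h1 : m₁ < 2 ^ w)
    (h2 : m₂ < 2 ^ w) (h3 : ℓ₁ < 2 ^ w) (h4 : ℓ₂ < 2 ^ w) (h5 : ℓ₃ < 2 ^ w)
    (A B : BoolMatrix n n)
    (hc₁ : cnt (flags n m₁ m₂ ℓ₁ ℓ₂ ℓ₃ (extend A) (extend B)) 0 n ≤ min ℓ₁ n)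
    (hc₂ : cnt (flags n m₁ m₂ ℓ₁ ℓ₂ ℓ₃ (extend A) (extend B)) 1 n ≤ min ℓ₂ n)
    (hc₃ : cnt (flags n m₁ m₂ ℓ₁ ℓ₂ ℓ₃ (extend A) (extend B)) 2 n ≤ min ℓ₃ n) :
    WP k prepare 0 (fun t => Prepared n m₁ m₂ ℓ₁ ℓ₂ ℓ₃ (extend A) (extend B)
      (initState w [min ℓ₁ n, min ℓ₂ n, min ℓ₃ n, lam]
        (subMatrix (flags n m₁ m₂ ℓ₁ ℓ₂ ℓ₃ (extend A) (extend B)) (extend A) n 0 1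
          (min ℓ₁ n) (min ℓ₂ n))
        (subMatrix (flags n m₁ m₂ ℓ₁ ℓ₂ ℓ₃ (extend A) (extend B)) (extend B) n 1 2
          (min ℓ₂ n) (min ℓ₃ n))) t ∧ t.time ≤ prepTime n)
      (initState w [n, m₁, m₂, ℓ₁, ℓ₂, ℓ₃, lam] A B) := by
  set s := initState w [n, m₁, m₂, ℓ₁, ℓ₂, ℓ₃, lam] A B with hs
  set F := flags n m₁ m₂ ℓ₁ ℓ₂ ℓ₃ (extend A) (extend B) with hF
  have hreg : ∀ x, 7 ≤ x → s.reg x = 0 := fun x hx => by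
    simp only [hs, initState]
    rw [List.getD_eq_default _ _ (by simpa using hx)]
    rfl
  have harr : ∀ x, 2 ≤ x → ∀ y z, s.arr x y z = 0 := fun x hx y z => by
    simp only [hs, initState]
    rw [if_neg (by omega), if_neg (by omega)]
  have hX : HoldsBool s 0 n n (extend A) := fun i hi j hj =>
    holdsBool_matrixArray (by omega) A hi hj
  have hY : HoldsBool s 1 n n (extend B) := fun i hi j hj =>
    holdsBool_matrixArray (by omega) B hi hj
  refine wp_seq_left (wp_computeConsts (s := s) (n := n) (m₁ := m₁) (m₂ := m₂) (ℓ₁ := ℓ₁)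
    (ℓ₂ := ℓ₂) (ℓ₃ := ℓ₃) hk hw (by omega) h1 h2 h3 h4 h5
    rfl rfl rfl rfl rfl rfl) ?_
  rintro t1 ⟨c1, n1, p1, b1⟩
  refine wp_seq_left (wp_computeTables (X := extend A) (Y := extend B) hk hw (by omega) h1 h2 c1
    (hX.congr (by rw [n1.arr])) (hY.congr (by rw [n1.arr]))
    (fun a ha _ x y => by rw [n1.arr]; exact harr a (by omega) x y)) ?_
  rintro t2 ⟨T2, f2, b2⟩
  have c2 := c1.frm f2
  have hS : ∀ x, 15 < x → x ∉ ({3, 4, 5, 6, 7, 8, 9, 10, 11, 12, 13, 14, 15} : Finset ℕ) := by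
    intro x hx; simp; omega
  refine wp_seq_left (wp_copySub (F := F) (Z := extend A) (b₁ := 0) (b₂ := 1) hk (by omega)
    (by omega) (by norm_num) (by norm_num) (by norm_num) le_rfl c2.r7 T2.r18 T2.l14 T2.a0
    (fun c hc x y => by rw [f2.arr _ (hS (_ + c) (by omega)), n1.arr]; exact harr _ (by omega) x y)) ?_
  rintro t3 ⟨⟨f3, x3⟩, b3⟩
  have c3 := c2.frm f3
  have T3 := T2.frm f3 (by simp)
  refine wp_seq_left (wp_copySub (F := F) (Z := extend B) (b₁ := 1) (b₂ := 2) hk (by omega)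
    (by omega) (by norm_num) (by norm_num) (by norm_num) (d := 103) (by norm_num) c3.r7 T3.r18
    T3.l14 T3.a1
    (fun c hc x y => by
      rw [f3.arr _ (by simp; omega), f2.arr _ (hS (_ + c) (by omega)), n1.arr]
      exact harr _ (by omega) x y)) ?_
  rintro t4 ⟨⟨f4, x4⟩, b4⟩
  have c4 := c3.frm f4
  have T4 := T3.frm f4 (by simp)
  have e6 : t4.reg 6 = wd w lam := by
    rw [f4.reg 6 (by norm_num), f3.reg 6 (by norm_num), f2.reg 6 (by norm_num),
      n1.reg 6 (by norm_num)]
    rfl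
  have e100 : ∀ x, 100 ≤ x → t4.reg x = 0 := fun x hx => by
    rw [f4.reg x (by omega), f3.reg x (by omega), f2.reg x (by omega), n1.reg x (by omega)]
    exact hreg x (by omega)
  have hps : Clean t4 := by
    refine f4.clean (f3.clean (f2.clean ⟨1, ?_⟩))
    rw [p1]; rfl
  have earr : ∀ x, (x = 2 ∨ 15 < x) → (x < 100 ∨ 106 ≤ x) → ∀ y z, t4.arr x y z = 0 := by
    intro x hx hx' y z
    rw [f4.arr x (by simp; omega), f3.arr x (by simp; omega), f2.arr x (by simp; omega), n1.arr]
    exact harr x (by omega) y z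
  refine wp_seqs_op (wp_seqs_op (wp_seqs_op (wp_seqs_op (wp_seqs_op (wp_seqs_op (wp_seqs_op
    (wp_seqs_op (wp_seqs_op (wp_seqs_op (wp_seqs_op (wp_seqs_op (wp_seqs_nil ?_))))))))))))
  simp only [reg_set, reg_tick, Nat.reduceEqDiff, if_false, c4.r14, c4.r15, c4.r16, c4.r8, e6,
    eval_add, add_zero]
  refine ⟨⟨?_, ?_, ?_, ?_, hps, ?_, ?_⟩, ?_⟩
  · constructor <;> simp [reg_set, c4.r0, c4.r7, c4.r8, c4.r9, c4.r10, c4.r11, c4.r12, c4.r13,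
      c4.r14, c4.r15, c4.r16, c4.r17]
  · refine ⟨T4.a0.congr rfl, T4.a1.congr rfl, T4.a13.congr rfl, T4.l5.congr rfl rfl,
      T4.l7.congr rfl rfl, T4.l9.congr rfl rfl, T4.l11.congr rfl rfl, T4.l14.congr rfl rfl,
      fun b hb => ?_⟩
    simp only [reg_set, reg_tick]
    repeat rw [if_neg (by omega)]
    exact T4.r18 b hb
  · exact earr 2 (by norm_num) (by norm_num)
  · exact earr 18 (by norm_num) (by norm_num)
  · intro c hc x
    rcases Nat.lt_or_ge x 4 with hx | hx
    · interval_cases c <;> interval_cases x <;> simp [reg_set, copyVar, initState, wd]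
    · simp only [reg_set, reg_tick, copyVar]
      repeat rw [if_neg (by omega)]
      rw [e100 _ (by omega)]
      simp only [initState]
      rw [List.getD_eq_default _ _ (by simpa using hx)]
      rfl
  · intro c hc x
    simp only [arr_set, arr_tick]
    funext y z
    rcases Nat.lt_or_ge x 2 with hx | hx
    · obtain rfl | rfl : x = 0 ∨ x = 1 := by omega
      · rw [show copyVar c 0 = 100 + c by simp [copyVar], f4.arr _ (by simp; omega), x3 c hc]
        exact (matrixArray_subMatrix hc₁ hc₂ y z).symm
      · rw [show copyVar c 1 = 103 + c by simp [copyVar], x4 c hc]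
        exact (matrixArray_subMatrix hc₂ hc₃ y z).symm
    · rw [earr _ (by unfold copyVar; omega) (by unfold copyVar; omega)]
      simp only [initState]
      rw [if_neg (by omega), if_neg (by omega)]
  · have hs0 : s.time = 0 := rfl
    simp only [time_set, time_tick]
    unfold prepTime
    omega

end

end QRAM

namespace QRAM

variable {w : ℕ} {k : ℕ} {p q : Prog} {δ δ' : ℝ≥0∞} {E E' : State w → Prop} {s t : State w}

/-! ### Merging the results -/

section

variable {n n₁ n₂ N₁ N₂ T : ℕ} {O O' H : ℕ → ℕ → Prop} {ρ κ : ℕ → ℕ}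

/-- The rule for two nested loops whose round `(i, j)` marks the entry `(ρ i, κ j)` of the output
if `H i j`. -/
theorem wp_markLoop (hk : 2 ^ w < k) (hw : 0 < w) (hn₁ : n₁ < 2 ^ w) (hn₂ : n₂ < 2 ^ w)
    (hN₁ : N₁ < 30) (hN₂ : N₂ < 30) (h1 : s.reg N₁ = wd w n₁) (h2 : s.reg N₂ = wd w n₂)
    (h7 : s.reg 7 = wd w 1) (hO : Holds s 2 n O)
    (hbody : ∀ i < n₁, ∀ j < n₂, ∀ t O', Frm 30 {2} s t → t.reg 30 = wd w i → t.reg 32 = wd w j →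
      Holds t 2 n O' → WP k p 0 (fun u => Frm 34 {2} t u ∧
        Holds u 2 n (fun i' j' => O' i' j' ∨ (H i j ∧ i' = ρ i ∧ j' = κ j)) ∧
        u.time ≤ t.time + T) t) :
    WP k (forLoop₂ N₁ N₂ p) 0 (fun t => Frm 30 {2} s t ∧
      Holds t 2 n (fun i' j' => O i' j' ∨ ∃ i < n₁, ∃ j < n₂, H i j ∧ i' = ρ i ∧ j' = κ j) ∧
      t.time ≤ s.time + forTime₂ n₁ n₂ T) s := by
  refine (wp_for₂ (T := T) (Inv := fun i j t => Frm 30 {2} s t ∧ Holds t 2 n fun i' j' =>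
    O i' j' ∨ ∃ a b, Before i j a b ∧ b < n₂ ∧ H a b ∧ i' = ρ a ∧ j' = κ b) hk hw hn₁ hn₂ hN₁ hN₂
    (fun i j t ht => ⟨(ht.1.reg _ (by omega)).trans h1, (ht.1.reg _ (by omega)).trans h2,
      (ht.1.reg _ (by omega)).trans h7⟩)
    (fun i j t u ht hu ha _ => ⟨ht.1.trans (b := 30) (S' := ∅) hu, ht.2.congr (by rw [ha])⟩)
    (fun i t ht => ⟨ht.1, ht.2.iff_congr fun i' _ j' _ => or_congr_right ?_⟩)
    (fun i hi j hj t ht h30 h32 => ?_)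
    ⟨Frm.refl _ _ _, hO.iff_congr fun i' _ j' _ => by simp [Before]⟩).mono
    fun t ht => ⟨ht.1.1, ht.1.2.iff_congr fun i' _ j' _ => or_congr_right ?_, ht.2⟩
  · constructor
    · rintro ⟨a, b, h | h, h'⟩
      · exact ⟨a, b, Or.inl (by omega), h'⟩
      · exact ⟨a, b, Or.inl (by omega), h'⟩
    · rintro ⟨a, b, h | h, h'⟩
      · exact ⟨a, b, by unfold Before; omega, h'⟩
      · omega
  · refine (hbody i hi j hj t _ ht.1 h30 h32 ht.2).mono fun u hu =>
      ⟨⟨ht.1.trans (b := 34) (S' := {2}) hu.1, hu.2.1.iff_congr fun i' _ j' _ => ?_⟩,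
        hu.1.reg 30 (by norm_num), hu.1.reg 32 (by norm_num), hu.2.2⟩
    rw [or_assoc]
    refine or_congr_right ⟨?_, ?_⟩
    · rintro (⟨a, b, h, h'⟩ | h)
      · exact ⟨a, b, by unfold Before at h ⊢; omega, h'⟩
      · exact ⟨i, j, by unfold Before; omega, hj, h⟩
    · rintro ⟨a, b, h, h'⟩
      by_cases hab : a = i ∧ b = j
      · obtain ⟨rfl, rfl⟩ := hab
        exact Or.inr h'.2
      · exact Or.inl ⟨a, b, by unfold Before at h ⊢; omega, h'⟩
  · constructor
    · rintro ⟨a, b, h | h, h'⟩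
      · exact ⟨a, h, b, h'⟩
      · omega
    · rintro ⟨a, h, b, h'⟩
      exact ⟨a, b, Or.inl h, h'⟩

/-- Mark the entries that have been found in the transposed product. -/
def mergeTransposed : Prog :=
  forLoop₂ 0 0 (.seq (seqs [.load 40 18 32 30]) (.ite 40 (seqs [.store 2 30 32 7]) .skip))

theorem wp_mergeTransposed (hk : 2 ^ w < k) (hw : 0 < w) (hn : n < 2 ^ w) (h0 : s.reg 0 = wd w n)
    (h7 : s.reg 7 = wd w 1) (hO : Holds s 2 n O) (hO' : Holds s 18 n O') :
    WP k mergeTransposed 0 (fun t => Frm 30 {2} s t ∧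
      Holds t 2 n (fun i j => O i j ∨ O' j i) ∧ t.time ≤ s.time + forTime₂ n n 3) s := by
  refine (wp_markLoop (T := 3) (H := fun i j => O' j i) (ρ := id) (κ := id) hk hw hn hn (by norm_num)
    (by norm_num) h0 h0 h7 hO ?_).mono fun t ht => ⟨ht.1, ht.2.1.iff_congr fun i hi j hj => ?_, ht.2.2⟩
  · intro i hi j hj t O₁ ht h30 h32 hO₁
    refine wp_seq_left (F := fun u => u = (t.tick.set 40 (t.arr 18 (wd w j) (wd w i)))) (wp_seqs_load
      (wp_seqs_nil (by simp [h30, h32]))) ?_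
    rintro u rfl
    have h18 : t.arr 18 = s.arr 18 := ht.arr 18 (by simp)
    have hOO := hO' j hj i hi
    by_cases hc : O' j i
    · refine wp_ite (fun h => absurd h ?_) fun _ => ?_
      · have := wd_inj (show 1 < 2 ^ w from Nat.one_lt_two_pow hw.ne') (show 0 < 2 ^ w by positivity)
        simp only [reg_set, if_true, h18, hOO.1 hc]
        exact mt this.1 one_ne_zero
      refine wp_seqs_store (wp_seqs_nil ?_)
      simp only [reg_set, reg_tick, Nat.reduceEqDiff, if_false, h30, h32, ht.reg 7 (by norm_num), h7]
      refine ⟨⟨fun x hx => ?_, fun x hx => ?_, id⟩, ?_, by simp⟩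
      · simp only [reg_set, reg_tick, reg_put]
        rw [if_neg (by omega)]
      · simp only [Finset.mem_singleton] at hx
        funext y z
        simp [arr_put, hx]
      · refine Holds.iff_congr (Holds.put (s := (t.tick.set 40 (t.arr 18 (wd w j) (wd w i))).tick.tick)
          (hO₁.congr rfl) hn hi hj) fun i' _ j' _ => ?_
        simp [hc]
    · refine wp_ite (fun _ => ?_) fun h => absurd (by simp [reg_set, h18, hOO.2 hc]) h
      refine wp_skip ⟨⟨fun x hx => ?_, fun x hx => rfl, id⟩, ?_, by simp⟩
      · simp only [reg_set, reg_tick]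
        rw [if_neg (by omega)]
      · exact Holds.iff_congr (hO₁.congr rfl) fun i' _ j' _ => by simp [hc]
  · refine or_congr_right ⟨?_, fun h => ⟨i, hi, j, hj, h, rfl, rfl⟩⟩
    rintro ⟨a, -, b, -, h, rfl, rfl⟩
    exact h

/-- The bitwise majority of three words. -/
def maj (x y z : BitVec w) : BitVec w := (x &&& y) ||| (x &&& z) ||| (y &&& z)

theorem maj_of_two {x : ℕ → BitVec w} {v : BitVec w} {c c' : ℕ} (hc : c < c') (hc' : c' < 3)
    (h : x c = v) (h' : x c' = v) : maj (x 0) (x 1) (x 2) = v := by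
  have h3 : (c = 0 ∧ c' = 1) ∨ (c = 0 ∧ c' = 2) ∨ (c = 1 ∧ c' = 2) := by omega
  unfold maj
  rcases h3 with ⟨rfl, rfl⟩ | ⟨rfl, rfl⟩ | ⟨rfl, rfl⟩ <;> rw [h, h'] <;> ext i <;> simp <;> grind

/-- Mark the entries that most of the copies of the assumed program have found. -/
def mergeMajority : Prog :=
  forLoop₂ 18 20 (.seq (seqs [.load 40 106 30 32, .load 41 107 30 32, .load 42 108 30 32,
    .op .and 43 40 41, .op .and 44 40 42, .op .and 45 41 42, .op .or 43 43 44, .op .or 43 43 45])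
    (.ite 43 (seqs [.const 45 2, .load 40 15 8 30, .load 41 15 45 32, .store 2 40 41 7]) .skip))

/-- Indices of the small product are ranks among the heavy rows and columns; the lists in the array
`15` translate them back. -/
theorem wp_mergeMajority {F : ℕ → ℕ → Bool} (hk : 2 ^ w < k) (hw : 1 < w) (hn : n < 2 ^ w)
    (h7 : s.reg 7 = wd w 1) (h8 : s.reg 8 = wd w 0)
    (hr : ∀ b < 3, s.reg (18 + b) = wd w (cnt F b n)) (hl : Listed s 14 15 F 3 n)
    (hO : Holds s 2 n O) :
    WP k mergeMajority 0 (fun t => Frm 30 {2} s t ∧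
      Holds t 2 n (fun i' j' => O i' j' ∨ ∃ i < cnt F 0 n, ∃ j < cnt F 2 n,
        maj (s.arr 106 (wd w i) (wd w j)) (s.arr 107 (wd w i) (wd w j))
          (s.arr 108 (wd w i) (wd w j)) ≠ 0 ∧ i' = heavy F 0 i ∧ j' = heavy F 2 j) ∧
      t.time ≤ s.time + forTime₂ n n 13) s := by
  refine (wp_markLoop (T := 13) (H := fun i j =>
      maj (s.arr 106 (wd w i) (wd w j)) (s.arr 107 (wd w i) (wd w j))
          (s.arr 108 (wd w i) (wd w j)) ≠ 0) (ρ := heavy F 0) (κ := heavy F 2) hk (by omega)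
    (cnt_le.trans_lt hn) (cnt_le.trans_lt hn) (by norm_num)
    (by norm_num) (hr 0 (by norm_num)) (hr 2 (by norm_num)) h7 hO ?_).mono fun t ht =>
      ⟨ht.1, ht.2.1, ht.2.2.trans (Nat.add_le_add_left ?_ _)⟩
  · intro i hi j hj t O₁ ht h30 h32 hO₁
    obtain ⟨hi1, hi2, hi3⟩ := heavy_spec hi
    obtain ⟨hj1, hj2, hj3⟩ := heavy_spec hj
    have e7 := (ht.reg 7 (by norm_num)).trans h7
    have e8 := (ht.reg 8 (by norm_num)).trans h8
    have l1 : t.arr 15 (wd w 0) (wd w i) = wd w (heavy F 0 i) := by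
      rw [ht.arr 15 (by simp), ← hl.lst 0 (by norm_num) _ hi1 hi2, hi3]
    have l2 : t.arr 15 (wd w 2) (wd w j) = wd w (heavy F 2 j) := by
      rw [ht.arr 15 (by simp), ← hl.lst 2 (by norm_num) _ hj1 hj2, hj3]
    refine wp_seq_left (F := fun u => Frm 34 ∅ t u ∧ u.arr = t.arr ∧ u.reg 43 =
      maj (s.arr 106 (wd w i) (wd w j)) (s.arr 107 (wd w i) (wd w j))
          (s.arr 108 (wd w i) (wd w j)) ∧ u.time = t.time + 8) (wp_seqs_load
      (wp_seqs_load (wp_seqs_load (wp_seqs_op (wp_seqs_op (wp_seqs_op (wp_seqs_op (wp_seqs_op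
        (wp_seqs_nil ⟨⟨fun x hx => ?_, fun x hx => rfl, id⟩, rfl, ?_, by simp⟩))))))))) ?_
    · simp only [reg_set, reg_tick]
      repeat rw [if_neg (by omega)]
    · simp only [reg_set, reg_tick, arr_set, arr_tick, Nat.reduceEqDiff, if_false, if_true, h30, h32]
      rw [ht.arr 106 (by simp), ht.arr 107 (by simp), ht.arr 108 (by simp)]
      rfl
    rintro u ⟨fu, au, ru, tu⟩
    by_cases hc : maj (s.arr 106 (wd w i) (wd w j)) (s.arr 107 (wd w i) (wd w j))
          (s.arr 108 (wd w i) (wd w j)) = 0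
    · refine wp_ite (fun _ => ?_) fun h => absurd (ru.trans hc) h
      refine wp_skip ⟨⟨fu.reg, fun x hx => by rw [← au]; rfl, fu.clean⟩, ?_, by simp [tu]⟩
      exact Holds.iff_congr (hO₁.congr (by rw [← au]; rfl)) fun i' _ j' _ => by simp [hc]
    · refine wp_ite (fun h => absurd (ru.symm.trans h) hc) fun _ => ?_
      refine wp_seqs_const (wp_seqs_load (wp_seqs_load (wp_seqs_store (wp_seqs_nil ?_))))
      simp only [reg_set, reg_tick, arr_set, arr_tick, Nat.reduceEqDiff, if_false, if_true,
        fu.reg 7 (by norm_num), fu.reg 8 (by norm_num), fu.reg 30 (by norm_num),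
        fu.reg 32 (by norm_num), e7, e8, h30, h32, au, l1, l2]
      refine ⟨⟨fun x hx => ?_, fun x hx => ?_, fu.clean⟩, ?_, by simp [tu]⟩
      · simp only [reg_set, reg_tick, reg_put]
        repeat rw [if_neg (by omega)]
        exact fu.reg x hx
      · simp only [Finset.mem_singleton] at hx
        funext y z
        simp [arr_put, hx, au]
      · refine Holds.iff_congr (Holds.put (hO₁.congr ?_) hn hi1 hj1) fun i' _ j' _ => ?_
        · simp [au]
        · simp only [ne_eq, hc, not_false_iff, true_and]
  · unfold forTime₂
    have h1 : cnt F 0 n ≤ n := cnt_le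
    have h2 : cnt F 2 n ≤ n := cnt_le
    gcongr

end

end QRAM

namespace QRAM

variable {w : ℕ} {k : ℕ} {p q : Prog} {δ δ' : ℝ≥0∞} {E E' : State w → Prop} {s t : State w}

/-! ### Running the copies of the assumed program -/

/-- After a copy of the assumed program the quantum memory need not be clean, so finiteness of the
weight must be inherited from the state before it. -/
theorem WP.and_weight (h : WP k p δ E s) : WP k p δ (fun t => E t ∧ t.weight ≤ s.weight) s := by
  refine h.trans (add_le_add (prob_mono fun t ht hE => ⟨hE, le_trans ?_ (prob_run_le k p s)⟩) le_rfl)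
  simp only [prob, if_true]
  exact List.single_le_sum (fun _ _ => zero_le) _ (List.mem_map.2 ⟨t, ht, rfl⟩)

theorem copyVar_injective (c : ℕ) : Function.Injective (copyVar c) := fun x y h => by
  unfold copyVar at h; omega

theorem copyVar_ne {c c' : ℕ} (hc : c < 3) (hc' : c' < 3) (h : c ≠ c') (x y : ℕ) :
    copyVar c x ≠ copyVar c' y := by
  unfold copyVar; omega

section

variable {D : (BitVec w → BitVec w → BitVec w) → Prop} {h : Prop} {τ c : ℕ} {S S' : Finset ℕ}
  {I t' u : State w}

/-- The state `t` after running `c` copies of the assumed program from the state `s`; the results of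
the copies in `S` satisfy `D`. -/
structure CopyCtx (D : (BitVec w → BitVec w → BitVec w) → Prop) (h : Prop) (τ : ℕ) (I s : State w)
    (c : ℕ) (S : Finset ℕ) (t : State w) : Prop where
  reg_eq : ∀ x < 100, t.reg x = s.reg x
  arr_eq : ∀ x < 100, t.arr x = s.arr x
  reg : ∀ c' < 3, c ≤ c' → ∀ x, t.reg (copyVar c' x) = I.reg x
  arr : ∀ c' < 3, c ≤ c' → ∀ x, t.arr (copyVar c' x) = I.arr x
  psi : ∀ c' < 3, c ≤ c' → ∀ b, t.psi b ≠ 0 → b ∘ copyVar c' = 0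
  good : ∀ c' ∈ S, c' < c ∧ D (t.arr (106 + c'))
  time : h → t.time ≤ s.time + c * τ

theorem CopyCtx.step (hs : CopyCtx D h τ I s c S t) (hc : c < 3)
    (hr : Renamed (copyVar c) t t' u) (hτ : h → t'.time ≤ τ)
    (hS : ∀ x ∈ S', x ∈ S ∨ (x = c ∧ D (t'.arr 2))) : CopyCtx D h τ I s (c + 1) S' u := by
  have h1 : ∀ x < 100, x ∉ Set.range (copyVar c) := by
    rintro x hx ⟨y, rfl⟩
    unfold copyVar at hx; omega
  have h2 : ∀ c' < 3, c' ≠ c → ∀ x, copyVar c' x ∉ Set.range (copyVar c) := by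
    rintro c' hc' hne x ⟨y, hy⟩
    exact copyVar_ne hc' hc hne x y hy.symm
  refine ⟨fun x hx => (hr.reg' x (h1 x hx)).trans (hs.reg_eq x hx),
    fun x hx => (hr.arr' x (h1 x hx)).trans (hs.arr_eq x hx),
    fun c' hc' hle x => (hr.reg' _ (h2 c' hc' (by omega) x)).trans (hs.reg c' hc' (by omega) x),
    fun c' hc' hle x => (hr.arr' _ (h2 c' hc' (by omega) x)).trans (hs.arr c' hc' (by omega) x),
    fun c' hc' hle b hb => hr.psi _ (copyVar_ne hc' hc (by omega)) (hs.psi c' hc' (by omega)) b hb,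
    fun c' hc' => ?_, fun hh => ?_⟩
  · rcases hS c' hc' with h3 | ⟨rfl, h3⟩
    · have h4 := hs.good c' h3
      refine ⟨by omega, ?_⟩
      rw [hr.arr' _ ?_]
      · exact h4.2
      · have := h2 c' (by omega) (by omega) 2
        rwa [show copyVar c' 2 = 106 + c' by unfold copyVar; omega] at this
    · refine ⟨by omega, ?_⟩
      rw [show 106 + c' = copyVar c' 2 by unfold copyVar; omega, hr.arr]
      exact h3
  · rw [hr.time]
    have := hs.time hh
    have := hτ hh
    linarith

theorem wp_copy {k' : ℕ} {Q : Prog} (hs : CopyCtx D h τ I s c S t) (hk : k' ≤ k) (hc : c < 3)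
    (hI : I.psi = delta 0 1) (hI0 : I.time = 0)
    (hQ : 1 ≤ prob (Q.run k' I) (fun t => h → t.time ≤ τ)) :
    WP k (Q.rename (copyVar c)) 0 (CopyCtx D h τ I s (c + 1) S) t :=
  (wp_rename (copyVar_injective c) hk (hs.reg c hc le_rfl) (hs.arr c hc le_rfl)
    (hs.psi c hc le_rfl) hI hI0 (hQ.trans le_self_add)).mono fun _ ⟨_, h1, h2⟩ =>
      hs.step hc h2 h1 fun _ hx => Or.inl hx

theorem wp_copy_good {k' : ℕ} {Q : Prog} (hs : CopyCtx D h τ I s c S t) (hk : k' ≤ k) (hc : c < 3)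
    (hI : I.psi = delta 0 1) (hI0 : I.time = 0)
    (hQ : 1 ≤ prob (Q.run k' I) (fun t => D (t.arr 2) ∧ (h → t.time ≤ τ)) + δ) :
    WP k (Q.rename (copyVar c)) δ (CopyCtx D h τ I s (c + 1) (insert c S)) t :=
  (wp_rename (copyVar_injective c) hk (hs.reg c hc le_rfl) (hs.arr c hc le_rfl)
    (hs.psi c hc le_rfl) hI hI0 hQ).mono fun _ ⟨_, h1, h2⟩ =>
      hs.step hc h2 h1.2 fun x hx => (Finset.mem_insert.1 hx).symm.imp id fun h3 => ⟨h3, h1.1⟩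

/-- Three copies of the assumed program. -/
def copies (Q : Prog) : Prog :=
  .seq (Q.rename (copyVar 0)) (.seq (Q.rename (copyVar 1)) (Q.rename (copyVar 2)))

theorem wp_copies {k' : ℕ} {Q : Prog} (hs : CopyCtx D h τ I s 0 ∅ s) (hk : k' ≤ k)
    (hI : I.psi = delta 0 1) (hI0 : I.time = 0)
    (hQ : 1 ≤ prob (Q.run k' I) (fun t => h → t.time ≤ τ)) :
    WP k (copies Q) 0 (CopyCtx D h τ I s 3 ∅) s :=
  wp_seq_left (wp_copy hs hk (by norm_num) hI hI0 hQ) fun _ ht =>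
    wp_seq_left (wp_copy ht hk (by norm_num) hI hI0 hQ) fun _ hu =>
      wp_copy hu hk (by norm_num) hI hI0 hQ

/-- If each of the three copies fails with probability at most `1 / 3`, then two of them fail with
probability at most `7 / 27`. -/
theorem wp_copies_majority {k' : ℕ} {Q : Prog} (hs : CopyCtx D h τ I s 0 ∅ s) (hk : k' ≤ k)
    (hw : s.weight ≠ ∞) (hI : I.psi = delta 0 1) (hI0 : I.time = 0)
    (hQ : 1 ≤ prob (Q.run k' I) (fun t => h → t.time ≤ τ))
    (hD : 1 ≤ prob (Q.run k' I) (fun t => D (t.arr 2) ∧ (h → t.time ≤ τ)) +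
      ((1 / 3 : NNReal) : ℝ≥0∞)) :
    WP k (copies Q) ((7 / 27 : NNReal) : ℝ≥0∞)
      (fun t => ∃ S, CopyCtx D h τ I s 3 S t ∧ ∃ c ∈ S, ∃ c' ∈ S, c < c') s := by
  have key : ∀ (c : ℕ) (hc : c < 3) (S : Finset ℕ) (u : State w), CopyCtx D h τ I s c S u →
      WP k (Q.rename (copyVar c)) 0 (fun t =>
        (CopyCtx D h τ I s (c + 1) (insert c S) t ∧ t.weight ≤ u.weight) ∨
        (CopyCtx D h τ I s (c + 1) S t ∧ t.weight ≤ u.weight)) u := fun c hc S u hu =>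
    (wp_copy hu hk hc hI hI0 hQ).and_weight.mono fun t ht => Or.inr ht
  have hgood := fun (c : ℕ) (hc : c < 3) (S : Finset ℕ) (u : State w)
    (hu : CopyCtx D h τ I s c S u) => (wp_copy_good hu hk hc hI hI0 hD).and_weight
  have hfin : ∀ (S : Finset ℕ) (u : State w), CopyCtx D h τ I s 2 S u →
      (∃ c ∈ S, ∃ c' ∈ S, c < c') → WP k (Q.rename (copyVar 2)) 0
      (fun t => ∃ S, CopyCtx D h τ I s 3 S t ∧ ∃ c ∈ S, ∃ c' ∈ S, c < c') u := fun S u hu h2 =>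
    (wp_copy hu hk (by norm_num) hI hI0 hQ).mono fun t ht => ⟨S, ht, h2⟩
  have hfin' : ∀ (S : Finset ℕ) (u : State w), CopyCtx D h τ I s 2 S u → (∃ c ∈ S, c < 2) →
      WP k (Q.rename (copyVar 2)) ((1 / 3 : NNReal) : ℝ≥0∞)
      (fun t => ∃ S, CopyCtx D h τ I s 3 S t ∧ ∃ c ∈ S, ∃ c' ∈ S, c < c') u :=
    fun S u hu ⟨c, hc, hc'⟩ => (hgood 2 (by norm_num) S u hu).mono fun t ht =>
      ⟨_, ht.1, c, by simp [hc], 2, by simp, hc'⟩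
  -- If the first copy succeeds, the other two must both fail, which gives `1 / 9`. If it fails, the
  -- error is `1 / 3 + 2 / 3 * 1 / 3 = 5 / 9 = 1 / 9 + 4 / 9`. Altogether this is `1 / 9 + 4 / 9 * 1
  -- / 3 = 7 / 27`.
  refine (wp_seq_branch (δ := ((1 / 9 : NNReal) : ℝ≥0∞)) (η := ((4 / 9 : NNReal) : ℝ≥0∞)) hw
    (hgood 0 (by norm_num) _ _ hs) (key 0 (by norm_num) _ _ hs) (fun t ht => ?_)
    fun t ht => ?_).mono (fun _ ht => ht) (le_of_eq ?_)
  · refine (wp_seq_branch (δ := 0) (η := ((1 / 3 : NNReal) : ℝ≥0∞)) (ne_top_of_le_ne_top hw ht.2)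
      (hgood 1 (by norm_num) _ _ ht.1) (key 1 (by norm_num) _ _ ht.1)
      (fun u hu => hfin _ u hu.1 ⟨0, by simp, 1, by simp, by norm_num⟩)
      fun u hu => (hfin' _ u hu.1 ⟨0, by simp, by norm_num⟩).mono (fun _ h => h) (by simp)).mono
      (fun _ h => h) (le_of_eq ?_)
    rw [zero_add, ← ENNReal.coe_mul]
    norm_num
  · refine (wp_seq_branch (δ := ((1 / 3 : NNReal) : ℝ≥0∞)) (η := ((2 / 3 : NNReal) : ℝ≥0∞))
      (ne_top_of_le_ne_top hw ht.2)
      (hgood 1 (by norm_num) _ _ ht.1) (key 1 (by norm_num) _ _ ht.1)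
      (fun u hu => hfin' _ u hu.1 ⟨1, by simp, by norm_num⟩)
      fun u hu => wp_of_one_le ?_).mono (fun _ h => h) (le_of_eq ?_)
    · rw [← ENNReal.coe_add, ← ENNReal.coe_one, ENNReal.coe_le_coe]
      norm_num
    · rw [← ENNReal.coe_mul, ← ENNReal.coe_add, ← ENNReal.coe_add, ENNReal.coe_inj]
      norm_num
  · rw [← ENNReal.coe_mul, ← ENNReal.coe_add, ENNReal.coe_inj]
    norm_num

end

end QRAM

namespace QRAM

variable {w : ℕ} {k : ℕ} {p q : Prog} {δ δ' : ℝ≥0∞} {E E' : State w → Prop} {s t : State w}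

/-! ### The searches -/

/-- All the searches. -/
def searches : Prog :=
  .seq (lightRows 5 6 7 8 2 0) (.seq (lightRows 11 12 9 10 18 2) (denseRows 5 6 7 8))

/-- The time for the search in the rows without flags. -/
noncomputable def lightTime (n R b : ℕ) (F X Y : ℕ → ℕ → Bool) : ℕ :=
  ∑ i ∈ Finset.range n,
    ((if F b i then 0 else rowTime R (cnt X i n) (prodRow X Y n i).card) + 6) + 3

/-- The time for the search in the parts of the rows that are encoded by numbers. -/
noncomputable def denseTotalTime (n R β : ℕ) (X Y : ℕ → ℕ → Bool) : ℕ :=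
  ∑ i ∈ Finset.range n, (denseTime R (cnt X i n * β) (denseRow X Y n β i).card + 3) + 3

/-- A bound for the probability that a search misses something. -/
noncomputable def searchError (n : ℕ) : ℝ≥0∞ :=
  n * ((2 * n + 1) * ((Nat.clog 2 (2 * n) + 4) * 2⁻¹ ^ reps n)) +
    (n * ((2 * n + 1) * ((Nat.clog 2 (2 * n) + 4) * 2⁻¹ ^ reps n)) +
      n * ((2 * n + 1) * ((Nat.clog 2 (n * n) + 5) * 2⁻¹ ^ reps n)))

/-- The state after the searches; if `g` holds, then nothing has been missed. -/
structure Searched (g : Prop) (n m₁ m₂ ℓ₁ ℓ₂ ℓ₃ : ℕ) (X Y : ℕ → ℕ → Bool) (I t : State w) :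
    Prop where
  consts : Consts n m₁ m₂ ℓ₁ ℓ₂ ℓ₃ t
  tables : Tables n X Y (flags n m₁ m₂ ℓ₁ ℓ₂ ℓ₃ X Y) t
  clean : Clean t
  reg : ∀ c < 3, ∀ x, t.reg (copyVar c x) = I.reg x
  arr : ∀ c < 3, ∀ x, t.arr (copyVar c x) = I.arr x
  out : ∃ G : ℕ → ℕ → Prop, (∀ i j, G i j → j ∈ prodRow X Y n i) ∧
    (g → ∀ i < n, ∀ j, (flags n m₁ m₂ ℓ₁ ℓ₂ ℓ₃ X Y 0 i = false → j ∈ prodRow X Y n i → G i j) ∧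
      (j ∈ denseRow X Y n (min (m₂ / ℓ₂) n) i → G i j)) ∧ Holds t 2 n G
  tout : ∃ G : ℕ → ℕ → Prop,
    (∀ i j, G i j → j ∈ prodRow (fun i j => Y j i) (fun i j => X j i) n i) ∧
    (g → ∀ i < n, ∀ j, flags n m₁ m₂ ℓ₁ ℓ₂ ℓ₃ X Y 2 i = false →
      j ∈ prodRow (fun i j => Y j i) (fun i j => X j i) n i → G i j) ∧ Holds t 18 n G

section

variable {n m₁ m₂ ℓ₁ ℓ₂ ℓ₃ : ℕ} {X Y F : ℕ → ℕ → Bool} {I : State w} {g : Prop}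

/-- Light columns are handled as light rows of the product of the transposes in reversed order;
hence the tables `11`, `12` and `9`, `10`, and the separate output array `18`. -/
theorem wp_searches [Decidable g] (hk : 2 ^ w < k) (hn : 4 * n + 4 < 2 ^ w)
    (he : Nat.clog 2 (2 * n) + 7 ≤ w) (hD : Nat.clog 2 (n * n) + 8 ≤ w) (hR : reps n < 2 ^ w)
    (hβ : 0 < min (m₂ / ℓ₂) n) (hP : Prepared n m₁ m₂ ℓ₁ ℓ₂ ℓ₃ X Y I s) :
    WP k searches (if g then searchError n else 0)
      (fun t => Searched g n m₁ m₂ ℓ₁ ℓ₂ ℓ₃ X Y I t ∧ t.time ≤ s.time +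
        (lightTime n (reps n) 0 (flags n m₁ m₂ ℓ₁ ℓ₂ ℓ₃ X Y) X Y +
          lightTime n (reps n) 2 (flags n m₁ m₂ ℓ₁ ℓ₂ ℓ₃ X Y) (fun i j => Y j i)
            (fun i j => X j i) +
          denseTotalTime n (reps n) (min (m₂ / ℓ₂) n) X Y)) s := by
  have hE : ∀ {u : State w}, Consts n m₁ m₂ ℓ₁ ℓ₂ ℓ₃ u →
      Tables n X Y (flags n m₁ m₂ ℓ₁ ℓ₂ ℓ₃ X Y) u → Env n (reps n) 5 6 7 8 X Y u :=
    fun hc hT => ⟨hc.r0, hc.r7, hc.r8, hc.r10, hT.l5, hT.l7⟩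
  have hE' : ∀ {u : State w}, Consts n m₁ m₂ ℓ₁ ℓ₂ ℓ₃ u →
      Tables n X Y (flags n m₁ m₂ ℓ₁ ℓ₂ ℓ₃ X Y) u →
      Env n (reps n) 11 12 9 10 (fun i j => Y j i) (fun i j => X j i) u :=
    fun hc hT => ⟨hc.r0, hc.r7, hc.r8, hc.r10, hT.l11, hT.l9⟩
  have h0 : ∀ {a : ℕ}, (∀ x y, s.arr a x y = 0) → Holds s a n fun _ _ => False :=
    fun h i _ j _ => ⟨False.elim, fun _ => h _ _⟩
  refine (wp_seq (wp_lightRows (g := g) hk hn he hR (by norm_num) (by norm_num) (by simp)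
    (hE hP.consts hP.tables) hP.tables.a13 (h0 hP.a2) hP.clean) (δ' := if g then
      (n * ((2 * n + 1) * ((Nat.clog 2 (2 * n) + 4) * 2⁻¹ ^ reps n)) +
      n * ((2 * n + 1) * ((Nat.clog 2 (n * n) + 5) * 2⁻¹ ^ reps n))) else 0) ?_).mono
    (fun _ h => h) ?_
  swap
  · split_ifs
    · exact le_rfl
    · simp
  rintro t1 ⟨⟨f1, cl1, G1, hG1, gG1, H1⟩, T1⟩
  have c1 := hP.consts.frm f1
  have tb1 := hP.tables.frm f1 (by simp)
  refine (wp_seq (wp_lightRows (g := g) hk hn he hR (by norm_num) (by norm_num) (by simp)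
    (hE' c1 tb1) tb1.a13 ((h0 hP.a18).congr (f1.arr 18 (by simp))) cl1) (δ' := if g then
      n * ((2 * n + 1) * ((Nat.clog 2 (n * n) + 5) * 2⁻¹ ^ reps n)) else 0) ?_).mono
    (fun _ h => h) ?_
  swap
  · split_ifs
    · exact le_rfl
    · simp
  rintro t2 ⟨⟨f2, cl2, G2, hG2, gG2, H2⟩, T2⟩
  have c2 := c1.frm f2
  have tb2 := tb1.frm f2 (by simp)
  refine (wp_denseRows (g := g) hk hn hD hR (min_le_right _ _) hβ (by simp) (hE c2 tb2) c2.r9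
    (H1.congr (f2.arr 2 (by simp))) cl2).mono ?_
  rintro t3 ⟨⟨f3, cl3, G3, hG3, gG3, H3⟩, T3⟩
  refine ⟨⟨c2.frm f3, tb2.frm f3 (by simp), cl3, fun c hc x => ?_, fun c hc x => ?_, ?_, ?_⟩, ?_⟩
  · rw [← hP.reg c hc x, f3.reg, f2.reg, f1.reg] <;> unfold copyVar <;> omega
  · rw [← hP.arr c hc x, f3.arr, f2.arr, f1.arr] <;> simp [copyVar] <;> omega
  · refine ⟨_, fun i j h => ?_, fun hg i hi j => ⟨fun h1 h2 => ?_, fun h1 => ?_⟩, H3⟩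
    · rcases h with (h | h) | h
      · exact h.elim
      · have := (hG1 i j h).2
        split_ifs at this
        · simp at this
        · exact this
      · exact denseRow_subset (hG3 i j h).2
    · exact Or.inl (Or.inr (gG1 hg i hi j (by rw [h1]; simpa using h2)))
    · exact Or.inr (gG3 hg i hi j h1)
  · refine ⟨_, fun i j h => ?_, fun hg i hi j h1 h2 => ?_, H2.congr (f3.arr 18 (by simp))⟩
    · rcases h with h | h
      · exact h.elim
      · have := (hG2 i j h).2
        split_ifs at this
        · simp at this
        · exact this
    · exact Or.inr (gG2 hg i hi j (by rw [h1]; simpa using h2))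
  · unfold lightTime denseTotalTime
    linarith

end

/-! ### The whole program -/

/-- The program for the product of `n × n`-matrices, where `Q` is the assumed program. -/
def mainProg (Q : Prog) : Prog :=
  .seq prepare (.seq searches (.seq (copies Q) (.seq mergeTransposed mergeMajority)))

section

variable {n m₁ m₂ ℓ₁ ℓ₂ ℓ₃ lam : ℕ}

/-- The time of the program, without the copies of the assumed program. -/
noncomputable def ownTime (n m₁ m₂ ℓ₁ ℓ₂ ℓ₃ : ℕ) (X Y : ℕ → ℕ → Bool) : ℕ :=
  prepTime n + (lightTime n (reps n) 0 (flags n m₁ m₂ ℓ₁ ℓ₂ ℓ₃ X Y) X Y +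
    lightTime n (reps n) 2 (flags n m₁ m₂ ℓ₁ ℓ₂ ℓ₃ X Y) (fun i j => Y j i) (fun i j => X j i) +
    denseTotalTime n (reps n) (min (m₂ / ℓ₂) n) X Y) + forTime₂ n n 3 + forTime₂ n n 13

theorem Searched.copyCtx {g h : Prop} {X Y : ℕ → ℕ → Bool} {I : State w} {τ : ℕ}
    {D : (BitVec w → BitVec w → BitVec w) → Prop}
    (hs : Searched g n m₁ m₂ ℓ₁ ℓ₂ ℓ₃ X Y I s) : CopyCtx D h τ I s 0 ∅ s := by
  refine ⟨fun _ _ => rfl, fun _ _ => rfl, fun c hc _ => hs.reg c hc, fun c hc _ => hs.arr c hc,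
    fun c _ _ b hb => ?_, by simp, by simp⟩
  obtain ⟨c, hc⟩ := hs.clean
  have : b = 0 := by
    by_contra h
    exact hb (by simp [hc, delta, h])
  rw [this]; rfl

theorem CopyCtx.consts {h : Prop} {X Y : ℕ → ℕ → Bool} {I : State w} {τ c : ℕ} {S : Finset ℕ}
    {D : (BitVec w → BitVec w → BitVec w) → Prop} {F : ℕ → ℕ → Bool}
    (hc : CopyCtx D h τ I s c S t) (hs : Consts n m₁ m₂ ℓ₁ ℓ₂ ℓ₃ s) (hT : Tables n X Y F s) :
    t.reg 0 = wd w n ∧ t.reg 7 = wd w 1 ∧ t.reg 8 = wd w 0 ∧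
      (∀ b < 3, t.reg (18 + b) = wd w (cnt F b n)) ∧ Listed t 14 15 F 3 n :=
  ⟨(hc.reg_eq 0 (by norm_num)).trans hs.r0, (hc.reg_eq 7 (by norm_num)).trans hs.r7,
    (hc.reg_eq 8 (by norm_num)).trans hs.r8,
    fun b hb => (hc.reg_eq _ (by omega)).trans (hT.r18 b hb),
    hT.l14.congr (hc.arr_eq 14 (by norm_num)) (hc.arr_eq 15 (by norm_num))⟩

theorem wp_mergeAll {h : Prop} {X Y : ℕ → ℕ → Bool} {I : State w} {τ : ℕ} {S : Finset ℕ}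
    {D : (BitVec w → BitVec w → BitVec w) → Prop} {F : ℕ → ℕ → Bool} {G G' : ℕ → ℕ → Prop}
    (hk : 2 ^ w < k) (hw : 1 < w) (hn : n < 2 ^ w)
    (hc : CopyCtx D h τ I s 3 S t) (hs : Consts n m₁ m₂ ℓ₁ ℓ₂ ℓ₃ s) (hT : Tables n X Y F s)
    (hG : Holds s 2 n G) (hG' : Holds s 18 n G') :
    WP k (.seq mergeTransposed mergeMajority) 0 (fun u => Holds u 2 n (fun i' j' =>
      (G i' j' ∨ G' j' i') ∨ ∃ i < cnt F 0 n, ∃ j < cnt F 2 n,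
        maj (t.arr 106 (wd w i) (wd w j)) (t.arr 107 (wd w i) (wd w j))
          (t.arr 108 (wd w i) (wd w j)) ≠ 0 ∧ i' = heavy F 0 i ∧ j' = heavy F 2 j) ∧
      u.time ≤ t.time + (forTime₂ n n 3 + forTime₂ n n 13)) t := by
  obtain ⟨e0, e7, e8, e18, l14⟩ := hc.consts hs hT
  refine wp_seq_left (wp_mergeTransposed hk (by omega) hn e0 e7
    (hG.congr (hc.arr_eq 2 (by norm_num))) (hG'.congr (hc.arr_eq 18 (by norm_num)))) ?_
  rintro u ⟨fu, hu, tu⟩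
  refine (wp_mergeMajority hk hw hn ((fu.reg 7 (by norm_num)).trans e7)
    ((fu.reg 8 (by norm_num)).trans e8) (fun b hb => (fu.reg _ (by omega)).trans (e18 b hb))
    (l14.congr (fu.arr 14 (by simp)) (fu.arr 15 (by simp))) hu).mono ?_
  rintro v ⟨-, hv, tv⟩
  rw [fu.arr 106 (by simp), fu.arr 107 (by simp), fu.arr 108 (by simp)] at hv
  exact ⟨hv, by omega⟩

end

end QRAM

namespace QRAM

variable {w : ℕ} {k : ℕ} {p q : Prog} {δ δ' : ℝ≥0∞} {E E' : State w → Prop} {s t : State w}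

/-! ### The product and the numbers of its ones -/

section

variable {n a b c : ℕ} {X Y F : ℕ → ℕ → Bool}

theorem mem_prodRow {i j : ℕ} :
    j ∈ prodRow X Y n i ↔ j < n ∧ ∃ k < n, X i k = true ∧ Y k j = true := by simp [prodRow]

theorem extend_fin (A : BoolMatrix n n) (i j : Fin n) : extend A i j = A i j := by
  simp [extend]

theorem mul_eq_true_iff (A B : BoolMatrix n n) (i j : Fin n) :
    A.mul B i j = true ↔ (j : ℕ) ∈ prodRow (extend A) (extend B) n i := by
  simp only [BoolMatrix.mul, Matrix.of_apply, decide_eq_true_eq, mem_prodRow, j.2, true_and]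
  constructor
  · rintro ⟨k, h1, h2⟩
    exact ⟨k, k.2, by rwa [extend_fin], by rwa [extend_fin]⟩
  · rintro ⟨k, hk, h1, h2⟩
    exact ⟨⟨k, hk⟩, (extend_fin A i ⟨k, hk⟩).symm.trans h1, (extend_fin B ⟨k, hk⟩ j).symm.trans h2⟩

theorem nnz_eq_sum {a b : ℕ} (A : BoolMatrix a b) :
    A.nnz = ∑ i : Fin a, ∑ j : Fin b, if A i j then 1 else 0 := by
  rw [BoolMatrix.nnz, Finset.card_filter, Fintype.sum_prod_type]

theorem cnt_eq_sum (i : ℕ) : cnt X i n = ∑ j ∈ Finset.range n, if X i j then 1 else 0 := by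
  rw [cnt, Nat.count_eq_card_filter_range, Finset.card_filter]

theorem sum_cnt (A : BoolMatrix n n) :
    ∑ i ∈ Finset.range n, cnt (extend A) i n = A.nnz := by
  simp only [nnz_eq_sum, cnt_eq_sum, Finset.sum_range, extend_fin]

theorem sum_cnt_transpose (A : BoolMatrix n n) :
    ∑ j ∈ Finset.range n, cnt (fun j i => extend A i j) j n = A.nnz := by
  rw [nnz_eq_sum, Finset.sum_comm]
  simp only [cnt_eq_sum, Finset.sum_range, extend_fin]

theorem sum_card_prodRow (A B : BoolMatrix n n) :
    ∑ i ∈ Finset.range n, (prodRow (extend A) (extend B) n i).card = (A.mul B).nnz := by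
  rw [nnz_eq_sum, Finset.sum_range]
  refine Finset.sum_congr rfl fun i _ => ?_
  simp only [mul_eq_true_iff]
  rw [← Finset.sum_range fun j => if j ∈ prodRow (extend A) (extend B) n i then 1 else 0,
    ← Finset.card_filter]
  congr 1
  ext j
  simp only [Finset.mem_filter, Finset.mem_range, mem_prodRow]
  tauto

theorem mem_prodRow_transpose {i j : ℕ} (hi : i < n) (hj : j < n) :
    i ∈ prodRow (fun i j => Y j i) (fun i j => X j i) n j ↔ j ∈ prodRow X Y n i := by
  simp only [mem_prodRow, hi, hj, true_and]
  exact exists_congr fun k => and_congr_right fun _ => and_comm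

theorem sum_card_prodRow_transpose (A B : BoolMatrix n n) :
    ∑ j ∈ Finset.range n,
      (prodRow (fun i j => extend B j i) (fun i j => extend A j i) n j).card = (A.mul B).nnz := by
  rw [nnz_eq_sum, Finset.sum_range, Finset.sum_comm]
  refine Finset.sum_congr rfl fun j _ => ?_
  simp only [mul_eq_true_iff]
  rw [← Finset.sum_range fun i => if (j : ℕ) ∈ prodRow (extend A) (extend B) n i then 1 else 0,
    ← Finset.card_filter]
  congr 1
  ext i
  simp only [Finset.mem_filter, Finset.mem_range]
  constructor
  · intro h
    have hi := lt_of_mem_prodRow h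
    exact ⟨hi, (mem_prodRow_transpose hi j.2).1 h⟩
  · rintro ⟨hi, h⟩
    exact (mem_prodRow_transpose hi j.2).2 h

theorem subMatrix_mul_eq_true_iff (i : Fin a) (j : Fin c) (hb : cnt F 1 n ≤ b) :
    (subMatrix F X n 0 1 a b).mul (subMatrix F Y n 1 2 b c) i j = true ↔
      i < cnt F 0 n ∧ j < cnt F 2 n ∧ ∃ k < cnt F 1 n,
        X (heavy F 0 i) (heavy F 1 k) = true ∧ Y (heavy F 1 k) (heavy F 2 j) = true := by
  simp only [BoolMatrix.mul, subMatrix, Matrix.of_apply, Bool.and_eq_true, decide_eq_true_eq]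
  constructor
  · rintro ⟨k, ⟨⟨h1, h2⟩, h3⟩, ⟨-, h4⟩, h5⟩
    exact ⟨h1, h4, k, h2, h3, h5⟩
  · rintro ⟨h1, h4, k, h2, h3, h5⟩
    exact ⟨⟨k, h2.trans_le hb⟩, ⟨⟨h1, h2⟩, h3⟩, ⟨h2, h4⟩, h5⟩

/-- Passing from ranks to rows and columns maps the ones of the small product injectively to ones of
`A.mul B`. So a bound for the large product may be given to the assumed program. -/
theorem nnz_subMatrix_mul_le (A B : BoolMatrix n n) (hb : cnt F 1 n ≤ b) :
    ((subMatrix F (extend A) n 0 1 a b).mul (subMatrix F (extend B) n 1 2 b c)).nnz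
      ≤ (A.mul B).nnz := by
  refine Finset.card_le_card_of_forall_subsingleton
    (fun x y => (y.1 : ℕ) = heavy F 0 x.1 ∧ (y.2 : ℕ) = heavy F 2 x.2) ?_ ?_
  · rintro ⟨i, j⟩ h
    simp only [Finset.mem_filter, Finset.mem_univ, true_and] at h
    obtain ⟨hi, hj, k, hk, h1, h2⟩ := (subMatrix_mul_eq_true_iff i j hb).1 h
    have hj' := (heavy_spec hj).1
    refine ⟨(⟨_, (heavy_spec hi).1⟩, ⟨_, hj'⟩), ?_, rfl, rfl⟩
    simp only [Finset.mem_filter, Finset.mem_univ, true_and, mul_eq_true_iff, mem_prodRow]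
    exact ⟨hj', _, (heavy_spec hk).1, h1, h2⟩
  · rintro y - ⟨i, j⟩ ⟨h, h1, h2⟩ ⟨i', j'⟩ ⟨h', h1', h2'⟩
    simp only [Finset.mem_filter, Finset.mem_univ, true_and] at h h'
    obtain ⟨hi, hj, -⟩ := (subMatrix_mul_eq_true_iff i j hb).1 h
    obtain ⟨hi', hj', -⟩ := (subMatrix_mul_eq_true_iff i' j' hb).1 h'
    have e1 := (heavy_spec hi).2.2
    have e2 := (heavy_spec hj).2.2
    rw [← h1, h1', (heavy_spec hi').2.2] at e1
    rw [← h2, h2', (heavy_spec hj').2.2] at e2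
    exact Prod.ext (Fin.ext e1.symm) (Fin.ext e2.symm)

end

/-! ### Time and correctness of the program -/

section

variable {n m₁ m₂ ℓ₁ ℓ₂ ℓ₃ lam : ℕ}

/-- The words are long enough, and the flags are few. -/
structure Fits (w k n m₁ m₂ ℓ₁ ℓ₂ ℓ₃ : ℕ) (F : ℕ → ℕ → Bool) : Prop where
  hk : 2 ^ w < k
  hw : 4 < w
  hn : 4 * n + 4 < 2 ^ w
  h1 : m₁ < 2 ^ w
  h2 : m₂ < 2 ^ w
  h3 : ℓ₁ < 2 ^ w
  h4 : ℓ₂ < 2 ^ w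
  h5 : ℓ₃ < 2 ^ w
  he : Nat.clog 2 (2 * n) + 7 ≤ w
  hD : Nat.clog 2 (n * n) + 8 ≤ w
  hR : reps n < 2 ^ w
  hβ : 0 < min (m₂ / ℓ₂) n
  c0 : cnt F 0 n ≤ min ℓ₁ n
  c1 : cnt F 1 n ≤ min ℓ₂ n
  c2 : cnt F 2 n ≤ min ℓ₃ n

/-- The initial state of the copies of the assumed program. -/
noncomputable def copyInit (w n ℓ₁ ℓ₂ ℓ₃ lam : ℕ) (F X Y : ℕ → ℕ → Bool) : State w :=
  initState w [min ℓ₁ n, min ℓ₂ n, min ℓ₃ n, lam]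
    (subMatrix F X n 0 1 (min ℓ₁ n) (min ℓ₂ n)) (subMatrix F Y n 1 2 (min ℓ₂ n) (min ℓ₃ n))

theorem initState_psi {a b c : ℕ} (ps : List ℕ) (A : BoolMatrix a b) (B : BoolMatrix b c) :
    (initState w ps A B).psi = delta 0 1 := by
  funext x
  simp only [initState, delta]

/-- Here the searches are used with `g` false: whether they find everything is irrelevant for the
time, and nothing is lost in probability. -/
theorem wp_mainProg_time {A B : BoolMatrix n n} {Q : Prog} {k' τ : ℕ} (hk' : k' ≤ k)
    (hF : Fits w k n m₁ m₂ ℓ₁ ℓ₂ ℓ₃ (flags n m₁ m₂ ℓ₁ ℓ₂ ℓ₃ (extend A) (extend B)))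
    (hQ : 1 ≤ prob (Q.run k' (copyInit w n ℓ₁ ℓ₂ ℓ₃ lam
      (flags n m₁ m₂ ℓ₁ ℓ₂ ℓ₃ (extend A) (extend B)) (extend A) (extend B)))
        fun t => t.time ≤ τ) :
    WP k (mainProg Q) 0 (fun t => t.time ≤ ownTime n m₁ m₂ ℓ₁ ℓ₂ ℓ₃ (extend A) (extend B) + 3 * τ)
      (initState w [n, m₁, m₂, ℓ₁, ℓ₂, ℓ₃, lam] A B) := by
  refine wp_seq_left (wp_prepare (lam := lam) hF.hk hF.hw hF.hn hF.h1 hF.h2 hF.h3 hF.h4 hF.h5 A B hF.c0 hF.c1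
    hF.c2) ?_
  rintro t1 ⟨hP, T1⟩
  refine wp_seq_left ((wp_searches (g := False) hF.hk hF.hn hF.he hF.hD hF.hR hF.hβ hP).mono
    (fun _ h => h) (by simp)) ?_
  rintro t2 ⟨hS, T2⟩
  refine wp_seq_left (wp_copies (D := fun _ => True) (h := True) (τ := τ) hS.copyCtx hk'
    (initState_psi _ _ _) rfl (by simpa [copyInit] using hQ)) ?_
  intro t3 hC
  obtain ⟨G, -, -, hG⟩ := hS.out
  obtain ⟨G', -, -, hG'⟩ := hS.tout
  refine (wp_mergeAll hF.hk (by have := hF.hw; omega) (by have := hF.hn; omega) hC hS.consts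
    hS.tables hG hG').mono ?_
  rintro u ⟨-, tu⟩
  have := hC.time trivial
  unfold ownTime
  omega

/-- Here the searches are used with `g` true, and the time of the copies is ignored. The errors of
the searches and of the majority vote add up. -/
theorem wp_mainProg_outputs {A B : BoolMatrix n n} {Q : Prog} {k' : ℕ} (hk' : k' ≤ k)
    (hF : Fits w k n m₁ m₂ ℓ₁ ℓ₂ ℓ₃ (flags n m₁ m₂ ℓ₁ ℓ₂ ℓ₃ (extend A) (extend B)))
    (hQ : 1 ≤ prob (Q.run k' (copyInit w n ℓ₁ ℓ₂ ℓ₃ lam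
      (flags n m₁ m₂ ℓ₁ ℓ₂ ℓ₃ (extend A) (extend B)) (extend A) (extend B))) fun _ => True)
    (hQ' : 1 ≤ prob (Q.run k' (copyInit w n ℓ₁ ℓ₂ ℓ₃ lam
      (flags n m₁ m₂ ℓ₁ ℓ₂ ℓ₃ (extend A) (extend B)) (extend A) (extend B)))
      (fun t => t.Outputs ((subMatrix (flags n m₁ m₂ ℓ₁ ℓ₂ ℓ₃ (extend A) (extend B)) (extend A) n
        0 1 (min ℓ₁ n) (min ℓ₂ n)).mul (subMatrix (flags n m₁ m₂ ℓ₁ ℓ₂ ℓ₃ (extend A) (extend B))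
          (extend B) n 1 2 (min ℓ₂ n) (min ℓ₃ n)))) + ((1 / 3 : NNReal) : ℝ≥0∞)) :
    WP k (mainProg Q) (searchError n + ((7 / 27 : NNReal) : ℝ≥0∞)) (fun t => t.Outputs (A.mul B))
      (initState w [n, m₁, m₂, ℓ₁, ℓ₂, ℓ₃, lam] A B) := by
  refine wp_seq_left (wp_prepare (lam := lam) hF.hk hF.hw hF.hn hF.h1 hF.h2 hF.h3 hF.h4 hF.h5 A B hF.c0 hF.c1
    hF.c2) ?_
  rintro t1 ⟨hP, -⟩
  refine wp_seq ((wp_searches (g := True) hF.hk hF.hn hF.he hF.hD hF.hR hF.hβ hP).mono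
    (fun _ h => h) (by simp)) ?_
  rintro t2 ⟨hS, -⟩
  set X := extend A with hX
  set Y := extend B with hY
  set F := flags n m₁ m₂ ℓ₁ ℓ₂ ℓ₃ X Y with hFdef
  set C := (subMatrix F X n 0 1 (min ℓ₁ n) (min ℓ₂ n)).mul
    (subMatrix F Y n 1 2 (min ℓ₂ n) (min ℓ₃ n)) with hC
  refine wp_seq_right (wp_copies_majority (h := False) (τ := 0) (D := fun a => ∀ i j,
    a (BitVec.ofNat w i.val) (BitVec.ofNat w j.val) = if C i j then 1 else 0) hS.copyCtx hk'
    (weight_ne_top_of_clean hS.clean) (initState_psi _ _ _) rfl (by simpa [copyInit] using hQ)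
    (by simpa [copyInit, State.Outputs] using hQ')) ?_
  rintro t3 ⟨S, hcc, c, hc, c', hc', hlt⟩
  obtain ⟨G, sG, gG, hG⟩ := hS.out
  obtain ⟨G', sG', gG', hG'⟩ := hS.tout
  have hn : n < 2 ^ w := by have := hF.hn; omega
  refine (wp_mergeAll hF.hk (by have := hF.hw; omega) hn hcc hS.consts hS.tables hG hG').mono ?_
  rintro u ⟨hu, -⟩
  have hmaj : ∀ i < cnt F 0 n, ∀ j < cnt F 2 n, maj (t3.arr 106 (wd w i) (wd w j))
      (t3.arr 107 (wd w i) (wd w j)) (t3.arr 108 (wd w i) (wd w j)) ≠ 0 ↔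
      ∃ k < cnt F 1 n, X (heavy F 0 i) (heavy F 1 k) = true ∧
        Y (heavy F 1 k) (heavy F 2 j) = true := by
    intro i hi j hj
    have e1 := (hcc.good c hc).2 ⟨i, hi.trans_le hF.c0⟩ ⟨j, hj.trans_le hF.c2⟩
    have e2 := (hcc.good c' hc').2 ⟨i, hi.trans_le hF.c0⟩ ⟨j, hj.trans_le hF.c2⟩
    have e3 := maj_of_two (x := fun c => t3.arr (106 + c) (wd w i) (wd w j)) hlt
      (hcc.good c' hc').1 e1 e2
    have e4 := subMatrix_mul_eq_true_iff (X := X) (Y := Y) ⟨i, hi.trans_le hF.c0⟩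
      ⟨j, hj.trans_le hF.c2⟩ hF.c1
    simp only [hi, hj, true_and] at e4
    rw [← e4, show maj (t3.arr 106 (wd w i) (wd w j)) (t3.arr 107 (wd w i) (wd w j))
      (t3.arr 108 (wd w i) (wd w j)) = _ from e3]
    have h10 := wd_inj (show 1 < 2 ^ w from Nat.one_lt_two_pow (by have := hF.hw; omega))
      (show 0 < 2 ^ w by positivity)
    constructor
    · intro h
      by_contra h'
      exact h (by rw [if_neg h'])
    · intro h
      rw [if_pos h]
      exact mt h10.1 one_ne_zero
  intro i j
  have hij := hu i i.2 j j.2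
  have key : A.mul B i j = true ↔ ((G i j ∨ G' j i) ∨ ∃ a < cnt F 0 n, ∃ b < cnt F 2 n,
        maj (t3.arr 106 (wd w a) (wd w b)) (t3.arr 107 (wd w a) (wd w b))
          (t3.arr 108 (wd w a) (wd w b)) ≠ 0 ∧ i = heavy F 0 a ∧ j = heavy F 2 b) := by
    rw [mul_eq_true_iff]
    constructor
    · intro h
      obtain ⟨-, k, hk, hA, hB⟩ := mem_prodRow.1 h
      -- The cases are: light row, light column, light witness, and all three heavy.
      cases f0 : F 0 i
      · exact Or.inl (Or.inl ((gG trivial i i.2 j).1 f0 h))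
      cases f2 : F 2 j
      · exact Or.inl (Or.inr (gG' trivial j j.2 i f2 ((mem_prodRow_transpose i.2 j.2).2 h)))
      cases f1 : F 1 k
      · refine Or.inl (Or.inl ((gG trivial i i.2 j).2 ?_))
        simp only [denseRow, Finset.mem_filter, Finset.mem_range]
        -- As row `k` is light, every one in it has rank below `β`, so the pair `(k, j)` has a code.
        refine ⟨j.2, _, k, hk, j.2, hA, hB, ?_, rfl⟩
        have h1 := cnt_lt_cnt hB j.2
        have h2 : cnt Y k n ≤ m₂ / ℓ₂ := by
          simpa [hFdef, flags] using f1
        have h3 : cnt Y k n ≤ n := cnt_le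
        exact lt_min (h1.trans_le h2) (h1.trans_le h3)
      · refine Or.inr ⟨cnt F 0 i, cnt_lt_cnt f0 i.2, cnt F 2 j, cnt_lt_cnt f2 j.2,
          (hmaj _ (cnt_lt_cnt f0 i.2) _ (cnt_lt_cnt f2 j.2)).2 ⟨cnt F 1 k, cnt_lt_cnt f1 hk, ?_⟩,
          (heavy_cnt f0).symm, (heavy_cnt f2).symm⟩
        rw [heavy_cnt f0, heavy_cnt f1, heavy_cnt f2]
        exact ⟨hA, hB⟩
    · rintro ((h | h) | ⟨a, ha, b, hb, h, h1, h2⟩)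
      · exact sG _ _ h
      · exact (mem_prodRow_transpose i.2 j.2).1 (sG' _ _ h)
      · obtain ⟨k, hk, hA, hB⟩ := (hmaj a ha b hb).1 h
        rw [h1, h2]
        exact mem_prodRow.2 ⟨(heavy_spec hb).1, _, (heavy_spec hk).1, hA, hB⟩
  by_cases h : A.mul B i j = true
  · rw [if_pos h]
    exact hij.1 (key.1 h)
  · rw [if_neg h]
    exact hij.2 (mt key.2 h)

end

end QRAM

namespace QRAM

/-! ### The time of the searches -/

section

variable {n R β c l N b : ℕ} {X Y F : ℕ → ℕ → Bool}

/-- Rounding up to a power of two costs a factor less than two; the summand `1` covers `N = 0`. -/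
theorem two_pow_clog_le (N : ℕ) : 2 ^ Nat.clog 2 N ≤ 2 * N + 1 := by
  rcases Nat.lt_or_ge 1 N with h | h
  · have h1 := Nat.pow_pred_clog_lt_self (b := 2) (by norm_num) h
    have h2 : 0 < Nat.clog 2 N := Nat.clog_pos (by norm_num) h
    obtain ⟨e, he⟩ : ∃ e, Nat.clog 2 N = e + 1 := ⟨Nat.clog 2 N - 1, by omega⟩
    rw [he] at h1 ⊢
    simp only [Nat.pred_eq_sub_one, Nat.add_sub_cancel] at h1
    rw [pow_succ]; omega
  · rw [Nat.clog_of_right_le_one h]; omega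

theorem one_le_clog (hn : 1 ≤ n) : 1 ≤ Nat.clog 2 (2 * n) := Nat.clog_pos (by norm_num) (by omega)

theorem le_two_pow_clog : 2 * n ≤ 2 ^ Nat.clog 2 (2 * n) := Nat.le_pow_clog (by norm_num) _

theorem clog_mul_self_le : Nat.clog 2 (n * n) ≤ 2 * Nat.clog 2 (2 * n) := by
  refine Nat.clog_le_of_le_pow ?_
  have := le_two_pow_clog (n := n)
  rw [two_mul, pow_add]
  nlinarith

theorem natSqrt_le (a : ℕ) : (Nat.sqrt a : ℝ) ≤ Real.sqrt a := Real.nat_sqrt_le_real_sqrt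

theorem searchUnit_le {L e l : ℕ} (hL : 1 ≤ L) (he : e ≤ 2 * L + 1) (hl : l ≤ 20) :
    2 * searchUnit l e (4 * L + 8) ≤ 2106 * L ^ 2 := by
  unfold searchUnit
  -- The product of the two bounds is `1044 * L ^ 2`; doubled, and with `2 * 9 * L ^ 2` added, it
  -- gives `2106 * L ^ 2`.
  have h1 : 2 * l + 8 * e + 23 ≤ 87 * L := by omega
  have h2 : 4 * L + 8 ≤ 12 * L := by omega
  have h3 := Nat.mul_le_mul h2 h1
  nlinarith

/-- A row without ones has no outputs, and otherwise `√c ≥ 1`. So `l ≤ l √c`, which absorbs the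
constant overhead of each search. The one additional search is paid for by `√c ≤ n`. -/
theorem rowTime_le (hn : 1 ≤ n) (hc : c ≤ n) (hl : c = 0 → l = 0) :
    (rowTime (reps n) c l : ℝ) ≤ (Nat.clog 2 (2 * n) : ℝ) ^ 2 *
      (60000 * (l * Real.sqrt c) + 40000 * n) := by
  set L := Nat.clog 2 (2 * n) with hL
  set e := Nat.clog 2 (2 * c) with he
  have hL1 : 1 ≤ L := one_le_clog hn
  have heL : e ≤ L := Nat.clog_mono_right 2 (by omega)
  have h1 : 2 ^ e ≤ 4 * c + 1 := by have := two_pow_clog_le (2 * c); rw [← he] at this; omega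
  have h2 : (Nat.sqrt (2 ^ (e + 3)) : ℝ) ≤ 6 * Real.sqrt c + 3 := by
    refine (natSqrt_le _).trans (Real.sqrt_le_iff.2 ⟨by positivity, ?_⟩)
    have h3 : ((2 ^ (e + 3) : ℕ) : ℝ) ≤ 32 * c + 8 := by
      have : 2 ^ (e + 3) ≤ 32 * c + 8 := by rw [pow_add]; omega
      exact_mod_cast this
    have h4 := Real.sq_sqrt (show (0 : ℝ) ≤ c by positivity)
    have h5 := Real.sqrt_nonneg (c : ℝ)
    nlinarith
  have h3 : ((2 * searchUnit 11 e (reps n) : ℕ) : ℝ) ≤ 2106 * (L : ℝ) ^ 2 := by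
    exact_mod_cast searchUnit_le (L := L) hL1 (by omega) (by norm_num)
  have h4 : Real.sqrt c ≤ n := Real.sqrt_le_iff.2 ⟨by positivity, by
    have h5 : (c : ℝ) ≤ n := by exact_mod_cast hc
    have h6 : (1 : ℝ) ≤ n := by exact_mod_cast hn
    nlinarith⟩
  have h5 : (l : ℝ) ≤ l * Real.sqrt c := by
    rcases Nat.eq_zero_or_pos c with h | h
    · rw [hl h]; simp
    · refine le_mul_of_one_le_right (by positivity) (Real.one_le_sqrt.2 ?_)
      exact_mod_cast h
  have h6 : (searchTime 11 e (reps n) : ℝ) ≤ 9 + 2106 * (L : ℝ) ^ 2 * (6 * Real.sqrt c + 3) := by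
    unfold searchTime
    rw [Nat.cast_add, Nat.cast_mul]
    push_cast at h3 ⊢
    gcongr
  have hL' : (1 : ℝ) ≤ L := by exact_mod_cast hL1
  have hn' : (1 : ℝ) ≤ n := by exact_mod_cast hn
  have he' : (e : ℝ) ≤ L := by exact_mod_cast heL
  have hLL : (L : ℝ) ≤ (L : ℝ) ^ 2 := by nlinarith
  have hs := Real.sqrt_nonneg (c : ℝ)
  set x := Real.sqrt c with hx
  have h7 : (searchTime 11 e (reps n) : ℝ) + 7 ≤ (L : ℝ) ^ 2 * (12636 * x + 6334) := by
    nlinarith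
  have h8 : (rowTime (reps n) c l : ℝ) =
      (2 * l + 1) * ((searchTime 11 e (reps n) : ℝ) + 7) + 4 * e + 10 := by
    unfold rowTime; push_cast; ring
  have h9 : (0 : ℝ) ≤ l := by positivity
  calc (rowTime (reps n) c l : ℝ)
      ≤ (2 * l + 1) * ((L : ℝ) ^ 2 * (12636 * x + 6334)) + 14 * (L : ℝ) ^ 2 := by
        rw [h8]
        have := mul_le_mul_of_nonneg_left h7 (show (0 : ℝ) ≤ 2 * l + 1 by positivity)
        nlinarith
    _ = (L : ℝ) ^ 2 * (25272 * (l * x) + 12668 * l + 12636 * x + 6348) := by ring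
    _ ≤ _ := by
        refine mul_le_mul_of_nonneg_left ?_ (by positivity)
        have : 0 ≤ (l : ℝ) * x := by positivity
        linarith

theorem lightTime_le {μ : ℝ} {lam : ℕ} (hn : 1 ≤ n) (hμ : ∀ i, F b i = false → (cnt X i n : ℝ) ≤ μ)
    (hs : ∑ i ∈ Finset.range n, (prodRow X Y n i).card ≤ lam) :
    (lightTime n (reps n) b F X Y : ℝ) ≤ (Nat.clog 2 (2 * n) : ℝ) ^ 2 *
      (60000 * (lam * Real.sqrt μ) + 40010 * (n : ℝ) ^ 2) := by
  set L := Nat.clog 2 (2 * n) with hL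
  have hL' : (1 : ℝ) ≤ L := by exact_mod_cast one_le_clog hn
  have hn' : (1 : ℝ) ≤ n := by exact_mod_cast hn
  have hLL : (1 : ℝ) ≤ (L : ℝ) ^ 2 := by nlinarith
  have hrow : ∀ i ∈ Finset.range n,
      (((if F b i then 0 else rowTime (reps n) (cnt X i n) (prodRow X Y n i).card) + 6 : ℕ) : ℝ) ≤
      (L : ℝ) ^ 2 * (60000 * ((prodRow X Y n i).card * Real.sqrt μ) + 40006 * n) := by
    intro i _
    cases hF : F b i
    · simp only [Bool.false_eq_true, if_false, Nat.cast_add, Nat.cast_ofNat]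
      have h1 := rowTime_le (n := n) (c := cnt X i n) (l := (prodRow X Y n i).card) hn cnt_le
        (fun h => ?_)
      · have h2 : ((prodRow X Y n i).card : ℝ) * Real.sqrt (cnt X i n) ≤
            (prodRow X Y n i).card * Real.sqrt μ :=
          mul_le_mul_of_nonneg_left (Real.sqrt_le_sqrt (hμ i hF)) (by positivity)
        refine (add_le_add_left h1 _).trans ?_
        have h3 := mul_le_mul_of_nonneg_left h2 (show 0 ≤ (L : ℝ) ^ 2 * 60000 by positivity)
        nlinarith
      · rw [Finset.card_eq_zero, Finset.eq_empty_iff_forall_notMem]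
        intro j hj
        obtain ⟨-, k, hk, hX, -⟩ := mem_prodRow.1 hj
        have := cnt_lt_cnt hX hk
        omega
    · simp only [if_true, Nat.zero_add, Nat.cast_ofNat]
      have h1 : 0 ≤ ((prodRow X Y n i).card : ℝ) * Real.sqrt μ := by positivity
      nlinarith [mul_nonneg (sub_nonneg.2 hLL) (sub_nonneg.2 hn'),
        mul_nonneg (sq_nonneg (L : ℝ)) h1]
  have h1 := Finset.sum_le_sum hrow
  rw [← Finset.mul_sum, Finset.sum_add_distrib, ← Finset.mul_sum, ← Finset.sum_mul,
    Finset.sum_const, Finset.card_range, nsmul_eq_mul] at h1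
  have h2 : (∑ i ∈ Finset.range n, ((prodRow X Y n i).card : ℝ)) ≤ lam := by exact_mod_cast hs
  have h3 := mul_le_mul_of_nonneg_right h2 (Real.sqrt_nonneg μ)
  have h4 : (lightTime n (reps n) b F X Y : ℝ) = ∑ i ∈ Finset.range n,
      (((if F b i then 0 else rowTime (reps n) (cnt X i n) (prodRow X Y n i).card) + 6 : ℕ) : ℝ)
        + 3 := by
    unfold lightTime
    push_cast
    rfl
  rw [h4]
  have h5 := mul_le_mul_of_nonneg_left h3 (show 0 ≤ (L : ℝ) ^ 2 * 60000 by positivity)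
  nlinarith [mul_nonneg (sub_nonneg.2 hLL) (sq_nonneg (n : ℝ)), sq_nonneg ((n : ℝ) - 1)]

/-- The sum telescopes after `1 / √(m + 1) ≤ 2 (√(m + 1) - √m)`. -/
theorem sum_inv_sqrt_le (m : ℕ) :
    ∑ q ∈ Finset.range m, 1 / Real.sqrt (q + 2) ≤ 2 * Real.sqrt m := by
  induction m with
  | zero => simp
  | succ m ih =>
    rw [Finset.sum_range_succ]
    have h1 : 0 < Real.sqrt (m + 1) := Real.sqrt_pos.2 (by positivity)
    have h2 := Real.sq_sqrt (show (0 : ℝ) ≤ m + 1 by positivity)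
    have h3 := Real.sq_sqrt (show (0 : ℝ) ≤ m by positivity)
    have h4 := Real.sqrt_nonneg (m : ℝ)
    have h5 : 1 / Real.sqrt (m + 2) ≤ 1 / Real.sqrt (m + 1) :=
      one_div_le_one_div_of_le h1 (Real.sqrt_le_sqrt (by linarith))
    have h6 : 1 / Real.sqrt (m + 1) ≤ 2 * (Real.sqrt (m + 1) - Real.sqrt m) := by
      rw [div_le_iff₀ h1]
      nlinarith [sq_nonneg (Real.sqrt (m + 1) - Real.sqrt m)]
    push_cast
    linarith

/-- The costs `√(N / (q + 2))` of the `2 l + 1` positions sum to order `√(N l)`. The remaining terms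
under the root are absorbed by `n`, because `l ≤ N ≤ n * n`. -/
theorem denseTime_le (hn : 1 ≤ n) (hN : N ≤ n * n) (hl : l ≤ n) (hlN : l ≤ N) :
    (denseTime (reps n) N l : ℝ) ≤ (Nat.clog 2 (2 * n) : ℝ) ^ 2 *
      (60000 * Real.sqrt (N * l) + 90000 * n) := by
  set L := Nat.clog 2 (2 * n) with hL
  set D := Nat.clog 2 N with hD
  have hL1 : 1 ≤ L := one_le_clog hn
  have hDL : D ≤ 2 * L := (Nat.clog_mono_right 2 hN).trans clog_mul_self_le
  have hL' : (1 : ℝ) ≤ L := by exact_mod_cast hL1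
  have hn' : (1 : ℝ) ≤ n := by exact_mod_cast hn
  have hLL : (L : ℝ) ≤ (L : ℝ) ^ 2 := by nlinarith
  have hl' : (l : ℝ) ≤ n := by exact_mod_cast hl
  have hD' : (D : ℝ) ≤ 2 * L := by exact_mod_cast hDL
  have h3 : ((2 * searchUnit 20 (D + 1) (reps n) : ℕ) : ℝ) ≤ 2106 * (L : ℝ) ^ 2 := by
    exact_mod_cast searchUnit_le (L := L) hL1 (by omega) (by norm_num)
  have hstep : ∀ q ∈ Finset.range (2 * l + 1), (denseStep D (reps n) q : ℝ) ≤
      2106 * (L : ℝ) ^ 2 * Real.sqrt (32 * (2 * N + 1)) * (1 / Real.sqrt (q + 2)) + 40 := by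
    intro q _
    have h4 : (Nat.sqrt (32 * 2 ^ D / (q + 2)) : ℝ) ≤
        Real.sqrt (32 * (2 * N + 1)) * (1 / Real.sqrt (q + 2)) := by
      rw [mul_one_div, ← Real.sqrt_div (by positivity)]
      refine (natSqrt_le _).trans (Real.sqrt_le_sqrt (Nat.cast_div_le.trans ?_))
      have h5 : ((2 ^ D : ℕ) : ℝ) ≤ 2 * N + 1 := by exact_mod_cast two_pow_clog_le N
      push_cast at h5 ⊢
      gcongr
    have h5 := mul_le_mul h3 h4 (by positivity) (by positivity)
    unfold denseStep
    push_cast at h5 ⊢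
    rw [← mul_assoc] at h5
    linarith
  have h4 : (denseTime (reps n) N l : ℝ) =
      ∑ q ∈ Finset.range (2 * l + 1), (denseStep D (reps n) q : ℝ) + 4 * D + 20 := by
    unfold denseTime; push_cast; ring
  have h5 := Finset.sum_le_sum hstep
  rw [Finset.sum_add_distrib, ← Finset.mul_sum, Finset.sum_const, Finset.card_range,
    nsmul_eq_mul] at h5
  have h6 : Real.sqrt (32 * (2 * N + 1)) * ∑ q ∈ Finset.range (2 * l + 1), 1 / Real.sqrt (q + 2) ≤
      24 * Real.sqrt (N * l) + 24 * n + 12 := by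
    refine (mul_le_mul_of_nonneg_left (sum_inv_sqrt_le _) (Real.sqrt_nonneg _)).trans ?_
    rw [mul_left_comm, ← Real.sqrt_mul (by positivity)]
    have h7 : Real.sqrt (32 * (2 * N + 1) * ((2 * l + 1 : ℕ) : ℝ)) ≤
        12 * Real.sqrt (N * l) + 12 * n + 6 := by
      refine Real.sqrt_le_iff.2 ⟨by positivity, ?_⟩
      have h8 := Real.sq_sqrt (show (0 : ℝ) ≤ N * l by positivity)
      have h9 := Real.sqrt_nonneg ((N : ℝ) * l)
      have h10 : (N : ℝ) ≤ n * n := by exact_mod_cast hN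
      have h11 : (l : ℝ) ≤ N := by exact_mod_cast hlN
      push_cast
      nlinarith [mul_nonneg h9 (show (0 : ℝ) ≤ n by positivity)]
    linarith
  have h7 := mul_le_mul_of_nonneg_left h6 (show 0 ≤ 2106 * (L : ℝ) ^ 2 by positivity)
  rw [← mul_assoc] at h7
  rw [h4]
  push_cast at h5 h7
  have h8 : (2 * (l : ℝ) + 1) * 40 + 4 * D + 20 ≤ (L : ℝ) ^ 2 * (80 * n + 68) := by
    nlinarith [mul_nonneg (show (0 : ℝ) ≤ (L : ℝ) ^ 2 - 1 by nlinarith) (show (0 : ℝ) ≤ n by positivity)]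
  have h9 : (L : ℝ) ^ 2 ≤ (L : ℝ) ^ 2 * n := le_mul_of_one_le_right (by positivity) hn'
  nlinarith [mul_nonneg (sq_nonneg (L : ℝ)) (Real.sqrt_nonneg ((N : ℝ) * l))]

/-- Cauchy–Schwarz over the rows, applied to the square roots of the numbers of codes and of
outputs. All rows together have at most `V` codes, hence also at most `V` encoded outputs; this is
the origin of the minimum. -/
theorem denseTotalTime_le {V : ℝ} {lam m : ℕ} (hn : 1 ≤ n) (hβ : β ≤ n)
    (hm : ∑ i ∈ Finset.range n, cnt X i n ≤ m) (hV : (m : ℝ) * β ≤ V)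
    (hs : ∑ i ∈ Finset.range n, (prodRow X Y n i).card ≤ lam) :
    (denseTotalTime n (reps n) β X Y : ℝ) ≤ (Nat.clog 2 (2 * n) : ℝ) ^ 2 *
      (60000 * Real.sqrt (V * min (lam : ℝ) V) + 90010 * (n : ℝ) ^ 2) := by
  set L := Nat.clog 2 (2 * n) with hL
  have hL' : (1 : ℝ) ≤ L := by exact_mod_cast one_le_clog hn
  have hn' : (1 : ℝ) ≤ n := by exact_mod_cast hn
  have hLL : (1 : ℝ) ≤ (L : ℝ) ^ 2 := by nlinarith
  have hrow : ∀ i ∈ Finset.range n,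
      ((denseTime (reps n) (cnt X i n * β) (denseRow X Y n β i).card + 3 : ℕ) : ℝ) ≤ (L : ℝ) ^ 2 *
      (60000 * (Real.sqrt (cnt X i n * β : ℕ) * Real.sqrt (denseRow X Y n β i).card) +
        90003 * n) := by
    intro i _
    have h1 := denseTime_le (n := n) (N := cnt X i n * β) (l := (denseRow X Y n β i).card) hn
      (Nat.mul_le_mul cnt_le hβ) card_denseRow_le card_denseRow_le_mul
    rw [Real.sqrt_mul (by positivity)] at h1
    push_cast at h1 ⊢
    nlinarith [mul_nonneg (sub_nonneg.2 hLL) (sub_nonneg.2 hn')]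
  have h1 := Finset.sum_le_sum hrow
  rw [← Finset.mul_sum, Finset.sum_add_distrib, ← Finset.mul_sum, Finset.sum_const,
    Finset.card_range, nsmul_eq_mul] at h1
  have h2 := Real.sum_sqrt_mul_sqrt_le (Finset.range n)
    (f := fun i => ((cnt X i n * β : ℕ) : ℝ)) (g := fun i => ((denseRow X Y n β i).card : ℝ))
    (fun _ => by positivity) (fun _ => by positivity)
  have h3 : ∑ i ∈ Finset.range n, ((cnt X i n * β : ℕ) : ℝ) ≤ V := by
    refine le_trans ?_ hV
    rw [← Nat.cast_sum, ← Finset.sum_mul]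
    exact_mod_cast Nat.mul_le_mul_right β hm
  have h4 : ∑ i ∈ Finset.range n, ((denseRow X Y n β i).card : ℝ) ≤ min (lam : ℝ) V := by
    refine le_min ?_ ?_
    · have : ∑ i ∈ Finset.range n, (denseRow X Y n β i).card ≤ lam :=
        (Finset.sum_le_sum fun i _ => Finset.card_le_card denseRow_subset).trans hs
      exact_mod_cast this
    · refine le_trans (Finset.sum_le_sum fun i _ => ?_) h3
      exact_mod_cast card_denseRow_le_mul
  rw [← Real.sqrt_mul (Finset.sum_nonneg fun _ _ => by positivity)] at h2
  have h5 := h2.trans (Real.sqrt_le_sqrt (mul_le_mul h3 h4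
    (Finset.sum_nonneg fun _ _ => by positivity)
    ((Finset.sum_nonneg fun _ _ => by positivity).trans h3)))
  have h6 := mul_le_mul_of_nonneg_left h5 (show 0 ≤ (L : ℝ) ^ 2 * 60000 by positivity)
  have h7 : (denseTotalTime n (reps n) β X Y : ℝ) = ∑ i ∈ Finset.range n,
      ((denseTime (reps n) (cnt X i n * β) (denseRow X Y n β i).card + 3 : ℕ) : ℝ) + 3 := by
    unfold denseTotalTime; push_cast; rfl
  rw [h7]
  nlinarith [mul_nonneg (sub_nonneg.2 hLL) (sq_nonneg (n : ℝ)), sq_nonneg ((n : ℝ) - 1)]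

theorem fixedTime_le (hn : 1 ≤ n) :
    (prepTime n + forTime₂ n n 3 + forTime₂ n n 13 : ℕ) ≤
      (Nat.clog 2 (2 * n) : ℝ) ^ 2 * (400 * (n : ℝ) ^ 2) := by
  set L := Nat.clog 2 (2 * n) with hL
  have hL' : (1 : ℝ) ≤ L := by exact_mod_cast one_le_clog hn
  have hn' : (1 : ℝ) ≤ n := by exact_mod_cast hn
  have hLL : (L : ℝ) ≤ (L : ℝ) ^ 2 := by nlinarith
  have hnn : (n : ℝ) ≤ (n : ℝ) ^ 2 := by nlinarith
  have h1 : ((prepTime n + forTime₂ n n 3 + forTime₂ n n 13 : ℕ) : ℝ) ≤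
      4 * L + 320 * (n : ℝ) ^ 2 := by
    unfold prepTime forTime₂
    push_cast
    nlinarith
  nlinarith [mul_nonneg (show (0 : ℝ) ≤ (L : ℝ) ^ 2 - 1 by nlinarith)
    (show (0 : ℝ) ≤ (n : ℝ) ^ 2 - 1 by nlinarith)]

end

end QRAM

/-! ### The total time and the total error -/

namespace QRAM

section

variable {n m₁ m₂ ℓ₁ ℓ₂ ℓ₃ lam : ℕ}

/-- The subpolynomial factor. -/
noncomputable def factor (n : ℕ) : ℝ := 300000 * (Nat.clog 2 (2 * n) : ℝ) ^ 2

theorem isSubpolynomial_factor : IsSubpolynomial factor := by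
  intro ε hε
  have h1 : (fun n : ℕ => Real.log n) =o[atTop] fun n : ℕ => (n : ℝ) ^ (ε / 2) :=
    (isLittleO_log_rpow_atTop (half_pos hε)).comp_tendsto tendsto_natCast_atTop_atTop
  have h2 : (fun n : ℕ => (Nat.clog 2 (2 * n) : ℝ)) =O[atTop] fun n : ℕ => Real.log n := by
    refine IsBigO.of_bound (4 / Real.log 2) ?_
    filter_upwards [eventually_ge_atTop 2] with n hn
    have hl : 0 < Real.log 2 := Real.log_pos (by norm_num)
    have hn' : Real.log 2 ≤ Real.log n := Real.log_le_log (by norm_num) (by exact_mod_cast hn)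
    have h3 : 2 ^ Nat.clog 2 (2 * n) ≤ 2 ^ 3 * n := by
      have := two_pow_clog_le (2 * n); omega
    have h4 : (Nat.clog 2 (2 * n) : ℝ) * Real.log 2 ≤ 3 * Real.log 2 + Real.log n := by
      have h5 : ((2 : ℝ) ^ Nat.clog 2 (2 * n)) ≤ 2 ^ 3 * n := by exact_mod_cast h3
      have h6 := Real.log_le_log (by positivity) h5
      rw [Real.log_pow, Real.log_mul (by positivity) (by positivity), Real.log_pow] at h6
      exact_mod_cast h6
    rw [Real.norm_of_nonneg (by positivity), Real.norm_of_nonneg (by linarith), div_mul_eq_mul_div,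
      le_div_iff₀ hl]
    linarith
  have h3 := (h2.trans_isLittleO h1).isBigO.pow 2
  refine (h3.const_mul_left 300000).congr_right fun n => ?_
  rw [← Real.rpow_natCast, ← Real.rpow_mul (by positivity)]
  norm_num

theorem ownTime_le (A B : BoolMatrix n n) (hn : 1 ≤ n) (hA : A.nnz ≤ m₁)
    (hl : (A.mul B).nnz ≤ lam) :
    (ownTime n m₁ m₂ ℓ₁ ℓ₂ ℓ₃ (extend A) (extend B) : ℝ) ≤ factor n *
      (Real.sqrt ((m₁ : ℝ) * m₂ * min (lam : ℝ) ((m₁ : ℝ) * m₂ / ℓ₂) / ℓ₂)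
        + lam * Real.sqrt ((m₁ : ℝ) / ℓ₁) + lam * Real.sqrt ((m₂ : ℝ) / ℓ₃) + (n : ℝ) ^ 2) := by
  have e1 := fixedTime_le hn
  have e2 := lightTime_le (b := 0) (F := flags n m₁ m₂ ℓ₁ ℓ₂ ℓ₃ (extend A) (extend B))
    (X := extend A) (Y := extend B) (μ := (m₁ : ℝ) / ℓ₁) (lam := lam) hn (fun i hi => ?_)
    ((sum_card_prodRow A B).trans_le hl)
  have e3 := lightTime_le (b := 2) (F := flags n m₁ m₂ ℓ₁ ℓ₂ ℓ₃ (extend A) (extend B))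
    (X := fun i j => extend B j i) (Y := fun i j => extend A j i) (μ := (m₂ : ℝ) / ℓ₃) (lam := lam)
    hn (fun i hi => ?_) ((sum_card_prodRow_transpose A B).trans_le hl)
  have e4 := denseTotalTime_le (X := extend A) (Y := extend B) (β := min (m₂ / ℓ₂) n) (m := m₁)
    (V := (m₁ : ℝ) * m₂ / ℓ₂) (lam := lam) hn (min_le_right _ _) ((sum_cnt A).trans_le hA) ?_
    ((sum_card_prodRow A B).trans_le hl)
  · rw [show (m₁ : ℝ) * m₂ / ℓ₂ * min (lam : ℝ) ((m₁ : ℝ) * m₂ / ℓ₂) =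
      (m₁ : ℝ) * m₂ * min (lam : ℝ) ((m₁ : ℝ) * m₂ / ℓ₂) / ℓ₂ by ring] at e4
    set S := Real.sqrt ((m₁ : ℝ) * m₂ * min (lam : ℝ) ((m₁ : ℝ) * m₂ / ℓ₂) / ℓ₂)
    set S₁ := (lam : ℝ) * Real.sqrt ((m₁ : ℝ) / ℓ₁)
    set S₃ := (lam : ℝ) * Real.sqrt ((m₂ : ℝ) / ℓ₃)
    have p0 : 0 ≤ S := Real.sqrt_nonneg _
    have p1 : 0 ≤ S₁ := by positivity
    have p3 : 0 ≤ S₃ := by positivity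
    have p4 : (0 : ℝ) ≤ (n : ℝ) ^ 2 := by positivity
    have e5 : (ownTime n m₁ m₂ ℓ₁ ℓ₂ ℓ₃ (extend A) (extend B) : ℝ) ≤
        (Nat.clog 2 (2 * n) : ℝ) ^ 2 * (400 * (n : ℝ) ^ 2) +
        (Nat.clog 2 (2 * n) : ℝ) ^ 2 * (60000 * S₁ + 40010 * (n : ℝ) ^ 2) +
        (Nat.clog 2 (2 * n) : ℝ) ^ 2 * (60000 * S₃ + 40010 * (n : ℝ) ^ 2) +
        (Nat.clog 2 (2 * n) : ℝ) ^ 2 * (60000 * S + 90010 * (n : ℝ) ^ 2) := by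
      unfold ownTime
      push_cast at e1 ⊢
      linarith
    refine e5.trans ?_
    unfold factor
    rw [← mul_add, ← mul_add, ← mul_add, mul_right_comm, mul_comm]
    refine mul_le_mul_of_nonneg_right ?_ (by positivity)
    -- The square roots have coefficient `60000`, and the multiples of `n ^ 2` add up to `400 + 2 *
    -- 40010 + 90010 = 170430`.
    linarith
  · rw [mul_div_assoc]
    refine mul_le_mul_of_nonneg_left ?_ (by positivity)
    refine le_trans ?_ (Nat.cast_div_le (α := ℝ) (m := m₂) (n := ℓ₂))
    exact_mod_cast min_le_left (m₂ / ℓ₂) n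
  · have h1 : cnt (fun i j => extend B j i) i n ≤ m₂ / ℓ₃ := by simpa [flags] using hi
    have h2 : (cnt (fun i j => extend B j i) i n : ℝ) ≤ (m₂ / ℓ₃ : ℕ) := by exact_mod_cast h1
    exact h2.trans Nat.cast_div_le
  · have h1 : cnt (extend A) i n ≤ m₁ / ℓ₁ := by simpa [flags] using hi
    have h2 : (cnt (extend A) i n : ℝ) ≤ (m₁ / ℓ₁ : ℕ) := by exact_mod_cast h1
    exact h2.trans Nat.cast_div_le

/-- With `N = 2 ^ L ≥ 2 n` the union bound has fewer than `17 * N ^ 3` terms, whereas the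
repetitions give `2 ^ reps n = 256 * N ^ 4`. The target `2 / 27` is what the majority vote leaves of
`1 / 3`. -/
theorem searchError_le (hn : 1 ≤ n) : searchError n ≤ ((2 / 27 : NNReal) : ℝ≥0∞) := by
  set L := Nat.clog 2 (2 * n) with hL
  have hL1 : 1 ≤ L := one_le_clog hn
  have h1 : searchError n = (((2 * (n * ((2 * n + 1) * (L + 4))) +
      n * ((2 * n + 1) * (Nat.clog 2 (n * n) + 5)) : ℕ) * (2 ^ reps n)⁻¹ : NNReal) : ℝ≥0∞) := by
    unfold searchError
    rw [← hL]
    push_cast [ENNReal.coe_inv, ENNReal.inv_pow]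
    ring
  rw [h1, ENNReal.coe_le_coe, ← div_eq_mul_inv, div_le_iff₀ (by positivity), div_mul_eq_mul_div,
    le_div_iff₀ (by norm_num)]
  have h2 : 2 * n ≤ 2 ^ L := le_two_pow_clog
  have h3 : Nat.clog 2 (n * n) ≤ 2 * L := clog_mul_self_le
  have h4 : L < 2 ^ L := Nat.lt_two_pow_self
  have h5 : 2 ^ reps n = 256 * (2 ^ L) ^ 4 := by
    unfold reps
    rw [← hL, pow_add, mul_comm 4 L, pow_mul]
    norm_num [mul_comm]
  have key : (2 * (n * ((2 * n + 1) * (L + 4))) + n * ((2 * n + 1) * (Nat.clog 2 (n * n) + 5))) * 27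
      ≤ 2 * 2 ^ reps n := by
    rw [h5]
    set N := 2 ^ L
    have hN : 2 ≤ N := by omega
    have h6 : n * (2 * n + 1) ≤ N * N := by nlinarith
    have h7 : 2 * (L + 4) + (Nat.clog 2 (n * n) + 5) ≤ 17 * N := by omega
    have h8 := Nat.mul_le_mul h6 h7
    have h9 : N ^ 3 * 2 ≤ N ^ 4 := by rw [pow_succ N 3]; exact Nat.mul_le_mul_left _ hN
    calc _ = n * (2 * n + 1) * (2 * (L + 4) + (Nat.clog 2 (n * n) + 5)) * 27 := by ring
      _ ≤ N * N * (17 * N) * 27 := Nat.mul_le_mul_right _ h8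
      _ = 459 * N ^ 3 := by ring
      _ ≤ _ := by omega
  exact_mod_cast key

end

end QRAM

/-! ### The program meets the specification -/

namespace QRAM

section

variable {n m₁ m₂ ℓ₁ ℓ₂ ℓ₃ w k : ℕ}

/-- All parameters are below `2 ^ Λ`. The logarithm of `n * n` is at most `2 * (Λ + 1)` and `reps n`
at most `4 * Λ + 12`, so `20 * Λ` bits leave room for every overflow condition. -/
theorem fits {A B : BoolMatrix n n} {Λ : ℕ} (hn : 1 ≤ n) (h₁ : 1 ≤ ℓ₁) (h₁' : ℓ₁ ≤ m₁)
    (h₂ : 1 ≤ ℓ₂) (h₂' : ℓ₂ ≤ m₂) (h₃ : 1 ≤ ℓ₃) (h₃' : ℓ₃ ≤ m₂) (hA : A.nnz ≤ m₁) (hB : B.nnz ≤ m₂)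
    (hΛ : 1 ≤ Λ) (hnΛ : n < 2 ^ Λ) (hm₁ : m₁ < 2 ^ Λ) (hm₂ : m₂ < 2 ^ Λ) (hw : 20 * Λ ≤ w)
    (hk : 2 ^ w < k) :
    Fits w k n m₁ m₂ ℓ₁ ℓ₂ ℓ₃ (flags n m₁ m₂ ℓ₁ ℓ₂ ℓ₃ (extend A) (extend B)) := by
  have h1 : 2 ^ Λ ≤ 2 ^ w := Nat.pow_le_pow_right (by norm_num) (by omega)
  have h2 : 2 ^ (Λ + 3) ≤ 2 ^ w := Nat.pow_le_pow_right (by norm_num) (by omega)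
  have h3 : Nat.clog 2 (2 * n) ≤ Λ + 1 := Nat.clog_le_of_le_pow (by rw [pow_succ]; omega)
  have h4 : Nat.clog 2 (n * n) ≤ 2 * (Λ + 1) := clog_mul_self_le.trans (by omega)
  have h5 : w < 2 ^ w := Nat.lt_two_pow_self
  rw [pow_add] at h2
  refine ⟨hk, by omega, by omega, by omega, by omega, by omega, by omega, by omega, by omega,
    by omega, by unfold reps; omega, lt_min (Nat.div_pos h₂' h₂) hn, ?_, ?_, ?_⟩
  · exact le_min (cnt_flag_le (Z := extend A) h₁ (fun i => rfl) ((sum_cnt A).trans_le hA)) cnt_le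
  · exact le_min (cnt_flag_le (Z := extend B) h₂ (fun i => rfl) ((sum_cnt B).trans_le hB)) cnt_le
  · exact le_min (cnt_flag_le (Z := fun i j => extend B j i) h₃ (fun i => rfl)
      ((sum_cnt_transpose B).trans_le hB)) cnt_le

theorem weight_initState {a b c : ℕ} (ps : List ℕ) (A : BoolMatrix a b) (B : BoolMatrix b c) :
    (initState w ps A B).weight = 1 := by
  rw [State.weight, initState_psi, tsum_delta]
  simp

theorem one_le_add_third {x : ℝ≥0∞} (h : 2 / 3 ≤ x) : 1 ≤ x + ((1 / 3 : NNReal) : ℝ≥0∞) := by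
  refine le_trans (le_of_eq ?_) (add_le_add_left h _)
  rw [show (2 / 3 : ℝ≥0∞) = ((2 / 3 : NNReal) : ℝ≥0∞) by
    rw [ENNReal.coe_div (by norm_num)]; rfl, ← ENNReal.coe_add, ← ENNReal.coe_one, ENNReal.coe_inj]
  norm_num

theorem two_thirds_le {x : ℝ≥0∞} (h : 1 ≤ x + ((1 / 3 : NNReal) : ℝ≥0∞)) : 2 / 3 ≤ x := by
  rw [show (1 : ℝ≥0∞) = ((2 / 3 : NNReal) : ℝ≥0∞) + ((1 / 3 : NNReal) : ℝ≥0∞) by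
    rw [← ENNReal.coe_add, ← ENNReal.coe_one, ENNReal.coe_inj]; norm_num] at h
  rw [show (2 / 3 : ℝ≥0∞) = ((2 / 3 : NNReal) : ℝ≥0∞) by
    rw [ENNReal.coe_div (by norm_num)]; rfl]
  exact (ENNReal.add_le_add_iff_right ENNReal.coe_ne_top).1 h

/-- The program is correct and fast enough if the assumed program is so on the submatrices. -/
theorem computesProduct_mainProg {A B : BoolMatrix n n} {Q : Prog} {Λ lam lam' : ℕ} {T : ℝ}
    (hn : 1 ≤ n) (h₁ : 1 ≤ ℓ₁) (h₁' : ℓ₁ ≤ m₁)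
    (h₂ : 1 ≤ ℓ₂) (h₂' : ℓ₂ ≤ m₂) (h₃ : 1 ≤ ℓ₃) (h₃' : ℓ₃ ≤ m₂) (hA : A.nnz ≤ m₁) (hB : B.nnz ≤ m₂)
    (hl : (A.mul B).nnz ≤ lam) (hΛ : 1 ≤ Λ) (hnΛ : n < 2 ^ Λ) (hm₁ : m₁ < 2 ^ Λ) (hm₂ : m₂ < 2 ^ Λ)
    (hw : 20 * Λ ≤ w)
    (hQ : ComputesProduct Q w [min ℓ₁ n, min ℓ₂ n, min ℓ₃ n, lam']
      (subMatrix (flags n m₁ m₂ ℓ₁ ℓ₂ ℓ₃ (extend A) (extend B)) (extend A) n 0 1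
        (min ℓ₁ n) (min ℓ₂ n))
      (subMatrix (flags n m₁ m₂ ℓ₁ ℓ₂ ℓ₃ (extend A) (extend B)) (extend B) n 1 2
        (min ℓ₂ n) (min ℓ₃ n)) T) :
    ComputesProduct (mainProg Q) w [n, m₁, m₂, ℓ₁, ℓ₂, ℓ₃, lam'] A B (factor n * (T +
      Real.sqrt ((m₁ : ℝ) * m₂ * min (lam : ℝ) ((m₁ : ℝ) * m₂ / ℓ₂) / ℓ₂)
        + lam * Real.sqrt ((m₁ : ℝ) / ℓ₁) + lam * Real.sqrt ((m₂ : ℝ) / ℓ₃) + (n : ℝ) ^ 2)) := by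
  obtain ⟨k', hQ1, hQ2⟩ := hQ
  -- The bound on the rounds of loops must suffice for the assumed program, which needs `k'`, and
  -- for the counted loops, which need more than `2 ^ w`.
  have hF := fits (k := max k' (2 ^ w + 1)) hn h₁ h₁' h₂ h₂' h₃ h₃' hA hB hΛ hnΛ hm₁ hm₂ hw
    (lt_of_lt_of_le (Nat.lt_succ_self _) (le_max_right _ _))
  -- No branch has a negative running time, so probability one forces `T` to be non-negative. This
  -- allows rounding `T` down to a natural number.
  have hT : 0 ≤ T := by
    by_contra hT
    rw [prob] at hQ1
    simp only [show ∀ t : State w, ¬ (t.time : ℝ) ≤ T from fun t h =>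
      hT ((Nat.cast_nonneg _).trans h), if_false] at hQ1
    simp at hQ1
  have htime := wp_mainProg_time (lam := lam') (τ := ⌊T⌋₊) (le_max_left k' (2 ^ w + 1)) hF
    (hQ1.ge.trans (prob_mono fun t _ ht => Nat.le_floor ht))
  have hout := wp_mainProg_outputs (lam := lam') (le_max_left k' (2 ^ w + 1)) hF
    (hQ1.ge.trans (prob_mono fun t _ _ => trivial)) (one_le_add_third hQ2)
  unfold WP at htime hout
  rw [weight_initState] at htime hout
  refine ⟨max k' (2 ^ w + 1), le_antisymm ?_ ?_, ?_⟩
  · rw [← weight_initState (w := w) [n, m₁, m₂, ℓ₁, ℓ₂, ℓ₃, lam'] A B]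
    exact (prob_mono fun _ _ _ => trivial).trans (prob_run_le _ _ _)
  · rw [zero_mul, add_zero] at htime
    refine htime.trans (prob_mono fun t _ ht => ?_)
    have e1 := ownTime_le (m₂ := m₂) (ℓ₁ := ℓ₁) (ℓ₂ := ℓ₂) (ℓ₃ := ℓ₃) A B hn hA hl
    have e2 := Nat.floor_le hT
    -- The three copies cost `3 * T`, which the subpolynomial factor absorbs.
    have e3 : (3 : ℝ) ≤ factor n := by
      have : (1 : ℝ) ≤ Nat.clog 2 (2 * n) := by exact_mod_cast one_le_clog hn
      unfold factor
      nlinarith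
    have e4 : (t.time : ℝ) ≤ ownTime n m₁ m₂ ℓ₁ ℓ₂ ℓ₃ (extend A) (extend B) + 3 * ⌊T⌋₊ := by
      exact_mod_cast ht
    have e5 := mul_le_mul_of_nonneg_right e3 hT
    refine e4.trans ((add_le_add e1 ((mul_le_mul_of_nonneg_left e2 (by norm_num)).trans e5)).trans
      (le_of_eq ?_))
    ring
  · rw [mul_one] at hout
    refine two_thirds_le (hout.trans (add_le_add le_rfl ?_))
    refine (add_le_add_left (searchError_le hn) _).trans (le_of_eq ?_)
    rw [← ENNReal.coe_add, ENNReal.coe_inj]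
    norm_num

end

end QRAM

theorem mainTheorem7 :
    ∃ f : ℕ → ℝ, IsSubpolynomial f ∧
      ∀ (known : Bool) (M : ℕ → ℕ → ℕ → ℕ → ℝ),
        (∃ (Q : QRAM.Prog) (d : ℕ),
          ∀ (n₁ n₂ n₃ L : ℕ), 1 ≤ n₁ → 1 ≤ n₂ → 1 ≤ n₃ →
          ∀ (A : BoolMatrix n₁ n₂) (B : BoolMatrix n₂ n₃), (A.mul B).nnz ≤ L →
          ∀ w : ℕ, d * (Nat.log 2 (max (max n₁ n₂) (max n₃ L)) + 1) ≤ w →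
            QRAM.ComputesProduct Q w [n₁, n₂, n₃, if known then L else 0] A B
              (M n₁ n₂ n₃ L)) →
        ∃ (P : QRAM.Prog) (c : ℕ),
          ∀ (n m₁ m₂ ℓ₁ ℓ₂ ℓ₃ lam : ℕ), 1 ≤ n →
          1 ≤ ℓ₁ → ℓ₁ ≤ m₁ → 1 ≤ ℓ₂ → ℓ₂ ≤ m₂ → 1 ≤ ℓ₃ → ℓ₃ ≤ m₂ →
          ∀ (A B : BoolMatrix n n), A.nnz ≤ m₁ → B.nnz ≤ m₂ → (A.mul B).nnz ≤ lam →
          ∀ w : ℕ, c * (Nat.log 2 (max (max n lam) (max m₁ m₂)) + 1) ≤ w →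
            QRAM.ComputesProduct P w [n, m₁, m₂, ℓ₁, ℓ₂, ℓ₃, if known then lam else 0] A B
              (f n *
                (M (min ℓ₁ n) (min ℓ₂ n) (min ℓ₃ n) lam
                  + Real.sqrt ((m₁ : ℝ) * m₂ * min (lam : ℝ) ((m₁ : ℝ) * m₂ / ℓ₂) / ℓ₂)
                  + lam * Real.sqrt ((m₁ : ℝ) / ℓ₁)
                  + lam * Real.sqrt ((m₂ : ℝ) / ℓ₃)
                  + (n : ℝ) ^ 2)) := by
  refine ⟨QRAM.factor, QRAM.isSubpolynomial_factor, ?_⟩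
  rintro known M ⟨Q, d, hQ⟩
  -- The parameters of the assumed program are at most `n` and `lam`, so `d` times the present
  -- logarithm is enough for it; `20` is what the other parts need.
  refine ⟨QRAM.mainProg Q, d + 20, ?_⟩
  intro n m₁ m₂ ℓ₁ ℓ₂ ℓ₃ lam hn h₁ h₁' h₂ h₂' h₃ h₃' A B hA hB hl w hw
  set Λ := Nat.log 2 (max (max n lam) (max m₁ m₂)) + 1 with hΛ
  have hlt : max (max n lam) (max m₁ m₂) < 2 ^ Λ := Nat.lt_pow_succ_log_self (by norm_num) _
  have hnnz := fun F => (QRAM.nnz_subMatrix_mul_le (F := F) (a := min ℓ₁ n) (b := min ℓ₂ n)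
    (c := min ℓ₃ n) A B)
  rw [add_mul] at hw
  refine QRAM.computesProduct_mainProg (Λ := Λ) hn h₁ h₁' h₂ h₂' h₃ h₃' hA hB hl (by omega)
    (by omega) (by omega) (by omega) (by omega) (hQ _ _ _ _ (by omega) (by omega) (by omega) _ _
      ((hnnz _ ?_).trans hl) w (le_trans (Nat.mul_le_mul_left d (Nat.succ_le_succ
        (Nat.log_mono_right (by omega)))) (le_trans (Nat.le_add_right _ _) hw)))
  exact (QRAM.fits (k := 2 ^ w + 1) hn h₁ h₁' h₂ h₂' h₃ h₃' hA hB (by omega : 1 ≤ Λ) (by omega)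
    (by omega) (by omega) (by omega) (Nat.lt_succ_self _)).c1
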